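/- Conventions. All manifolds are Hausdorff and without boundary; $M$ is second countable and $C^\infty$ and $J$ is a $C^\infty$ almost complex structure on $M$. A current of dimension $2p$ on $M$ is of order $0$ if it is continuous for the $C^0$-seminorms on the compactly supported smooth $2p$-forms with support in any fixed compact set; it is of bidimension $(p,p)$, written $T\in\mathcal D'_{p,p}(M)$, if it vanishes on test forms of every type $(r,s)\neq(p,p)$; it is positive if $\langle T,\varphi\rangle\ge 0$ for every test form $\varphi$ that is, at each point, a finite nonnegative combination of forms $i\alpha_1\wedge\bar\alpha_1\wedge\dots\wedge i\alpha_p\wedge\bar\alpha_p$ with $\alpha_j$ of type $(1,0)$. A complex measure $\nu$ on $\gamma$ is a locally finite complex Radon measure, i.e. a linear form on the space $C_c(\gamma)$ of continuous compactly supported functions that is bounded in the sup norm on the functions supported in any fixed compact set; it is positive if $\int f\,d\nu\ge0$ for all $f\ge0$. Complex submanifolds (i.e. $C^1$ submanifolds with $J$-invariant tangent spaces) are oriented by $J$, and $[L]$ denotes the current of integration over $L$. (a) Let $(M,J)$ be an almost complex manifold of complex dimension $2$, $\Gamma\subset M$ a closed real hypersurface of class $C^1$, and $\gamma$ a $C^1$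 real curve. Suppose that there is a $C^1$ submersion $F:\Gamma\to\gamma$ such that every fibre $L_t=F^{-1}(t)$, $t\in\gamma$, is a (non-empty) connected $J$-complex curve (in particular $\Gamma$ is Levi-flat, with leaves $L_t$). Let $T\in\mathcal D'_{1,1}(M)$ be a closed current of order $0$ with $\operatorname{supp}T\subset\Gamma$. Then there is a unique complex measure $\nu$ on $\gamma$ such that $$\langle T,\varphi\rangle=\int_{t\in\gamma}\Big(\int_{L_t}\varphi\Big)\,d\nu(t)\qquad\text{for every test form }\varphi ,$$ where $t\mapsto\int_{L_t}\varphi$ is continuous with compact support on $\gamma$. The current $T$ is positive if and only if $\nu$ is positive. (b) Let $(M,J)$ be an almost complex manifold and $N\subset M$ a closed CR submanifold of class $C^1$ of CR dimension $p$, i.e. $\dim_{\mathbb C}(T_xN\cap J\,T_xN)=p$ for all $x\in N$. Suppose that there is a $C^1$ submersion $F:N\to\gamma$ onto a real $C^1$ manifold $\gamma$ such that every fibre $L_t=F^{-1}(t)$ is a connected $J$-complex submanifold of complex dimension $p$. Let $T\in\mathcal D'_{p,p}(M)$ be a closed current of order $0$ with $\operatorname{supp}T\subset N$. Then there is a unique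 complex measure $\nu$ on $\gamma$ such that $T=\int_{t\in\gamma}[L_t]\,d\nu(t)$ in the same sense, and $T$ is positive if and only if $\nu$ is positive. -/

import Mathlib

open Set Topology MeasureTheory Module
open scoped Manifold ContDiff CompactlySupported

noncomputable section

/-! ### Almost complex structures -/

section AlmostComplex

/-- An almost complex structure on the manifold `M` (modelled on `E`): a `C^∞` field of
endomorphisms `J x` of the tangent spaces with `(J x)² = -1`. -/
structure AlmostComplexStructure (E : Type*) [NormedAddCommGroup E] [NormedSpace ℝ E]
    (M : Type*) [TopologicalSpace M] [ChartedSpace E M] [IsManifold 𝓘(ℝ, E) ∞ M] where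
  toFun : ∀ x : M, TangentSpace 𝓘(ℝ, E) x →L[ℝ] TangentSpace 𝓘(ℝ, E) x
  smooth : ContMDiff 𝓘(ℝ, E) (𝓘(ℝ, E).prod 𝓘(ℝ, E →L[ℝ] E)) ∞
    (fun x => Bundle.TotalSpace.mk' (E →L[ℝ] E)
      (E := fun x : M => TangentSpace 𝓘(ℝ, E) x →L[ℝ] TangentSpace 𝓘(ℝ, E) x) x (toFun x))
  sq : ∀ (x : M) (v : TangentSpace 𝓘(ℝ, E) x), toFun x (toFun x v) = -v

end AlmostComplex

/-! ### Linear algebra of a complex structure `J` on a real vector space `V` -/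

section LinearAlgebra

variable {V : Type*} [AddCommGroup V] [Module ℝ V] [TopologicalSpace V]

/-- The complex valued alternating form `φ` of degree `k = r + s` is of type `(r, s)`.
For `k = r + s` the forms of type `(r, s)` are exactly the eigenvectors, for the eigenvalue
`i (r - s)`, of the derivation `φ ↦ ∑ᵢ φ(…, J vᵢ, …)` extending `α ↦ α ∘ J`: this derivation
multiplies each `(1,0)` factor by `i` and each `(0,1)` factor by `-i`. -/
def IsOfType (J : V →L[ℝ] V) {k : ℕ} (r s : ℕ) (φ : V [⋀^Fin k]→L[ℝ] ℂ) : Prop :=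
  r + s = k ∧ ∀ v : Fin k → V,
    ∑ i, φ (Function.update v i (J (v i))) = (((r : ℂ) - (s : ℂ)) * Complex.I) * φ v

/-- The real frame `e₀, J e₀, e₁, J e₁, …, e_{p-1}, J e_{p-1}`. -/
def complexFrame (J : V →L[ℝ] V) {p : ℕ} (e : Fin p → V) (i : Fin (2 * p)) : V :=
  if i.1 % 2 = 0 then e ⟨i.1 / 2, by omega⟩ else J (e ⟨i.1 / 2, by omega⟩)

/-- A real basis `v` of a `J`-invariant subspace of real dimension `2p` is positively oriented,
for the orientation defined by `J`, if it has the orientation of a frame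
`e₀, J e₀, …, e_{p-1}, J e_{p-1}`. -/
def IsPositivelyOriented (J : V →L[ℝ] V) {p : ℕ} (v : Fin (2 * p) → V) : Prop :=
  ∃ (e : Fin p → V) (A : Matrix (Fin (2 * p)) (Fin (2 * p)) ℝ),
    0 < A.det ∧ ∀ i, v i = ∑ j, A i j • complexFrame J e j

/-- The value of the covector `α₀, ᾱ₀, α₁, ᾱ₁, …` number `i` on the vector `w`. -/
def conjPair {p : ℕ} (α : Fin p → (V →L[ℝ] ℂ)) (i : Fin (2 * p)) (w : V) : ℂ :=
  if i.1 % 2 = 0 then α ⟨i.1 / 2, by omega⟩ w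
  else (starRingEnd ℂ) (α ⟨i.1 / 2, by omega⟩ w)

/-- Strongly positive `(p,p)`-forms: finite combinations, with nonnegative coefficients, of the forms
`i α₀ ∧ ᾱ₀ ∧ … ∧ i α_{p-1} ∧ ᾱ_{p-1}` with `αⱼ` of type `(1,0)`. The value of
`β₀ ∧ … ∧ β_{2p-1}` on `v₀, …, v_{2p-1}` is the determinant of `(βᵢ(vⱼ))`. -/
def IsStronglyPositive (J : V →L[ℝ] V) {p : ℕ} (φ : V [⋀^Fin (2 * p)]→L[ℝ] ℂ) : Prop :=
  ∃ (m : ℕ) (c : Fin m → ℝ) (α : Fin m → Fin p → (V →L[ℝ] ℂ)),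
    (∀ a, 0 ≤ c a) ∧ (∀ a j w, α a j (J w) = Complex.I * α a j w) ∧
    ∀ v : Fin (2 * p) → V, φ v = ∑ a, (c a : ℂ) *
      (Complex.I ^ p * (Matrix.of fun i j => conjPair (α a) i (v j)).det)

end LinearAlgebra

/-! ### Differential forms and currents on a manifold -/

section Forms

variable {E : Type*} [NormedAddCommGroup E] [NormedSpace ℝ E]
  {M : Type*} [TopologicalSpace M] [ChartedSpace E M]

/-- The expression of the differential form `φ` in the preferred chart at `x₀`: the pull-back of
`φ` by the inverse of the chart. -/
def formInChart {k : ℕ} (φ : ∀ x : M, TangentSpace 𝓘(ℝ, E) x [⋀^Fin k]→L[ℝ] ℂ) (x₀ : M) (y : E) :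
    E [⋀^Fin k]→L[ℝ] ℂ :=
  (φ ((extChartAt 𝓘(ℝ, E) x₀).symm y)).compContinuousLinearMap
    (mfderiv 𝓘(ℝ, E) 𝓘(ℝ, E) (extChartAt 𝓘(ℝ, E) x₀).symm y)

/-- The support of a differential form. -/
def formSupport {k : ℕ} (φ : ∀ x : M, TangentSpace 𝓘(ℝ, E) x [⋀^Fin k]→L[ℝ] ℂ) : Set M :=
  closure {x | φ x ≠ 0}

variable (E M) in
/-- The space of complex valued test forms of degree `k`: `C^∞` forms with compact support. -/
def TestForm [T2Space M] (k : ℕ) :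
    Submodule ℂ (∀ x : M, TangentSpace 𝓘(ℝ, E) x [⋀^Fin k]→L[ℝ] ℂ) where
  carrier := {φ | IsCompact (formSupport φ) ∧
    ∀ x₀ : M, ContDiffOn ℝ ∞ (formInChart φ x₀) (extChartAt 𝓘(ℝ, E) x₀).target}
  zero_mem' := by
    refine ⟨by simp [formSupport], fun x₀ => ?_⟩
    have h : formInChart (0 : ∀ x : M, TangentSpace 𝓘(ℝ, E) x [⋀^Fin k]→L[ℝ] ℂ) x₀ =
        fun _ => 0 := by
      funext y; ext v; rfl
    rw [h]; exact contDiffOn_const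
  add_mem' := by
    intro φ ψ hφ hψ
    refine ⟨?_, fun x₀ => ?_⟩
    · refine (hφ.1.union hψ.1).of_isClosed_subset isClosed_closure ?_
      refine closure_minimal ?_ (isClosed_closure.union isClosed_closure)
      intro x hx
      by_cases h : φ x = 0
      · right; apply subset_closure
        intro h'; apply hx; simp [h, h']
      · exact Or.inl (subset_closure h)
    · have h : formInChart (φ + ψ) x₀ = fun y => formInChart φ x₀ y + formInChart ψ x₀ y := by
        funext y; ext v; rfl
      rw [h]; exact (hφ.2 x₀).add (hψ.2 x₀)
  smul_mem' := by
    intro c φ hφ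
    refine ⟨?_, fun x₀ => ?_⟩
    · refine hφ.1.of_isClosed_subset isClosed_closure (closure_mono ?_)
      intro x hx h; apply hx; simp [h]
    · have h : formInChart (c • φ) x₀ = fun y => c • formInChart φ x₀ y := by
        funext y; ext v; rfl
      rw [h]; exact (hφ.2 x₀).const_smul c

/-- The exterior derivative of a form on `M`. The tangent space at `x` is identified with `E` by
the preferred chart at `x`, so that at `x` it is enough to differentiate in this chart. -/
def formExtDeriv {k : ℕ} (φ : ∀ x : M, TangentSpace 𝓘(ℝ, E) x [⋀^Fin k]→L[ℝ] ℂ) (x : M) :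
    TangentSpace 𝓘(ℝ, E) x [⋀^Fin (k + 1)]→L[ℝ] ℂ :=
  (extDeriv (formInChart φ x) (extChartAt 𝓘(ℝ, E) x x) : E [⋀^Fin (k + 1)]→L[ℝ] ℂ)

variable [T2Space M]

namespace TestForm

/-- The linear form `T` on test forms is a current of order `0`: it is continuous for the `C^0`
seminorms, on the test forms supported in a given compact subset of a chart domain. -/
def IsOrderZero {k : ℕ} (T : TestForm E M k →ₗ[ℂ] ℂ) : Prop :=
  ∀ (x₀ : M) (K : Set M), IsCompact K → K ⊆ (chartAt E x₀).source →
    ∃ C : ℝ, ∀ φ : TestForm E M k, formSupport φ.1 ⊆ K → ∀ B : ℝ, 0 ≤ B →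
      (∀ x ∈ K, ‖formInChart φ.1 x₀ (extChartAt 𝓘(ℝ, E) x₀ x)‖ ≤ B) → ‖T φ‖ ≤ C * B

/-- `dT = 0`, that is `T (dη) = 0` for all test forms `η` of degree one less. -/
def IsClosedCurrent {k : ℕ} (T : TestForm E M k →ₗ[ℂ] ℂ) : Prop :=
  ∀ (m : ℕ) (h : m + 1 = k) (η : TestForm E M m) (ψ : TestForm E M k),
    (∀ x (v : Fin k → TangentSpace 𝓘(ℝ, E) x),
      ψ.1 x v = formExtDeriv η.1 x (fun i => v (Fin.cast h i))) → T ψ = 0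

/-- The support of a current: the complement of the largest open set on which `T` vanishes. -/
def currentSupport {k : ℕ} (T : TestForm E M k →ₗ[ℂ] ℂ) : Set M :=
  {x | ∀ U ∈ 𝓝 x, ∃ φ : TestForm E M k, formSupport φ.1 ⊆ U ∧ T φ ≠ 0}

variable [IsManifold 𝓘(ℝ, E) ∞ M] (J : AlmostComplexStructure E M)

/-- `T`, a current of dimension `2p`, is of bidimension `(p,p)`: it vanishes on the test forms of
all the types `(r,s) ≠ (p,p)`. -/
def IsBidimension (p : ℕ) (T : TestForm E M (2 * p) →ₗ[ℂ] ℂ) : Prop :=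
  ∀ (r s : ℕ), (r, s) ≠ (p, p) → ∀ φ : TestForm E M (2 * p),
    (∀ x, IsOfType (J.toFun x) r s (φ.1 x)) → T φ = 0

/-- `T` is positive: `T φ ≥ 0` for all test forms `φ` strongly positive at every point. -/
def IsPositiveCurrent (p : ℕ) (T : TestForm E M (2 * p) →ₗ[ℂ] ℂ) : Prop :=
  ∀ φ : TestForm E M (2 * p), (∀ x, IsStronglyPositive (J.toFun x) (φ.1 x)) →
    0 ≤ (T φ).re ∧ (T φ).im = 0

end TestForm

/-! ### Currents of integration over complex submanifolds -/

/-- `u : V → M` (`V` open in `ℝ^{2p}`) is a positively oriented local `C^1` parametrization of the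
`J`-complex submanifold `S` of complex dimension `p`: a `C^1` immersion that is a homeomorphism
onto a relatively open subset of `S`, such that the vectors `∂u/∂yᵢ` are positively
oriented for the orientation given by `J`. -/
structure IsOrientedParametrization [IsManifold 𝓘(ℝ, E) ∞ M] (J : AlmostComplexStructure E M)
    (p : ℕ) (S : Set M) (V : Set (EuclideanSpace ℝ (Fin (2 * p))))
    (u : EuclideanSpace ℝ (Fin (2 * p)) → M) : Prop where
  isOpen : IsOpen V
  contMDiffOn : ContMDiffOn 𝓘(ℝ, EuclideanSpace ℝ (Fin (2 * p))) 𝓘(ℝ, E) 1 u V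
  injOn : InjOn u V
  immersion : ∀ y ∈ V, Function.Injective
    (mfderiv 𝓘(ℝ, EuclideanSpace ℝ (Fin (2 * p))) 𝓘(ℝ, E) u y)
  image_open : ∀ V' ⊆ V, IsOpen V' → ∃ W : Set M, IsOpen W ∧ u '' V' = S ∩ W
  oriented : ∀ y ∈ V, IsPositivelyOriented (J.toFun (u y)) (p := p) (fun i =>
    mfderiv 𝓘(ℝ, EuclideanSpace ℝ (Fin (2 * p))) 𝓘(ℝ, E) u y (EuclideanSpace.single i (1 : ℝ)))

/-- `I` is the functional `φ ↦ ∫_S φ` on the test forms of degree `2p`, where `S` is a closed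
`J`-complex submanifold of complex dimension `p` oriented by `J`: the functional `I` is linear, and
if `φ` is supported, on `S`, in the image of a positively oriented local parametrization
`u : V → S`, then `I φ` is the Lebesgue integral over `V` of the coefficient of `u^* φ`.
(By a partition of unity, there is only one such functional.) -/
def IsIntegrationCurrent [IsManifold 𝓘(ℝ, E) ∞ M] (J : AlmostComplexStructure E M) (p : ℕ)
    (S : Set M) (I : TestForm E M (2 * p) →ₗ[ℂ] ℂ) : Prop :=
  ∀ V u, IsOrientedParametrization J p S V u → ∀ φ : TestForm E M (2 * p),
    formSupport φ.1 ∩ S ⊆ u '' V →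
      I φ = ∫ y in V, φ.1 (u y) (fun i =>
        mfderiv 𝓘(ℝ, EuclideanSpace ℝ (Fin (2 * p))) 𝓘(ℝ, E) u y
          (EuclideanSpace.single i (1 : ℝ)))

open Classical in
/-- The current of integration `[S]` over a closed `J`-complex submanifold `S` of complex
dimension `p`. -/
def integrationCurrent [IsManifold 𝓘(ℝ, E) ∞ M] (J : AlmostComplexStructure E M) (p : ℕ)
    (S : Set M) : TestForm E M (2 * p) →ₗ[ℂ] ℂ :=
  if h : ∃ I, IsIntegrationCurrent J p S I then h.choose else 0

end Forms

/-! ### Complex measures -/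

section Measures

/-- A (locally finite) complex Radon measure on `X`: a linear form on the continuous functions with
compact support that is bounded, for the sup norm, on the functions supported in a given
compact set. The value at `f` is the integral `∫ f dν`. -/
structure ComplexRadonMeasure (X : Type*) [TopologicalSpace X] where
  integral : C_c(X, ℂ) →ₗ[ℂ] ℂ
  bounded : ∀ K : Set X, IsCompact K → ∃ C : ℝ, ∀ f : C_c(X, ℂ), tsupport f ⊆ K →
    ∀ B : ℝ, 0 ≤ B → (∀ x, ‖f x‖ ≤ B) → ‖integral f‖ ≤ C * B

/-- The complex measure `ν` is a positive measure. -/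
def ComplexRadonMeasure.IsPositive {X : Type*} [TopologicalSpace X]
    (ν : ComplexRadonMeasure X) : Prop :=
  ∀ f : C_c(X, ℂ), (∀ x, 0 ≤ (f x).re ∧ (f x).im = 0) →
    0 ≤ (ν.integral f).re ∧ (ν.integral f).im = 0

end Measures

/-! ### Submanifolds foliated by complex leaves

A closed `C^1` submanifold of `M` is given as the image of a `C^1` embedding `ι : N → M` with closed
range, where `N` is a `C^1` manifold modelled on `E'`; the leaves are the fibres
of a map `F : N → γ`, where `γ` is a `C^1` manifold modelled on `G`. -/

section Leaves

variable {E : Type*} [NormedAddCommGroup E] [NormedSpace ℝ E]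
  {M : Type*} [TopologicalSpace M] [ChartedSpace E M]
  {E' : Type*} [NormedAddCommGroup E'] [NormedSpace ℝ E']
  {N : Type*} [TopologicalSpace N] [ChartedSpace E' N]
  {G : Type*} [NormedAddCommGroup G] [NormedSpace ℝ G]
  {γ : Type*} [TopologicalSpace γ] [ChartedSpace G γ]

/-- The leaf `L_t = F⁻¹(t)`, as a subset of `M`. -/
def leaf (ι : N → M) (F : N → γ) (t : γ) : Set M := ι '' (F ⁻¹' {t})

variable (E E') in
/-- The tangent space of the submanifold `ι(N)` at `ι x`, inside the tangent space of `M`. -/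
def tangentOf (ι : N → M) (x : N) : Submodule ℝ (TangentSpace 𝓘(ℝ, E) (ι x)) :=
  LinearMap.range (mfderiv 𝓘(ℝ, E') 𝓘(ℝ, E) ι x).toLinearMap

variable (E E' G) in
/-- The tangent space at `ι x` of the leaf through `ι x`, inside the tangent space of `M`. -/
def leafTangent (ι : N → M) (F : N → γ) (x : N) : Submodule ℝ (TangentSpace 𝓘(ℝ, E) (ι x)) :=
  (LinearMap.ker (mfderiv 𝓘(ℝ, E') 𝓘(ℝ, G) F x).toLinearMap).map
    (mfderiv 𝓘(ℝ, E') 𝓘(ℝ, E) ι x).toLinearMap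

variable (E') in
/-- `ι(N)` is a CR submanifold of CR dimension `p`: the maximal complex subspaces
`H = T ∩ J T` of its tangent spaces `T` have complex dimension `p`. -/
def IsCRSubmanifold [IsManifold 𝓘(ℝ, E) ∞ M] (J : AlmostComplexStructure E M) (ι : N → M)
    (p : ℕ) : Prop :=
  ∀ x : N, finrank ℝ
    ↥(tangentOf E E' ι x ⊓ (tangentOf E E' ι x).map (J.toFun (ι x)).toLinearMap) = 2 * p

/-- `T = ∫ [L_t] dν(t)`: for every test form `φ` the function `t ↦ ⟨[L_t], φ⟩` on `γ` is continuous
with compact support, and `⟨T, φ⟩` is its integral with respect to `ν`. -/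
def IsIntegralOfLeaves [T2Space M] [IsManifold 𝓘(ℝ, E) ∞ M] (J : AlmostComplexStructure E M)
    (p : ℕ) (ι : N → M) (F : N → γ) (T : TestForm E M (2 * p) →ₗ[ℂ] ℂ)
    (ν : ComplexRadonMeasure γ) : Prop :=
  ∀ φ : TestForm E M (2 * p), ∃ f : C_c(γ, ℂ),
    (∀ t, f t = integrationCurrent J p (leaf ι F t) φ) ∧ T φ = ν.integral f

end Leaves

end

/-!
Part (a) is the case `p = 1` of part (b), since a real hypersurface of an almost complex manifold of
complex dimension `2` that is foliated by complex curves is a CR submanifold of CR dimension `1`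
(`isCRSubmanifold_of_hypersurface`). Part (b) is proved first locally, in flow boxes, and then by
gluing.

*Local structure.* Near a point of `ι(N)` there is a `C^1` chart `Θ` of `M` with values in `H × (G × R)`
in which `ι(N)` is `H × G × {0}` and `F` is the projection to `G`, with `H` the model of the leaves;
it can be chosen compatible with the orientation of the leaves by `J` (`exists_isFlowBox`,
`exists_isOrientedFlowBox`). A current `T` of order `0` with support in `ι(N)` is bounded by the
uniform norm of the form on `ι(N)` alone, so it extends to a continuous functional on the continuous
forms on a compact piece `X` of `ι(N)` (`TestForm.IsOrderZero.exists_functional`). Such functionals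
can be transported by `C^1` changes of coordinates, and a regularization shows that closedness is
preserved (`VanishesOnExact.isClosedFunctional`). Let `S` be the transported functional on forms on
`H × (G × R)`.

* If a linear form `ℓ` vanishes on `X`, then `d (f ℓ θ) = ℓ df ∧ θ + f dℓ ∧ θ` for constant forms
  `θ`, where the first term vanishes on `X`. As `S` is closed, `S (f dℓ ∧ θ) = 0`. Hence `S` only
  depends on the pull-back of a form to `H × G` (`IsClosedFunctional.apply_eq_proj`).
* Forms of type `(p,p)` are `J`-invariant, and `T` vanishes on the other types, so `T` is invariant
  under `J` (`TestForm.IsBidimension.apply_compJ`). The CR condition says that `J` maps no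
  vector of `H × G` outside `H` into `H × G`. By composing with `J` and with a projection to
  `H × G`, it follows that `S` only depends on the restriction of a form to the leaves
  (`IsClosedFunctional.exists_isOpen_apply_eq_zero`): `S` is a functional of the coefficient of a
  form along `H`.
* Closedness, used once more, makes this functional vanish on derivatives in the directions of
  `H`. It is therefore invariant under translations along the leaves, and factors through the
  integration over the leaves (`IsClosedFunctional.exists_transverse`). The remaining functional of
  the variable in `G` is the local transverse measure (`IsFlowBox.exists_local_measure`).

*Global structure.* Integrals over the plaques of the flow boxes, added up by a partition of
unity, define the currents of integration over the leaves (`exists_isIntegrationCurrent`), and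
`t ↦ ⟨[L_t], φ⟩` is continuous, as a sum of integrals over parallel plaques
(`continuous_integrationCurrent`), with support in the image under `F` of the compact set of the
points of `N` that `ι` maps into the support of `φ`. As `F` is globally
defined on `N`, a leaf meets a flow box in a single plaque.

Two measures that represent the same current near a point of a leaf have the same germ at the
parameter of this leaf, because every continuous function near this parameter is a uniform limit
of functions `t ↦ ⟨[L_t], φ⟩` with `φ` supported near the given point, and nonnegative functions are
limits of such functions with `φ` strongly positive (`IsOrientedFlowBox.exists_approx`,
`exists_leafIntegrals_approx`). As the leaves are connected, the germ does not depend on the point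
of the leaf, and a partition of unity glues the germs (`exists_measure_eqNear`,
`exists_leafMeasure`). The same approximation gives uniqueness of `ν` and the equivalence of the
positivity of `T` and of `ν`.
-/

noncomputable section

set_option linter.unusedSectionVars false



/-! ### Type decomposition of alternating forms -/

section TypeDecomposition

/-- If commuting endomorphisms `A i` satisfy `A i ^ 2 = -1`, then the vectors which are, for every
`i ∈ S`, an eigenvector of `A i` for one of the eigenvalues `± I` span the whole space. -/
lemma mem_span_jointEigenvectors {X : Type*} [AddCommGroup X] [Module ℂ X] {ι : Type*}
    [DecidableEq ι] (A : ι → X →ₗ[ℂ] X) (hcomm : ∀ i j x, A i (A j x) = A j (A i x))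
    (hsq : ∀ i x, A i (A i x) = -x) (S : Finset ι) (x : X) :
    x ∈ Submodule.span ℂ {y | ∀ i ∈ S, A i y = Complex.I • y ∨ A i y = -Complex.I • y} := by
  induction S using Finset.induction_on generalizing x with
  | empty => exact Submodule.subset_span (by simp)
  | insert j S hj ih =>
    refine Submodule.span_induction ?_ (zero_mem _) (fun _ _ _ _ h h' => add_mem h h')
      (fun c _ _ h => Submodule.smul_mem _ c h) (ih x)
    intro y hy
    have h : y = (1 / 2 : ℂ) • (y - Complex.I • A j y) + (1 / 2 : ℂ) • (y + Complex.I • A j y) := by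
      module
    rw [h]
    refine add_mem (Submodule.smul_mem _ _ (Submodule.subset_span ?_))
      (Submodule.smul_mem _ _ (Submodule.subset_span ?_))
    all_goals
      intro i hi
      rcases Finset.mem_insert.1 hi with rfl | hi
    · left
      simp only [map_sub, map_smul, hsq, smul_sub, smul_smul, Complex.I_mul_I]
      module
    · rcases hy i hi with h | h
      · left; rw [map_sub, map_smul, hcomm, h, map_smul]; module
      · right; rw [map_sub, map_smul, hcomm, h, map_smul]; module
    · right
      simp only [map_add, map_smul, hsq, smul_add, smul_smul, neg_mul, Complex.I_mul_I]
      module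
    · rcases hy i hi with h | h
      · left; rw [map_add, map_smul, hcomm, h, map_smul]; module
      · right; rw [map_add, map_smul, hcomm, h, map_smul]; module

lemma aeval_apply_eigenvector {X : Type*} [AddCommGroup X] [Module ℂ X] (D : X →ₗ[ℂ] X) {l : ℂ}
    {x : X} (h : D x = l • x) (f : Polynomial ℂ) : Polynomial.aeval D f x = f.eval l • x := by
  induction f using Polynomial.induction_on' with
  | add p q hp hq => simp [hp, hq, add_smul]
  | monomial n a =>
    have hn : (D ^ n) x = l ^ n • x := by
      induction n with
      | zero => simp
      | succ n ih => rw [pow_succ', Module.End.mul_apply, ih, map_smul, h, smul_smul, pow_succ]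
    simp [Polynomial.aeval_monomial, hn, smul_smul, mul_comm]

lemma aeval_intertwine {X Y : Type*} [AddCommGroup X] [Module ℂ X] [AddCommGroup Y] [Module ℂ Y]
    (D : X →ₗ[ℂ] X) (D' : Y →ₗ[ℂ] Y) (e : X →ₗ[ℂ] Y) (h : ∀ x, e (D x) = D' (e x))
    (f : Polynomial ℂ) (x : X) : e (Polynomial.aeval D f x) = Polynomial.aeval D' f (e x) := by
  induction f using Polynomial.induction_on' with
  | add p q hp hq => simp [hp, hq]
  | monomial n a =>
    have hn : e ((D ^ n) x) = (D' ^ n) (e x) := by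
      induction n with
      | zero => simp
      | succ n ih => rw [pow_succ', Module.End.mul_apply, h, ih, pow_succ', Module.End.mul_apply]
    simp [Polynomial.aeval_monomial, hn]

variable {V : Type*} [AddCommGroup V] [Module ℝ V]

/-- The endomorphism `φ ↦ φ (…, J vᵢ, …)` of the space of multilinear maps, for a fixed slot `i`. -/
def slotMap (J : V →ₗ[ℝ] V) {k : ℕ} (i : Fin k) :
    MultilinearMap ℝ (fun _ : Fin k => V) ℂ →ₗ[ℂ] MultilinearMap ℝ (fun _ : Fin k => V) ℂ where
  toFun φ := φ.compLinearMap (Function.update (fun _ => LinearMap.id) i J)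
  map_add' _ _ := rfl
  map_smul' _ _ := rfl

lemma slotMap_apply (J : V →ₗ[ℝ] V) {k : ℕ} (i : Fin k)
    (φ : MultilinearMap ℝ (fun _ : Fin k => V) ℂ) (v : Fin k → V) :
    slotMap J i φ v = φ (Function.update v i (J (v i))) := by
  change φ _ = φ _
  congr 1
  ext j
  rcases eq_or_ne j i with rfl | h
  · simp
  · simp [h]

/-- The eigenvalue `i (r - s)` of the slot-wise derivation, where `r + s = k`. -/
def typeEigenvalue (k r : ℕ) : ℂ := ((r : ℂ) - ((k - r : ℕ) : ℂ)) * Complex.I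

lemma typeEigenvalue_injOn (k : ℕ) : Set.InjOn (typeEigenvalue k) (Finset.range (k + 1)) := by
  intro r hr s hs h
  simp only [Finset.coe_range, mem_Iio] at hr hs
  unfold typeEigenvalue at h
  have h2 := mul_right_cancel₀ Complex.I_ne_zero h
  rw [Nat.cast_sub (by omega), Nat.cast_sub (by omega)] at h2
  have : (r : ℂ) = s := by linear_combination h2 / 2
  exact_mod_cast this

/-- Every multilinear form is a combination of forms which are eigenvectors both of the slot-wise
derivation and of the pull-back by `J`, with eigenvalues `i (r - s)` and `i ^ r (-i) ^ s`. -/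
lemma mem_span_typeEigenvectors (J : V →ₗ[ℝ] V) (hJ : ∀ v, J (J v) = -v) {k : ℕ}
    (φ : MultilinearMap ℝ (fun _ : Fin k => V) ℂ) :
    φ ∈ Submodule.span ℂ {y : MultilinearMap ℝ (fun _ : Fin k => V) ℂ |
      ∃ r ∈ Finset.range (k + 1), (∑ i, slotMap J i) y = typeEigenvalue k r • y ∧
        y.compLinearMap (fun _ => J) = (Complex.I ^ r * (-Complex.I) ^ (k - r)) • y} := by
  classical
  have h := mem_span_jointEigenvectors (fun i : Fin k => slotMap J i) ?_ ?_ Finset.univ φ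
  · refine Submodule.span_mono ?_ h
    intro y hy
    simp only [Finset.mem_univ, true_imp_iff] at hy
    set S := Finset.univ.filter (fun i : Fin k => slotMap J i y = Complex.I • y) with hS
    have hcard : S.card + Sᶜ.card = k := by
      rw [Finset.card_add_card_compl, Fintype.card_fin]
    have hSi : ∀ i ∈ S, slotMap J i y = Complex.I • y := fun i hi => (Finset.mem_filter.1 hi).2
    have hSc : ∀ i ∈ Sᶜ, slotMap J i y = -Complex.I • y := fun i hi =>
      (hy i).resolve_left (fun h => by simp [hS, h] at hi)
    refine ⟨S.card, by simp; omega, ?_, ?_⟩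
    · rw [LinearMap.sum_apply, ← Finset.sum_add_sum_compl S, Finset.sum_congr rfl hSi,
        Finset.sum_congr rfl hSc]
      simp only [Finset.sum_const, typeEigenvalue]
      rw [show k - S.card = Sᶜ.card by omega]
      simp only [← Nat.cast_smul_eq_nsmul ℂ, smul_smul, ← add_smul]
      congr 1; ring
    · have key : ∀ U : Finset (Fin k), ∀ v, y (fun i => if i ∈ U then J (v i) else v i) =
          (∏ i ∈ U, (if i ∈ S then Complex.I else -Complex.I)) • y v := by
        intro U
        induction U using Finset.induction_on with
        | empty => simp
        | insert j U hj ih =>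
          intro v
          rw [Finset.prod_insert hj, mul_smul, ← ih, ← smul_apply]
          have hj' : slotMap J j y = (if j ∈ S then Complex.I else -Complex.I) • y := by
            split_ifs with h
            · exact hSi j h
            · exact hSc j (by simpa using h)
          rw [← hj', slotMap_apply]
          congr 1; ext i
          rcases eq_or_ne i j with rfl | h
          · simp [hj]
          · simp [h]
      ext v
      have := key Finset.univ v
      simp only [Finset.mem_univ, if_true] at this
      rw [MultilinearMap.compLinearMap_apply, this, smul_apply]
      congr 1
      rw [Finset.prod_ite, Finset.prod_const, Finset.prod_const]
      congr 2
      · congr 1; ext i; simp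
      · rw [show k - S.card = Sᶜ.card by omega]
        congr 1; ext i; simp
  · intro i j y
    ext v
    simp only [slotMap_apply]
    rcases eq_or_ne i j with rfl | hij
    · rfl
    · rw [Function.update_of_ne hij, Function.update_of_ne hij.symm,
        Function.update_comm hij]
  · intro i y
    ext v
    simp only [slotMap_apply, Function.update_self, Function.update_idem, hJ,
      neg_apply]
    rw [← neg_one_smul ℝ (v i), y.map_update_smul, Function.update_eq_self]
    simp

end TypeDecomposition

/-! ### Positivity of `(p,p)`-covectors and orientation by a complex structure -/

section Positivity

/-- The pairing of `{0, …, p-1} ⊔ {0, …, p-1}` with `{0, …, 2p-1}` that interlaces the two copies. -/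
def interlace (p : ℕ) : Fin p ⊕ Fin p ≃ Fin (2 * p) where
  toFun := Sum.elim (fun j => ⟨2 * j.1, by omega⟩) (fun j => ⟨2 * j.1 + 1, by omega⟩)
  invFun i := if i.1 % 2 = 0 then Sum.inl ⟨i.1 / 2, by omega⟩ else Sum.inr ⟨i.1 / 2, by omega⟩
  left_inv := by
    rintro (j | j)
    · simp
    · have h : (2 * j.1 + 1) % 2 = 1 := by omega
      have h' : (2 * j.1 + 1) / 2 = j.1 := by omega
      simp [h, h']
  right_inv := by
    intro i
    rcases Nat.mod_two_eq_zero_or_one i.1 with h | h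
    · simp only [h, if_true, Sum.elim_inl]; ext; simp; omega
    · simp only [h, one_ne_zero, if_false, Sum.elim_inr]; ext; simp; omega

variable {V : Type*} [AddCommGroup V] [Module ℝ V] [TopologicalSpace V]

lemma complexFrame_interlace_inl (J : V →L[ℝ] V) {p : ℕ} (e : Fin p → V) (j : Fin p) :
    complexFrame J e (interlace p (Sum.inl j)) = e j := by
  simp [complexFrame, interlace]

lemma complexFrame_interlace_inr (J : V →L[ℝ] V) {p : ℕ} (e : Fin p → V) (j : Fin p) :
    complexFrame J e (interlace p (Sum.inr j)) = J (e j) := by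
  have h : (2 * j.1 + 1) % 2 = 1 := by omega
  have h' : (2 * j.1 + 1) / 2 = j.1 := by omega
  simp [complexFrame, interlace, h, h']

lemma conjPair_interlace_inl {p : ℕ} (α : Fin p → (V →L[ℝ] ℂ)) (j : Fin p) (w : V) :
    conjPair α (interlace p (Sum.inl j)) w = α j w := by
  simp [conjPair, interlace]

lemma conjPair_interlace_inr {p : ℕ} (α : Fin p → (V →L[ℝ] ℂ)) (j : Fin p) (w : V) :
    conjPair α (interlace p (Sum.inr j)) w = (starRingEnd ℂ) (α j w) := by
  have h : (2 * j.1 + 1) % 2 = 1 := by omega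
  have h' : (2 * j.1 + 1) / 2 = j.1 := by omega
  simp [conjPair, interlace, h, h']

/-- The value of `i α₀ ∧ ᾱ₀ ∧ … ∧ i α_{p-1} ∧ ᾱ_{p-1}` on `v₀, …, v_{2p-1}`. -/
def elementaryPositive {p : ℕ} (α : Fin p → (V →L[ℝ] ℂ)) (v : Fin (2 * p) → V) : ℂ :=
  Complex.I ^ p * (Matrix.of fun i j => conjPair α i (v j)).det

/-- On a frame `e₀, J e₀, …` the form `i α₀ ∧ ᾱ₀ ∧ …` takes the value `2 ^ p |det αᵢ(eⱼ)|²`. -/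
lemma elementaryPositive_complexFrame (J : V →L[ℝ] V) {p : ℕ} (α : Fin p → (V →L[ℝ] ℂ))
    (hα : ∀ j w, α j (J w) = Complex.I * α j w) (e : Fin p → V) :
    elementaryPositive α (complexFrame J e) =
      ((2 ^ p * Complex.normSq (Matrix.of fun i j => α i (e j)).det : ℝ) : ℂ) := by
  set B : Matrix (Fin p) (Fin p) ℂ := Matrix.of fun i j => α i (e j) with hB
  have h1 : (Matrix.of fun i j => conjPair α i (complexFrame J e j)).submatrix
      (interlace p) (interlace p) =
      Matrix.fromBlocks B 0 0 (B.map (starRingEnd ℂ)) *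
        Matrix.fromBlocks 1 (Complex.I • 1) 1 (-Complex.I • 1) := by
    rw [Matrix.fromBlocks_multiply]
    ext (i | i) (j | j)
    · simp [complexFrame_interlace_inl, conjPair_interlace_inl, hB]
    · simp [complexFrame_interlace_inr, conjPair_interlace_inl, hB, hα]
    · simp [complexFrame_interlace_inl, conjPair_interlace_inr, hB]
    · simp [complexFrame_interlace_inr, conjPair_interlace_inr, hB, hα]
  unfold elementaryPositive
  rw [← Matrix.det_submatrix_equiv_self (interlace p), h1, Matrix.det_mul,
    Matrix.det_fromBlocks_zero₂₁, Matrix.det_fromBlocks_one₁₁, Matrix.one_mul, ← sub_smul,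
    Matrix.det_smul, Matrix.det_one, ← RingHom.mapMatrix_apply, ← RingHom.map_det,
    Complex.mul_conj, Fintype.card_fin]
  push_cast
  rw [show (2 : ℂ) ^ p = (Complex.I * (-Complex.I - Complex.I)) ^ p by
    congr 1; linear_combination (2 : ℂ) * Complex.I_mul_I, mul_pow]
  ring

lemma elementaryPositive_linearCombination {p : ℕ} (α : Fin p → (V →L[ℝ] ℂ))
    (v w : Fin (2 * p) → V) (A : Matrix (Fin (2 * p)) (Fin (2 * p)) ℝ)
    (h : ∀ i, v i = ∑ j, A i j • w j) :
    elementaryPositive α v = (A.det : ℂ) * elementaryPositive α w := by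
  have h1 : (Matrix.of fun i j => conjPair α i (v j)) =
      (Matrix.of fun i j => conjPair α i (w j)) * (A.map (algebraMap ℝ ℂ)).transpose := by
    ext i j
    simp only [Matrix.of_apply, Matrix.mul_apply, Matrix.transpose_apply, Matrix.map_apply, h]
    unfold conjPair
    split_ifs
    · simp [map_sum, mul_comm]
    · simp [map_sum, mul_comm]
  unfold elementaryPositive
  rw [h1, Matrix.det_mul, Matrix.det_transpose, ← RingHom.mapMatrix_apply, ← RingHom.map_det]
  simp only [Complex.coe_algebraMap]
  ring

/-- The form `i α₀ ∧ ᾱ₀ ∧ …` is nonnegative on positively oriented families. -/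
lemma IsPositivelyOriented.elementaryPositive_eq {J : V →L[ℝ] V} {p : ℕ} {v : Fin (2 * p) → V}
    (hv : IsPositivelyOriented J v) (α : Fin p → (V →L[ℝ] ℂ))
    (hα : ∀ j w, α j (J w) = Complex.I * α j w) :
    ∃ c : ℝ, 0 ≤ c ∧ elementaryPositive α v = c := by
  obtain ⟨e, A, hA, h⟩ := hv
  refine ⟨A.det * (2 ^ p * Complex.normSq (Matrix.of fun i j => α i (e j)).det), ?_, ?_⟩
  · have := Complex.normSq_nonneg (Matrix.of fun i j => α i (e j)).det
    positivity
  · rw [elementaryPositive_linearCombination α v _ A h, elementaryPositive_complexFrame J α hα]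
    push_cast; ring

lemma IsStronglyPositive.apply_nonneg {J : V →L[ℝ] V} {p : ℕ} {φ : V [⋀^Fin (2 * p)]→L[ℝ] ℂ}
    (hφ : IsStronglyPositive J φ) {v : Fin (2 * p) → V} (hv : IsPositivelyOriented J v) :
    0 ≤ (φ v).re ∧ (φ v).im = 0 := by
  obtain ⟨m, c, α, hc, hα, h⟩ := hφ
  choose d hd hd' using fun a => hv.elementaryPositive_eq (α a) (hα a)
  have : φ v = ((∑ a, c a * d a : ℝ) : ℂ) := by
    rw [h v]; push_cast
    refine Finset.sum_congr rfl fun a _ => ?_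
    rw [← hd' a]; rfl
  rw [this]
  exact ⟨by rw [Complex.ofReal_re]; exact Finset.sum_nonneg fun a _ => mul_nonneg (hc a) (hd a),
    Complex.ofReal_im _⟩

end Positivity

section Orientation

variable {V : Type*} [NormedAddCommGroup V] [NormedSpace ℝ V]

/-- The `(1,0)`-form `a - i a ∘ J` with real part `a`. -/
def oneZeroForm (J : V →L[ℝ] V) (a : V →L[ℝ] ℝ) : V →L[ℝ] ℂ :=
  Complex.ofRealCLM.comp a - Complex.I • Complex.ofRealCLM.comp (a.comp J)

lemma oneZeroForm_apply (J : V →L[ℝ] V) (a : V →L[ℝ] ℝ) (w : V) :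
    oneZeroForm J a w = (a w : ℂ) - Complex.I * (a (J w) : ℂ) := rfl

lemma oneZeroForm_comp (J : V →L[ℝ] V) (hJ : ∀ v, J (J v) = -v) (a : V →L[ℝ] ℝ) (w : V) :
    oneZeroForm J a (J w) = Complex.I * oneZeroForm J a w := by
  simp only [oneZeroForm_apply, hJ, map_neg, Complex.ofReal_neg]
  linear_combination (a (J w) : ℂ) * Complex.I_mul_I

variable [FiniteDimensional ℝ V]

/-- For a linearly independent positively oriented family `v` some form `i α₀ ∧ ᾱ₀ ∧ …` built
from `(1,0)`-forms `αⱼ = aⱼ - i aⱼ ∘ J` is positive on `v`. -/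
lemma IsPositivelyOriented.exists_elementaryPositive_pos {J : V →L[ℝ] V} (hJ : ∀ v, J (J v) = -v)
    {p : ℕ} {v : Fin (2 * p) → V} (hv : IsPositivelyOriented J v) (hli : LinearIndependent ℝ v) :
    ∃ a : Fin p → (V →L[ℝ] ℝ), ∃ c : ℝ, 0 < c ∧
      elementaryPositive (fun j => oneZeroForm J (a j)) v = c := by
  obtain ⟨e, A, hA, h⟩ := hv
  have hli' : LinearIndependent ℝ (complexFrame J e) := by
    rw [linearIndependent_iff_card_eq_finrank_span, Set.finrank]
    apply le_antisymm _ (finrank_range_le_card _)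
    rw [linearIndependent_iff_card_eq_finrank_span.1 hli, Set.finrank]
    apply Submodule.finrank_mono
    rw [Submodule.span_le]
    rintro _ ⟨i, rfl⟩
    rw [h i]
    exact Submodule.sum_mem _ fun j _ => Submodule.smul_mem _ _ (Submodule.subset_span ⟨j, rfl⟩)
  have hex : ∀ j : Fin p, ∃ a : V →L[ℝ] ℝ, ∀ i, a (complexFrame J e i) =
      if i = interlace p (Sum.inl j) then 1 else 0 := by
    intro j
    let b := Basis.span hli'
    obtain ⟨g, hg⟩ := (b.constr ℝ (fun i => if i = interlace p (Sum.inl j) then (1 : ℝ)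
      else 0)).exists_extend
    refine ⟨LinearMap.toContinuousLinearMap g, fun i => ?_⟩
    have h2 := congrArg (fun f => f (b i)) hg
    simp only [LinearMap.comp_apply, Basis.constr_basis] at h2
    rw [← h2]
    simp [b, Basis.span_apply]
  choose a ha using hex
  refine ⟨a, A.det * 2 ^ p, by positivity, ?_⟩
  rw [elementaryPositive_linearCombination _ v _ A h,
    elementaryPositive_complexFrame J _ (fun j w => oneZeroForm_comp J hJ _ _)]
  have : (Matrix.of fun i j => oneZeroForm J (a i) (e j)) = (1 : Matrix (Fin p) (Fin p) ℂ) := by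
    ext i j
    have h1 := ha i (interlace p (Sum.inl j))
    have h2 := ha i (interlace p (Sum.inr j))
    rw [complexFrame_interlace_inl] at h1
    rw [complexFrame_interlace_inr] at h2
    simp only [Matrix.of_apply, oneZeroForm_apply, h1, h2, (interlace p).injective.eq_iff,
      Matrix.one_apply]
    rcases eq_or_ne i j with rfl | hij
    · simp
    · simp [hij, hij.symm]
  rw [this]
  simp

/-- Two positively oriented bases of the same complex subspace have the same orientation. -/
lemma IsPositivelyOriented.det_pos {J : V →L[ℝ] V} (hJ : ∀ v, J (J v) = -v)
    {p : ℕ} {v w : Fin (2 * p) → V} (hv : IsPositivelyOriented J v)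
    (hw : IsPositivelyOriented J w) (hli : LinearIndependent ℝ v)
    (A : Matrix (Fin (2 * p)) (Fin (2 * p)) ℝ) (h : ∀ i, v i = ∑ j, A i j • w j) : 0 < A.det := by
  obtain ⟨a, c, hc, hac⟩ := hv.exists_elementaryPositive_pos hJ hli
  obtain ⟨d, hd, had⟩ := hw.elementaryPositive_eq (fun j => oneZeroForm J (a j))
    (fun j w => oneZeroForm_comp J hJ _ _)
  rw [elementaryPositive_linearCombination _ v w A h, had] at hac
  have hac' : A.det * d = c := by exact_mod_cast hac
  rw [← hac'] at hc
  exact pos_of_mul_pos_left hc hd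

end Orientation

section Frames

variable {V : Type*} [NormedAddCommGroup V] [NormedSpace ℝ V] [FiniteDimensional ℝ V]

/-- A `J`-invariant subspace of real dimension `2p` has a real basis of the form
`e₀, J e₀, …, e_{p-1}, J e_{p-1}`. -/
lemma exists_complexFrame (J : V →L[ℝ] V) (hJ : ∀ v, J (J v) = -v) (H : Submodule ℝ V)
    (hH : ∀ v ∈ H, J v ∈ H) {p : ℕ} (hp : finrank ℝ H = 2 * p) :
    ∃ e : Fin p → V, LinearIndependent ℝ (complexFrame J e) ∧
      Submodule.span ℝ (range (complexFrame J e)) = H := by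
  let j : Module.End ℝ H := J.toLinearMap.restrict hH
  have hj : j * j = -1 := by
    ext x; simp [j, hJ]
  -- `H` is a complex vector space, where `i` acts by `J`
  let f : ℂ →ₐ[ℝ] Module.End ℝ H := Complex.liftAux j hj
  let _ : Module ℂ H := Module.compHom H f.toRingHom
  have hsmul : ∀ (z : ℂ) (x : H), z • x = z.re • x + z.im • j x := by
    intro z x
    change f z x = _
    simp [f, Complex.liftAux_apply, Algebra.algebraMap_eq_smul_one]
  have : IsScalarTower ℝ ℂ H := ⟨fun r z x => by
    simp only [hsmul, Complex.real_smul, Complex.mul_re, Complex.mul_im, Complex.ofReal_re,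
      Complex.ofReal_im, zero_mul, sub_zero, add_zero, smul_add, smul_smul]⟩
  have : Module.Finite ℂ H := Module.Finite.of_restrictScalars_finite ℝ ℂ H
  have hfr : finrank ℂ H = p := by
    have := Module.finrank_mul_finrank ℝ ℂ H
    rw [Complex.finrank_real_complex] at this
    omega
  let b := finBasisOfFinrankEq ℂ H hfr
  have hspan : Submodule.span ℝ (range (complexFrame J (fun i => (b i : V)))) = H := by
    apply le_antisymm
    · rw [Submodule.span_le]
      rintro _ ⟨i, rfl⟩
      unfold complexFrame
      split_ifs
      · exact (b _).2
      · exact hH _ (b _).2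
    · intro x hx
      have h1 := b.sum_repr ⟨x, hx⟩
      have h2 : x = ∑ i, (((b.repr ⟨x, hx⟩ i).re • (b i : V)) +
          (b.repr ⟨x, hx⟩ i).im • J (b i : V)) := by
        have := congrArg (Subtype.val) h1
        simp only [hsmul] at this
        refine this.symm.trans ?_
        simp [j]
      rw [h2]
      refine Submodule.sum_mem _ fun i _ => Submodule.add_mem _ (Submodule.smul_mem _ _ ?_)
        (Submodule.smul_mem _ _ ?_)
      · exact Submodule.subset_span ⟨interlace p (Sum.inl i), complexFrame_interlace_inl _ _ _⟩
      · exact Submodule.subset_span ⟨interlace p (Sum.inr i), complexFrame_interlace_inr _ _ _⟩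
  refine ⟨fun i => (b i : V), ?_, hspan⟩
  rw [linearIndependent_iff_card_eq_finrank_span, Set.finrank, hspan, hp, Fintype.card_fin]

end Frames

/-! ### Regularity of maps into spaces of alternating forms -/

section Regularity

variable {V : Type*} [NormedAddCommGroup V] [NormedSpace ℝ V] [FiniteDimensional ℝ V]
  {W : Type*} [NormedAddCommGroup W] [NormedSpace ℝ W]
  {D : Type*} [NormedAddCommGroup D] [NormedSpace ℝ D]

instance finiteDimensional_continuousAlternatingMap (k : ℕ) :
    FiniteDimensional ℝ (V [⋀^Fin k]→L[ℝ] ℂ) := by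
  let f : (V [⋀^Fin k]→L[ℝ] ℂ) →ₗ[ℝ] MultilinearMap ℝ (fun _ : Fin k => V) ℂ :=
    { toFun := fun φ => φ.toMultilinearMap
      map_add' := fun _ _ => rfl
      map_smul' := fun _ _ => rfl }
  refine FiniteDimensional.of_injective f fun φ ψ h => ?_
  ext v
  exact congrArg (fun g : MultilinearMap ℝ (fun _ : Fin k => V) ℂ => g v) h

/-- The evaluation of an alternating form at fixed vectors. -/
def evalForm {k : ℕ} (v : Fin k → W) : (W [⋀^Fin k]→L[ℝ] ℂ) →L[ℝ] ℂ :=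
  (ContinuousMultilinearMap.apply ℝ (fun _ : Fin k => W) ℂ v).comp
    (ContinuousAlternatingMap.toContinuousMultilinearMapCLM ℝ)

/-- Forms of degree `k` are recovered, by a continuous linear map, from finitely many of their
values. -/
lemma exists_form_of_values (V : Type*) [NormedAddCommGroup V] [NormedSpace ℝ V]
    [FiniteDimensional ℝ V] (k : ℕ) : ∃ (m : ℕ) (v : Fin m → Fin k → V)
    (R : (Fin m → ℂ) →L[ℝ] (V [⋀^Fin k]→L[ℝ] ℂ)),
      ∀ φ : V [⋀^Fin k]→L[ℝ] ℂ, R (fun i => φ (v i)) = φ := by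
  let b := finBasis ℝ V
  let m := Fintype.card (Fin k → Fin (finrank ℝ V))
  let σ := Fintype.equivFin (Fin k → Fin (finrank ℝ V))
  let v : Fin m → Fin k → V := fun i l => b (σ.symm i l)
  let f : (V [⋀^Fin k]→L[ℝ] ℂ) →ₗ[ℝ] (Fin m → ℂ) :=
    { toFun := fun φ i => φ (v i)
      map_add' := fun _ _ => rfl
      map_smul' := fun _ _ => rfl }
  have hf : LinearMap.ker f = ⊥ := by
    rw [LinearMap.ker_eq_bot]
    intro φ ψ h
    apply ContinuousAlternatingMap.toContinuousMultilinearMap_injective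
    apply ContinuousMultilinearMap.toMultilinearMap_injective
    refine Basis.ext_multilinear (fun _ => b) fun s => ?_
    have := congrFun h (σ s)
    simpa [f, v] using this
  obtain ⟨g, hg⟩ := f.exists_leftInverse_of_injective hf
  exact ⟨m, v, LinearMap.toContinuousLinearMap g, fun φ => congrArg (fun h => h φ) hg⟩

lemma contDiffOn_form_iff {n : WithTop ℕ∞} {k : ℕ} {φ : D → V [⋀^Fin k]→L[ℝ] ℂ} {s : Set D} :
    ContDiffOn ℝ n φ s ↔ ∀ v, ContDiffOn ℝ n (fun y => φ y v) s := by
  refine ⟨fun h v => (evalForm v).contDiff.comp_contDiffOn h, fun h => ?_⟩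
  obtain ⟨m, v, R, hR⟩ := exists_form_of_values V k
  have : φ = fun y => R (fun i => φ y (v i)) := funext fun y => (hR _).symm
  rw [this]
  exact R.contDiff.comp_contDiffOn (contDiffOn_pi.2 fun i => h (v i))

lemma continuousOn_form_iff {X : Type*} [TopologicalSpace X] {k : ℕ} {φ : X → V [⋀^Fin k]→L[ℝ] ℂ}
    {s : Set X} : ContinuousOn φ s ↔ ∀ v, ContinuousOn (fun y => φ y v) s := by
  refine ⟨fun h v => (evalForm v).continuous.comp_continuousOn h, fun h => ?_⟩
  obtain ⟨m, v, R, hR⟩ := exists_form_of_values V k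
  have : φ = fun y => R (fun i => φ y (v i)) := funext fun y => (hR _).symm
  rw [this]
  exact R.continuous.comp_continuousOn (continuousOn_pi.2 fun i => h (v i))

omit [FiniteDimensional ℝ V] in
lemma ContDiffOn.form_apply_clm {n : WithTop ℕ∞} {k : ℕ} {φ : D → W [⋀^Fin k]→L[ℝ] ℂ} {s : Set D}
    (hφ : ContDiffOn ℝ n φ s) {A : Fin k → D → (V →L[ℝ] W)} (hA : ∀ i, ContDiffOn ℝ n (A i) s)
    (v : Fin k → V) : ContDiffOn ℝ n (fun y => φ y (fun i => A i y (v i))) s := by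
  let c := ContinuousMultilinearMap.compContinuousLinearMapContinuousMultilinear ℝ
    (fun _ : Fin k => V) (fun _ => W) ℂ
  let l : (W [⋀^Fin k]→L[ℝ] ℂ) →L[ℝ] _ := ContinuousAlternatingMap.toContinuousMultilinearMapCLM ℝ
  have hc : ContDiff ℝ n c := ContinuousMultilinearMap.contDiff _
  have hl : ContDiff ℝ n l := ContinuousLinearMap.contDiff _
  have h1 : ContDiffOn ℝ n (fun y => c (fun i => A i y)) s :=
    hc.comp_contDiffOn (contDiffOn_pi.2 hA)
  have h2 : ContDiffOn ℝ n (fun y => l (φ y)) s := hl.comp_contDiffOn hφ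
  have h3 := h1.clm_apply h2
  exact (ContinuousMultilinearMap.apply ℝ (fun _ : Fin k => V) ℂ v).contDiff.comp_contDiffOn h3

omit [FiniteDimensional ℝ V] in
lemma ContinuousOn.form_apply_clm {X : Type*} [TopologicalSpace X] {k : ℕ}
    {φ : X → W [⋀^Fin k]→L[ℝ] ℂ} {s : Set X}
    (hφ : ContinuousOn φ s) {A : Fin k → X → (V →L[ℝ] W)} (hA : ∀ i, ContinuousOn (A i) s)
    (v : Fin k → V) : ContinuousOn (fun y => φ y (fun i => A i y (v i))) s := by
  let c := ContinuousMultilinearMap.compContinuousLinearMapContinuousMultilinear ℝ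
        (fun _ : Fin k => V) (fun _ => W) ℂ
  have h1 : ContinuousOn (fun y => c (fun i => A i y)) s :=
    c.cont.comp_continuousOn (continuousOn_pi.2 hA)
  have h2 : ContinuousOn
      (fun y => ContinuousAlternatingMap.toContinuousMultilinearMapCLM ℝ (φ y)) s :=
    (ContinuousAlternatingMap.toContinuousMultilinearMapCLM ℝ).continuous.comp_continuousOn hφ
  exact (ContinuousMultilinearMap.apply ℝ (fun _ : Fin k => V) ℂ v).continuous.comp_continuousOn
    (h1.clm_apply h2)

lemma ContDiffOn.form_comp_clm {n : WithTop ℕ∞} {k : ℕ} {φ : D → W [⋀^Fin k]→L[ℝ] ℂ} {s : Set D}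
    (hφ : ContDiffOn ℝ n φ s) {A : D → (V →L[ℝ] W)} (hA : ContDiffOn ℝ n A s) :
    ContDiffOn ℝ n (fun y => (φ y).compContinuousLinearMap (A y)) s :=
  contDiffOn_form_iff.2 fun v => hφ.form_apply_clm (fun _ => hA) v

lemma ContinuousOn.form_comp_clm {X : Type*} [TopologicalSpace X] {k : ℕ}
    {φ : X → W [⋀^Fin k]→L[ℝ] ℂ} {s : Set X}
    (hφ : ContinuousOn φ s) {A : X → (V →L[ℝ] W)} (hA : ContinuousOn A s) :
    ContinuousOn (fun y => (φ y).compContinuousLinearMap (A y)) s :=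
  continuousOn_form_iff.2 fun v => hφ.form_apply_clm (fun _ => hA) v

/-- The derivation `φ ↦ ∑ᵢ φ(…, A vᵢ, …)` of the algebra of forms defined by an endomorphism `A`. -/
def slotSum {k : ℕ} (A : W →L[ℝ] W) (φ : W [⋀^Fin k]→L[ℝ] ℂ) : W [⋀^Fin k]→L[ℝ] ℂ :=
  φ.fderivCompContinuousLinearMap (ContinuousLinearMap.id ℝ W) A

lemma slotSum_apply {k : ℕ} (A : W →L[ℝ] W) (φ : W [⋀^Fin k]→L[ℝ] ℂ) (v : Fin k → W) :
    slotSum A φ v = ∑ i, φ (Function.update v i (A (v i))) := by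
  simp only [slotSum, ContinuousAlternatingMap.fderivCompContinuousLinearMap_apply]
  refine Finset.sum_congr rfl fun i _ => ?_
  congr 1; ext j
  rcases eq_or_ne j i with rfl | h
  · simp
  · simp [h]

lemma ContDiffOn.slotSum {n : WithTop ℕ∞} {k : ℕ} {φ : D → V [⋀^Fin k]→L[ℝ] ℂ} {s : Set D}
    (hφ : ContDiffOn ℝ n φ s) {A : D → (V →L[ℝ] V)} (hA : ContDiffOn ℝ n A s) :
    ContDiffOn ℝ n (fun y => _root_.slotSum (A y) (φ y)) s := by
  refine contDiffOn_form_iff.2 fun v => ?_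
  simp only [slotSum_apply]
  refine ContDiffOn.sum fun i _ => ?_
  have := hφ.form_apply_clm (A := fun j y => if j = i then A y else ContinuousLinearMap.id ℝ V)
    (fun j => by split_ifs; exacts [hA, contDiffOn_const]) v
  refine this.congr fun y _ => ?_
  congr 1; ext j
  rcases eq_or_ne j i with rfl | h
  · simp
  · simp [h]

end Regularity

/-! ### Differential forms in charts -/

section Charts

variable {E : Type*} [NormedAddCommGroup E] [NormedSpace ℝ E]
  {M : Type*} [TopologicalSpace M] [ChartedSpace E M]

/-- The derivative of the preferred chart at `x₀`, as an endomorphism of the model space. -/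
def dChart (x₀ x : M) : E →L[ℝ] E := mfderiv 𝓘(ℝ, E) 𝓘(ℝ, E) (extChartAt 𝓘(ℝ, E) x₀) x

/-- The derivative of the inverse of the preferred chart at `x₀`, as an endomorphism of the model
space. -/
def dSymm (x₀ : M) (y : E) : E →L[ℝ] E := mfderiv 𝓘(ℝ, E) 𝓘(ℝ, E) (extChartAt 𝓘(ℝ, E) x₀).symm y

/-- The value of a differential form at a point, as a form on the model space. -/
def formAt {k : ℕ} (φ : ∀ x : M, TangentSpace 𝓘(ℝ, E) x [⋀^Fin k]→L[ℝ] ℂ) (x : M) :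
    E [⋀^Fin k]→L[ℝ] ℂ := φ x

lemma formInChart_eq {k : ℕ} (φ : ∀ x : M, TangentSpace 𝓘(ℝ, E) x [⋀^Fin k]→L[ℝ] ℂ) (x₀ : M)
    (y : E) : formInChart φ x₀ y =
      (formAt φ ((extChartAt 𝓘(ℝ, E) x₀).symm y)).compContinuousLinearMap (dSymm x₀ y) := rfl

lemma formInChart_eq_zero_of {k : ℕ} {φ : ∀ x : M, TangentSpace 𝓘(ℝ, E) x [⋀^Fin k]→L[ℝ] ℂ}
    {x₀ : M} {y : E} (h : φ ((extChartAt 𝓘(ℝ, E) x₀).symm y) = 0) : formInChart φ x₀ y = 0 := by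
  rw [formInChart_eq, formAt, h]; rfl

variable [IsManifold 𝓘(ℝ, E) ∞ M]

lemma isManifold_one_of_infty : IsManifold 𝓘(ℝ, E) 1 M :=
  IsManifold.of_le (n := ∞) (by exact_mod_cast le_top)

lemma mdifferentiableAt_extChartAt_symm' {x₀ : M} {y : E} (hy : y ∈ (extChartAt 𝓘(ℝ, E) x₀).target) :
    MDifferentiableAt 𝓘(ℝ, E) 𝓘(ℝ, E) (extChartAt 𝓘(ℝ, E) x₀).symm y := by
  have := isManifold_one_of_infty (E := E) (M := M)
  have h := mdifferentiableWithinAt_extChartAt_symm hy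
  rwa [ModelWithCorners.range_eq_univ, mdifferentiableWithinAt_univ] at h

lemma dSymm_comp_dChart {x₀ x : M} (hx : x ∈ (extChartAt 𝓘(ℝ, E) x₀).source) :
    (dSymm x₀ (extChartAt 𝓘(ℝ, E) x₀ x)).comp (dChart x₀ x) = ContinuousLinearMap.id ℝ E := by
  have := isManifold_one_of_infty (E := E) (M := M)
  have h := mfderivWithin_extChartAt_symm_comp_mfderiv_extChartAt' hx
  rw [ModelWithCorners.range_eq_univ, mfderivWithin_univ] at h
  exact h

lemma dChart_comp_dSymm {x₀ : M} {y : E} (hy : y ∈ (extChartAt 𝓘(ℝ, E) x₀).target) :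
    (dChart x₀ ((extChartAt 𝓘(ℝ, E) x₀).symm y)).comp (dSymm x₀ y) =
      ContinuousLinearMap.id ℝ E := by
  have := isManifold_one_of_infty (E := E) (M := M)
  have h := mfderiv_extChartAt_comp_mfderivWithin_extChartAt_symm hy
  rw [ModelWithCorners.range_eq_univ, mfderivWithin_univ] at h
  exact h

lemma dChart_dSymm {x₀ : M} {y : E} (hy : y ∈ (extChartAt 𝓘(ℝ, E) x₀).target) (v : E) :
    dChart x₀ ((extChartAt 𝓘(ℝ, E) x₀).symm y) (dSymm x₀ y v) = v :=
  congrArg (fun f : E →L[ℝ] E => f v) (dChart_comp_dSymm hy)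

lemma dSymm_dChart {x₀ x : M} (hx : x ∈ (extChartAt 𝓘(ℝ, E) x₀).source) (v : E) :
    dSymm x₀ (extChartAt 𝓘(ℝ, E) x₀ x) (dChart x₀ x v) = v :=
  congrArg (fun f : E →L[ℝ] E => f v) (dSymm_comp_dChart hx)

lemma dSymm_self (x : M) : dSymm x (extChartAt 𝓘(ℝ, E) x x) = ContinuousLinearMap.id ℝ E := by
  have := isManifold_one_of_infty (E := E) (M := M)
  have h := mfderivWithin_range_extChartAt_symm (I := 𝓘(ℝ, E)) (x := x)
  rw [ModelWithCorners.range_eq_univ, mfderivWithin_univ] at h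
  exact h

omit [IsManifold 𝓘(ℝ, E) ∞ M] in
lemma chartTransition_eventually {x₀ x₁ : M} {y : E} (hy : y ∈ (extChartAt 𝓘(ℝ, E) x₁).target)
    (hy' : (extChartAt 𝓘(ℝ, E) x₁).symm y ∈ (extChartAt 𝓘(ℝ, E) x₀).source) :
    ∀ᶠ z in 𝓝 y, z ∈ (extChartAt 𝓘(ℝ, E) x₁).target ∧
      (extChartAt 𝓘(ℝ, E) x₁).symm z ∈ (extChartAt 𝓘(ℝ, E) x₀).source := by
  filter_upwards [(isOpen_extChartAt_target x₁).mem_nhds hy,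
    (continuousAt_extChartAt_symm'' hy).preimage_mem_nhds
      ((isOpen_extChartAt_source x₀).mem_nhds hy')] with z h1 h2
  exact ⟨h1, h2⟩

lemma contDiffAt_chartTransition {x₀ x₁ : M} {y : E} (hy : y ∈ (extChartAt 𝓘(ℝ, E) x₁).target)
    (hy' : (extChartAt 𝓘(ℝ, E) x₁).symm y ∈ (extChartAt 𝓘(ℝ, E) x₀).source) :
    ContDiffAt ℝ ∞ (extChartAt 𝓘(ℝ, E) x₀ ∘ (extChartAt 𝓘(ℝ, E) x₁).symm) y := by
  have h := contDiffWithinAt_ext_coord_change (I := 𝓘(ℝ, E)) (n := ∞) x₀ x₁ (y := y)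
    (by rw [PartialEquiv.trans_source]; exact ⟨hy, hy'⟩)
  rwa [ModelWithCorners.range_eq_univ, contDiffWithinAt_univ] at h

lemma dSymm_change {x₀ x₁ : M} {y : E} (hy : y ∈ (extChartAt 𝓘(ℝ, E) x₁).target)
    (hy' : (extChartAt 𝓘(ℝ, E) x₁).symm y ∈ (extChartAt 𝓘(ℝ, E) x₀).source) :
    dSymm x₁ y = (dSymm x₀ (extChartAt 𝓘(ℝ, E) x₀ ((extChartAt 𝓘(ℝ, E) x₁).symm y))).comp
      (fderiv ℝ (extChartAt 𝓘(ℝ, E) x₀ ∘ (extChartAt 𝓘(ℝ, E) x₁).symm) y) := by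
  have h1 : (extChartAt 𝓘(ℝ, E) x₁).symm =ᶠ[𝓝 y] (extChartAt 𝓘(ℝ, E) x₀).symm ∘
      (extChartAt 𝓘(ℝ, E) x₀ ∘ (extChartAt 𝓘(ℝ, E) x₁).symm) := by
    filter_upwards [chartTransition_eventually hy hy'] with z hz
    exact ((extChartAt 𝓘(ℝ, E) x₀).left_inv hz.2).symm
  have h2 : DifferentiableAt ℝ (extChartAt 𝓘(ℝ, E) x₀ ∘ (extChartAt 𝓘(ℝ, E) x₁).symm) y :=
    (contDiffAt_chartTransition hy hy').differentiableAt (by simp)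
  unfold dSymm
  rw [h1.mfderiv_eq, mfderiv_comp (I' := 𝓘(ℝ, E)) y
    (mdifferentiableAt_extChartAt_symm' ((extChartAt 𝓘(ℝ, E) x₀).map_source hy'))
    h2.mdifferentiableAt, mfderiv_eq_fderiv]
  rfl

/-- The change of charts for differential forms. -/
lemma formInChart_change {k : ℕ} (φ : ∀ x : M, TangentSpace 𝓘(ℝ, E) x [⋀^Fin k]→L[ℝ] ℂ)
    {x₀ x₁ : M} {y : E} (hy : y ∈ (extChartAt 𝓘(ℝ, E) x₁).target)
    (hy' : (extChartAt 𝓘(ℝ, E) x₁).symm y ∈ (extChartAt 𝓘(ℝ, E) x₀).source) :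
    formInChart φ x₁ y =
      (formInChart φ x₀ (extChartAt 𝓘(ℝ, E) x₀ ((extChartAt 𝓘(ℝ, E) x₁).symm y))
        ).compContinuousLinearMap
      (fderiv ℝ (extChartAt 𝓘(ℝ, E) x₀ ∘ (extChartAt 𝓘(ℝ, E) x₁).symm) y) := by
  rw [formInChart_eq, formInChart_eq, dSymm_change hy hy',
    (extChartAt 𝓘(ℝ, E) x₀).left_inv hy']
  rfl

lemma form_eq_formInChart {k : ℕ} (φ : ∀ x : M, TangentSpace 𝓘(ℝ, E) x [⋀^Fin k]→L[ℝ] ℂ)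
    {x₀ x : M} (hx : x ∈ (extChartAt 𝓘(ℝ, E) x₀).source) :
    formAt φ x =
      (formInChart φ x₀ (extChartAt 𝓘(ℝ, E) x₀ x)).compContinuousLinearMap (dChart x₀ x) := by
  rw [formInChart_eq, (extChartAt 𝓘(ℝ, E) x₀).left_inv hx]
  apply ContinuousAlternatingMap.ext
  intro v
  change formAt φ x v = formAt φ x _
  congr 1; ext i
  exact (dSymm_dChart hx (v i)).symm

lemma formInChart_eq_zero_iff {k : ℕ} (φ : ∀ x : M, TangentSpace 𝓘(ℝ, E) x [⋀^Fin k]→L[ℝ] ℂ)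
    {x₀ : M} {y : E} (hy : y ∈ (extChartAt 𝓘(ℝ, E) x₀).target) :
    formInChart φ x₀ y = 0 ↔ φ ((extChartAt 𝓘(ℝ, E) x₀).symm y) = 0 := by
  constructor
  · intro h
    change formAt φ _ = 0
    rw [form_eq_formInChart φ ((extChartAt 𝓘(ℝ, E) x₀).map_target hy),
      (extChartAt 𝓘(ℝ, E) x₀).right_inv hy, h]
    rfl
  · exact formInChart_eq_zero_of

/-- In a chart, the exterior derivative on `M` is the exterior derivative of the local
expression. -/
lemma formInChart_formExtDeriv {k : ℕ} {φ : ∀ x : M, TangentSpace 𝓘(ℝ, E) x [⋀^Fin k]→L[ℝ] ℂ}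
    (hφ : ∀ x₀ : M, ContDiffOn ℝ ∞ (formInChart φ x₀) (extChartAt 𝓘(ℝ, E) x₀).target)
    {x₀ : M} {y : E} (hy : y ∈ (extChartAt 𝓘(ℝ, E) x₀).target) :
    formInChart (formExtDeriv φ) x₀ y = extDeriv (formInChart φ x₀) y := by
  set x := (extChartAt 𝓘(ℝ, E) x₀).symm y with hx
  have hxs : (extChartAt 𝓘(ℝ, E) x₀).symm y ∈ (extChartAt 𝓘(ℝ, E) x).source :=
    mem_extChartAt_source x
  have h1 : formInChart φ x₀ =ᶠ[𝓝 y] fun z => (formInChart φ x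
      ((extChartAt 𝓘(ℝ, E) x ∘ (extChartAt 𝓘(ℝ, E) x₀).symm) z)).compContinuousLinearMap
      (fderiv ℝ (extChartAt 𝓘(ℝ, E) x ∘ (extChartAt 𝓘(ℝ, E) x₀).symm) z) := by
    filter_upwards [chartTransition_eventually hy hxs] with z hz
    exact formInChart_change φ hz.1 hz.2
  rw [h1.extDeriv_eq, extDeriv_pullback (r := ∞) _ (contDiffAt_chartTransition hy hxs)
    (by
      simp only [minSmoothness_of_isRCLikeNormedField]
      exact WithTop.coe_le_coe.2 (le_top : (2 : ℕ∞) ≤ ⊤))]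
  · rw [formInChart_eq, dSymm_change hy hxs, ← hx, dSymm_self]
    rfl
  · have h2 : (extChartAt 𝓘(ℝ, E) x ∘ (extChartAt 𝓘(ℝ, E) x₀).symm) y ∈
        (extChartAt 𝓘(ℝ, E) x).target := (extChartAt 𝓘(ℝ, E) x).map_source hxs
    exact ((hφ x).contDiffAt ((isOpen_extChartAt_target x).mem_nhds h2)).differentiableAt (by simp)

end Charts

section TestForms

variable {E : Type*} [NormedAddCommGroup E] [NormedSpace ℝ E] [FiniteDimensional ℝ E]
  {M : Type*} [TopologicalSpace M] [T2Space M] [ChartedSpace E M] [IsManifold 𝓘(ℝ, E) ∞ M]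

omit [FiniteDimensional ℝ E] in
lemma contDiffOn_extDeriv {k : ℕ} {η : E → E [⋀^Fin k]→L[ℝ] ℂ} {s : Set E} (hs : IsOpen s)
    (h : ContDiffOn ℝ ∞ η s) : ContDiffOn ℝ ∞ (extDeriv η) s :=
  (ContinuousAlternatingMap.alternatizeUncurryFinCLM ℝ E ℂ).contDiff.comp_contDiffOn
    (h.fderiv_of_isOpen hs (by simp))

omit [FiniteDimensional ℝ E] [T2Space M] [IsManifold 𝓘(ℝ, E) ∞ M] in
lemma formSupport_formExtDeriv {k : ℕ}
    {φ : ∀ x : M, TangentSpace 𝓘(ℝ, E) x [⋀^Fin k]→L[ℝ] ℂ} :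
    formSupport (formExtDeriv φ) ⊆ formSupport φ := by
  refine closure_minimal (fun x hx => ?_) isClosed_closure
  by_contra h
  apply hx
  have h1 : ∀ᶠ z in 𝓝 x, φ z = 0 := by
    filter_upwards [isClosed_closure.isOpen_compl.mem_nhds h] with z hz
    by_contra hz'
    exact hz (subset_closure hz')
  have h2 : formInChart φ x =ᶠ[𝓝 (extChartAt 𝓘(ℝ, E) x x)] fun _ => 0 := by
    have hc := (continuousAt_extChartAt_symm (I := 𝓘(ℝ, E)) x)
    rw [ContinuousAt, extChartAt_to_inv] at hc
    filter_upwards [hc.eventually h1] with z hz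
    exact formInChart_eq_zero_of hz
  unfold formExtDeriv
  rw [h2.extDeriv_eq, extDeriv, fderiv_fun_const]
  exact (ContinuousAlternatingMap.alternatizeUncurryFinCLM ℝ E ℂ).map_zero

/-- The exterior derivative of a test form is a test form. -/
def TestForm.extDeriv {k : ℕ} (η : TestForm E M k) : TestForm E M (k + 1) :=
  ⟨formExtDeriv η.1, η.2.1.of_isClosed_subset isClosed_closure formSupport_formExtDeriv,
    fun x₀ => (contDiffOn_extDeriv (isOpen_extChartAt_target x₀) (η.2.2 x₀)).congr
      fun _ hy => formInChart_formExtDeriv η.2.2 hy⟩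

open Classical in
/-- The form on `M` whose expression in the preferred chart at `x₀` is `η`, extended by zero
outside of the domain of this chart. -/
def pushForm {k : ℕ} (x₀ : M) (η : E → E [⋀^Fin k]→L[ℝ] ℂ) (x : M) :
    TangentSpace 𝓘(ℝ, E) x [⋀^Fin k]→L[ℝ] ℂ :=
  (if x ∈ (extChartAt 𝓘(ℝ, E) x₀).source then
    (η (extChartAt 𝓘(ℝ, E) x₀ x)).compContinuousLinearMap (dChart x₀ x)
  else 0 : E [⋀^Fin k]→L[ℝ] ℂ)

omit [FiniteDimensional ℝ E] [T2Space M] [IsManifold 𝓘(ℝ, E) ∞ M] in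
lemma pushForm_of_mem {k : ℕ} {x₀ : M} {η : E → E [⋀^Fin k]→L[ℝ] ℂ} {x : M}
    (hx : x ∈ (extChartAt 𝓘(ℝ, E) x₀).source) : formAt (pushForm x₀ η) x =
      (η (extChartAt 𝓘(ℝ, E) x₀ x)).compContinuousLinearMap (dChart x₀ x) := by
  unfold formAt pushForm
  exact if_pos hx

omit [FiniteDimensional ℝ E] [T2Space M] [IsManifold 𝓘(ℝ, E) ∞ M] in
lemma pushForm_of_notMem {k : ℕ} {x₀ : M} {η : E → E [⋀^Fin k]→L[ℝ] ℂ} {x : M}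
    (hx : x ∉ (extChartAt 𝓘(ℝ, E) x₀).source) : pushForm x₀ η x = 0 := by
  unfold pushForm
  exact if_neg hx

omit [FiniteDimensional ℝ E] [T2Space M] in
lemma formInChart_pushForm {k : ℕ} {x₀ : M} {η : E → E [⋀^Fin k]→L[ℝ] ℂ} {y : E}
    (hy : y ∈ (extChartAt 𝓘(ℝ, E) x₀).target) : formInChart (pushForm x₀ η) x₀ y = η y := by
  rw [formInChart_eq, pushForm_of_mem ((extChartAt 𝓘(ℝ, E) x₀).map_target hy),
    (extChartAt 𝓘(ℝ, E) x₀).right_inv hy]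
  ext v
  change η y _ = η y v
  congr 1; ext i
  exact dChart_dSymm hy (v i)

omit [FiniteDimensional ℝ E] [T2Space M] [IsManifold 𝓘(ℝ, E) ∞ M] in
lemma pushForm_ne_zero {k : ℕ} {x₀ : M} {η : E → E [⋀^Fin k]→L[ℝ] ℂ} {x : M}
    (h : pushForm x₀ η x ≠ 0) : x ∈ (extChartAt 𝓘(ℝ, E) x₀).source ∧
      η (extChartAt 𝓘(ℝ, E) x₀ x) ≠ 0 := by
  by_cases hx : x ∈ (extChartAt 𝓘(ℝ, E) x₀).source
  · refine ⟨hx, fun h0 => h ?_⟩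
    change formAt (pushForm x₀ η) x = 0
    rw [pushForm_of_mem hx, h0]; rfl
  · exact absurd (pushForm_of_notMem hx) h

omit [FiniteDimensional ℝ E] [T2Space M] [IsManifold 𝓘(ℝ, E) ∞ M] in
lemma isCompact_chart_symm_image {x₀ : M} {K : Set E} (hK : IsCompact K)
    (hs : K ⊆ (extChartAt 𝓘(ℝ, E) x₀).target) :
    IsCompact ((extChartAt 𝓘(ℝ, E) x₀).symm '' K) :=
  hK.image_of_continuousOn ((continuousOn_extChartAt_symm x₀).mono hs)

omit [FiniteDimensional ℝ E] [IsManifold 𝓘(ℝ, E) ∞ M] in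
lemma formSupport_pushForm {k : ℕ} {x₀ : M} {η : E → E [⋀^Fin k]→L[ℝ] ℂ} {K : Set E}
    (hK : IsCompact K) (hη : ∀ y ∉ K, η y = 0) (hs : K ⊆ (extChartAt 𝓘(ℝ, E) x₀).target) :
    formSupport (pushForm x₀ η) ⊆ (extChartAt 𝓘(ℝ, E) x₀).symm '' K := by
  refine closure_minimal (fun x hx => ?_) (isCompact_chart_symm_image hK hs).isClosed
  obtain ⟨h1, h2⟩ := pushForm_ne_zero hx
  exact ⟨_, by_contra fun h => h2 (hη _ h), (extChartAt 𝓘(ℝ, E) x₀).left_inv h1⟩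

/-- A smooth form with compact support in the target of a chart defines a test form on `M`. -/
def pushTestForm {k : ℕ} (x₀ : M) (η : E → E [⋀^Fin k]→L[ℝ] ℂ) (hη : ContDiff ℝ ∞ η) (K : Set E)
    (hK : IsCompact K) (hη' : ∀ y ∉ K, η y = 0) (hs : K ⊆ (extChartAt 𝓘(ℝ, E) x₀).target) :
    TestForm E M k := by
  refine ⟨pushForm x₀ η, (isCompact_chart_symm_image hK hs).of_isClosed_subset isClosed_closure
    (formSupport_pushForm hK hη' hs), fun x₁ y hy => ?_⟩
  apply ContDiffAt.contDiffWithinAt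
  by_cases hx : (extChartAt 𝓘(ℝ, E) x₁).symm y ∈ (extChartAt 𝓘(ℝ, E) x₀).source
  · have h1 : formInChart (pushForm x₀ η) x₁ =ᶠ[𝓝 y] fun z => (η
        ((extChartAt 𝓘(ℝ, E) x₀ ∘ (extChartAt 𝓘(ℝ, E) x₁).symm) z)).compContinuousLinearMap
        (fderiv ℝ (extChartAt 𝓘(ℝ, E) x₀ ∘ (extChartAt 𝓘(ℝ, E) x₁).symm) z) := by
      filter_upwards [chartTransition_eventually hy hx] with z hz
      rw [formInChart_change _ hz.1 hz.2, formInChart_pushForm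
        ((extChartAt 𝓘(ℝ, E) x₀).map_source hz.2)]
      rfl
    refine ContDiffAt.congr_of_eventuallyEq ?_ h1
    obtain ⟨U, hU, hUo, hyU⟩ := eventually_nhds_iff.1 (chartTransition_eventually hy hx)
    have h2 : ContDiffOn ℝ ∞ (extChartAt 𝓘(ℝ, E) x₀ ∘ (extChartAt 𝓘(ℝ, E) x₁).symm) U :=
      fun z hz => (contDiffAt_chartTransition (hU z hz).1 (hU z hz).2).contDiffWithinAt
    exact ((hη.comp_contDiffOn h2).form_comp_clm
      (h2.fderiv_of_isOpen hUo (by simp))).contDiffAt (hUo.mem_nhds hyU)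
  · have h0 : (extChartAt 𝓘(ℝ, E) x₁).symm y ∉ formSupport (pushForm x₀ η) := by
      intro h
      obtain ⟨z, hz, hz'⟩ := formSupport_pushForm hK hη' hs h
      exact hx (hz' ▸ (extChartAt 𝓘(ℝ, E) x₀).map_target (hs hz))
    have h1 : formInChart (pushForm x₀ η) x₁ =ᶠ[𝓝 y] fun _ => 0 := by
      filter_upwards [(continuousAt_extChartAt_symm'' hy).eventually
        (isClosed_closure.isOpen_compl.mem_nhds h0)] with z hz
      exact formInChart_eq_zero_of (by_contra fun h => hz (subset_closure h))
    exact contDiffAt_const.congr_of_eventuallyEq h1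

/-- The expression of the form `φ` in a chart, extended by zero outside of the target. -/
def localForm {k : ℕ} (φ : ∀ x : M, TangentSpace 𝓘(ℝ, E) x [⋀^Fin k]→L[ℝ] ℂ) (x₀ : M) :
    E → E [⋀^Fin k]→L[ℝ] ℂ :=
  (extChartAt 𝓘(ℝ, E) x₀).target.indicator (formInChart φ x₀)

omit [FiniteDimensional ℝ E] [T2Space M] in
lemma pushForm_localForm {k : ℕ} {φ : ∀ x : M, TangentSpace 𝓘(ℝ, E) x [⋀^Fin k]→L[ℝ] ℂ} {x₀ : M}
    (h : formSupport φ ⊆ (extChartAt 𝓘(ℝ, E) x₀).source) : pushForm x₀ (localForm φ x₀) = φ := by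
  funext x
  by_cases hx : x ∈ (extChartAt 𝓘(ℝ, E) x₀).source
  · change formAt (pushForm x₀ (localForm φ x₀)) x = formAt φ x
    rw [pushForm_of_mem hx, localForm,
      indicator_of_mem ((extChartAt 𝓘(ℝ, E) x₀).map_source hx)]
    exact (form_eq_formInChart φ hx).symm
  · rw [pushForm_of_notMem hx]
    exact by_contra fun h' => hx (h (subset_closure (Ne.symm h')))

omit [FiniteDimensional ℝ E] [T2Space M] in
lemma localForm_eq_zero {k : ℕ} {φ : ∀ x : M, TangentSpace 𝓘(ℝ, E) x [⋀^Fin k]→L[ℝ] ℂ} {x₀ : M}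
    {y : E} (hy : y ∉ extChartAt 𝓘(ℝ, E) x₀ '' formSupport φ) : localForm φ x₀ y = 0 := by
  unfold localForm
  by_cases h : y ∈ (extChartAt 𝓘(ℝ, E) x₀).target
  · rw [indicator_of_mem h, formInChart_eq_zero_iff φ h]
    by_contra h'
    exact hy ⟨_, subset_closure h', (extChartAt 𝓘(ℝ, E) x₀).right_inv h⟩
  · exact indicator_of_notMem h _

omit [FiniteDimensional ℝ E] [T2Space M] [IsManifold 𝓘(ℝ, E) ∞ M] in
lemma isCompact_chart_image {x₀ : M} {K : Set M} (hK : IsCompact K)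
    (h : K ⊆ (extChartAt 𝓘(ℝ, E) x₀).source) : IsCompact (extChartAt 𝓘(ℝ, E) x₀ '' K) :=
  hK.image_of_continuousOn ((continuousOn_extChartAt x₀).mono h)

omit [FiniteDimensional ℝ E] in
lemma contDiff_localForm {k : ℕ} (φ : TestForm E M k) {x₀ : M}
    (h : formSupport φ.1 ⊆ (extChartAt 𝓘(ℝ, E) x₀).source) : ContDiff ℝ ∞ (localForm φ.1 x₀) := by
  rw [contDiff_iff_contDiffAt]
  intro y
  by_cases hy : y ∈ (extChartAt 𝓘(ℝ, E) x₀).target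
  · refine ((φ.2.2 x₀).contDiffAt ((isOpen_extChartAt_target x₀).mem_nhds hy)).congr_of_eventuallyEq
      ?_
    filter_upwards [(isOpen_extChartAt_target x₀).mem_nhds hy] with z hz
    exact indicator_of_mem hz _
  · have hK := isCompact_chart_image φ.2.1 h
    have hy' : y ∉ extChartAt 𝓘(ℝ, E) x₀ '' formSupport φ.1 := by
      rintro ⟨x, hx, rfl⟩
      exact hy ((extChartAt 𝓘(ℝ, E) x₀).map_source (h hx))
    refine contDiffAt_const (c := 0) |>.congr_of_eventuallyEq ?_
    filter_upwards [hK.isClosed.isOpen_compl.mem_nhds hy'] with z hz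
    exact localForm_eq_zero hz

end TestForms

/-! ### The almost complex structure acting on test forms -/

section AlmostComplexForms

variable {E : Type*} [NormedAddCommGroup E] [NormedSpace ℝ E]
  {M : Type*} [TopologicalSpace M] [ChartedSpace E M] [IsManifold 𝓘(ℝ, E) ∞ M]
  (J : AlmostComplexStructure E M)

/-- The almost complex structure at a point, as an endomorphism of the model space. -/
def AlmostComplexStructure.toEnd (x : M) : E →L[ℝ] E := J.toFun x

lemma AlmostComplexStructure.toEnd_sq (x : M) (v : E) : J.toEnd x (J.toEnd x v) = -v := J.sq x v

/-- The expression of the almost complex structure in the preferred chart at `x₀`. -/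
def jChart (x₀ : M) (y : E) : E →L[ℝ] E :=
  (dChart x₀ ((extChartAt 𝓘(ℝ, E) x₀).symm y)).comp
    ((J.toEnd ((extChartAt 𝓘(ℝ, E) x₀).symm y)).comp (dSymm x₀ y))

lemma jChart_sq {x₀ : M} {y : E} (hy : y ∈ (extChartAt 𝓘(ℝ, E) x₀).target) (v : E) :
    jChart J x₀ y (jChart J x₀ y v) = -v := by
  have h := dSymm_dChart ((extChartAt 𝓘(ℝ, E) x₀).map_target hy) (x₀ := x₀)
    (J.toEnd ((extChartAt 𝓘(ℝ, E) x₀).symm y) (dSymm x₀ y v))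
  rw [(extChartAt 𝓘(ℝ, E) x₀).right_inv hy] at h
  simp only [jChart, ContinuousLinearMap.comp_apply]
  rw [h, J.toEnd_sq, map_neg, dChart_dSymm hy]

lemma dSymm_jChart {x₀ : M} {y : E} (hy : y ∈ (extChartAt 𝓘(ℝ, E) x₀).target) (v : E) :
    dSymm x₀ y (jChart J x₀ y v) = J.toEnd ((extChartAt 𝓘(ℝ, E) x₀).symm y) (dSymm x₀ y v) := by
  have h := dSymm_dChart ((extChartAt 𝓘(ℝ, E) x₀).map_target hy) (x₀ := x₀)
    (J.toEnd ((extChartAt 𝓘(ℝ, E) x₀).symm y) (dSymm x₀ y v))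
  rwa [(extChartAt 𝓘(ℝ, E) x₀).right_inv hy] at h

lemma contDiffOn_jChart (x₀ : M) :
    ContDiffOn ℝ ∞ (jChart J x₀) (extChartAt 𝓘(ℝ, E) x₀).target := by
  have := isManifold_one_of_infty (E := E) (M := M)
  have : IsManifold 𝓘(ℝ, E) (∞ + 1) M := by simpa using ‹IsManifold 𝓘(ℝ, E) ∞ M›
  intro y hy
  have hx := (extChartAt 𝓘(ℝ, E) x₀).map_target hy
  set e := trivializationAt (E →L[ℝ] E)
    (fun x : M => TangentSpace 𝓘(ℝ, E) x →L[ℝ] TangentSpace 𝓘(ℝ, E) x) x₀ with he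
  have hb : (extChartAt 𝓘(ℝ, E) x₀).symm y ∈ e.baseSet := by
    rw [he]
    simp only [hom_trivializationAt_baseSet, TangentBundle.trivializationAt_baseSet, inter_self]
    simpa using hx
  have h1 := (e.contMDiffAt_section_iff (IB := 𝓘(ℝ, E)) (n := ∞) (s := J.toFun) hb).1
    J.smooth.contMDiffAt
  have h2 := h1.comp y ((contMDiffOn_extChartAt_symm (I := 𝓘(ℝ, E)) (n := ∞) x₀).contMDiffAt
    ((isOpen_extChartAt_target x₀).mem_nhds hy))
  refine (h2.contDiffAt.congr_of_eventuallyEq ?_).contDiffWithinAt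
  filter_upwards [(isOpen_extChartAt_target x₀).mem_nhds hy] with z hz
  have hz' := (extChartAt 𝓘(ℝ, E) x₀).map_target hz
  rw [extChartAt_source] at hz'
  simp only [Function.comp_apply, he, hom_trivializationAt_apply, ContinuousLinearMap.inCoordinates]
  rw [TangentBundle.continuousLinearMapAt_trivializationAt hz',
    TangentBundle.symmL_trivializationAt hz', (extChartAt 𝓘(ℝ, E) x₀).right_inv hz,
    ModelWithCorners.range_eq_univ, mfderivWithin_univ]
  rfl

lemma dChart_toEnd {x₀ x : M} (hx : x ∈ (extChartAt 𝓘(ℝ, E) x₀).source) (v : E) :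
    dChart x₀ x (J.toEnd x v) = jChart J x₀ (extChartAt 𝓘(ℝ, E) x₀ x) (dChart x₀ x v) := by
  simp only [jChart, ContinuousLinearMap.comp_apply, (extChartAt 𝓘(ℝ, E) x₀).left_inv hx,
    dSymm_dChart hx]

end AlmostComplexForms

section TypeProjections

variable {V : Type*} [AddCommGroup V] [Module ℝ V] {k : ℕ} (J : V →ₗ[ℝ] V)

/-- The derivation of multilinear forms extending `α ↦ α ∘ J`. -/
def slotDerivation (k : ℕ) : MultilinearMap ℝ (fun _ : Fin k => V) ℂ →ₗ[ℂ]
    MultilinearMap ℝ (fun _ : Fin k => V) ℂ := ∑ i, slotMap J i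

lemma slotDerivation_apply (φ : MultilinearMap ℝ (fun _ : Fin k => V) ℂ) (v : Fin k → V) :
    slotDerivation J k φ v = ∑ i, φ (Function.update v i (J (v i))) := by
  unfold slotDerivation
  rw [LinearMap.sum_apply, sum_apply]
  simp only [slotMap_apply]

/-- The polynomial which is `1` at the eigenvalue of type `(r, k - r)` and vanishes at the other
eigenvalues; its value at the derivation is the projection to the forms of this type. -/
def typePolynomial (k r : ℕ) : Polynomial ℂ :=
  Lagrange.basis (Finset.range (k + 1)) (typeEigenvalue k) r

lemma aeval_typePolynomial {r r₀ : ℕ} (hr : r ∈ Finset.range (k + 1))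
    (hr₀ : r₀ ∈ Finset.range (k + 1)) {y : MultilinearMap ℝ (fun _ : Fin k => V) ℂ}
    (hy : slotDerivation J k y = typeEigenvalue k r₀ • y) :
    Polynomial.aeval (slotDerivation J k) (typePolynomial k r) y = if r = r₀ then y else 0 := by
  rw [aeval_apply_eigenvector _ hy, typePolynomial]
  split_ifs with h
  · subst h
    rw [Lagrange.eval_basis_self (typeEigenvalue_injOn k) hr, one_smul]
  · rw [Lagrange.eval_basis_of_ne h hr₀, zero_smul]

lemma sum_typePolynomial (hJ : ∀ v, J (J v) = -v) (φ : MultilinearMap ℝ (fun _ : Fin k => V) ℂ) :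
    φ = ∑ r ∈ Finset.range (k + 1),
      Polynomial.aeval (slotDerivation J k) (typePolynomial k r) φ := by
  refine Submodule.span_induction (p := fun y _ => y = ∑ r ∈ Finset.range (k + 1),
    Polynomial.aeval (slotDerivation J k) (typePolynomial k r) y) ?_ (by simp)
    (fun a b _ _ ha hb => ?_) (fun c a _ ha => ?_) (mem_span_typeEigenvectors J hJ φ)
  · rintro y ⟨r₀, hr₀, hy, -⟩
    rw [Finset.sum_congr rfl fun r hr => aeval_typePolynomial J hr hr₀ hy, Finset.sum_ite_eq' _ r₀,
      if_pos hr₀]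
  · simp only [map_add, Finset.sum_add_distrib]
    rw [← ha, ← hb]
  · simp only [map_smul, ← Finset.smul_sum]
    rw [← ha]

lemma slotDerivation_typePolynomial (hJ : ∀ v, J (J v) = -v) {r : ℕ}
    (hr : r ∈ Finset.range (k + 1)) (φ : MultilinearMap ℝ (fun _ : Fin k => V) ℂ) :
    slotDerivation J k (Polynomial.aeval (slotDerivation J k) (typePolynomial k r) φ) =
      typeEigenvalue k r • Polynomial.aeval (slotDerivation J k) (typePolynomial k r) φ := by
  refine Submodule.span_induction (p := fun y _ =>
      slotDerivation J k (Polynomial.aeval (slotDerivation J k) (typePolynomial k r) y) =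
      typeEigenvalue k r • Polynomial.aeval (slotDerivation J k) (typePolynomial k r) y) ?_ (by simp)
    (fun a b _ _ ha hb => by simp only [map_add, ha, hb, smul_add])
    (fun c a _ ha => by simp only [map_smul, ha, smul_comm c]) (mem_span_typeEigenvectors J hJ φ)
  rintro y ⟨r₀, hr₀, hy, -⟩
  rw [aeval_typePolynomial J hr hr₀ hy]
  split_ifs with h
  · rw [h]; exact hy
  · simp

lemma typePolynomial_compLinearMap (hJ : ∀ v, J (J v) = -v) {r : ℕ}
    (hr : r ∈ Finset.range (k + 1)) (φ : MultilinearMap ℝ (fun _ : Fin k => V) ℂ) :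
    (Polynomial.aeval (slotDerivation J k) (typePolynomial k r) φ).compLinearMap (fun _ => J) =
      (Complex.I ^ r * (-Complex.I) ^ (k - r)) •
        Polynomial.aeval (slotDerivation J k) (typePolynomial k r) φ := by
  refine Submodule.span_induction (p := fun y _ =>
      (Polynomial.aeval (slotDerivation J k) (typePolynomial k r) y).compLinearMap (fun _ => J) =
      (Complex.I ^ r * (-Complex.I) ^ (k - r)) •
        Polynomial.aeval (slotDerivation J k) (typePolynomial k r) y) ?_ (by ext v; simp)
    (fun a b _ _ ha hb => ?_) (fun c a _ ha => ?_) (mem_span_typeEigenvectors J hJ φ)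
  · rintro y ⟨r₀, hr₀, hy, hy'⟩
    rw [aeval_typePolynomial J hr hr₀ hy]
    split_ifs with h
    · rw [h]; exact hy'
    · ext v; simp
  · rw [map_add, smul_add, ← ha, ← hb]; rfl
  · rw [map_smul, smul_comm, ← ha]; rfl

end TypeProjections

section TestFormOperations

variable {E : Type*} [NormedAddCommGroup E] [NormedSpace ℝ E] [FiniteDimensional ℝ E]
  {M : Type*} [TopologicalSpace M] [T2Space M] [ChartedSpace E M] [IsManifold 𝓘(ℝ, E) ∞ M]
  (J : AlmostComplexStructure E M)

omit [FiniteDimensional ℝ E] [T2Space M] [IsManifold 𝓘(ℝ, E) ∞ M] in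
lemma formSupport_mono {k l : ℕ} {φ : ∀ x : M, TangentSpace 𝓘(ℝ, E) x [⋀^Fin k]→L[ℝ] ℂ}
    {ψ : ∀ x : M, TangentSpace 𝓘(ℝ, E) x [⋀^Fin l]→L[ℝ] ℂ} (h : ∀ x, φ x = 0 → ψ x = 0) :
    formSupport ψ ⊆ formSupport φ :=
  closure_mono fun _ hx h' => hx (h _ h')

namespace TestForm

/-- The action of the derivation `φ ↦ ∑ᵢ φ(…, J vᵢ, …)` on test forms. -/
def slotSumJ {k : ℕ} : TestForm E M k →ₗ[ℂ] TestForm E M k where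
  toFun φ := ⟨fun x => (slotSum (J.toEnd x) (formAt φ.1 x) : E [⋀^Fin k]→L[ℝ] ℂ), by
    refine ⟨φ.2.1.of_isClosed_subset isClosed_closure (formSupport_mono fun x hx => ?_),
      fun x₀ => ?_⟩
    · change slotSum (J.toEnd x) (formAt φ.1 x) = 0
      have h0 : formAt φ.1 x = 0 := hx
      rw [h0]
      ext v
      rw [slotSum_apply]
      exact Finset.sum_eq_zero fun i _ => rfl
    · refine ((φ.2.2 x₀).slotSum (contDiffOn_jChart J x₀)).congr fun y hy => ?_
      apply ContinuousAlternatingMap.ext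
      intro v
      change slotSum (J.toEnd ((extChartAt 𝓘(ℝ, E) x₀).symm y)) (formAt φ.1 _)
        (fun i => dSymm x₀ y (v i)) = slotSum (jChart J x₀ y) (formInChart φ.1 x₀ y) v
      rw [slotSum_apply, slotSum_apply]
      refine Finset.sum_congr rfl fun i _ => ?_
      change _ = formAt φ.1 ((extChartAt 𝓘(ℝ, E) x₀).symm y) (fun j => dSymm x₀ y _)
      congr 1; ext j
      rcases eq_or_ne j i with rfl | h
      · simp [dSymm_jChart J hy]
      · simp [h]⟩
  map_add' φ ψ := by
    apply Subtype.ext; funext x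
    change slotSum (J.toEnd x) (formAt φ.1 x + formAt ψ.1 x) =
      slotSum (J.toEnd x) (formAt φ.1 x) + slotSum (J.toEnd x) (formAt ψ.1 x)
    ext v
    simp [slotSum_apply, Finset.sum_add_distrib]
  map_smul' c φ := by
    apply Subtype.ext; funext x
    change slotSum (J.toEnd x) (c • formAt φ.1 x) = c • slotSum (J.toEnd x) (formAt φ.1 x)
    ext v
    simp [slotSum_apply, Finset.mul_sum]

/-- The pull-back of a test form by `J`: `(v₁, …, v_k) ↦ φ (J v₁, …, J v_k)`. -/
def compJ {k : ℕ} : TestForm E M k →ₗ[ℂ] TestForm E M k where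
  toFun φ := ⟨fun x => ((formAt φ.1 x).compContinuousLinearMap (J.toEnd x) :
      E [⋀^Fin k]→L[ℝ] ℂ), by
    refine ⟨φ.2.1.of_isClosed_subset isClosed_closure (formSupport_mono fun x hx => ?_),
      fun x₀ => ?_⟩
    · change (formAt φ.1 x).compContinuousLinearMap (J.toEnd x) = 0
      have h0 : formAt φ.1 x = 0 := hx
      rw [h0]; rfl
    · refine ((φ.2.2 x₀).form_comp_clm (contDiffOn_jChart J x₀)).congr fun y hy => ?_
      apply ContinuousAlternatingMap.ext
      intro v
      change formAt φ.1 _ _ = formAt φ.1 ((extChartAt 𝓘(ℝ, E) x₀).symm y) (fun j => dSymm x₀ y _)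
      congr 1; ext j
      exact (dSymm_jChart J hy _).symm⟩
  map_add' _ _ := rfl
  map_smul' _ _ := rfl

/-- The product of a test form with a smooth real function. -/
def mulFun {k : ℕ} (f : M → ℝ) (hf : ContMDiff 𝓘(ℝ, E) 𝓘(ℝ) ∞ f) (φ : TestForm E M k) :
    TestForm E M k :=
  ⟨fun x => (f x • formAt φ.1 x : E [⋀^Fin k]→L[ℝ] ℂ), by
    refine ⟨φ.2.1.of_isClosed_subset isClosed_closure (formSupport_mono fun x hx => ?_),
      fun x₀ => ?_⟩
    · change f x • formAt φ.1 x = 0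
      have h0 : formAt φ.1 x = 0 := hx
      rw [h0]; exact smul_zero (A := E [⋀^Fin k]→L[ℝ] ℂ) (f x)
    · have h1 : ContDiffOn ℝ ∞ (f ∘ (extChartAt 𝓘(ℝ, E) x₀).symm)
          (extChartAt 𝓘(ℝ, E) x₀).target :=
        (hf.comp_contMDiffOn (contMDiffOn_extChartAt_symm x₀)).contDiffOn
      exact h1.smul (φ.2.2 x₀)⟩

lemma mulFun_apply {k : ℕ} (f : M → ℝ) (hf : ContMDiff 𝓘(ℝ, E) 𝓘(ℝ) ∞ f) (φ : TestForm E M k)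
    (x : M) : formAt (mulFun f hf φ).1 x = f x • formAt φ.1 x := rfl

lemma formSupport_mulFun {k : ℕ} (f : M → ℝ) (hf : ContMDiff 𝓘(ℝ, E) 𝓘(ℝ) ∞ f)
    (φ : TestForm E M k) : formSupport (mulFun f hf φ).1 ⊆ tsupport f ∩ formSupport φ.1 := by
  refine closure_minimal (fun x hx => ?_) ((isClosed_tsupport f).inter isClosed_closure)
  have hx' : f x • formAt φ.1 x ≠ 0 := hx
  refine ⟨subset_closure fun h => hx' (by rw [h]; exact zero_smul ℝ (formAt φ.1 x)),
    subset_closure fun h => hx' ?_⟩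
  have h0 : formAt φ.1 x = 0 := h
  rw [h0]; exact smul_zero (A := E [⋀^Fin k]→L[ℝ] ℂ) (f x)

/-- The value of a test form at a point, as a multilinear form. -/
def evalAt {k : ℕ} (x : M) : TestForm E M k →ₗ[ℂ] MultilinearMap ℝ (fun _ : Fin k => E) ℂ where
  toFun φ := (formAt φ.1 x).toMultilinearMap
  map_add' _ _ := rfl
  map_smul' _ _ := rfl

lemma ext_evalAt {k : ℕ} {φ ψ : TestForm E M k} (h : ∀ x, evalAt x φ = evalAt x ψ) : φ = ψ := by
  apply Subtype.ext; funext x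
  apply ContinuousAlternatingMap.ext
  intro v
  exact congrArg (fun g : MultilinearMap ℝ (fun _ : Fin k => E) ℂ => g v) (h x)

lemma evalAt_slotSumJ {k : ℕ} (x : M) (φ : TestForm E M k) :
    evalAt (E := E) x (slotSumJ J φ) =
      slotDerivation (J.toEnd x).toLinearMap k (evalAt (E := E) x φ) := by
  ext v
  rw [slotDerivation_apply]
  exact slotSum_apply (J.toEnd x) (formAt φ.1 x) v

/-- The component of type `(r, k - r)` of a test form. -/
def typeComponent {k : ℕ} (r : ℕ) (φ : TestForm E M k) : TestForm E M k :=
  (Polynomial.aeval (slotSumJ J : Module.End ℂ (TestForm E M k)) (typePolynomial k r) :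
    Module.End ℂ (TestForm E M k)) φ

lemma evalAt_typeComponent {k : ℕ} (r : ℕ) (φ : TestForm E M k) (x : M) :
    evalAt (E := E) x (typeComponent J r φ) = Polynomial.aeval
      (slotDerivation (J.toEnd x).toLinearMap k) (typePolynomial k r) (evalAt (E := E) x φ) :=
  aeval_intertwine (slotSumJ J : Module.End ℂ (TestForm E M k))
    (slotDerivation (J.toEnd x).toLinearMap k) (evalAt (E := E) (M := M) (k := k) x)
    (fun ψ => evalAt_slotSumJ J x ψ) (typePolynomial k r) φ

lemma sum_typeComponent {k : ℕ} (φ : TestForm E M k) :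
    φ = ∑ r ∈ Finset.range (k + 1), typeComponent J r φ := by
  refine ext_evalAt fun x => ?_
  rw [map_sum]
  simp only [evalAt_typeComponent]
  exact sum_typePolynomial _ (J.toEnd_sq x) _

lemma isOfType_typeComponent {k : ℕ} {r : ℕ} (hr : r ∈ Finset.range (k + 1))
    (φ : TestForm E M k) (x : M) :
    IsOfType (J.toFun x) r (k - r) ((typeComponent J r φ).1 x) := by
  refine ⟨by simp only [Finset.mem_range] at hr; omega, fun v => ?_⟩
  have h1 := slotDerivation_typePolynomial (J.toEnd x).toLinearMap (J.toEnd_sq x) hr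
    (evalAt (E := E) x φ)
  rw [← evalAt_typeComponent] at h1
  have h2 := congrArg (fun q : MultilinearMap ℝ (fun _ : Fin k => E) ℂ => q v) h1
  exact (slotDerivation_apply (J.toEnd x).toLinearMap _ v).symm.trans h2

lemma compJ_typeComponent {k : ℕ} {r : ℕ} (hr : r ∈ Finset.range (k + 1)) (φ : TestForm E M k) :
    compJ J (typeComponent J r φ) =
      (Complex.I ^ r * (-Complex.I) ^ (k - r)) • typeComponent J r φ := by
  refine ext_evalAt fun x => ?_
  have h1 := typePolynomial_compLinearMap (J.toEnd x).toLinearMap (J.toEnd_sq x) hr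
    (evalAt (E := E) x φ)
  rw [← evalAt_typeComponent] at h1
  rw [map_smul, ← h1]
  rfl

/-- A current of bidimension `(p,p)` is invariant under the pull-back of forms by `J`: a form of
type `(r,s)` is an eigenvector of this pull-back for the eigenvalue `i ^ (r - s)`. -/
lemma IsBidimension.apply_compJ {p : ℕ} {T : TestForm E M (2 * p) →ₗ[ℂ] ℂ}
    (hT : IsBidimension J p T) (φ : TestForm E M (2 * p)) : T (compJ J φ) = T φ := by
  conv_lhs => rw [sum_typeComponent J φ]
  conv_rhs => rw [sum_typeComponent J φ]
  rw [map_sum, map_sum, map_sum]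
  refine Finset.sum_congr rfl fun r hr => ?_
  rw [compJ_typeComponent J hr, map_smul]
  by_cases hrp : r = p
  · rw [hrp, show 2 * p - p = p by omega, ← mul_pow]
    simp
  · rw [hT r (2 * p - r) (by simp [hrp]) _ (isOfType_typeComponent J hr φ), smul_zero]

end TestForm

end TestFormOperations

/-! ### Localization of currents -/

section Localization

variable {E : Type*} [NormedAddCommGroup E] [NormedSpace ℝ E] [FiniteDimensional ℝ E]
  {M : Type*} [TopologicalSpace M] [T2Space M] [ChartedSpace E M] [IsManifold 𝓘(ℝ, E) ∞ M]

lemma formSupport_eq_empty_iff {k : ℕ}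
    {φ : ∀ x : M, TangentSpace 𝓘(ℝ, E) x [⋀^Fin k]→L[ℝ] ℂ} : formSupport φ = ∅ ↔ φ = 0 := by
  unfold formSupport
  rw [closure_empty_iff, eq_empty_iff_forall_notMem]
  constructor
  · intro h; funext x; exact not_not.1 (h x)
  · rintro rfl x hx; exact hx rfl

/-- A property of test forms that is stable under sums holds for `φ` if it holds for the products of
`φ` with the nonnegative smooth functions that have a sufficiently small support. -/
lemma TestForm.induction_mulFun [SecondCountableTopology M] {k : ℕ}
    (P : AddSubmonoid (TestForm E M k)) (φ : TestForm E M k)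
    (h : ∀ x ∈ formSupport φ.1, ∃ U ∈ 𝓝 x, ∀ f hf, (∀ z, 0 ≤ f z) →
      formSupport (mulFun f hf φ).1 ⊆ U → mulFun f hf φ ∈ P) : φ ∈ P := by
  have : LocallyCompactSpace M := ChartedSpace.locallyCompactSpace E M
  have h' : ∀ x : M, ∃ U : Set M, IsOpen U ∧ x ∈ U ∧
      ∀ f hf, (∀ z, 0 ≤ f z) →
        formSupport (mulFun f hf φ).1 ⊆ U ∩ formSupport φ.1 → mulFun f hf φ ∈ P := by
    intro x
    by_cases hx : x ∈ formSupport φ.1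
    · obtain ⟨U, hU, hP⟩ := h x hx
      obtain ⟨V, hVU, hV, hxV⟩ := mem_nhds_iff.1 hU
      exact ⟨V, hV, hxV, fun f hf hf0 hψ => hP f hf hf0 (hψ.trans (inter_subset_left.trans hVU))⟩
    · refine ⟨(formSupport φ.1)ᶜ, isClosed_closure.isOpen_compl, hx, fun f hf _ hψ => ?_⟩
      rw [compl_inter_self, subset_empty_iff, formSupport_eq_empty_iff] at hψ
      rw [show mulFun f hf φ = 0 from Subtype.ext hψ]
      exact P.zero_mem
  choose U hUo hxU hUP using h'
  obtain ⟨ρ, hρ⟩ := SmoothPartitionOfUnity.exists_isSubordinate 𝓘(ℝ, E) (isClosed_univ (X := M)) U hUo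
    (fun x _ => mem_iUnion.2 ⟨x, hxU x⟩)
  have hfin := ρ.locallyFinite.finite_nonempty_inter_compact φ.2.1
  have hsum : φ = ∑ i ∈ hfin.toFinset, mulFun (ρ i) (ρ i).contMDiff φ := by
    refine ext_evalAt fun x => ?_
    rw [map_sum]
    by_cases hx : x ∈ formSupport φ.1
    · have h1 : ∑ i ∈ hfin.toFinset, ρ i x = 1 := by
        rw [← ρ.sum_eq_one (mem_univ x), finsum_eq_sum_of_support_subset]
        intro i hi
        rw [Finite.coe_toFinset]
        exact ⟨x, hi, hx⟩
      calc evalAt x φ = (∑ i ∈ hfin.toFinset, ρ i x) • evalAt x φ := by rw [h1, one_smul]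
        _ = _ := by rw [Finset.sum_smul]; rfl
    · have h0 : formAt φ.1 x = 0 := by
        by_contra h0
        exact hx (subset_closure h0)
      have h1 : ∀ ψ : TestForm E M k, formAt ψ.1 x = 0 → evalAt (E := E) x ψ = 0 := by
        intro ψ hψ
        change (formAt ψ.1 x).toMultilinearMap = 0
        rw [hψ]; rfl
      rw [h1 φ h0, Finset.sum_eq_zero fun i _ => h1 _ ?_]
      rw [mulFun_apply, h0]
      exact smul_zero (A := E [⋀^Fin k]→L[ℝ] ℂ) (ρ i x)
  rw [hsum]
  refine P.sum_mem fun i _ => hUP i _ _ (ρ.nonneg i) ?_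
  refine (formSupport_mulFun _ _ φ).trans (inter_subset_inter_left _ (hρ i))

/-- A subspace of test forms that contains all the test forms with a sufficiently small support
near every point of an open set contains all the test forms supported in this set. -/
lemma TestForm.induction_local [SecondCountableTopology M] {k : ℕ}
    (P : Submodule ℂ (TestForm E M k)) {S : Set M}
    (h : ∀ x ∈ S, ∃ U ∈ 𝓝 x, ∀ φ : TestForm E M k, formSupport φ.1 ⊆ U → φ ∈ P)
    (φ : TestForm E M k) (hφ : formSupport φ.1 ⊆ S) : φ ∈ P :=
  TestForm.induction_mulFun P.toAddSubmonoid φ fun x hx =>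
    let ⟨U, hU, hP⟩ := h x (hφ hx)
    ⟨U, hU, fun _ _ _ hs => hP _ hs⟩

lemma TestForm.apply_eq_zero_of_disjoint [SecondCountableTopology M] {k : ℕ}
    (T : TestForm E M k →ₗ[ℂ] ℂ) (φ : TestForm E M k)
    (h : Disjoint (formSupport φ.1) (currentSupport T)) : T φ = 0 := by
  refine induction_local (LinearMap.ker T) (S := (currentSupport T)ᶜ) (fun x hx => ?_) φ
    (subset_compl_iff_disjoint_right.2 h)
  simp only [currentSupport, mem_compl_iff, mem_ofPred_eq, not_forall, not_exists, not_and,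
    not_not] at hx
  obtain ⟨U, hU, hx⟩ := hx
  exact ⟨U, hU, hx⟩

variable (E) in
/-- The smooth forms on the model space with compact support in the target of the preferred chart
at `x₀`. -/
def chartForms (x₀ : M) (k : ℕ) : Submodule ℂ (E → E [⋀^Fin k]→L[ℝ] ℂ) where
  carrier := {η | ContDiff ℝ ∞ η ∧ HasCompactSupport η ∧
    tsupport η ⊆ (extChartAt 𝓘(ℝ, E) x₀).target}
  zero_mem' := ⟨contDiff_const, HasCompactSupport.zero, by simp [tsupport]⟩
  add_mem' := fun h h' => ⟨h.1.add h'.1, h.2.1.add h'.2.1,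
    (tsupport_add _ _).trans (union_subset h.2.2 h'.2.2)⟩
  smul_mem' := fun c η h => by
    have h1 : tsupport (c • η) ⊆ tsupport η := closure_mono fun y hy h0 => hy (by
      change c • η y = 0
      rw [h0]
      exact smul_zero (A := E [⋀^Fin k]→L[ℝ] ℂ) c)
    exact ⟨h.1.const_smul c, h.2.1.of_isClosed_subset (isClosed_tsupport _) h1, h1.trans h.2.2⟩

/-- The test form on `M` defined by a form in a chart. -/
def pushLinear (x₀ : M) (k : ℕ) : chartForms E x₀ k →ₗ[ℂ] TestForm E M k where
  toFun η := pushTestForm x₀ η.1 η.2.1 (tsupport η.1) η.2.2.1 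
    (fun _ hy => image_eq_zero_of_notMem_tsupport hy) η.2.2.2
  map_add' η ξ := by
    apply Subtype.ext; funext x
    change formAt (pushForm x₀ (η.1 + ξ.1)) x =
      formAt (pushForm x₀ η.1) x + formAt (pushForm x₀ ξ.1) x
    by_cases hx : x ∈ (extChartAt 𝓘(ℝ, E) x₀).source
    · rw [pushForm_of_mem hx, pushForm_of_mem hx, pushForm_of_mem hx]; rfl
    · have h0 : ∀ ξ : E → E [⋀^Fin k]→L[ℝ] ℂ, formAt (pushForm x₀ ξ) x = 0 :=
        fun ξ => pushForm_of_notMem hx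
      rw [h0, h0, h0, add_zero]
  map_smul' c η := by
    apply Subtype.ext; funext x
    change formAt (pushForm x₀ (c • η.1)) x = c • formAt (pushForm x₀ η.1) x
    by_cases hx : x ∈ (extChartAt 𝓘(ℝ, E) x₀).source
    · rw [pushForm_of_mem hx, pushForm_of_mem hx]; rfl
    · have h0 : ∀ ξ : E → E [⋀^Fin k]→L[ℝ] ℂ, formAt (pushForm x₀ ξ) x = 0 :=
        fun ξ => pushForm_of_notMem hx
      rw [h0, h0]
      exact (smul_zero (A := E [⋀^Fin k]→L[ℝ] ℂ) c).symm

lemma pushLinear_val (x₀ : M) {k : ℕ} (η : chartForms E x₀ k) :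
    (pushLinear x₀ k η).1 = pushForm x₀ η.1 := rfl

lemma formSupport_pushLinear (x₀ : M) {k : ℕ} (η : chartForms E x₀ k) :
    formSupport (pushLinear x₀ k η).1 ⊆ (extChartAt 𝓘(ℝ, E) x₀).symm '' tsupport η.1 :=
  formSupport_pushForm η.2.2.1 (fun _ hy => image_eq_zero_of_notMem_tsupport hy) η.2.2.2

/-- A test form supported in the domain of a chart comes from a form in this chart. -/
lemma exists_pushLinear_eq (x₀ : M) {k : ℕ} (φ : TestForm E M k)
    (h : formSupport φ.1 ⊆ (extChartAt 𝓘(ℝ, E) x₀).source) :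
    ∃ η : chartForms E x₀ k, pushLinear x₀ k η = φ ∧
      tsupport η.1 ⊆ extChartAt 𝓘(ℝ, E) x₀ '' formSupport φ.1 ∧
      ∀ y ∈ (extChartAt 𝓘(ℝ, E) x₀).target, η.1 y = formInChart φ.1 x₀ y := by
  have hK := isCompact_chart_image φ.2.1 h
  have h1 : tsupport (localForm φ.1 x₀) ⊆ extChartAt 𝓘(ℝ, E) x₀ '' formSupport φ.1 :=
    closure_minimal (fun y hy => by_contra fun h' => hy (localForm_eq_zero h')) hK.isClosed
  refine ⟨⟨localForm φ.1 x₀, contDiff_localForm φ h,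
    hK.of_isClosed_subset (isClosed_tsupport _) h1, h1.trans ?_⟩,
    Subtype.ext (pushForm_localForm h), h1, fun y hy => indicator_of_mem hy _⟩
  rintro _ ⟨x, hx, rfl⟩
  exact (extChartAt 𝓘(ℝ, E) x₀).map_source (h hx)

lemma extDeriv_mem_chartForms {x₀ : M} {k : ℕ} (η : chartForms E x₀ k) :
    extDeriv η.1 ∈ chartForms E x₀ (k + 1) := by
  have h1 : tsupport (extDeriv η.1) ⊆ tsupport η.1 := by
    refine closure_minimal (fun y hy => ?_) (isClosed_tsupport _)
    by_contra h
    apply hy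
    have h2 : η.1 =ᶠ[𝓝 y] fun _ => 0 := notMem_tsupport_iff_eventuallyEq.1 h
    rw [h2.extDeriv_eq, extDeriv, fderiv_fun_const]
    exact (ContinuousAlternatingMap.alternatizeUncurryFinCLM ℝ E ℂ).map_zero
  refine ⟨contDiffOn_univ.1 (contDiffOn_extDeriv isOpen_univ η.2.1.contDiffOn),
    η.2.2.1.of_isClosed_subset (isClosed_tsupport _) h1, h1.trans η.2.2.2⟩

lemma TestForm.extDeriv_pushLinear {x₀ : M} {k : ℕ} (η : chartForms E x₀ k) :
    TestForm.extDeriv (pushLinear x₀ k η) =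
      pushLinear x₀ (k + 1) ⟨_root_.extDeriv η.1, extDeriv_mem_chartForms η⟩ := by
  apply Subtype.ext; funext x
  change formAt (formExtDeriv (pushLinear x₀ k η).1) x = formAt (pushForm x₀ (_root_.extDeriv η.1)) x
  by_cases hx : x ∈ (extChartAt 𝓘(ℝ, E) x₀).source
  · rw [form_eq_formInChart _ hx, pushForm_of_mem hx]
    have hy := (extChartAt 𝓘(ℝ, E) x₀).map_source hx
    rw [formInChart_formExtDeriv (pushLinear x₀ k η).2.2 hy]
    have h1 : formInChart (pushLinear x₀ k η).1 x₀ =ᶠ[𝓝 (extChartAt 𝓘(ℝ, E) x₀ x)] η.1 := by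
      filter_upwards [(isOpen_extChartAt_target x₀).mem_nhds hy] with z hz
      exact formInChart_pushForm hz
    rw [h1.extDeriv_eq]
  · have h1 : pushForm x₀ (_root_.extDeriv η.1) x = 0 := pushForm_of_notMem hx
    refine Eq.trans ?_ h1.symm
    by_contra h2
    obtain ⟨y, hy, rfl⟩ := formSupport_pushLinear x₀ η (formSupport_formExtDeriv (subset_closure h2))
    exact hx ((extChartAt 𝓘(ℝ, E) x₀).map_target (η.2.2.2 hy))

lemma TestForm.IsClosedCurrent.apply_extDeriv {x₀ : M} {k : ℕ} {T : TestForm E M (k + 1) →ₗ[ℂ] ℂ}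
    (hT : IsClosedCurrent T) (η : chartForms E x₀ k) :
    T (pushLinear x₀ (k + 1) ⟨_root_.extDeriv η.1, extDeriv_mem_chartForms η⟩) = 0 := by
  rw [← extDeriv_pushLinear]
  exact hT k rfl (pushLinear x₀ k η) _ fun _ _ => rfl

/-- The pull-back of forms by `J`, in a chart. -/
lemma compJ_mem_chartForms (J : AlmostComplexStructure E M) {x₀ : M} {k : ℕ}
    (η : chartForms E x₀ k) :
    (fun y => (η.1 y).compContinuousLinearMap (jChart J x₀ y)) ∈ chartForms E x₀ k := by
  have h1 : tsupport (fun y => (η.1 y).compContinuousLinearMap (jChart J x₀ y)) ⊆ tsupport η.1 :=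
    closure_mono fun y hy h => hy (by
      change (η.1 y).compContinuousLinearMap (jChart J x₀ y) = 0
      rw [h]; rfl)
  refine ⟨?_, η.2.2.1.of_isClosed_subset (isClosed_tsupport _) h1, h1.trans η.2.2.2⟩
  rw [contDiff_iff_contDiffAt]
  intro y
  by_cases hy : y ∈ (extChartAt 𝓘(ℝ, E) x₀).target
  · exact (η.2.1.contDiffOn.form_comp_clm (contDiffOn_jChart J x₀)).contDiffAt
      ((isOpen_extChartAt_target x₀).mem_nhds hy)
  · have h2 : y ∉ tsupport (fun y => (η.1 y).compContinuousLinearMap (jChart J x₀ y)) :=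
      fun h => hy (η.2.2.2 (h1 h))
    exact contDiffAt_const.congr_of_eventuallyEq (notMem_tsupport_iff_eventuallyEq.1 h2)

lemma TestForm.compJ_pushLinear (J : AlmostComplexStructure E M) {x₀ : M} {k : ℕ}
    (η : chartForms E x₀ k) : compJ J (pushLinear x₀ k η) =
      pushLinear x₀ k ⟨_, compJ_mem_chartForms J η⟩ := by
  apply Subtype.ext; funext x
  change (formAt (pushForm x₀ η.1) x).compContinuousLinearMap (J.toEnd x) =
    formAt (pushForm x₀ fun y => (η.1 y).compContinuousLinearMap (jChart J x₀ y)) x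
  by_cases hx : x ∈ (extChartAt 𝓘(ℝ, E) x₀).source
  · rw [pushForm_of_mem hx, pushForm_of_mem hx]
    apply ContinuousAlternatingMap.ext
    intro v
    change η.1 _ _ = η.1 _ _
    congr 1; ext i
    exact dChart_toEnd J hx (v i)
  · have h0 : ∀ ξ : E → E [⋀^Fin k]→L[ℝ] ℂ, formAt (pushForm x₀ ξ) x = 0 :=
      fun ξ => pushForm_of_notMem hx
    rw [h0, h0]; rfl

/-- A current of order `0` supported in a closed set is bounded, on the forms supported in a given
compact set of a chart, by the supremum of the form on this closed set. -/
lemma TestForm.IsOrderZero.bound [SecondCountableTopology M] {k : ℕ} {T : TestForm E M k →ₗ[ℂ] ℂ}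
    (hT : IsOrderZero T) {S : Set M} (hTS : currentSupport T ⊆ S) (x₀ : M)
    {K : Set E} (hK : IsCompact K) (hKt : K ⊆ (extChartAt 𝓘(ℝ, E) x₀).target) :
    ∃ C : ℝ, 0 ≤ C ∧ ∀ η : chartForms E x₀ k, tsupport η.1 ⊆ K → ∀ B : ℝ,
      0 ≤ B → (∀ y ∈ K, (extChartAt 𝓘(ℝ, E) x₀).symm y ∈ S → ‖η.1 y‖ ≤ B) →
      ‖T (pushLinear x₀ k η)‖ ≤ C * B := by
  have hKs : (extChartAt 𝓘(ℝ, E) x₀).symm '' K ⊆ (chartAt E x₀).source := by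
    rintro _ ⟨y, hy, rfl⟩
    have := (extChartAt 𝓘(ℝ, E) x₀).map_target (hKt hy)
    rwa [extChartAt_source] at this
  obtain ⟨C, hC⟩ := hT x₀ _ (isCompact_chart_symm_image hK hKt) hKs
  have hC' : ∀ η : chartForms E x₀ k, tsupport η.1 ⊆ K → ∀ B : ℝ, 0 ≤ B →
      (∀ y ∈ K, ‖η.1 y‖ ≤ B) → ‖T (pushLinear x₀ k η)‖ ≤ max C 0 * B := by
    intro η hη B hB h
    refine (hC _ ((formSupport_pushLinear x₀ η).trans (image_mono hη)) B hB ?_).trans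
      (mul_le_mul_of_nonneg_right (le_max_left _ _) hB)
    rintro _ ⟨y, hy, rfl⟩
    rw [(extChartAt 𝓘(ℝ, E) x₀).right_inv (hKt hy), pushLinear_val, formInChart_pushForm (hKt hy)]
    exact h y hy
  refine ⟨max C 0, le_max_right _ _, fun η hη B hB h => ?_⟩
  -- it suffices to prove the estimate for all larger bounds
  have key : ∀ B' > B, ‖T (pushLinear x₀ k η)‖ ≤ max C 0 * B' := by
    intro B' hBB'
    obtain ⟨B₁, hB₁, hB₁'⟩ := exists_between hBB'
    have hcont : Continuous fun y => ‖η.1 y‖ := η.2.1.continuous.norm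
    -- a cut-off equal to one where the form is large, with support away from `S`
    obtain ⟨θ, hθ0, hθ1, hθ⟩ := exists_contMDiffMap_zero_one_of_isClosed 𝓘(ℝ, E) (n := ⊤)
      (s := {y | ‖η.1 y‖ ≤ B₁}) (t := {y | B' ≤ ‖η.1 y‖})
      (isClosed_le hcont continuous_const) (isClosed_le continuous_const hcont)
      (disjoint_left.2 fun y hy hy' => absurd (le_trans hy' hy) (not_le.2 hB₁'))
    have hθs : ContDiff ℝ ∞ (θ : E → ℝ) := θ.contMDiff.contDiff
    have hsub : tsupport (fun y => θ y • η.1 y) ⊆ tsupport η.1 :=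
      closure_mono fun y hy h0 => hy (by
        change θ y • η.1 y = 0
        rw [h0]
        exact smul_zero (A := E [⋀^Fin k]→L[ℝ] ℂ) (θ y))
    have hmem : (fun y => θ y • η.1 y) ∈ chartForms E x₀ k :=
      ⟨hθs.smul η.2.1, η.2.2.1.of_isClosed_subset (isClosed_tsupport _) hsub, hsub.trans η.2.2.2⟩
    set ξ : chartForms E x₀ k := ⟨_, hmem⟩ with hξ
    -- the support of this cut-off form is disjoint from the support of `T`
    have hT0 : T (pushLinear x₀ k ξ) = 0 := by
      refine apply_eq_zero_of_disjoint T _ (disjoint_left.2 fun x hx hxT => ?_)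
      obtain ⟨y, hy, rfl⟩ := formSupport_pushLinear x₀ ξ hx
      have h1 : tsupport ξ.1 ⊆ {y | B₁ ≤ ‖η.1 y‖} := by
        refine closure_minimal (fun z hz => ?_) (isClosed_le continuous_const hcont)
        by_contra h2
        exact hz (by
          change θ z • η.1 z = 0
          have h5 : ‖η.1 z‖ ≤ B₁ := le_of_not_ge h2
          rw [hθ0 h5]
          exact zero_smul ℝ (η.1 z))
      have h2 := h y (hη (hsub hy)) (hTS hxT)
      exact absurd ((h1 hy).trans h2) (not_le.2 hB₁)
    have hsub' : tsupport (fun y => (1 - θ y) • η.1 y) ⊆ tsupport η.1 :=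
      closure_mono fun y hy h0 => hy (by
        change (1 - θ y) • η.1 y = 0
        rw [h0]
        exact smul_zero (A := E [⋀^Fin k]→L[ℝ] ℂ) (1 - θ y))
    have hmem' : (fun y => (1 - θ y) • η.1 y) ∈ chartForms E x₀ k :=
      ⟨(contDiff_const.sub hθs).smul η.2.1,
        η.2.2.1.of_isClosed_subset (isClosed_tsupport _) hsub', hsub'.trans η.2.2.2⟩
    have hadd : η = ξ + ⟨_, hmem'⟩ := by
      apply Subtype.ext; funext y
      apply ContinuousAlternatingMap.ext
      intro v
      change η.1 y v = θ y • η.1 y v + (1 - θ y) • η.1 y v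
      rw [← add_smul, add_sub_cancel, one_smul]
    rw [hadd, map_add, map_add, hT0, zero_add]
    refine hC' ⟨_, hmem'⟩ (hsub'.trans hη) B' (hB.trans hBB'.le) fun y _ => ?_
    · change ‖(1 - θ y) • η.1 y‖ ≤ B'
      by_cases hy : B' ≤ ‖η.1 y‖
      · rw [show θ y = 1 from hθ1 hy, sub_self, zero_smul ℝ (η.1 y), norm_zero]
        exact hB.trans hBB'.le
      · rw [norm_smul (1 - θ y) (η.1 y), Real.norm_of_nonneg (by linarith [(hθ y).2])]
        refine (mul_le_of_le_one_left (norm_nonneg _) (by linarith [(hθ y).1])).trans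
          (not_le.1 hy).le
  refine ge_of_tendsto (x := 𝓝[>] B) (f := fun B' => max C 0 * B') ?_
    (eventually_mem_nhdsWithin.mono key)
  exact ((continuous_const.mul continuous_id).tendsto B).mono_left nhdsWithin_le_nhds

end Localization

/-! ### Closed functionals on continuous forms -/

section ClosedFunctionals

variable {V : Type*} [NormedAddCommGroup V] [NormedSpace ℝ V] [FiniteDimensional ℝ V]

instance finiteDimensional_complex_continuousAlternatingMap (k : ℕ) :
    FiniteDimensional ℂ (V [⋀^Fin k]→L[ℝ] ℂ) :=
  FiniteDimensional.right ℝ ℂ (V [⋀^Fin k]→L[ℝ] ℂ)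

/-- The functional `S` on the continuous forms on the compact set `X` vanishes on the differentials
of the forms `f θ`, where `f` is a smooth function with compact support in `O` and `θ` is a constant
form. -/
def IsClosedFunctional {k : ℕ} {X : Set V} [CompactSpace X] (O : Set V)
    (S : C(X, V [⋀^Fin k]→L[ℝ] ℂ) →L[ℂ] ℂ) : Prop :=
  ∀ (m : ℕ) (h : m + 1 = k) (f : V → ℂ), ContDiff ℝ ∞ f → HasCompactSupport f → tsupport f ⊆ O →
    ∀ (θ : V [⋀^Fin m]→L[ℝ] ℂ) (β : C(X, V [⋀^Fin k]→L[ℝ] ℂ)),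
      (∀ z v, β z v = ∑ i : Fin (m + 1), (-1 : ℂ) ^ (i : ℕ) *
        (fderiv ℝ f z (v (Fin.cast h i)) * θ (i.removeNth fun j => v (Fin.cast h j)))) → S β = 0

/-- The continuous form `f α` on `X`, where `α` is a constant form. -/
def smulForm {k : ℕ} {X : Set V} (α : V [⋀^Fin k]→L[ℝ] ℂ) (f : C(X, ℂ)) :
    C(X, V [⋀^Fin k]→L[ℝ] ℂ) := ⟨fun z => f z • α, by fun_prop⟩

lemma smulForm_apply {k : ℕ} {X : Set V} (α : V [⋀^Fin k]→L[ℝ] ℂ) (f : C(X, ℂ)) (z : X)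
    (v : Fin k → V) : smulForm α f z v = f z * α v := rfl

variable {k : ℕ} {X : Set V} [CompactSpace X] {O : Set V} {S : C(X, V [⋀^Fin k]→L[ℝ] ℂ) →L[ℂ] ℂ}

/-- If the linear form `ℓ` vanishes on `X`, then `S` vanishes on `f ℓ ∧ θ = d(f ℓ θ)` on `X`. -/
lemma IsClosedFunctional.apply_wedge (hS : IsClosedFunctional O S) {m : ℕ} (h : m + 1 = k)
    {f : V → ℂ} (hf : ContDiff ℝ ∞ f) (hfc : HasCompactSupport f) (hfO : tsupport f ⊆ O)
    (ℓ : V →L[ℝ] ℝ) (hℓ : ∀ z ∈ X, ℓ z = 0) (θ : V [⋀^Fin m]→L[ℝ] ℂ)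
    (β : C(X, V [⋀^Fin k]→L[ℝ] ℂ))
    (hβ : ∀ z v, β z v = f z * ∑ i : Fin (m + 1), (-1 : ℂ) ^ (i : ℕ) *
        (ℓ (v (Fin.cast h i)) * θ (i.removeNth fun j => v (Fin.cast h j)))) : S β = 0 := by
  have hsub : tsupport (fun z => (ℓ z : ℂ) * f z) ⊆ tsupport f :=
    closure_mono fun z hz h0 => hz (by simp [h0])
  have hℓ' : ContDiff ℝ ∞ fun z => (ℓ z : ℂ) := Complex.ofRealCLM.contDiff.comp ℓ.contDiff
  refine hS m h (fun z => (ℓ z : ℂ) * f z) (hℓ'.mul hf)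
    (hfc.of_isClosed_subset (isClosed_tsupport _) hsub) (hsub.trans hfO) θ β fun z v => ?_
  have hd : fderiv ℝ (fun z => (ℓ z : ℂ) * f z) z = (f z) • (Complex.ofRealCLM.comp ℓ) := by
    have h1 : HasFDerivAt (fun z => (ℓ z : ℂ)) (Complex.ofRealCLM.comp ℓ) (z : V) :=
      (Complex.ofRealCLM.comp ℓ).hasFDerivAt
    rw [(h1.fun_mul (hf.differentiable (by simp) z).hasFDerivAt).fderiv, hℓ z z.2]
    simp only [Complex.ofReal_zero]
    rw [zero_smul ℂ (fderiv ℝ f (z : V)), zero_add]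
  rw [hβ, hd, Finset.mul_sum]
  refine Finset.sum_congr rfl fun i _ => ?_
  simp only [smul_apply, ContinuousLinearMap.comp_apply,
    Complex.ofRealCLM_apply, smul_eq_mul]
  ring

/-- If the projection `q` is the identity on `X`, then `S` vanishes on the forms `f D α`, where `D`
is the derivation defined by `1 - q`. -/
lemma IsClosedFunctional.apply_slotSum (hS : IsClosedFunctional O S)
    {f : V → ℂ} (hf : ContDiff ℝ ∞ f) (hfc : HasCompactSupport f) (hfO : tsupport f ⊆ O)
    (A : V →L[ℝ] V) (hA : ∀ z ∈ X, A z = 0) (α : V [⋀^Fin k]→L[ℝ] ℂ) (fX : C(X, ℂ))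
    (hfX : ∀ z, fX z = f z) : S (smulForm (slotSum A α) fX) = 0 := by
  rcases k with - | m
  · have : smulForm (slotSum A α) fX = 0 := by
      ext z v
      rw [smulForm_apply, slotSum_apply]
      simp
    rw [this, map_zero]
  -- in a basis `b` of `V` with coordinates `ℓ j` of `A`, the derivation `slotSum A` maps `α` to
  -- the sum of the forms `ℓ j ∧ (b j ⌟ α)`
  let b := finBasis ℝ V
  let ℓ : Fin (finrank ℝ V) → (V →L[ℝ] ℝ) := fun j =>
    (LinearMap.toContinuousLinearMap (b.coord j)).comp A
  let w : Fin (finrank ℝ V) → (V [⋀^Fin (m + 1)]→L[ℝ] ℂ) := fun j =>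
    ContinuousAlternatingMap.alternatizeUncurryFin ((ℓ j).smulRight (α.curryLeft (b j)))
  have hw : ∀ j v, w j v = ∑ i : Fin (m + 1), (-1 : ℂ) ^ (i : ℕ) *
        (ℓ j (v i) * α.curryLeft (b j) (i.removeNth v)) := by
    intro j v
    simp only [w, ContinuousAlternatingMap.alternatizeUncurryFin_apply,
      ContinuousLinearMap.smulRight_apply]
    refine Finset.sum_congr rfl fun i _ => ?_
    simp
  have hwα : slotSum A α = ∑ j, w j := by
    ext v
    rw [slotSum_apply, ContinuousAlternatingMap.sum_apply]
    simp only [hw]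
    rw [Finset.sum_comm]
    refine Finset.sum_congr rfl fun i _ => ?_
    have h1 : ∀ j, (-1 : ℂ) ^ (i : ℕ) * (ℓ j (v i) * α.curryLeft (b j) (i.removeNth v)) =
        ℓ j (v i) • α (Function.update v i (b j)) := by
      intro j
      have h2 := α.toAlternatingMap.neg_one_pow_smul_map_insertNth i (b j) (i.removeNth v)
      have h3 : i.insertNth (α := fun _ => V) (b j) (i.removeNth v) = Function.update v i (b j) := by
        simp
      rw [h3] at h2
      have h4 : α.curryLeft (b j) (i.removeNth v) = (-1 : ℤ) ^ (i : ℕ) •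
        α (Function.update v i (b j)) := h2.symm
      rw [h4, Complex.real_smul]
      simp only [zsmul_eq_mul, Int.cast_pow, Int.cast_neg, Int.cast_one]
      have h5 : (-1 : ℂ) ^ (i : ℕ) * (-1 : ℂ) ^ (i : ℕ) = 1 := by
        rw [← mul_pow]; simp
      linear_combination (ℓ j (v i) : ℂ) * α (Function.update v i (b j)) * h5
    simp only [h1]
    have h6 : A (v i) = ∑ j, ℓ j (v i) • b j := (b.sum_repr (A (v i))).symm
    rw [h6]
    exact (α.toMultilinearMap.map_update_sum _ i _ v).trans
      (Finset.sum_congr rfl fun j _ => α.toMultilinearMap.map_update_smul v i _ _)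
  have h7 : smulForm (slotSum A α) fX = ∑ j, smulForm (w j) fX := by
    ext z v
    rw [ContinuousMap.sum_apply, ContinuousAlternatingMap.sum_apply, smulForm_apply, hwα,
      ContinuousAlternatingMap.sum_apply, Finset.mul_sum]
    rfl
  rw [h7, map_sum]
  refine Finset.sum_eq_zero fun j _ => ?_
  refine hS.apply_wedge rfl hf hfc hfO (ℓ j) (fun z hz => ?_) (α.curryLeft (b j)) _ fun z v => ?_
  · simp [ℓ, hA z hz]
  · rw [smulForm_apply, hfX, hw]; rfl

/-- The functional `α ↦ S (f α)` on constant forms. -/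
def constFunctional (S : C(X, V [⋀^Fin k]→L[ℝ] ℂ) →L[ℂ] ℂ) (f : C(X, ℂ)) :
    (V [⋀^Fin k]→L[ℝ] ℂ) →L[ℂ] ℂ :=
  LinearMap.toContinuousLinearMap
    { toFun := fun α => S (smulForm α f)
      map_add' := fun α α' => by
        rw [← map_add]; congr 1; ext z v; simp [smulForm_apply, mul_add]
      map_smul' := fun c α => by
        rw [RingHom.id_apply, ← map_smul]; congr 1; ext z v
        change f z * (c * α v) = c * (f z * α v)
        ring }

/-- If the projection `q` is the identity on `X`, then `S (f α) = S (f q^* α)`: along the path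
`q + e^{-t} (1 - q)`, which joins the identity to `q`, the derivative of the pull-back of `α` is in
the range of the derivation defined by `1 - q`. -/
lemma IsClosedFunctional.apply_smulForm_proj (hS : IsClosedFunctional O S)
    {f : V → ℂ} (hf : ContDiff ℝ ∞ f) (hfc : HasCompactSupport f) (hfO : tsupport f ⊆ O)
    (q : V →L[ℝ] V) (hq : ∀ v, q (q v) = q v) (hqX : ∀ z ∈ X, q z = z)
    (α : V [⋀^Fin k]→L[ℝ] ℂ) (fX : C(X, ℂ)) (hfX : ∀ z, fX z = f z) :
    S (smulForm α fX) = S (smulForm (α.compContinuousLinearMap q) fX) := by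
  let A : V →L[ℝ] V := ContinuousLinearMap.id ℝ V - q
  have hA : ∀ v, A v = v - q v := fun v => rfl
  let g : ℝ → (V →L[ℝ] V) := fun t => q + Real.exp (-t) • A
  have hgA : ∀ t v, g t (A v) = Real.exp (-t) • A v := by
    intro t v
    simp only [g, add_apply, smul_apply, hA, map_sub, hq]
    simp
  let L := (constFunctional S fX).restrictScalars ℝ
  let c : ℝ → ℂ := fun t => L (α.compContinuousLinearMap (g t))
  have hg : ∀ t, HasDerivAt g (-Real.exp (-t) • A) t := by
    intro t
    have h1 : HasDerivAt (fun t : ℝ => Real.exp (-t)) (-Real.exp (-t)) t := by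
      simpa using (hasDerivAt_neg t).exp
    exact (h1.smul_const A).const_add q
  -- up to a factor, the derivative of `c` is the value at `slotSum A (α ∘ g t)`, which vanishes
  have hc : ∀ t, HasDerivAt c 0 t := by
    intro t
    have h1 := (hasFDerivAt_const α t).continuousAlternatingMapCompContinuousLinearMap
      (hg t).hasFDerivAt
    have h2 := L.hasFDerivAt.comp t h1
    have h3 := h2.hasDerivAt
    convert! h3 using 1
    have h4 : Real.exp (-t) • α.fderivCompContinuousLinearMap (g t) A =
        slotSum A (α.compContinuousLinearMap (g t)) := by
      ext v
      change Real.exp (-t) • (α.fderivCompContinuousLinearMap (g t) A) v = _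
      rw [slotSum_apply, ContinuousAlternatingMap.fderivCompContinuousLinearMap_apply,
        Finset.smul_sum]
      refine Finset.sum_congr rfl fun i _ => ?_
      have h5 : (fun j => (Function.update (fun _ : Fin k => g t) i A j) (v j)) =
          Function.update (fun j => g t (v j)) i (A (v i)) := by
        funext j
        rcases eq_or_ne j i with rfl | h
        · simp
        · simp [h]
      have h6 : (g t) ∘ (Function.update v i (A (v i))) =
          Function.update (fun j => g t (v j)) i (Real.exp (-t) • A (v i)) := by
        funext j
        rcases eq_or_ne j i with rfl | h
        · simp [hgA]
        · simp [h]
      rw [h5, ContinuousAlternatingMap.compContinuousLinearMap_apply, h6]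
      exact (α.toMultilinearMap.map_update_smul _ i _ _).symm
    have h7 : L (slotSum A (α.compContinuousLinearMap (g t))) = 0 :=
      hS.apply_slotSum hf hfc hfO A (fun z hz => by rw [hA, hqX z hz, sub_self]) _ fX hfX
    rw [← h4, map_smul] at h7
    simp [(smul_eq_zero.1 h7).resolve_left (Real.exp_pos _).ne']
  have hconst : ∀ t, c t = c 0 := fun t => is_const_of_deriv_eq_zero
    (fun t => (hc t).differentiableAt) (fun t => (hc t).deriv) t 0
  have h0 : c 0 = S (smulForm α fX) := by
    have : g 0 = ContinuousLinearMap.id ℝ V := by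
      ext v; simp [g, hA]
    change L (α.compContinuousLinearMap (g 0)) = _
    rw [this]; rfl
  -- `c` is constant with `c 0 = S (f α)`, and it tends to the value at `α ∘ q`
  have hlim : Filter.Tendsto c Filter.atTop (𝓝 (L (α.compContinuousLinearMap q))) := by
    have h1 : Filter.Tendsto g Filter.atTop (𝓝 q) := by
      have h2 : Filter.Tendsto (fun t : ℝ => q + Real.exp (-t) • A) Filter.atTop
          (𝓝 (q + (0 : ℝ) • A)) :=
        tendsto_const_nhds.add ((Real.tendsto_exp_neg_atTop_nhds_zero).smul_const A)
      simpa using h2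
    have h3 : Continuous fun B : V →L[ℝ] V => L (α.compContinuousLinearMap B) :=
      L.continuous.comp (continuousOn_univ.1
        ((continuousOn_const (c := α)).form_comp_clm continuousOn_id))
    exact (h3.tendsto q).comp h1
  have h1 : c = fun _ => c 0 := funext hconst
  rw [h1] at hlim
  rw [← h0]
  exact tendsto_nhds_unique tendsto_const_nhds hlim

/-- The functional `f ↦ S (f α)` on continuous functions. -/
def scalarFunctional (S : C(X, V [⋀^Fin k]→L[ℝ] ℂ) →L[ℂ] ℂ) (α : V [⋀^Fin k]→L[ℝ] ℂ) :
    C(X, ℂ) →L[ℂ] ℂ :=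
  S.comp (ContinuousLinearMap.compLeftContinuous ℂ X ((ContinuousLinearMap.id ℂ ℂ).smulRight α))

lemma scalarFunctional_apply (S : C(X, V [⋀^Fin k]→L[ℝ] ℂ) →L[ℂ] ℂ) (α : V [⋀^Fin k]→L[ℝ] ℂ)
    (f : C(X, ℂ)) : scalarFunctional S α f = S (smulForm α f) := rfl

/-- Smooth functions with support in `O` are dense, for the uniform convergence, in the continuous
functions with support in `O`. -/
lemma eq_zero_of_smooth (Φ : C(X, ℂ) →L[ℂ] ℂ)
    (h : ∀ f : V → ℂ, ContDiff ℝ ∞ f → HasCompactSupport f → tsupport f ⊆ O →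
      ∀ fX : C(X, ℂ), (∀ z, fX z = f z) → Φ fX = 0)
    {f : V → ℂ} (hf : Continuous f) (hfc : HasCompactSupport f) (hfO : tsupport f ⊆ O)
    (fX : C(X, ℂ)) (hfX : ∀ z, fX z = f z) : Φ fX = 0 := by
  rw [← norm_le_zero_iff]
  have key : ∀ ε > 0, ‖Φ fX‖ ≤ ‖Φ‖ * ε := by
    intro ε hε
    obtain ⟨g, hg, hgf, hgs⟩ := hf.exists_contDiff_approx ⊤ (ε := fun _ => ε) continuous_const
      (fun _ => hε)
    let gX : C(X, ℂ) := ⟨fun z => g z, hg.continuous.comp continuous_subtype_val⟩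
    have h1 : Φ gX = 0 := h g hg (hfc.mono hgs) ((closure_mono hgs).trans hfO) gX fun _ => rfl
    have h2 : Φ fX = Φ (fX - gX) := by rw [map_sub, h1, sub_zero]
    rw [h2]
    refine (Φ.le_opNorm _).trans (mul_le_mul_of_nonneg_left ?_ (norm_nonneg _))
    refine (ContinuousMap.norm_le _ hε.le).2 fun z => ?_
    rw [ContinuousMap.sub_apply, hfX, ← dist_eq_norm, dist_comm]
    exact (hgf z).le
  refine ge_of_tendsto (x := 𝓝[>] (0 : ℝ)) (f := fun ε => ‖Φ‖ * ε) ?_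
    (eventually_mem_nhdsWithin.mono key)
  have h3 : Filter.Tendsto (fun ε : ℝ => ‖Φ‖ * ε) (𝓝 0) (𝓝 (‖Φ‖ * 0)) :=
    (continuous_const.mul continuous_id).tendsto 0
  rw [mul_zero] at h3
  exact h3.mono_left nhdsWithin_le_nhds

/-- A closed functional on the forms on a subset `X` of the range of the projection `q` only depends
on the restrictions of forms to this range. -/
lemma IsClosedFunctional.apply_eq_proj (hS : IsClosedFunctional O S)
    {β : V → V [⋀^Fin k]→L[ℝ] ℂ} (hβ : Continuous β) (hβc : HasCompactSupport β)
    (hβO : tsupport β ⊆ O)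
    (q : V →L[ℝ] V) (hq : ∀ v, q (q v) = q v) (hqX : ∀ z ∈ X, q z = z)
    (βX βX' : C(X, V [⋀^Fin k]→L[ℝ] ℂ)) (hβX : ∀ z, βX z = β z)
    (hβX' : ∀ z v, βX' z v = β z (fun i => q (v i))) : S βX = S βX' := by
  let b := finBasis ℂ (V [⋀^Fin k]→L[ℝ] ℂ)
  let c : ∀ i, (V [⋀^Fin k]→L[ℝ] ℂ) →L[ℂ] ℂ := fun i => LinearMap.toContinuousLinearMap (b.coord i)
  have hc : ∀ α, α = ∑ i, c i α • b i := fun α => (b.sum_repr α).symm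
  let fX : ∀ i, C(X, ℂ) := fun i => ⟨fun z => c i (βX z), by fun_prop⟩
  have h1 : βX = ∑ i, smulForm (b i) (fX i) := by
    ext z v
    rw [ContinuousMap.sum_apply, ContinuousAlternatingMap.sum_apply]
    conv_lhs => rw [hc (βX z)]
    rw [ContinuousAlternatingMap.sum_apply]
    rfl
  have h2 : βX' = ∑ i, smulForm ((b i).compContinuousLinearMap q) (fX i) := by
    ext z v
    rw [ContinuousMap.sum_apply, ContinuousAlternatingMap.sum_apply, hβX', ← hβX]
    conv_lhs => rw [hc (βX z)]
    rw [ContinuousAlternatingMap.sum_apply]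
    rfl
  rw [h1, h2, map_sum, map_sum]
  refine Finset.sum_congr rfl fun i _ => ?_
  have hsupp : Function.support (fun z => c i (β z)) ⊆ Function.support β := fun z hz h => hz (by simp [h])
  have h3 := eq_zero_of_smooth (O := O)
    (scalarFunctional S (b i) - scalarFunctional S ((b i).compContinuousLinearMap q))
    (fun f hf hfc hfO fX hfX => by
      rw [sub_apply, scalarFunctional_apply, scalarFunctional_apply,
        hS.apply_smulForm_proj hf hfc hfO q hq hqX (b i) fX hfX, sub_self])
    ((c i).continuous.comp hβ) (hβc.mono hsupp) ((closure_mono hsupp).trans hβO) (fX i)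
    fun z => by simp [fX, hβX]
  rwa [sub_apply, scalarFunctional_apply, scalarFunctional_apply, sub_eq_zero] at h3

/-- A closed functional on the forms on a subset `X` of the range of the projection `q` vanishes on
the forms which restrict to zero on this range. -/
lemma IsClosedFunctional.apply_eq_zero (hS : IsClosedFunctional O S)
    {β : V → V [⋀^Fin k]→L[ℝ] ℂ} (hβ : Continuous β) (hβc : HasCompactSupport β)
    (hβO : tsupport β ⊆ O)
    (q : V →L[ℝ] V) (hq : ∀ v, q (q v) = q v) (hqX : ∀ z ∈ X, q z = z)
    (βX : C(X, V [⋀^Fin k]→L[ℝ] ℂ)) (hβX : ∀ z, βX z = β z)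
    (h : ∀ (z : X) (v : Fin k → V), β z (fun i => q (v i)) = 0) : S βX = 0 := by
  rw [hS.apply_eq_proj hβ hβc hβO q hq hqX βX 0 hβX fun z v => (h z v).symm, map_zero]

end ClosedFunctionals

/-! ### Invariance under an almost complex structure -/

section Invariance

lemma continuous_form_comp_of_tsupport {V W : Type*} [NormedAddCommGroup V] [NormedSpace ℝ V]
    [FiniteDimensional ℝ V] [NormedAddCommGroup W] [NormedSpace ℝ W] {Y : Type*}
    [TopologicalSpace Y] {k : ℕ} {β : Y → W [⋀^Fin k]→L[ℝ] ℂ} {A : Y → (V →L[ℝ] W)} {O : Set Y}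
    (hO : IsOpen O) (hβ : Continuous β) (hs : tsupport β ⊆ O) (hA : ContinuousOn A O) :
    Continuous fun z => (β z).compContinuousLinearMap (A z) := by
  rw [continuous_iff_continuousAt]
  intro z
  by_cases hz : z ∈ O
  · exact (hβ.continuousOn.form_comp_clm hA).continuousAt (hO.mem_nhds hz)
  · have h1 : β =ᶠ[𝓝 z] fun _ => 0 := notMem_tsupport_iff_eventuallyEq.1 fun h => hz (hs h)
    refine (continuousAt_const (y := 0)).congr (h1.mono fun y hy => ?_)
    change 0 = (β y).compContinuousLinearMap (A y)
    rw [hy]; rfl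

lemma support_form_comp_subset {V W : Type*} [NormedAddCommGroup V] [NormedSpace ℝ V]
    [NormedAddCommGroup W] [NormedSpace ℝ W] {Y : Type*} {k : ℕ}
    (β : Y → W [⋀^Fin k]→L[ℝ] ℂ) (A : Y → (V →L[ℝ] W)) :
    Function.support (fun z => (β z).compContinuousLinearMap (A z)) ⊆ Function.support β :=
  fun z hz h => hz (by
    change (β z).compContinuousLinearMap (A z) = 0
    rw [h]; rfl)

variable {H G R : Type*} [NormedAddCommGroup H] [NormedSpace ℝ H] [FiniteDimensional ℝ H]
  [NormedAddCommGroup G] [NormedSpace ℝ G] [FiniteDimensional ℝ G]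
  [NormedAddCommGroup R] [NormedSpace ℝ R] [FiniteDimensional ℝ R]

variable (H G R) in
/-- The projection of `H × (G × R)` to `H × G`. -/
def flatProj : H × (G × R) →L[ℝ] H × (G × R) :=
  (ContinuousLinearMap.fst ℝ H (G × R)).prod
    (((ContinuousLinearMap.fst ℝ G R).comp (ContinuousLinearMap.snd ℝ H (G × R))).prod 0)

@[simp] lemma flatProj_apply (v : H × (G × R)) : flatProj H G R v = (v.1, v.2.1, 0) := rfl

/-- In `H × (G × R)`, let `J` be a field of endomorphisms such that, at the points of `H × G`, the
space `H` is `J`-invariant and contains all the vectors `w ∈ H × G` with `J w ∈ H × G`. Let `S` be a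
closed functional on the forms on a subset of `H × G` that is invariant under the pull-back by `J`.
Then, locally, `S` vanishes on the forms `β` which restrict to zero on `H`. Indeed there are
projections `q` with range `H × G` such that `q J` maps `H × G` to `H`, and `S β = S (J^* q^* β)`. -/
lemma IsClosedFunctional.exists_isOpen_apply_eq_zero {k : ℕ} {X : Set (H × (G × R))}
    [CompactSpace X] (hX : ∀ z ∈ X, z.2.2 = 0) {O : Set (H × (G × R))} (hO : IsOpen O)
    {S : C(X, (H × (G × R)) [⋀^Fin k]→L[ℝ] ℂ) →L[ℂ] ℂ} (hS : IsClosedFunctional O S)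
    (J : H × (G × R) → (H × (G × R) →L[ℝ] H × (G × R))) (hJ : ContinuousOn J O)
    (hJS : ∀ β : H × (G × R) → (H × (G × R)) [⋀^Fin k]→L[ℝ] ℂ, Continuous β →
      HasCompactSupport β → tsupport β ⊆ O → ∀ βX βX' : C(X, (H × (G × R)) [⋀^Fin k]→L[ℝ] ℂ),
      (∀ z, βX z = β z) → (∀ z v, βX' z v = β z (fun i => J z (v i))) → S βX' = S βX)
    (hJH : ∀ z ∈ O, z.2.2 = 0 → ∀ h : H, (J z (h, 0)).2 = 0)
    (hJW : ∀ z ∈ O, z.2.2 = 0 → ∀ w : H × (G × R), w.2.2 = 0 → (J z w).2.2 = 0 → w.2 = 0)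
    {z₀ : H × (G × R)} (hz₀ : z₀ ∈ O) (hz₀' : z₀.2.2 = 0) :
    ∃ O' ⊆ O, IsOpen O' ∧ z₀ ∈ O' ∧ ∀ β : H × (G × R) → (H × (G × R)) [⋀^Fin k]→L[ℝ] ℂ,
      Continuous β → HasCompactSupport β → tsupport β ⊆ O' →
      ∀ βX : C(X, (H × (G × R)) [⋀^Fin k]→L[ℝ] ℂ), (∀ z, βX z = β z) →
      (∀ (z : X) (v : Fin k → H), β z (fun i => (v i, 0)) = 0) → S βX = 0 := by
  let incG : G →L[ℝ] H × (G × R) :=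
    (ContinuousLinearMap.inr ℝ H (G × R)).comp (ContinuousLinearMap.inl ℝ G R)
  let prR : H × (G × R) →L[ℝ] R :=
    (ContinuousLinearMap.snd ℝ G R).comp (ContinuousLinearMap.snd ℝ H (G × R))
  -- `s z` is the component of `J z` from `G` to `R`, injective at `z₀`; the left inverse `lam z`
  -- of `s z` depends continuously on `z`
  let s : H × (G × R) → (G →L[ℝ] R) := fun z => prR.comp ((J z).comp incG)
  have hs : ContinuousOn s O :=
    (continuousOn_const (c := prR)).clm_comp (hJ.clm_comp (continuousOn_const (c := incG)))
  have hinj : LinearMap.ker (s z₀).toLinearMap = ⊥ := by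
    rw [LinearMap.ker_eq_bot']
    intro g hg
    have h1 := hJW z₀ hz₀ hz₀' (0, g, 0) rfl hg
    exact congrArg Prod.fst h1
  obtain ⟨l, hl⟩ := (s z₀).toLinearMap.exists_leftInverse_of_injective hinj
  let l' : R →L[ℝ] G := LinearMap.toContinuousLinearMap l
  let P : H × (G × R) → (G →L[ℝ] G) := fun z => l'.comp (s z)
  have hP : ContinuousOn P O := (continuousOn_const (c := l')).clm_comp hs
  have hPz₀ : P z₀ = 1 := by
    ext g; exact congrArg (fun f => f g) hl
  let O' : Set (H × (G × R)) := O ∩ P ⁻¹' {u | IsUnit u}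
  have hO' : IsOpen O' := hP.isOpen_inter_preimage hO Units.isOpen
  let lam : H × (G × R) → (R →L[ℝ] G) := fun z => (Ring.inverse (P z)).comp l'
  have hlam : ContinuousOn lam O' := by
    refine ContinuousOn.clm_comp (fun z hz => ?_) (continuousOn_const (c := l'))
    obtain ⟨u, hu⟩ := hz.2
    have h1 := NormedRing.inverse_continuousAt u
    rw [hu] at h1
    exact h1.comp_continuousWithinAt ((hP z hz.1).mono inter_subset_left)
  have hlams : ∀ z ∈ O', ∀ g, lam z (s z g) = g := fun z hz g =>
    congrArg (fun f : G →L[ℝ] G => f g) (Ring.inverse_mul_cancel _ hz.2)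
  -- `Q z` is a projection onto `H × G × {0}` along a complement for which the composite of `J z`
  -- and `Q z` maps `H × G` into `H`
  let Q : H × (G × R) → (H × (G × R) →L[ℝ] H × (G × R)) := fun z =>
    flatProj H G R - (flatProj H G R).comp ((J z).comp (incG.comp ((lam z).comp prR)))
  have hQ : ContinuousOn Q O' := by
    refine continuousOn_const.sub (continuousOn_const.clm_comp ((hJ.mono inter_subset_left).clm_comp
      (continuousOn_const.clm_comp (hlam.clm_comp continuousOn_const))))
  have hQW : ∀ z v, Q z (flatProj H G R v) = flatProj H G R v := by
    intro z v
    have h1 : prR (flatProj H G R v) = 0 := rfl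
    have h2 : flatProj H G R (flatProj H G R v) = flatProj H G R v := rfl
    simp only [Q, sub_apply, ContinuousLinearMap.comp_apply, h1, h2, map_zero, sub_zero]
  have hQJ : ∀ z ∈ O', z.2.2 = 0 → ∀ v, (Q z (J z (flatProj H G R v))).2 = 0 := by
    intro z hz hz' v
    have h1 : flatProj H G R v = (v.1, 0) + incG v.2.1 := by simp [incG]
    have h2 : prR (J z (v.1, 0)) = 0 := by
      change (J z (v.1, 0)).2.2 = 0
      rw [hJH z hz.1 hz' v.1]; rfl
    have h3 : prR (J z (flatProj H G R v)) = s z v.2.1 := by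
      rw [h1, map_add, map_add, h2, zero_add]; rfl
    have h4 : Q z (J z (flatProj H G R v)) = flatProj H G R (J z (v.1, 0)) := by
      simp only [Q, sub_apply, ContinuousLinearMap.comp_apply, h3, hlams z hz]
      rw [← map_sub, ← map_sub, h1, add_sub_cancel_right]
    rw [h4, flatProj_apply, hJH z hz.1 hz' v.1]
    rfl
  refine ⟨O', inter_subset_left, hO', ⟨hz₀, by
    change IsUnit (P z₀)
    rw [hPz₀]; exact isUnit_one⟩, fun β hβ hβc hβO βX hβX hβ0 => ?_⟩
  have hflat : ∀ z ∈ X, flatProj H G R z = z := fun z hz => by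
    rw [flatProj_apply, ← hX z hz]
  let β₁ : H × (G × R) → (H × (G × R)) [⋀^Fin k]→L[ℝ] ℂ :=
    fun z => (β z).compContinuousLinearMap (Q z)
  let β₂ : H × (G × R) → (H × (G × R)) [⋀^Fin k]→L[ℝ] ℂ :=
    fun z => (β₁ z).compContinuousLinearMap (J z)
  have hβ₁ : Continuous β₁ := continuous_form_comp_of_tsupport hO' hβ hβO hQ
  have hs₁ := support_form_comp_subset β Q
  have ht₁ : tsupport β₁ ⊆ tsupport β := closure_mono hs₁
  have hβ₂ : Continuous β₂ := continuous_form_comp_of_tsupport hO' hβ₁ (ht₁.trans hβO)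
    (hJ.mono inter_subset_left)
  have hs₂ := support_form_comp_subset β₁ J
  have ht₂ : tsupport β₂ ⊆ tsupport β := (closure_mono hs₂).trans ht₁
  let res : ∀ β : H × (G × R) → (H × (G × R)) [⋀^Fin k]→L[ℝ] ℂ, Continuous β →
      C(X, (H × (G × R)) [⋀^Fin k]→L[ℝ] ℂ) := fun β hβ =>
    ⟨fun z => β z, hβ.comp continuous_subtype_val⟩
  have hβ₀ : Continuous fun z => (β z).compContinuousLinearMap (flatProj H G R) :=
    continuous_form_comp_of_tsupport isOpen_univ hβ (subset_univ _) continuousOn_const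
  have hidem : ∀ v, flatProj H G R (flatProj H G R v) = flatProj H G R v := fun v => rfl
  -- `S β = S (Q^* β) = S (J^* Q^* β)`, and `J^* Q^* β` vanishes on `H × G`
  have e1 : S βX = S (res _ hβ₀) :=
    hS.apply_eq_proj hβ hβc (hβO.trans inter_subset_left) _ hidem hflat βX _ hβX fun _ _ => rfl
  have e2 : S (res β₁ hβ₁) = S (res _ hβ₀) := by
    refine hS.apply_eq_proj hβ₁ (hβc.mono hs₁) ((ht₁.trans hβO).trans inter_subset_left) _ hidem
      hflat _ _ (fun _ => rfl) fun z v => ?_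
    change β z (fun i => flatProj H G R (v i)) = β z (fun i => Q z (flatProj H G R (v i)))
    simp only [hQW]
  have e3 : S (res β₂ hβ₂) = S (res β₁ hβ₁) :=
    hJS β₁ hβ₁ (hβc.mono hs₁) ((ht₁.trans hβO).trans inter_subset_left) _ _ (fun _ => rfl)
      fun _ _ => rfl
  have e4 : S (res β₂ hβ₂) = 0 := by
    refine hS.apply_eq_zero hβ₂ (hβc.mono (hs₂.trans hs₁)) ((ht₂.trans hβO).trans inter_subset_left)
      _ hidem hflat _ (fun _ => rfl) fun z v => ?_
    change β z (fun i => Q z (J z (flatProj H G R (v i)))) = 0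
    by_cases hz : (z : H × (G × R)) ∈ O'
    · have h1 : (fun i => Q z (J z (flatProj H G R (v i)))) =
          fun i => ((Q z (J z (flatProj H G R (v i)))).1, 0) := by
        funext i
        exact Prod.ext rfl (hQJ z hz (hX z z.2) (v i))
      rw [h1]
      exact hβ0 z fun i => (Q z (J z (flatProj H G R (v i)))).1
    · have h1 : β z = 0 := image_eq_zero_of_notMem_tsupport fun h => hz (hβO h)
      rw [h1]; rfl
  rw [e1, ← e2, ← e3, e4]

end Invariance

/-! ### Functionals invariant under translations -/

section Translations

variable {V : Type*} [NormedAddCommGroup V] [NormedSpace ℝ V]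

/-- A functional that vanishes on the derivatives of functions in the direction `u` is invariant
under the translation by `u`, as long as the supports of the translates stay in `O`. -/
lemma apply_translate_eq {X : Set V} [CompactSpace X] {O : Set V} (Φ : C(X, ℂ) →L[ℂ] ℂ) (u : V)
    (hΦ : ∀ f : V → ℂ, ContDiff ℝ ∞ f → HasCompactSupport f → tsupport f ⊆ O → ∀ fX : C(X, ℂ),
      (∀ z, fX z = fderiv ℝ f z u) → Φ fX = 0)
    {f : V → ℂ} (hf : ContDiff ℝ ∞ f) (hfc : HasCompactSupport f)
    (hfO : ∀ t ∈ Icc (0 : ℝ) 1, tsupport (fun z => f (z - t • u)) ⊆ O) (fX gX : C(X, ℂ))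
    (hfX : ∀ z, fX z = f z) (hgX : ∀ z, gX z = f (z - u)) : Φ fX = Φ gX := by
  have hfd : Continuous (fderiv ℝ f) := hf.continuous_fderiv (by simp)
  -- by the fundamental theorem of calculus, `fX - gX` is the integral over `t ∈ [0,1]` of the
  -- derivatives `c t` in the direction `u` of the translates of `f`, which are annihilated by `Φ`
  let c : C(ℝ, C(X, ℂ)) := ContinuousMap.curry
    ⟨fun p : ℝ × X => fderiv ℝ f ((p.2 : V) - p.1 • u) u, by fun_prop⟩
  have hc : ∀ t z, c t z = fderiv ℝ f ((z : V) - t • u) u := fun t z => rfl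
  have h1 : ∀ t ∈ Icc (0 : ℝ) 1, Φ (c t) = 0 := by
    intro t ht
    refine hΦ (fun z => f (z - t • u)) (hf.comp (contDiff_id.sub contDiff_const)) ?_ (hfO t ht) _
      fun z => ?_
    · exact hfc.comp_homeomorph (Homeomorph.subRight (t • u))
    · rw [hc, fderiv_comp_sub]
  have hint : IntervalIntegrable c volume 0 1 := c.continuous.intervalIntegrable 0 1
  have h2 : ∫ t in (0 : ℝ)..1, c t = fX - gX := by
    ext z
    have h3 := (ContinuousMap.evalCLM ℂ z).intervalIntegral_comp_comm hint
    rw [ContinuousMap.evalCLM_apply] at h3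
    rw [← h3, ContinuousMap.sub_apply, hfX, hgX]
    have h4 : ∀ t ∈ uIcc (0 : ℝ) 1, HasDerivAt (fun t : ℝ => -f ((z : V) - t • u))
        (fderiv ℝ f ((z : V) - t • u) u) t := by
      intro t _
      have h5 : HasDerivAt (fun t : ℝ => (z : V) - t • u) (-u) t := by
        simpa using ((hasDerivAt_id t).smul_const u).const_sub (z : V)
      have h6 := ((hf.differentiable (by simp) _).hasFDerivAt.comp_hasDerivAt t h5).neg
      simp only [map_neg, neg_neg] at h6
      exact h6
    have h7 := intervalIntegral.integral_eq_sub_of_hasDerivAt h4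
      (by exact (Continuous.intervalIntegrable (by fun_prop) 0 1))
    simp only [ContinuousMap.evalCLM_apply, hc]
    rw [h7, one_smul, zero_smul, sub_zero]
    ring
  have h3 : Φ (∫ t in (0 : ℝ)..1, c t) = 0 := by
    rw [← Φ.intervalIntegral_comp_comm hint, intervalIntegral.integral_congr (g := fun _ => 0)]
    · simp
    · intro t ht
      rw [uIcc_of_le zero_le_one] at ht
      exact h1 t ht
  rw [h2, map_sub, sub_eq_zero] at h3
  exact h3

variable {H P : Type*} [NormedAddCommGroup H] [NormedSpace ℝ H] [FiniteDimensional ℝ H]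
  [MeasurableSpace H] [BorelSpace H] [NormedAddCommGroup P] [NormedSpace ℝ P]
  [FiniteDimensional ℝ P]

/-- A functional invariant under the translations by the vectors of `H` is the composition of the
integration along `H` and of a functional in the transverse direction: smooth case. -/
lemma apply_eq_apply_integral_of_contDiff (m : Measure H) [m.IsAddHaarMeasure] {X : Set (H × P)}
    [CompactSpace X] {h₀ : H} {p₀ : P} {ε : ℝ} (Φ : C(X, ℂ) →L[ℂ] ℂ)
    (hΦ : ∀ u : H, ∀ f : H × P → ℂ, ContDiff ℝ ∞ f → HasCompactSupport f →
      tsupport f ⊆ Metric.ball h₀ ε ×ˢ Metric.ball p₀ ε → ∀ fX : C(X, ℂ),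
      (∀ z, fX z = fderiv ℝ f z (u, 0)) → Φ fX = 0)
    {ρ : H → ℝ} (hρ : ContDiff ℝ ∞ ρ) (hρs : tsupport ρ ⊆ Metric.ball h₀ ε) (hρ1 : ∫ s, ρ s ∂m = 1)
    {f : H × P → ℂ} (hf : ContDiff ℝ ∞ f)
    (hfO : tsupport f ⊆ Metric.ball h₀ ε ×ˢ Metric.ball p₀ ε) (fX gX : C(X, ℂ))
    (hfX : ∀ z, fX z = f z)
    (hgX : ∀ z : X, gX z = ρ (z : H × P).1 * ∫ s, f (s, (z : H × P).2) ∂m) : Φ fX = Φ gX := by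
  have hfcont := hf.continuous
  have hρcont := hρ.continuous
  -- the integrals over `s` of `c₁ s` and `c₂ s` are `gX` and `fX`, and `c₂ s` is a translate of `c₁ s`
  let c₁ : C(H, C(X, ℂ)) := ContinuousMap.curry
    ⟨fun p : H × X => (ρ (p.2 : H × P).1 : ℂ) * f ((p.2 : H × P).1 + p.1, (p.2 : H × P).2),
      by fun_prop⟩
  have hc₁ : ∀ s (z : X), c₁ s z = (ρ (z : H × P).1 : ℂ) * f ((z : H × P).1 + s, (z : H × P).2) :=
    fun s z => rfl
  let c₂ : C(H, C(X, ℂ)) := ContinuousMap.curry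
    ⟨fun p : H × X => (ρ ((p.2 : H × P).1 - p.1) : ℂ) * f (p.2 : H × P), by fun_prop⟩
  have hc₂ : ∀ s (z : X), c₂ s z = (ρ ((z : H × P).1 - s) : ℂ) * f z := fun s z => rfl
  have hρ0 : ∀ x, x ∉ Metric.ball h₀ ε → ρ x = 0 := fun x hx =>
    image_eq_zero_of_notMem_tsupport fun h => hx (hρs h)
  have hf0 : ∀ z : H × P, z.1 ∉ Metric.ball h₀ ε → f z = 0 := fun z hz =>
    image_eq_zero_of_notMem_tsupport fun h => hz (hfO h).1
  have hsupp₁ : HasCompactSupport c₁ := by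
    refine HasCompactSupport.intro (isCompact_closedBall (0 : H) (2 * ε)) fun s hs => ?_
    ext z
    rw [hc₁, ContinuousMap.zero_apply]
    by_contra h
    obtain ⟨h1, h2⟩ := mul_ne_zero_iff.1 h
    have h1' : (z : H × P).1 ∈ Metric.ball h₀ ε := by
      by_contra h'; exact h1 (by rw [hρ0 _ h']; simp)
    have h2' : (z : H × P).1 + s ∈ Metric.ball h₀ ε := by
      by_contra h'; exact h2 (hf0 _ h')
    apply hs
    rw [mem_closedBall_zero_iff, show s = ((z : H × P).1 + s - h₀) - ((z : H × P).1 - h₀) by abel]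
    rw [mem_ball_iff_norm] at h1' h2'
    linarith [norm_sub_le ((z : H × P).1 + s - h₀) ((z : H × P).1 - h₀)]
  have hsupp₂ : HasCompactSupport c₂ := by
    refine HasCompactSupport.intro (isCompact_closedBall (0 : H) (2 * ε)) fun s hs => ?_
    ext z
    rw [hc₂, ContinuousMap.zero_apply]
    by_contra h
    obtain ⟨h1, h2⟩ := mul_ne_zero_iff.1 h
    have h1' : (z : H × P).1 - s ∈ Metric.ball h₀ ε := by
      by_contra h'; exact h1 (by rw [hρ0 _ h']; simp)
    have h2' : (z : H × P).1 ∈ Metric.ball h₀ ε := by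
      by_contra h'; exact h2 (hf0 _ h')
    apply hs
    rw [mem_closedBall_zero_iff, show s = ((z : H × P).1 - h₀) - ((z : H × P).1 - s - h₀) by abel]
    rw [mem_ball_iff_norm] at h1' h2'
    linarith [norm_sub_le ((z : H × P).1 - h₀) ((z : H × P).1 - s - h₀)]
  have hint₁ : Integrable c₁ m := c₁.continuous.integrable_of_hasCompactSupport hsupp₁
  have hint₂ : Integrable c₂ m := c₂.continuous.integrable_of_hasCompactSupport hsupp₂
  have hI₁ : ∫ s, c₁ s ∂m = gX := by
    ext z
    have h3 := (ContinuousMap.evalCLM ℂ z).integral_comp_comm hint₁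
    rw [ContinuousMap.evalCLM_apply] at h3
    rw [← h3, hgX]
    simp only [ContinuousMap.evalCLM_apply, hc₁]
    rw [integral_const_mul]
    congr 1
    exact integral_add_left_eq_self (μ := m) (fun s => f (s, (z : H × P).2)) (z : H × P).1
  have hI₂ : ∫ s, c₂ s ∂m = fX := by
    ext z
    have h3 := (ContinuousMap.evalCLM ℂ z).integral_comp_comm hint₂
    rw [ContinuousMap.evalCLM_apply] at h3
    rw [← h3, hfX]
    simp only [ContinuousMap.evalCLM_apply, hc₂]
    rw [integral_mul_const, integral_complex_ofReal,
      integral_sub_left_eq_self (μ := m) ρ (z : H × P).1, hρ1]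
    simp
  rw [← hI₁, ← hI₂, ← Φ.integral_comp_comm hint₁, ← Φ.integral_comp_comm hint₂]
  refine integral_congr_ae (Filter.Eventually.of_forall fun s => ?_)
  -- the two functions are translates of each other
  symm
  have hψ : ContDiff ℝ ∞ fun z : H × P => (ρ z.1 : ℂ) * f (z.1 + s, z.2) := by
    have : ContDiff ℝ ∞ fun x : ℝ => (x : ℂ) := Complex.ofRealCLM.contDiff
    fun_prop
  have hcl : ∀ t ∈ Icc (0 : ℝ) 1, tsupport (fun z : H × P => (ρ (z - t • ((s, 0) : H × P)).1 : ℂ) *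
      f ((z - t • ((s, 0) : H × P)).1 + s, (z - t • ((s, 0) : H × P)).2)) ⊆
      Metric.ball h₀ ε ×ˢ Metric.ball p₀ ε := by
    intro t ht
    have h1 : tsupport (fun z : H × P => (ρ (z - t • ((s, 0) : H × P)).1 : ℂ) *
      f ((z - t • ((s, 0) : H × P)).1 + s, (z - t • ((s, 0) : H × P)).2)) ⊆
      {z | z.1 - t • s ∈ tsupport ρ} ∩ {z | (z.1 - t • s + s, z.2) ∈ tsupport f} := by
      refine closure_minimal (fun z hz => ?_) (IsClosed.inter
        ((isClosed_tsupport ρ).preimage (by fun_prop))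
        ((isClosed_tsupport f).preimage (f := fun z : H × P => (z.1 - t • s + s, z.2))
          (by fun_prop)))
      obtain ⟨h1, h2⟩ := mul_ne_zero_iff.1 hz
      refine ⟨subset_closure fun h => h1 ?_, subset_closure fun h => h2 ?_⟩
      · simpa using h
      · simpa using h
    rintro z hz
    obtain ⟨h2, h3⟩ := h1 hz
    have h4 := hρs h2
    obtain ⟨h5, h6⟩ := hfO h3
    refine ⟨?_, h6⟩
    have h7 := (convex_ball h₀ ε) h4 h5 (sub_nonneg.2 ht.2) ht.1 (by ring)
    convert h7 using 1
    module
  refine apply_translate_eq Φ ((s, 0) : H × P) (hΦ s) hψ ?_ hcl (c₁ s) (c₂ s) (fun z => hc₁ s z)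
    fun z => ?_
  · refine (isCompact_closedBall (h₀ : H) ε |>.prod (isCompact_closedBall p₀ ε)).of_isClosed_subset
      (isClosed_tsupport _) ?_
    have := hcl 0 ⟨le_rfl, zero_le_one⟩
    simp only [zero_smul, sub_zero] at this
    exact this.trans (prod_mono Metric.ball_subset_closedBall Metric.ball_subset_closedBall)
  · rw [hc₂]; simp

end Translations

/-! ### Functionals on a product and their transverse parts -/

section TransverseFunctional

lemma eq_zero_of_norm_le_mul {x : ℂ} {C : ℝ} (h : ∀ ε > 0, ‖x‖ ≤ C * ε) : x = 0 := by
  rw [← norm_le_zero_iff]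
  refine ge_of_tendsto (x := 𝓝[>] (0 : ℝ)) (f := fun ε => C * ε) ?_
    (eventually_mem_nhdsWithin.mono h)
  have h3 : Filter.Tendsto (fun ε : ℝ => C * ε) (𝓝 0) (𝓝 (C * 0)) :=
    (continuous_const.mul continuous_id).tendsto 0
  rw [mul_zero] at h3
  exact h3.mono_left nhdsWithin_le_nhds

variable {H P : Type*} [NormedAddCommGroup H] [NormedSpace ℝ H] [FiniteDimensional ℝ H]
  [MeasurableSpace H] [BorelSpace H] [NormedAddCommGroup P] [NormedSpace ℝ P]
  [FiniteDimensional ℝ P]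

/-- A functional invariant under the translations by the vectors of `H` is the composition of the
integration along `H` and of a functional in the transverse direction. -/
lemma apply_eq_apply_integral (m : Measure H) [m.IsAddHaarMeasure] {X : Set (H × P)}
    [CompactSpace X] {h₀ : H} {p₀ : P} {ε : ℝ} (Φ : C(X, ℂ) →L[ℂ] ℂ)
    (hΦ : ∀ u : H, ∀ f : H × P → ℂ, ContDiff ℝ ∞ f → HasCompactSupport f →
      tsupport f ⊆ Metric.ball h₀ ε ×ˢ Metric.ball p₀ ε → ∀ fX : C(X, ℂ),
      (∀ z, fX z = fderiv ℝ f z (u, 0)) → Φ fX = 0)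
    {ρ : H → ℝ} (hρ : ContDiff ℝ ∞ ρ) (hρs : tsupport ρ ⊆ Metric.ball h₀ ε) (hρ1 : ∫ s, ρ s ∂m = 1)
    {f : H × P → ℂ} (hf : Continuous f)
    (hfO : tsupport f ⊆ Metric.ball h₀ ε ×ˢ Metric.ball p₀ ε) (fX uX ρX : C(X, ℂ))
    (hfX : ∀ z, fX z = f z) (hρX : ∀ z : X, ρX z = ρ (z : H × P).1)
    (huX : ∀ z : X, uX z = ∫ s, f (s, (z : H × P).2) ∂m) : Φ fX = Φ (ρX * uX) := by
  rw [← sub_eq_zero]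
  refine eq_zero_of_norm_le_mul (C := ‖Φ‖ * (1 + ‖ρX‖ * m.real (Metric.ball h₀ ε)))
    fun δ hδ => ?_
  obtain ⟨g, hg, hgf, hgs⟩ := hf.exists_contDiff_approx ⊤ (ε := fun _ => δ) continuous_const
    (fun _ => hδ)
  have hgO := (closure_mono hgs).trans hfO
  have hint : ∀ k : H × P → ℂ, Continuous k → tsupport k ⊆ Metric.ball h₀ ε ×ˢ Metric.ball p₀ ε →
      ∀ p, (∀ s, s ∉ Metric.ball h₀ ε → k (s, p) = 0) ∧ Integrable (fun s => k (s, p)) m := by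
    intro k hk hks p
    have h0 : ∀ s, s ∉ Metric.ball h₀ ε → k (s, p) = 0 := fun s hs =>
      image_eq_zero_of_notMem_tsupport fun h => hs (hks h).1
    refine ⟨h0, Continuous.integrable_of_hasCompactSupport (by fun_prop)
      (HasCompactSupport.intro (isCompact_closedBall h₀ ε) fun s hs => h0 s fun h => hs
        (Metric.ball_subset_closedBall h))⟩
  have hbd : ∀ p, ‖(∫ s, f (s, p) ∂m) - ∫ s, g (s, p) ∂m‖ ≤ δ * m.real (Metric.ball h₀ ε) := by
    intro p
    obtain ⟨hf0, hfi⟩ := hint f hf hfO p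
    obtain ⟨hg0, hgi⟩ := hint g hg.continuous hgO p
    rw [← integral_sub hfi hgi, ← setIntegral_eq_integral_of_forall_compl_eq_zero
      (s := Metric.ball h₀ ε) fun s hs => by rw [hf0 s hs, hg0 s hs, sub_zero]]
    refine norm_setIntegral_le_of_norm_le_const measure_ball_lt_top fun s _ => ?_
    rw [← dist_eq_norm, dist_comm]
    exact (hgf _).le
  let gX : C(X, ℂ) := ⟨fun z => g z, hg.continuous.comp continuous_subtype_val⟩
  have hvcont : Continuous fun p : P => ∫ s, g (s, p) ∂m :=
    continuous_parametric_integral_of_continuous (μ := m) (f := fun p s => g (s, p))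
      (s := Metric.closedBall h₀ ε) (by
        have := hg.continuous
        fun_prop) (isCompact_closedBall h₀ ε) |>.congr fun p =>
      setIntegral_eq_integral_of_forall_compl_eq_zero fun s hs =>
        (hint g hg.continuous hgO p).1 s fun h => hs (Metric.ball_subset_closedBall h)
  let vX : C(X, ℂ) := ⟨fun z => ∫ s, g (s, (z : H × P).2) ∂m,
    hvcont.comp (continuous_snd.comp continuous_subtype_val)⟩
  have h1 : Φ gX = Φ (ρX * vX) :=
    apply_eq_apply_integral_of_contDiff m Φ hΦ hρ hρs hρ1 hg hgO gX (ρX * vX) (fun _ => rfl)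
      fun z => by rw [ContinuousMap.mul_apply, hρX]; rfl
  have h2 : Φ fX - Φ (ρX * uX) = Φ ((fX - gX) - ρX * (uX - vX)) := by
    rw [mul_sub, map_sub, map_sub, map_sub, h1]; ring
  rw [h2, mul_assoc]
  refine (Φ.le_opNorm _).trans (mul_le_mul_of_nonneg_left ?_ (norm_nonneg _))
  refine (norm_sub_le _ _).trans ?_
  rw [add_mul, one_mul]
  refine add_le_add ((ContinuousMap.norm_le _ hδ.le).2 fun z => ?_) ((norm_mul_le _ _).trans ?_)
  · rw [ContinuousMap.sub_apply, hfX, ← dist_eq_norm, dist_comm]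
    exact (hgf z).le
  · rw [mul_assoc, mul_comm (m.real _)]
    refine mul_le_mul_of_nonneg_left ((ContinuousMap.norm_le _ (by positivity)).2 fun z => ?_)
      (norm_nonneg _)
    rw [ContinuousMap.sub_apply, huX]
    exact hbd _

end TransverseFunctional

section FlatTheorem

variable {k : ℕ} {G R : Type*}
  [NormedAddCommGroup G] [NormedSpace ℝ G] [FiniteDimensional ℝ G]
  [NormedAddCommGroup R] [NormedSpace ℝ R] [FiniteDimensional ℝ R]

/-- The vectors of the standard frame of `ℝᵏ`, in `ℝᵏ × P`. -/
def flatFrame (k : ℕ) (P : Type*) [NormedAddCommGroup P] (i : Fin k) :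
    EuclideanSpace ℝ (Fin k) × P := (EuclideanSpace.single i 1, 0)

/-- The volume form of `ℝᵏ`, as a form on `ℝᵏ × P`. -/
def flatVolume (k : ℕ) (P : Type*) [NormedAddCommGroup P] [NormedSpace ℝ P] :
    (EuclideanSpace ℝ (Fin k) × P) [⋀^Fin k]→L[ℝ] ℂ :=
  { (Complex.ofRealCLM.toLinearMap.compAlternatingMap
      ((EuclideanSpace.basisFun (Fin k) ℝ).toBasis.det.compLinearMap
        (LinearMap.fst ℝ (EuclideanSpace ℝ (Fin k)) P))) with
    cont := by
      refine Complex.continuous_ofReal.comp (Continuous.matrix_det ?_)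
      refine continuous_matrix fun i j => ?_
      change Continuous fun v : Fin k → EuclideanSpace ℝ (Fin k) × P => (v j).1 i
      fun_prop }

lemma flatVolume_apply (P : Type*) [NormedAddCommGroup P] [NormedSpace ℝ P]
    (v : Fin k → EuclideanSpace ℝ (Fin k) × P) : flatVolume k P v =
      ((EuclideanSpace.basisFun (Fin k) ℝ).toBasis.det fun i => (v i).1 : ℝ) := rfl

lemma flatVolume_frame (P : Type*) [NormedAddCommGroup P] [NormedSpace ℝ P] :
    flatVolume k P (flatFrame k P) = 1 := by
  have h : (fun i => (flatFrame k P i).1) = (EuclideanSpace.basisFun (Fin k) ℝ).toBasis := by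
    funext i; simp [flatFrame]
  rw [flatVolume_apply, h, Basis.det_self, Complex.ofReal_one]

/-- A form of degree `k` vanishes on `ℝᵏ` if it vanishes on the standard frame. -/
lemma apply_eq_zero_of_apply_flatFrame {P : Type*} [NormedAddCommGroup P] [NormedSpace ℝ P]
    (α : (EuclideanSpace ℝ (Fin k) × P) [⋀^Fin k]→L[ℝ] ℂ) (h : α (flatFrame k P) = 0)
    (v : Fin k → EuclideanSpace ℝ (Fin k)) : α (fun i => (v i, 0)) = 0 := by
  let f := α.toAlternatingMap.compLinearMap (LinearMap.inl ℝ (EuclideanSpace ℝ (Fin k)) P)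
  have hf : f = 0 := by
    refine Basis.ext_alternating (EuclideanSpace.basisFun (Fin k) ℝ).toBasis fun w hw => ?_
    have hw' := Finite.injective_iff_bijective.1 hw
    have h1 := f.map_perm (fun i => (EuclideanSpace.basisFun (Fin k) ℝ).toBasis i)
      (Equiv.ofBijective w hw')
    have h2 : f (fun i => (EuclideanSpace.basisFun (Fin k) ℝ).toBasis i) = 0 := by
      have h3 : (fun i => LinearMap.inl ℝ (EuclideanSpace ℝ (Fin k)) P
          ((EuclideanSpace.basisFun (Fin k) ℝ).toBasis i)) = flatFrame k P := by
        funext i; simp [flatFrame]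
      exact (congrArg α h3).trans h
    rw [h2, smul_zero] at h1
    exact h1
  exact congrArg (fun g => g v) hf

/-- The differential of `f ι_{eᵢ} vol` is `∂ᵢ f vol` on the frame `e`. -/
lemma sum_fderiv_curryLeft_flatVolume {m : ℕ} {P : Type*} [NormedAddCommGroup P] [NormedSpace ℝ P]
    (ℓ : EuclideanSpace ℝ (Fin (m + 1)) × P →L[ℝ] ℂ) (i : Fin (m + 1)) :
    ∑ j : Fin (m + 1), (-1 : ℂ) ^ (j : ℕ) * (ℓ (flatFrame (m + 1) P j) *
      (flatVolume (m + 1) P).curryLeft (flatFrame (m + 1) P i)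
        (j.removeNth (flatFrame (m + 1) P))) = ℓ (flatFrame (m + 1) P i) := by
  set e := flatFrame (m + 1) P
  set α := flatVolume (m + 1) P
  rw [Finset.sum_eq_single i]
  · have h2 := α.toAlternatingMap.neg_one_pow_smul_map_insertNth i (e i) (i.removeNth e)
    rw [Fin.insertNth_self_removeNth] at h2
    have h4 : α.curryLeft (e i) (i.removeNth e) = (-1 : ℤ) ^ (i : ℕ) • α e := h2.symm
    have h6 : α e = 1 := flatVolume_frame P
    rw [h4, h6]
    simp only [zsmul_eq_mul, Int.cast_pow, Int.cast_neg, Int.cast_one]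
    have h5 : (-1 : ℂ) ^ (i : ℕ) * (-1 : ℂ) ^ (i : ℕ) = 1 := by
      rw [← mul_pow]; simp
    linear_combination ℓ (e i) * h5
  · intro j _ hj
    obtain ⟨l, hl⟩ := Fin.exists_succAbove_eq hj.symm
    have h1 : α.curryLeft (e i) (j.removeNth e) = 0 := by
      refine α.toAlternatingMap.map_eq_zero_of_eq (Matrix.vecCons (e i) (j.removeNth e))
        (i := 0) (j := l.succ) ?_ (Fin.succ_ne_zero l).symm
      simp [Fin.removeNth, hl]
    rw [h1]; simp
  · simp

/-- **Closed functionals invariant under an almost complex structure.** With the hypotheses of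
`IsClosedFunctional.exists_isOpen_apply_eq_zero`, where `H = ℝᵏ`, the functional `S` only depends,
locally, on the integrals of forms over the leaves `ℝᵏ × {g} × {0}`. -/
theorem IsClosedFunctional.exists_transverse {X : Set (EuclideanSpace ℝ (Fin k) × (G × R))}
    [CompactSpace X] (hX : ∀ z ∈ X, z.2.2 = 0) {O : Set (EuclideanSpace ℝ (Fin k) × (G × R))}
    (hO : IsOpen O)
    {S : C(X, (EuclideanSpace ℝ (Fin k) × (G × R)) [⋀^Fin k]→L[ℝ] ℂ) →L[ℂ] ℂ}
    (hS : IsClosedFunctional O S)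
    (J : EuclideanSpace ℝ (Fin k) × (G × R) →
      (EuclideanSpace ℝ (Fin k) × (G × R) →L[ℝ] EuclideanSpace ℝ (Fin k) × (G × R)))
    (hJ : ContinuousOn J O)
    (hJS : ∀ β : EuclideanSpace ℝ (Fin k) × (G × R) →
      (EuclideanSpace ℝ (Fin k) × (G × R)) [⋀^Fin k]→L[ℝ] ℂ, Continuous β →
      HasCompactSupport β → tsupport β ⊆ O →
      ∀ βX βX' : C(X, (EuclideanSpace ℝ (Fin k) × (G × R)) [⋀^Fin k]→L[ℝ] ℂ),
      (∀ z, βX z = β z) → (∀ z v, βX' z v = β z (fun i => J z (v i))) → S βX' = S βX)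
    (hJH : ∀ z ∈ O, z.2.2 = 0 → ∀ h : EuclideanSpace ℝ (Fin k), (J z (h, 0)).2 = 0)
    (hJW : ∀ z ∈ O, z.2.2 = 0 → ∀ w : EuclideanSpace ℝ (Fin k) × (G × R), w.2.2 = 0 →
      (J z w).2.2 = 0 → w.2 = 0)
    {z₀ : EuclideanSpace ℝ (Fin k) × (G × R)} (hz₀ : z₀ ∈ O) (hz₀' : z₀.2.2 = 0) :
    ∃ ε > 0, Metric.ball z₀.1 ε ×ˢ Metric.ball z₀.2 ε ⊆ O ∧ ∃ σ : C(X, ℂ) →L[ℂ] ℂ,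
      ∀ β : EuclideanSpace ℝ (Fin k) × (G × R) →
        (EuclideanSpace ℝ (Fin k) × (G × R)) [⋀^Fin k]→L[ℝ] ℂ,
      Continuous β → tsupport β ⊆ Metric.ball z₀.1 ε ×ˢ Metric.ball z₀.2 ε →
      ∀ (βX : C(X, (EuclideanSpace ℝ (Fin k) × (G × R)) [⋀^Fin k]→L[ℝ] ℂ)) (uX : C(X, ℂ)),
      (∀ z, βX z = β z) →
      (∀ z : X, uX z = ∫ s, β (s, (z : EuclideanSpace ℝ (Fin k) × (G × R)).2)
        (flatFrame k (G × R))) → S βX = σ uX := by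
  obtain ⟨O', hO'O, hO', hz₀O', hvan⟩ :=
    hS.exists_isOpen_apply_eq_zero hX hO J hJ hJS hJH hJW hz₀ hz₀'
  obtain ⟨ε, hε, hεO⟩ := Metric.isOpen_iff.1 hO' z₀ hz₀O'
  have hbox : Metric.ball z₀.1 ε ×ˢ Metric.ball z₀.2 ε ⊆ O' := by
    rw [ball_prod_same]; exact hεO
  have hcomp : ∀ {Y : Type _} [Zero Y] (f : EuclideanSpace ℝ (Fin k) × (G × R) → Y),
      tsupport f ⊆ Metric.ball z₀.1 ε ×ˢ Metric.ball z₀.2 ε → HasCompactSupport f := by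
    intro Y _ f hf
    refine ((isCompact_closedBall z₀.1 ε).prod (isCompact_closedBall z₀.2 ε)).of_isClosed_subset
      (isClosed_tsupport _) (hf.trans
      (prod_mono Metric.ball_subset_closedBall Metric.ball_subset_closedBall))
  let e := flatFrame k (G × R)
  let vol := flatVolume k (G × R)
  let μ : C(X, ℂ) →L[ℂ] ℂ := scalarFunctional S vol
  -- `S β` only depends on the values of `β` on the frame
  have hμ : ∀ β : EuclideanSpace ℝ (Fin k) × (G × R) →
      (EuclideanSpace ℝ (Fin k) × (G × R)) [⋀^Fin k]→L[ℝ] ℂ, Continuous β →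
      tsupport β ⊆ Metric.ball z₀.1 ε ×ˢ Metric.ball z₀.2 ε →
      ∀ (βX : C(X, (EuclideanSpace ℝ (Fin k) × (G × R)) [⋀^Fin k]→L[ℝ] ℂ)) (fX : C(X, ℂ)),
      (∀ z, βX z = β z) → (∀ z : X, fX z = β z e) → S βX = μ fX := by
    intro β hβ hβs βX fX hβX hfX
    have hcont : Continuous fun z => β z - (β z e) • vol :=
      hβ.sub (((evalForm e).continuous.comp hβ).smul continuous_const)
    have hsupp : tsupport (fun z => β z - (β z e) • vol) ⊆ tsupport β := by
      refine closure_mono fun z hz h => hz ?_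
      change β z - (β z e) • vol = 0
      rw [h]
      apply ContinuousAlternatingMap.ext
      intro v
      change (0 : ℂ) - 0 * vol v = 0
      ring
    have h1 := hvan _ hcont (hcomp _ (hsupp.trans hβs)) ((hsupp.trans hβs).trans hbox)
      (βX - smulForm vol fX) (fun z => by
        rw [ContinuousMap.sub_apply, hβX]
        congr 1
        change fX z • vol = _
        rw [hfX]) fun z v => apply_eq_zero_of_apply_flatFrame _ (by
          change β z e - β z e * vol e = 0
          rw [show vol e = 1 from flatVolume_frame _]; ring) v
    rw [map_sub, sub_eq_zero] at h1
    exact h1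
  -- this functional vanishes on the derivatives in the directions of the leaves
  have hder : ∀ u : EuclideanSpace ℝ (Fin k), ∀ f : EuclideanSpace ℝ (Fin k) × (G × R) → ℂ,
      ContDiff ℝ ∞ f → HasCompactSupport f →
      tsupport f ⊆ Metric.ball z₀.1 ε ×ˢ Metric.ball z₀.2 ε → ∀ fX : C(X, ℂ),
      (∀ z, fX z = fderiv ℝ f z (u, 0)) → μ fX = 0 := by
    intro u f hf hfc hfs fX hfX
    have hfd : Continuous (fderiv ℝ f) := hf.continuous_fderiv (by simp)
    let dX : Fin k → C(X, ℂ) := fun i => ⟨fun z => fderiv ℝ f z (e i), by fun_prop⟩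
    have hsum : fX = ∑ i, (u i : ℂ) • dX i := by
      ext z
      rw [hfX, ContinuousMap.sum_apply]
      have h1 : ((u, 0) : EuclideanSpace ℝ (Fin k) × (G × R)) = ∑ i, u i • e i := by
        have h2 : u = ∑ i, u i • EuclideanSpace.single i (1 : ℝ) := by
          simpa using ((EuclideanSpace.basisFun (Fin k) ℝ).sum_repr u).symm
        apply Prod.ext
        · rw [Prod.fst_sum]
          conv_lhs => rw [h2]
          rfl
        · rw [Prod.snd_sum]
          simp [e, flatFrame]
      rw [h1, map_sum]
      refine Finset.sum_congr rfl fun i _ => ?_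
      rw [map_smul, Complex.real_smul]; rfl
    rw [hsum, map_sum]
    refine Finset.sum_eq_zero fun i _ => ?_
    rw [map_smul]
    refine smul_eq_zero_of_right _ ?_
    rcases k with - | m
    · exact i.elim0
    let θ := vol.curryLeft (e i)
    let β : EuclideanSpace ℝ (Fin (m + 1)) × (G × R) →
        (EuclideanSpace ℝ (Fin (m + 1)) × (G × R)) [⋀^Fin (m + 1)]→L[ℝ] ℂ :=
      fun z => ContinuousAlternatingMap.alternatizeUncurryFin ((fderiv ℝ f z).smulRight θ)
    have hβapply : ∀ z v, β z v = ∑ j : Fin (m + 1), (-1 : ℂ) ^ (j : ℕ) *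
        (fderiv ℝ f z (v j) * θ (j.removeNth v)) := by
      intro z v
      simp only [β, ContinuousAlternatingMap.alternatizeUncurryFin_apply]
      refine Finset.sum_congr rfl fun j _ => ?_
      change (-1 : ℤ) ^ (j : ℕ) • (fderiv ℝ f z (v j) * θ (j.removeNth v)) = _
      simp
    have hβ : Continuous β := by
      rw [← continuousOn_univ, continuousOn_form_iff]
      intro v
      simp only [hβapply]
      rw [continuousOn_univ]
      fun_prop
    have hβs : tsupport β ⊆ tsupport f := by
      have h1 : tsupport β ⊆ tsupport (fderiv ℝ f) := by
        refine closure_mono fun z hz h => hz ?_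
        ext v
        rw [hβapply, h]
        simp
      exact h1.trans (tsupport_fderiv_subset ℝ)
    let βX : C(X, (EuclideanSpace ℝ (Fin (m + 1)) × (G × R)) [⋀^Fin (m + 1)]→L[ℝ] ℂ) :=
      ⟨fun z => β z, hβ.comp continuous_subtype_val⟩
    have h1 : S βX = 0 := hS m rfl f hf hfc ((hfs.trans hbox).trans hO'O) θ βX fun z v =>
      hβapply z v
    rw [← h1]
    refine (hμ β hβ (hβs.trans hfs) βX (dX i) (fun _ => rfl) fun z => ?_).symm
    rw [hβapply]
    exact (sum_fderiv_curryLeft_flatVolume (fderiv ℝ f z) i).symm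
  -- the transverse functional is `σ u = μ (ρ u)`, with `ρ` a bump function along the leaves of
  -- integral `1`
  let b : ContDiffBump z₀.1 := ⟨ε / 4, ε / 2, by positivity, by linarith⟩
  let ρ : EuclideanSpace ℝ (Fin k) → ℝ := b.normed volume
  have hρ : ContDiff ℝ ∞ ρ := b.contDiff_normed
  have hρs : tsupport ρ ⊆ Metric.ball z₀.1 ε := by
    rw [b.tsupport_normed_eq]
    exact Metric.closedBall_subset_ball (by change ε / 2 < ε; linarith)
  let ρX : C(X, ℂ) := ⟨fun z => (ρ (z : EuclideanSpace ℝ (Fin k) × (G × R)).1 : ℂ), by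
    have := hρ.continuous
    fun_prop⟩
  refine ⟨ε, hε, hbox.trans hO'O, μ.comp (ContinuousLinearMap.mul ℂ C(X, ℂ) ρX),
    fun β hβ hβs βX uX hβX huX => ?_⟩
  have hβe : Continuous fun z => β z e := (evalForm e).continuous.comp hβ
  let fX : C(X, ℂ) := ⟨fun z => β z e, hβe.comp continuous_subtype_val⟩
  have hes : tsupport (fun z => β z e) ⊆ tsupport β := by
    refine closure_mono fun z hz h => hz ?_
    change β z e = 0
    rw [h]; rfl
  rw [hμ β hβ hβs βX fX hβX fun _ => rfl]
  exact apply_eq_apply_integral volume μ hder hρ hρs (b.integral_normed) hβe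
    (hes.trans hβs) fX uX ρX (fun _ => rfl) (fun _ => rfl) huX

end FlatTheorem

/-! ### Flow boxes -/

section PartialDiffeo

variable {V W Z : Type*} [NormedAddCommGroup V] [NormedSpace ℝ V]
  [NormedAddCommGroup W] [NormedSpace ℝ W] [NormedAddCommGroup Z] [NormedSpace ℝ Z]

/-- The open partial homeomorphism `Θ` between normed spaces is a `C^1` diffeomorphism. -/
structure OpenPartialHomeomorph.IsC1 (Θ : OpenPartialHomeomorph V W) : Prop where
  contDiffOn : ContDiffOn ℝ 1 Θ Θ.source
  contDiffOn_symm : ContDiffOn ℝ 1 Θ.symm Θ.target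

namespace OpenPartialHomeomorph.IsC1

variable {Θ : OpenPartialHomeomorph V W}

lemma symm (h : Θ.IsC1) : Θ.symm.IsC1 := ⟨h.contDiffOn_symm, by simpa using h.contDiffOn⟩

lemma trans {Ψ : OpenPartialHomeomorph W Z} (h : Θ.IsC1) (h' : Ψ.IsC1) : (Θ.trans Ψ).IsC1 := by
  refine ⟨?_, ?_⟩
  · rw [OpenPartialHomeomorph.coe_trans]
    exact h'.contDiffOn.comp (h.contDiffOn.mono fun x hx => hx.1) fun x hx => hx.2
  · rw [OpenPartialHomeomorph.coe_trans_symm]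
    refine h.contDiffOn_symm.comp (h'.contDiffOn_symm.mono fun x hx => hx.1) fun x hx => hx.2

lemma restrOpen (h : Θ.IsC1) {s : Set V} (hs : IsOpen s) : (Θ.restrOpen s hs).IsC1 := by
  refine ⟨h.contDiffOn.mono inter_subset_left, h.contDiffOn_symm.mono fun x hx => ?_⟩
  have h1 := hx.1
  simpa using h1

lemma prod_refl (h : Θ.IsC1) : (Θ.prod (OpenPartialHomeomorph.refl Z)).IsC1 := by
  refine ⟨?_, ?_⟩
  · exact (h.contDiffOn.comp contDiffOn_fst fun x hx => hx.1).prodMk contDiffOn_snd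
  · exact (h.contDiffOn_symm.comp contDiffOn_fst fun x hx => hx.1).prodMk contDiffOn_snd

lemma _root_.ContinuousLinearEquiv.isC1 (A : V ≃L[ℝ] W) :
    A.toHomeomorph.toOpenPartialHomeomorph.IsC1 :=
  ⟨A.contDiff.contDiffOn, A.symm.contDiff.contDiffOn⟩

lemma differentiableAt (h : Θ.IsC1) {y : V} (hy : y ∈ Θ.source) : DifferentiableAt ℝ Θ y :=
  (h.contDiffOn.contDiffAt (Θ.open_source.mem_nhds hy)).differentiableAt one_ne_zero

lemma fderiv_symm_fderiv (h : Θ.IsC1) {y : V} (hy : y ∈ Θ.source) (v : V) :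
    fderiv ℝ Θ.symm (Θ y) (fderiv ℝ Θ y v) = v := by
  have h1 : HasFDerivAt (Θ.symm ∘ Θ) ((fderiv ℝ Θ.symm (Θ y)).comp (fderiv ℝ Θ y)) y :=
    (h.symm.differentiableAt (Θ.map_source hy)).hasFDerivAt.comp y
      (h.differentiableAt hy).hasFDerivAt
  have h2 : HasFDerivAt (Θ.symm ∘ Θ) (ContinuousLinearMap.id ℝ V) y :=
    (hasFDerivAt_id y).congr_of_eventuallyEq (by
      filter_upwards [Θ.open_source.mem_nhds hy] with z hz using Θ.left_inv hz)
  exact congrArg (fun f : V →L[ℝ] V => f v) (h1.unique h2)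

lemma fderiv_fderiv_symm (h : Θ.IsC1) {z : W} (hz : z ∈ Θ.target) (w : W) :
    fderiv ℝ Θ (Θ.symm z) (fderiv ℝ Θ.symm z w) = w := by
  have := h.symm.fderiv_symm_fderiv (y := z) hz w
  simpa using this

lemma fderiv_injective (h : Θ.IsC1) {y : V} (hy : y ∈ Θ.source) :
    Function.Injective (fderiv ℝ Θ y) := fun v w hvw => by
  rw [← h.fderiv_symm_fderiv hy v, hvw, h.fderiv_symm_fderiv hy w]

end OpenPartialHomeomorph.IsC1

variable {M : Type*} [TopologicalSpace M] [ChartedSpace V M] [IsManifold 𝓘(ℝ, V) 1 M]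

lemma isC1_of_mem_maximalAtlas {e₁ e₂ : OpenPartialHomeomorph M V}
    (h₁ : e₁ ∈ IsManifold.maximalAtlas 𝓘(ℝ, V) 1 M)
    (h₂ : e₂ ∈ IsManifold.maximalAtlas 𝓘(ℝ, V) 1 M) : (e₁.symm.trans e₂).IsC1 := by
  have key : ∀ e₁ e₂ : OpenPartialHomeomorph M V, e₁ ∈ IsManifold.maximalAtlas 𝓘(ℝ, V) 1 M →
      e₂ ∈ IsManifold.maximalAtlas 𝓘(ℝ, V) 1 M →
      ContDiffOn ℝ 1 (e₁.symm.trans e₂) (e₁.symm.trans e₂).source := fun e₁ e₂ h₁ h₂ => by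
    rw [← contMDiffOn_iff_contDiffOn, OpenPartialHomeomorph.coe_trans]
    exact (contMDiffOn_of_mem_maximalAtlas h₂).comp
      ((contMDiffOn_symm_of_mem_maximalAtlas h₁).mono fun x hx => hx.1) fun x hx => hx.2
  refine ⟨key _ _ h₁ h₂, ?_⟩
  have := key _ _ h₂ h₁
  simpa [OpenPartialHomeomorph.trans_symm_eq_symm_trans_symm] using this

lemma mdifferentiable_of_mem_maximalAtlas {d : OpenPartialHomeomorph M V}
    (h : d ∈ IsManifold.maximalAtlas 𝓘(ℝ, V) 1 M) : d.MDifferentiable 𝓘(ℝ, V) 𝓘(ℝ, V) :=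
  ⟨(contMDiffOn_of_mem_maximalAtlas h).mdifferentiableOn one_ne_zero,
    (contMDiffOn_symm_of_mem_maximalAtlas h).mdifferentiableOn one_ne_zero⟩

end PartialDiffeo

section FlowBox

variable {E : Type*} [NormedAddCommGroup E] [NormedSpace ℝ E]
  {M : Type*} [TopologicalSpace M] [ChartedSpace E M] [IsManifold 𝓘(ℝ, E) ∞ M]
  {E' : Type*} [NormedAddCommGroup E'] [NormedSpace ℝ E']
  {N : Type*} [TopologicalSpace N] [ChartedSpace E' N] [IsManifold 𝓘(ℝ, E') 1 N]
  {G : Type*} [NormedAddCommGroup G] [NormedSpace ℝ G]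
  {γ : Type*} [TopologicalSpace γ] [ChartedSpace G γ] [IsManifold 𝓘(ℝ, G) 1 γ]
  {H R : Type*} [NormedAddCommGroup H] [NormedSpace ℝ H] [NormedAddCommGroup R] [NormedSpace ℝ R]

variable (E') in
/-- A flow box of the foliation of `ι(N)` by the fibres of `F`, in the preferred chart at `x₀`: a
`C^1` change of coordinates `Θ` to a product `H × (G × R)` in which `ι(N)` is `H × G × {0}` and
`F`, read in the chart `c` of `γ`, is the projection to `G`. -/
structure IsFlowBox (ι : N → M) (F : N → γ) (x₀ : M) (Θ : OpenPartialHomeomorph E (H × (G × R)))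
    (c : OpenPartialHomeomorph γ G) : Prop where
  isC1 : Θ.IsC1
  source_subset : Θ.source ⊆ (extChartAt 𝓘(ℝ, E) x₀).target
  exists_eq : ∀ y ∈ Θ.source, (Θ y).2.2 = 0 → ∃ n, ι n = (extChartAt 𝓘(ℝ, E) x₀).symm y
  map_eq : ∀ n, ι n ∈ (extChartAt 𝓘(ℝ, E) x₀).source →
    extChartAt 𝓘(ℝ, E) x₀ (ι n) ∈ Θ.source →
    F n ∈ c.source ∧ (Θ (extChartAt 𝓘(ℝ, E) x₀ (ι n))).2 = (c (F n), 0)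
  mem_tangentOf : ∀ n, ι n ∈ (extChartAt 𝓘(ℝ, E) x₀).source →
    extChartAt 𝓘(ℝ, E) x₀ (ι n) ∈ Θ.source → ∀ v : E, v ∈ tangentOf E E' ι n ↔
      (fderiv ℝ Θ (extChartAt 𝓘(ℝ, E) x₀ (ι n)) (dChart x₀ (ι n) v)).2.2 = 0
  mem_leafTangent : ∀ n, ι n ∈ (extChartAt 𝓘(ℝ, E) x₀).source →
    extChartAt 𝓘(ℝ, E) x₀ (ι n) ∈ Θ.source → ∀ v : E, v ∈ leafTangent E E' G ι F n ↔
      (fderiv ℝ Θ (extChartAt 𝓘(ℝ, E) x₀ (ι n)) (dChart x₀ (ι n) v)).2 = 0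

namespace IsFlowBox

variable {ι : N → M} {F : N → γ} {x₀ : M} {Θ : OpenPartialHomeomorph E (H × (G × R))}
  {c : OpenPartialHomeomorph γ G}

lemma restrOpen (h : IsFlowBox E' ι F x₀ Θ c) {s : Set E} (hs : IsOpen s) :
    IsFlowBox E' ι F x₀ (Θ.restrOpen s hs) c where
  isC1 := h.isC1.restrOpen hs
  source_subset := inter_subset_left.trans h.source_subset
  exists_eq y hy := h.exists_eq y hy.1
  map_eq n hn hn' := h.map_eq n hn hn'.1
  mem_tangentOf n hn hn' := h.mem_tangentOf n hn hn'.1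
  mem_leafTangent n hn hn' := h.mem_leafTangent n hn hn'.1

lemma linearChange {H' : Type*} [NormedAddCommGroup H'] [NormedSpace ℝ H']
    (h : IsFlowBox E' ι F x₀ Θ c) (A : H ≃L[ℝ] H') :
    IsFlowBox E' ι F x₀ (Θ.transHomeomorph
      (A.prodCongr (ContinuousLinearEquiv.refl ℝ (G × R))).toHomeomorph) c := by
  have hd : ∀ y ∈ Θ.source, ∀ v, (fderiv ℝ (Θ.transHomeomorph
      (A.prodCongr (ContinuousLinearEquiv.refl ℝ (G × R))).toHomeomorph) y v).2 =
      (fderiv ℝ Θ y v).2 := fun y hy v => by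
    have h1 : HasFDerivAt (Θ.transHomeomorph
        (A.prodCongr (ContinuousLinearEquiv.refl ℝ (G × R))).toHomeomorph)
        ((A.prodCongr (ContinuousLinearEquiv.refl ℝ (G × R))).toContinuousLinearMap.comp
          (fderiv ℝ Θ y)) y :=
      ((A.prodCongr (ContinuousLinearEquiv.refl ℝ (G × R))).toContinuousLinearMap.hasFDerivAt
        (x := Θ y)).comp y (h.isC1.differentiableAt hy).hasFDerivAt
    rw [h1.fderiv]; rfl
  refine ⟨?_, h.source_subset, fun y hy hy' => h.exists_eq y hy hy',
    fun n hn hn' => h.map_eq n hn hn', fun n hn hn' v => ?_, fun n hn hn' v => ?_⟩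
  · rw [OpenPartialHomeomorph.transHomeomorph_eq_trans]
    exact h.isC1.trans (ContinuousLinearEquiv.isC1 _)
  · rw [hd _ hn' _]; exact h.mem_tangentOf n hn hn' v
  · rw [hd _ hn' _]; exact h.mem_leafTangent n hn hn' v

end IsFlowBox

/-- Flow boxes exist: the chart of the target of an immersion, in which `ι` is an inclusion, is
combined with the chart of the source of a submersion, in which `F` is a projection. -/
theorem exists_isFlowBox {ι : N → M} {F : N → γ} {x : N} (hι : IsEmbedding ι)
    (h₁ : Manifold.IsImmersionAtOfComplement R 𝓘(ℝ, E') 𝓘(ℝ, E) 1 ι x)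
    (h₂ : Manifold.IsSubmersionAtOfComplement H 𝓘(ℝ, E') 𝓘(ℝ, G) 1 F x) :
    ∃ (Θ : OpenPartialHomeomorph E (H × (G × R))) (c : OpenPartialHomeomorph γ G),
      IsFlowBox E' ι F (ι x) Θ c ∧ c ∈ IsManifold.maximalAtlas 𝓘(ℝ, G) 1 γ ∧
      extChartAt 𝓘(ℝ, E) (ι x) (ι x) ∈ Θ.source := by
  have := isManifold_one_of_infty (E := E) (M := M)
  obtain ⟨U, hU, hUd⟩ := hι.isOpen_iff.1 h₁.domChart.open_source
  set e := chartAt E (ι x) with he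
  set b := h₁.codChart
  set d₁ := h₁.domChart
  set d₂ := h₂.domChart
  set c := h₂.codChart
  let A : (E' × R) ≃L[ℝ] (H × (G × R)) :=
    ((h₂.equiv.trans (ContinuousLinearEquiv.prodComm ℝ G H)).prodCongr
      (ContinuousLinearEquiv.refl ℝ R)).trans (ContinuousLinearEquiv.prodAssoc ℝ H G R)
  -- `Θ` is the chart of `E` in which `ι` is linear, followed by the change between the charts of `N`
  -- in which `ι` and `F` are linear
  let Θ : OpenPartialHomeomorph E (H × (G × R)) :=
    ((((e.symm.trans b).restrOpen (e.target ∩ e.symm ⁻¹' U)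
      (e.isOpen_inter_preimage_symm hU)).trans h₁.equiv.symm.toHomeomorph.toOpenPartialHomeomorph).trans
      ((d₁.symm.trans d₂).prod (OpenPartialHomeomorph.refl R))).trans
      A.toHomeomorph.toOpenPartialHomeomorph
  have hw₁ : ∀ n ∈ d₁.source, b (ι n) = h₁.equiv (d₁ n, 0) := fun n hn => by
    have := h₁.writtenInCharts
      (show d₁ n ∈ (d₁.extend 𝓘(ℝ, E')).target by simpa using d₁.map_source hn)
    simpa [hn, d₁, b] using this
  have hw₂ : ∀ n ∈ d₂.source, c (F n) = (h₂.equiv (d₂ n)).1 := fun n hn => by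
    have := h₂.writtenInCharts
      (show d₂ n ∈ (d₂.extend 𝓘(ℝ, E')).target by simpa using d₂.map_source hn)
    simpa [hn, d₂, c] using this
  have hΘ : ∀ y, Θ y = A (d₂ (d₁.symm (h₁.equiv.symm (b (e.symm y))).1),
    (h₁.equiv.symm (b (e.symm y))).2) := fun y => rfl
  have hA : ∀ w r, A (w, r) = ((h₂.equiv w).2, ((h₂.equiv w).1, r)) := fun w r => rfl
  have hsrc : ∀ y, y ∈ Θ.source ↔ y ∈ e.target ∧ e.symm y ∈ b.source ∧ e.symm y ∈ U ∧
      (h₁.equiv.symm (b (e.symm y))).1 ∈ d₁.target ∧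
      d₁.symm (h₁.equiv.symm (b (e.symm y))).1 ∈ d₂.source := fun y => by
    simp only [Θ, OpenPartialHomeomorph.trans_source, OpenPartialHomeomorph.restrOpen_source,
      OpenPartialHomeomorph.prod_source, OpenPartialHomeomorph.symm_source,
      OpenPartialHomeomorph.refl_source, Homeomorph.toOpenPartialHomeomorph_source, preimage_univ,
      inter_univ, mem_inter_iff, mem_preimage, mem_prod, mem_univ, and_true]
    constructor
    · rintro ⟨⟨⟨h1, h2⟩, h3, h4⟩, h5, h6⟩
      exact ⟨h1, h2, h4, h5, h6⟩
    · rintro ⟨h1, h2, h4, h5, h6⟩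
      exact ⟨⟨⟨h1, h2⟩, h1, h4⟩, h5, h6⟩
  have hsrc' : ∀ n, ι n ∈ e.source → (e (ι n) ∈ Θ.source ↔ ι n ∈ b.source ∧ n ∈ d₁.source ∧
      n ∈ d₂.source) := fun n hn => by
    have hnU : ι n ∈ U ↔ n ∈ d₁.source := by rw [← hUd]; rfl
    rw [hsrc, e.left_inv hn, hnU]
    constructor
    · rintro ⟨-, h1, h2, -, h4⟩
      rw [hw₁ n h2, ContinuousLinearEquiv.symm_apply_apply, d₁.left_inv h2] at h4
      exact ⟨h1, h2, h4⟩
    · rintro ⟨h1, h2, h3⟩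
      rw [hw₁ n h2, ContinuousLinearEquiv.symm_apply_apply, d₁.left_inv h2]
      exact ⟨e.map_source hn, h1, h2, d₁.map_source h2, h3⟩
  have hval : ∀ n, ι n ∈ e.source → n ∈ d₁.source →
      Θ (e (ι n)) = A (d₂ n, 0) := fun n hn h2 => by
    rw [hΘ, e.left_inv hn, hw₁ n h2, ContinuousLinearEquiv.symm_apply_apply, d₁.left_inv h2]
  have hC1 : Θ.IsC1 := by
    refine ((((isC1_of_mem_maximalAtlas (IsManifold.chart_mem_maximalAtlas _)
      h₁.codChart_mem_maximalAtlas).restrOpen _).trans (ContinuousLinearEquiv.isC1 _)).trans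
      ((isC1_of_mem_maximalAtlas h₁.domChart_mem_maximalAtlas
        h₂.domChart_mem_maximalAtlas).prod_refl)).trans (ContinuousLinearEquiv.isC1 _)
  have hext : ∀ y, extChartAt 𝓘(ℝ, E) (ι x) y = e y := fun y => rfl
  have hexts : ∀ y, (extChartAt 𝓘(ℝ, E) (ι x)).symm y = e.symm y := fun y => rfl
  have hs : (extChartAt 𝓘(ℝ, E) (ι x)).source = e.source := extChartAt_source _ _
  -- the two expressions of the derivative of `Θ` along `ι(N)`
  have hder : ∀ n, ι n ∈ e.source → e (ι n) ∈ Θ.source → ∀ v : E',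
      fderiv ℝ Θ (e (ι n)) (dChart (ι x) (ι n) (mfderiv 𝓘(ℝ, E') 𝓘(ℝ, E) ι n v)) =
        A (mfderiv 𝓘(ℝ, E') 𝓘(ℝ, E') d₂ n v, 0) ∧
      mfderiv 𝓘(ℝ, G) 𝓘(ℝ, G) c (F n) (mfderiv 𝓘(ℝ, E') 𝓘(ℝ, G) F n v) =
        (h₂.equiv (mfderiv 𝓘(ℝ, E') 𝓘(ℝ, E') d₂ n v)).1 := fun n hn hn' v => by
    obtain ⟨hnb, hn1, hn2⟩ := (hsrc' n hn).1 hn'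
    have hιc : ContMDiffAt 𝓘(ℝ, E') 𝓘(ℝ, E) 1 ι n :=
      (h₁.contMDiffOn n hn1).contMDiffAt (d₁.open_source.mem_nhds hn1)
    have hFc : ContMDiffAt 𝓘(ℝ, E') 𝓘(ℝ, G) 1 F n :=
      (h₂.contMDiffOn n hn2).contMDiffAt (d₂.open_source.mem_nhds hn2)
    have hd2 := ((mdifferentiable_of_mem_maximalAtlas
      h₂.domChart_mem_maximalAtlas).mdifferentiableAt hn2).hasMFDerivAt
    have hFn : F n ∈ c.source := h₂.source_subset_preimage_source hn2
    have hc := ((mdifferentiable_of_mem_maximalAtlas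
      h₂.codChart_mem_maximalAtlas).mdifferentiableAt hFn).hasMFDerivAt
    constructor
    · have e1 : HasMFDerivAt 𝓘(ℝ, E') 𝓘(ℝ, H × (G × R)) (Θ ∘ (extChartAt 𝓘(ℝ, E) (ι x)) ∘ ι) n
          ((fderiv ℝ Θ (e (ι n))).comp ((dChart (ι x) (ι n)).comp
            (mfderiv 𝓘(ℝ, E') 𝓘(ℝ, E) ι n))) := by
        have e0 : HasMFDerivAt 𝓘(ℝ, E) 𝓘(ℝ, E) (extChartAt 𝓘(ℝ, E) (ι x)) (ι n)
            (dChart (E := E) (ι x) (ι n)) := (mdifferentiableAt_extChartAt (I := 𝓘(ℝ, E)) hn).hasMFDerivAt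
        have e0' := e0.comp n (hιc.mdifferentiableAt one_ne_zero).hasMFDerivAt
        exact HasMFDerivAt.comp (I' := 𝓘(ℝ, E)) n
          (hC1.differentiableAt (y := e (ι n)) hn').hasFDerivAt.hasMFDerivAt e0'
      have e2 : HasMFDerivAt 𝓘(ℝ, E') 𝓘(ℝ, H × (G × R))
          ((A.toContinuousLinearMap.comp (ContinuousLinearMap.inl ℝ E' R)) ∘ d₂) n
          ((A.toContinuousLinearMap.comp (ContinuousLinearMap.inl ℝ E' R)).comp
            (mfderiv 𝓘(ℝ, E') 𝓘(ℝ, E') d₂ n)) :=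
        (ContinuousLinearMap.hasFDerivAt _).hasMFDerivAt.comp n hd2
      have e3 := e2.congr_of_eventuallyEq (f₁ := Θ ∘ (extChartAt 𝓘(ℝ, E) (ι x)) ∘ ι) (by
        filter_upwards [d₁.open_source.mem_nhds hn1,
          hιc.continuousAt.preimage_mem_nhds (e.open_source.mem_nhds hn)] with m hm1 hm2
        exact hval m hm2 hm1)
      exact congrArg (fun f : E' →L[ℝ] H × (G × R) => f v) (hasMFDerivAt_unique e1 e3)
    · have e1 : HasMFDerivAt 𝓘(ℝ, E') 𝓘(ℝ, G) (c ∘ F) n _ :=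
        hc.comp n (hFc.mdifferentiableAt one_ne_zero).hasMFDerivAt
      have e2 : HasMFDerivAt 𝓘(ℝ, E') 𝓘(ℝ, G)
          (((ContinuousLinearMap.fst ℝ G H).comp h₂.equiv.toContinuousLinearMap) ∘ d₂) n
          (((ContinuousLinearMap.fst ℝ G H).comp h₂.equiv.toContinuousLinearMap).comp
            (mfderiv 𝓘(ℝ, E') 𝓘(ℝ, E') d₂ n)) :=
        (ContinuousLinearMap.hasFDerivAt _).hasMFDerivAt.comp n hd2
      have e3 := e2.congr_of_eventuallyEq (f₁ := c ∘ F) (by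
        filter_upwards [d₂.open_source.mem_nhds hn2] with m hm2
        exact hw₂ m hm2)
      exact congrArg (fun f : E' →L[ℝ] G => f v) (hasMFDerivAt_unique e1 e3)
  -- the derivative of `Θ` in the preferred chart is injective
  have hinj : ∀ n, ι n ∈ e.source → e (ι n) ∈ Θ.source → ∀ v w : E,
      fderiv ℝ Θ (e (ι n)) (dChart (ι x) (ι n) v) = fderiv ℝ Θ (e (ι n)) (dChart (ι x) (ι n) w) →
      v = w := fun n hn hn' v w hvw => by
    have h1 := hC1.fderiv_injective hn' hvw
    rw [← dSymm_dChart (x₀ := ι x) (x := ι n) (hs ▸ hn) v, h1,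
      dSymm_dChart (x₀ := ι x) (x := ι n) (hs ▸ hn) w]
  have hsurj : ∀ n ∈ d₂.source, ∀ w : E', ∃ v : E', (mfderiv 𝓘(ℝ, E') 𝓘(ℝ, E') d₂ n v : E') = w :=
    fun n hn w => ((mdifferentiable_of_mem_maximalAtlas
      h₂.domChart_mem_maximalAtlas).mfderiv_bijective hn).2 w
  have hcinj : ∀ n ∈ d₂.source, ∀ w : G, (mfderiv 𝓘(ℝ, G) 𝓘(ℝ, G) c (F n) w : G) = 0 → w = 0 :=
    fun n hn w hw => ((mdifferentiable_of_mem_maximalAtlas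
      h₂.codChart_mem_maximalAtlas).mfderiv_bijective
        (h₂.source_subset_preimage_source hn)).1 (hw.trans (map_zero _).symm)
  have hc0 : ∀ n, (mfderiv 𝓘(ℝ, G) 𝓘(ℝ, G) c (F n) (0 : G) : G) = 0 := fun n => map_zero _
  refine ⟨Θ, c, ⟨hC1, ?_, ?_, ?_, ?_, ?_⟩, h₂.codChart_mem_maximalAtlas, ?_⟩
  · intro y hy
    simpa using ((hsrc y).1 hy).1
  · intro y hy hy0
    obtain ⟨-, h1, -, h3, -⟩ := (hsrc y).1 hy
    rw [hΘ, hA] at hy0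
    refine ⟨d₁.symm (h₁.equiv.symm (b (e.symm y))).1, ?_⟩
    have h5 : d₁.symm (h₁.equiv.symm (b (e.symm y))).1 ∈ d₁.source := d₁.map_target h3
    refine b.injOn (h₁.source_subset_preimage_source h5) h1 ?_
    rw [hw₁ _ h5, d₁.right_inv h3]
    have h6 : ((h₁.equiv.symm (b (e.symm y))).1, (0 : R)) = h₁.equiv.symm (b (e.symm y)) :=
      Prod.ext rfl hy0.symm
    rw [h6, ContinuousLinearEquiv.apply_symm_apply]
    rfl
  · intro n hn hn'
    have hn2 : ι n ∈ e.source := hs ▸ hn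
    obtain ⟨-, h1, h2⟩ := (hsrc' n hn2).1 hn'
    refine ⟨h₂.source_subset_preimage_source h2, ?_⟩
    rw [hext, hval n hn2 h1, hA, hw₂ n h2]
  · intro n hn hn' v
    have hn2 : ι n ∈ e.source := hs ▸ hn
    obtain ⟨-, h1, h2⟩ := (hsrc' n hn2).1 hn'
    rw [hext]
    constructor
    · rintro ⟨w, rfl⟩
      have := (hder n hn2 hn' w).1
      exact (congrArg (fun z => z.2.2) this).trans rfl
    · intro h0
      obtain ⟨w, hw⟩ := hsurj n h2 (A.symm (fderiv ℝ Θ (e (ι n)) (dChart (ι x) (ι n) v))).1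
      refine ⟨w, hinj n hn2 hn' _ _ ?_⟩
      have h3 := (hder n hn2 hn' w).1
      rw [hw] at h3
      refine h3.trans ?_
      rw [← A.apply_symm_apply (fderiv ℝ Θ (e (ι n)) (dChart (ι x) (ι n) v))]
      congr 1
      refine Prod.ext (by simp) ?_
      rw [ContinuousLinearEquiv.apply_symm_apply]
      exact h0.symm
  · intro n hn hn' v
    have hn2 : ι n ∈ e.source := hs ▸ hn
    obtain ⟨-, h1, h2⟩ := (hsrc' n hn2).1 hn'
    rw [hext]
    constructor
    · rintro ⟨w, hw0, rfl⟩
      have h3 := hder n hn2 hn' w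
      have hw1 : (mfderiv 𝓘(ℝ, E') 𝓘(ℝ, G) F n w : G) = 0 := hw0
      have h4 : (h₂.equiv (mfderiv 𝓘(ℝ, E') 𝓘(ℝ, E') d₂ n w : E')).1 = 0 :=
        (h3.2.symm.trans (congrArg _ hw1)).trans (hc0 n)
      refine (congrArg (fun z => z.2) h3.1).trans ?_
      exact (Prod.ext h4 rfl : ((h₂.equiv (mfderiv 𝓘(ℝ, E') 𝓘(ℝ, E') d₂ n w : E')).1, (0 : R)) = 0)
    · intro h0
      obtain ⟨w, hw⟩ := hsurj n h2 (A.symm (fderiv ℝ Θ (e (ι n)) (dChart (ι x) (ι n) v))).1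
      have h3 := hder n hn2 hn' w
      rw [hw] at h3
      have hz : ∀ z : H × (G × R), z.2 = 0 → (h₂.equiv (A.symm z).1).1 = 0 ∧ (A.symm z).2 = 0 :=
        fun z hz => by
          have h4 : A (A.symm z) = z := A.apply_symm_apply z
          have h5 : A (A.symm z) =
            ((h₂.equiv (A.symm z).1).2, ((h₂.equiv (A.symm z).1).1, (A.symm z).2)) := rfl
          rw [h4] at h5
          rw [h5] at hz
          exact ⟨congrArg Prod.fst hz, congrArg Prod.snd hz⟩
      refine ⟨w, ?_, hinj n hn2 hn' _ _ ?_⟩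
      · change (mfderiv 𝓘(ℝ, E') 𝓘(ℝ, G) F n w : G) = 0
        refine hcinj n h2 _ (h3.2.trans (hz _ h0).1)
      · refine h3.1.trans ?_
        conv_rhs => rw [← A.apply_symm_apply (fderiv ℝ Θ (e (ι n)) (dChart (ι x) (ι n) v))]
        congr 1
        exact Prod.ext rfl (hz _ h0).2.symm
  · exact (hsrc' x (mem_chart_source _ _)).2 ⟨h₁.mem_codChart_source, h₁.mem_domChart_source,
      h₂.mem_domChart_source⟩

end FlowBox

/-! ### Orientation of the leaves in flow boxes -/

section OrientedFlowBox

lemma IsPositivelyOriented.map {V W : Type*} [AddCommGroup V] [Module ℝ V] [TopologicalSpace V]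
    [AddCommGroup W] [Module ℝ W] [TopologicalSpace W] {J : V →L[ℝ] V} {J' : W →L[ℝ] W}
    {p : ℕ} {v : Fin (2 * p) → V} (hv : IsPositivelyOriented J v) (L : V →L[ℝ] W)
    (hL : ∀ v, L (J v) = J' (L v)) : IsPositivelyOriented J' fun i => L (v i) := by
  obtain ⟨e, A, hA, h⟩ := hv
  refine ⟨fun j => L (e j), A, hA, fun i => ?_⟩
  change L (v i) = _
  rw [h i, map_sum]
  refine Finset.sum_congr rfl fun j _ => ?_
  rw [map_smul]
  congr 1
  unfold complexFrame
  split_ifs <;> simp [hL]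

lemma ContinuousOn.elementaryPositive {X V : Type*} [TopologicalSpace X] [NormedAddCommGroup V]
    [NormedSpace ℝ V] {p : ℕ} {s : Set X} {A : X → (V →L[ℝ] V)} (hA : ContinuousOn A s)
    (a : Fin p → (V →L[ℝ] ℝ)) {v : Fin (2 * p) → X → V} (hv : ∀ i, ContinuousOn (v i) s) :
    ContinuousOn (fun x => _root_.elementaryPositive (fun j => oneZeroForm (A x) (a j))
      fun i => v i x) s := by
  have hc : ∀ i j, ContinuousOn (fun x => oneZeroForm (A x) (a i) (v j x)) s := fun i j => by
    simp only [oneZeroForm_apply]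
    exact (Complex.continuous_ofReal.comp_continuousOn
      ((a i).continuous.comp_continuousOn (hv j))).sub (continuousOn_const.mul
      (Complex.continuous_ofReal.comp_continuousOn
        ((a i).continuous.comp_continuousOn (hA.clm_apply (hv j)))))
  refine continuousOn_const.mul ((continuous_id.matrix_det).comp_continuousOn
    (continuousOn_pi.2 fun i => continuousOn_pi.2 fun j => ?_))
  simp only [Matrix.of_apply, conjPair]
  split_ifs
  · exact hc _ j
  · exact Complex.continuous_conj.comp_continuousOn (hc _ j)

variable {E : Type*} [NormedAddCommGroup E] [NormedSpace ℝ E]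
  {M : Type*} [TopologicalSpace M] [ChartedSpace E M] [IsManifold 𝓘(ℝ, E) ∞ M]
  {E' : Type*} [NormedAddCommGroup E'] [NormedSpace ℝ E']
  {N : Type*} [TopologicalSpace N] [ChartedSpace E' N] [IsManifold 𝓘(ℝ, E') 1 N]
  {G : Type*} [NormedAddCommGroup G] [NormedSpace ℝ G]
  {γ : Type*} [TopologicalSpace γ] [ChartedSpace G γ] [IsManifold 𝓘(ℝ, G) 1 γ]
  {H R : Type*} [NormedAddCommGroup H] [NormedSpace ℝ H] [NormedAddCommGroup R] [NormedSpace ℝ R]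
  (J : AlmostComplexStructure E M)
  {ι : N → M} {F : N → γ} {x₀ : M} {c : OpenPartialHomeomorph γ G}

namespace IsFlowBox

variable {Θ : OpenPartialHomeomorph E (H × (G × R))}

/-- The leaves are `J`-complex, in the coordinates of the chart. -/
lemma fderiv_jChart_snd (h : IsFlowBox E' ι F x₀ Θ c)
    (hcomplex : ∀ x : N, ∀ v ∈ leafTangent E E' G ι F x,
      J.toFun (ι x) v ∈ leafTangent E E' G ι F x)
    {y : E} (hy : y ∈ Θ.source) (hy0 : (Θ y).2.2 = 0) {v : E} (hv : (fderiv ℝ Θ y v).2 = 0) :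
    (fderiv ℝ Θ y (jChart J x₀ y v)).2 = 0 := by
  have hyt := h.source_subset hy
  obtain ⟨n, hn⟩ := h.exists_eq y hy hy0
  have hns : ι n ∈ (extChartAt 𝓘(ℝ, E) x₀).source := hn ▸ (extChartAt 𝓘(ℝ, E) x₀).map_target hyt
  have hny : extChartAt 𝓘(ℝ, E) x₀ (ι n) = y := by
    rw [hn, (extChartAt 𝓘(ℝ, E) x₀).right_inv hyt]
  have h1 := h.mem_leafTangent n hns (hny ▸ hy)
  rw [hny] at h1
  have h2 : ∀ w : E, dChart x₀ (ι n) (dSymm x₀ y w) = w := by rw [hn]; exact dChart_dSymm hyt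
  have h3 := hcomplex n (dSymm x₀ y v) ((h1 _).2 (by rw [h2]; exact hv))
  have h4 := (h1 _).1 h3
  have h5 := dChart_toEnd J hns (dSymm x₀ y v)
  rw [h2, hny] at h5
  rw [← h5]; exact h4

/-- The maximal complex subspaces of the tangent spaces of `ι(N)` are the tangent spaces of the
leaves, in the coordinates of the chart. -/
lemma fderiv_snd_eq_zero [FiniteDimensional ℝ E] {p : ℕ} (h : IsFlowBox E' ι F x₀ Θ c)
    (hcomplex : ∀ x : N, ∀ v ∈ leafTangent E E' G ι F x,
      J.toFun (ι x) v ∈ leafTangent E E' G ι F x)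
    (hCR : IsCRSubmanifold E' J ι p)
    (hdim : ∀ x : N, finrank ℝ (leafTangent E E' G ι F x) = 2 * p)
    {y : E} (hy : y ∈ Θ.source) (hy0 : (Θ y).2.2 = 0) {v : E} (hv : (fderiv ℝ Θ y v).2.2 = 0)
    (hv' : (fderiv ℝ Θ y (jChart J x₀ y v)).2.2 = 0) : (fderiv ℝ Θ y v).2 = 0 := by
  have hyt := h.source_subset hy
  obtain ⟨n, hn⟩ := h.exists_eq y hy hy0
  have hns : ι n ∈ (extChartAt 𝓘(ℝ, E) x₀).source := hn ▸ (extChartAt 𝓘(ℝ, E) x₀).map_target hyt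
  have hny : extChartAt 𝓘(ℝ, E) x₀ (ι n) = y := by
    rw [hn, (extChartAt 𝓘(ℝ, E) x₀).right_inv hyt]
  have h1 := h.mem_leafTangent n hns (hny ▸ hy)
  have h1' := h.mem_tangentOf n hns (hny ▸ hy)
  rw [hny] at h1 h1'
  have h2 : ∀ w : E, dChart x₀ (ι n) (dSymm x₀ y w) = w := by rw [hn]; exact dChart_dSymm hyt
  have hle : leafTangent E E' G ι F n ≤
      tangentOf E E' ι n ⊓ (tangentOf E E' ι n).map (J.toFun (ι n)).toLinearMap := by
    have hsub : ∀ w ∈ leafTangent E E' G ι F n, w ∈ tangentOf E E' ι n := fun w hw =>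
      (h1' w).2 (by rw [(h1 w).1 hw]; rfl)
    intro w hw
    refine ⟨hsub w hw, -(J.toFun (ι n) w), ?_, ?_⟩
    · exact (tangentOf E E' ι n).neg_mem (hsub _ (hcomplex n w hw))
    · exact ((J.toFun (ι n)).map_neg _).trans ((congrArg Neg.neg (J.sq (ι n) w)).trans (neg_neg w))
  have hfin : FiniteDimensional ℝ (TangentSpace 𝓘(ℝ, E) (ι n)) :=
    inferInstanceAs (FiniteDimensional ℝ E)
  have heq := Submodule.eq_of_le_of_finrank_eq hle ((hdim n).trans (hCR n).symm)
  have h5 := dChart_toEnd J hns (dSymm x₀ y v)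
  rw [h2, hny] at h5
  have h6 : dSymm x₀ y v ∈ leafTangent E E' G ι F n := by
    rw [heq]
    refine ⟨(h1' _).2 (by rw [h2]; exact hv), -(J.toFun (ι n) (dSymm x₀ y v)), ?_, ?_⟩
    · refine (tangentOf E E' ι n).neg_mem ((h1' _).2 ?_)
      rw [← h5] at hv'
      exact hv'
    · exact ((J.toFun (ι n)).map_neg _).trans
        ((congrArg Neg.neg (J.sq (ι n) (dSymm x₀ y v))).trans (neg_neg (dSymm x₀ y v)))
  have h7 := (h1 _).1 h6
  rwa [h2] at h7

lemma _root_.finrank_eq_of_forall_mem_iff {V P : Type*} [AddCommGroup V] [Module ℝ V]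
    [AddCommGroup P] [Module ℝ P] {S : Submodule ℝ V} {L : V →ₗ[ℝ] H × P}
    (hL : Function.Bijective L) (hS : ∀ v, v ∈ S ↔ (L v).2 = 0) : finrank ℝ S = finrank ℝ H := by
  refine LinearEquiv.finrank_eq (LinearEquiv.ofBijective
    ((LinearMap.fst ℝ H P).comp (L.comp S.subtype)) ⟨fun v w hvw => ?_, fun w => ?_⟩)
  · refine Subtype.ext (hL.1 (Prod.ext hvw ?_))
    rw [(hS _).1 v.2, (hS _).1 w.2]
  · obtain ⟨v, hv⟩ := hL.2 (w, 0)
    refine ⟨⟨v, (hS v).2 (by rw [hv])⟩, ?_⟩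
    simp [hv]

lemma _root_.OpenPartialHomeomorph.IsC1.fderiv_bijective {V W : Type*} [NormedAddCommGroup V]
    [NormedSpace ℝ V] [NormedAddCommGroup W] [NormedSpace ℝ W] {Θ : OpenPartialHomeomorph V W}
    (h : Θ.IsC1) {y : V} (hy : y ∈ Θ.source) : Function.Bijective (fderiv ℝ Θ y) := by
  refine ⟨h.fderiv_injective hy, fun w => ⟨fderiv ℝ Θ.symm (Θ y) w, ?_⟩⟩
  have := h.fderiv_fderiv_symm (Θ.map_source hy) w
  rwa [Θ.left_inv hy] at this

/-- The dimension of the leaves is the dimension of the first factor of a flow box. -/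
lemma finrank_leafTangent (h : IsFlowBox E' ι F x₀ Θ c) {n : N}
    (hn : ι n ∈ (extChartAt 𝓘(ℝ, E) x₀).source)
    (hn' : extChartAt 𝓘(ℝ, E) x₀ (ι n) ∈ Θ.source) :
    finrank ℝ (leafTangent E E' G ι F n) = finrank ℝ H := by
  refine finrank_eq_of_forall_mem_iff (V := E)
    (L := ((fderiv ℝ Θ (extChartAt 𝓘(ℝ, E) x₀ (ι n))).comp (dChart x₀ (ι n))).toLinearMap)
    ?_ (h.mem_leafTangent n hn hn')
  refine (h.isC1.fderiv_bijective hn').comp ⟨fun v w hvw => ?_, fun w => ?_⟩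
  · rw [← dSymm_dChart hn v, ← dSymm_dChart hn w]
    exact congrArg _ hvw
  · have h1 := dChart_dSymm ((extChartAt 𝓘(ℝ, E) x₀).map_source hn) w
    rw [(extChartAt 𝓘(ℝ, E) x₀).left_inv hn] at h1
    exact ⟨_, h1⟩

/-- In a flow box the leaves have bases of the form `e₀, J e₀, …`. -/
lemma exists_complexFrame [FiniteDimensional ℝ E] {p : ℕ} (h : IsFlowBox E' ι F x₀ Θ c)
    (hcomplex : ∀ x : N, ∀ v ∈ leafTangent E E' G ι F x,
      J.toFun (ι x) v ∈ leafTangent E E' G ι F x)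
    (hH : finrank ℝ H = 2 * p) {y : E} (hy : y ∈ Θ.source) (hy0 : (Θ y).2.2 = 0) :
    ∃ e : Fin p → E, LinearIndependent ℝ (complexFrame (jChart J x₀ y) e) ∧
      ∀ v, (fderiv ℝ Θ y v).2 = 0 ↔
        v ∈ Submodule.span ℝ (range (complexFrame (jChart J x₀ y) e)) := by
  let K : Submodule ℝ E := LinearMap.ker ((ContinuousLinearMap.snd ℝ H (G × R)).comp
    (fderiv ℝ Θ y)).toLinearMap
  have hK : ∀ v, v ∈ K ↔ (fderiv ℝ Θ y v).2 = 0 := fun v => Iff.rfl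
  obtain ⟨e, he, he'⟩ := _root_.exists_complexFrame (jChart J x₀ y)
    (jChart_sq J (h.source_subset hy)) K
    (fun v hv => h.fderiv_jChart_snd J hcomplex hy hy0 hv) (p := p)
    ((finrank_eq_of_forall_mem_iff (L := (fderiv ℝ Θ y).toLinearMap)
      (h.isC1.fderiv_bijective hy) hK).trans hH)
  exact ⟨e, he, fun v => by rw [he']; exact (hK v).symm⟩

end IsFlowBox

variable (E') in
/-- A flow box `Θ` such that the leaves, which are the subspaces `ℝ^{2p} × {(t, 0)}` in the
coordinates `Θ`, are positively oriented by the standard frame of `ℝ^{2p}`. -/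
structure IsOrientedFlowBox (p : ℕ) (ι : N → M) (F : N → γ) (x₀ : M)
    (Θ : OpenPartialHomeomorph E (EuclideanSpace ℝ (Fin (2 * p)) × (G × R)))
    (c : OpenPartialHomeomorph γ G) : Prop extends IsFlowBox E' ι F x₀ Θ c where
  oriented : ∀ y ∈ Θ.source, (Θ y).2.2 = 0 → IsPositivelyOriented (jChart J x₀ y)
    fun i => fderiv ℝ Θ.symm (Θ y) (flatFrame (2 * p) (G × R) i)

/-- Every point of `ι(N)` has an oriented flow box. The coordinates along the leaf are chosen such
that the frame is positively oriented at the given point. Then it is so nearby: a form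
`i α₀ ∧ ᾱ₀ ∧ …` that is positive on the frame at the given point remains so. -/
theorem exists_isOrientedFlowBox [FiniteDimensional ℝ E] {x : N} (hι : IsEmbedding ι)
    (h₁ : Manifold.IsImmersionAtOfComplement R 𝓘(ℝ, E') 𝓘(ℝ, E) 1 ι x)
    (h₂ : Manifold.IsSubmersionAtOfComplement H 𝓘(ℝ, E') 𝓘(ℝ, G) 1 F x)
    (hcomplex : ∀ x : N, ∀ v ∈ leafTangent E E' G ι F x,
      J.toFun (ι x) v ∈ leafTangent E E' G ι F x)
    {p : ℕ} (hdim : ∀ x : N, finrank ℝ (leafTangent E E' G ι F x) = 2 * p) :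
    ∃ (Θ : OpenPartialHomeomorph E (EuclideanSpace ℝ (Fin (2 * p)) × (G × R)))
      (c : OpenPartialHomeomorph γ G), IsOrientedFlowBox E' J p ι F (ι x) Θ c ∧
      extChartAt 𝓘(ℝ, E) (ι x) (ι x) ∈ Θ.source := by
  obtain ⟨Θ₀, c, h₀, -, hx⟩ := exists_isFlowBox hι h₁ h₂
  set y₀ := extChartAt 𝓘(ℝ, E) (ι x) (ι x) with hy₀
  have hxs : ι x ∈ (extChartAt 𝓘(ℝ, E) (ι x)).source := mem_extChartAt_source _
  have hy₀0 : (Θ₀ y₀).2.2 = 0 := by rw [(h₀.map_eq x hxs hx).2]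
  have hH : finrank ℝ H = 2 * p := (h₀.finrank_leafTangent hxs hx).symm.trans (hdim x)
  -- linear change of the coordinates along the leaves
  obtain ⟨e, he, he'⟩ := h₀.exists_complexFrame J hcomplex hH hx hy₀0
  have hb0 : ∀ i, (fderiv ℝ Θ₀ y₀ (complexFrame (jChart J (ι x) y₀) e i)).2 = 0 := fun i =>
    (he' _).2 (Submodule.subset_span (mem_range_self i))
  have hfin : FiniteDimensional ℝ H := by
    have h3 : FiniteDimensional ℝ (H × (G × R)) := Module.Finite.of_surjective
      (fderiv ℝ Θ₀ y₀).toLinearMap (h₀.isC1.fderiv_bijective hx).2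
    exact Module.Finite.of_surjective (LinearMap.fst ℝ H (G × R)) LinearMap.fst_surjective
  let b' : Fin (2 * p) → H := fun i => (fderiv ℝ Θ₀ y₀ (complexFrame (jChart J (ι x) y₀) e i)).1
  have hb' : LinearIndependent ℝ b' := by
    have h3 : LinearIndependent ℝ fun i => fderiv ℝ Θ₀ y₀ (complexFrame (jChart J (ι x) y₀) e i) :=
      he.map' (fderiv ℝ Θ₀ y₀).toLinearMap
        (LinearMap.ker_eq_bot.2 (h₀.isC1.fderiv_injective hx))
    rw [Fintype.linearIndependent_iff] at h3 ⊢
    intro g hg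
    refine h3 g (Prod.ext ?_ ?_)
    · rw [Prod.fst_sum]; exact hg
    · rw [Prod.snd_sum]
      exact Finset.sum_eq_zero fun i _ => by rw [Prod.smul_snd, hb0, smul_zero]
  let b : Basis (Fin (2 * p)) ℝ H := basisOfLinearIndependentOfCardEqFinrank' b' hb'
    (by rw [Fintype.card_fin, hH])
  let A : H ≃L[ℝ] EuclideanSpace ℝ (Fin (2 * p)) :=
    b.equivFunL.trans (EuclideanSpace.equiv (Fin (2 * p)) ℝ).symm
  have hA : ∀ i, A (b' i) = EuclideanSpace.single i 1 := fun i => by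
    have h3 : b i = b' i := by simp [b]
    rw [← h3]
    ext j
    simp [A, Finsupp.single_apply, eq_comm]
  set Θ := Θ₀.transHomeomorph (A.prodCongr (ContinuousLinearEquiv.refl ℝ (G × R))).toHomeomorph
    with hΘ
  have h : IsFlowBox E' ι F (ι x) Θ c := h₀.linearChange A
  have hH' : finrank ℝ (EuclideanSpace ℝ (Fin (2 * p))) = 2 * p := finrank_euclideanSpace_fin
  have hv₀ : ∀ i, fderiv ℝ Θ.symm (Θ y₀) (flatFrame (2 * p) (G × R) i) =
      complexFrame (jChart J (ι x) y₀) e i := fun i => by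
    have h3 : HasFDerivAt Θ ((A.prodCongr (ContinuousLinearEquiv.refl ℝ
        (G × R))).toContinuousLinearMap.comp (fderiv ℝ Θ₀ y₀)) y₀ :=
      ((A.prodCongr (ContinuousLinearEquiv.refl ℝ (G × R))).toContinuousLinearMap.hasFDerivAt
        (x := Θ₀ y₀)).comp y₀ (h₀.isC1.differentiableAt hx).hasFDerivAt
    have h4 : fderiv ℝ Θ y₀ (complexFrame (jChart J (ι x) y₀) e i) =
        flatFrame (2 * p) (G × R) i := by
      rw [h3.fderiv]
      exact Prod.ext (hA i) (hb0 i)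
    rw [← h4, h.isC1.fderiv_symm_fderiv hx]
  have hpos₀ : IsPositivelyOriented (jChart J (ι x) y₀) (complexFrame (jChart J (ι x) y₀) e) :=
    ⟨e, 1, by simp, fun i => by simp [Matrix.one_apply]⟩
  obtain ⟨a, d, hd, had⟩ := hpos₀.exists_elementaryPositive_pos
    (jChart_sq J (h.source_subset hx)) he
  -- the form `i α₀ ∧ ᾱ₀ ∧ …` remains positive on the frame near `y₀`
  let f : E → ℂ := fun y => elementaryPositive (fun j => oneZeroForm (jChart J (ι x) y) (a j))
    fun i => fderiv ℝ Θ.symm (Θ y) (flatFrame (2 * p) (G × R) i)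
  have hf : ContinuousOn f Θ.source := by
    refine ContinuousOn.elementaryPositive
      ((contDiffOn_jChart J (ι x)).continuousOn.mono h.source_subset) a fun i => ?_
    exact ((h.isC1.contDiffOn_symm.continuousOn_fderiv_of_isOpen Θ.open_target le_rfl).comp
      Θ.continuousOn fun y hy => Θ.map_source hy).clm_apply continuousOn_const
  have hs : IsOpen (Θ.source ∩ f ⁻¹' {w | 0 < w.re}) :=
    hf.isOpen_inter_preimage Θ.open_source (isOpen_lt continuous_const Complex.continuous_re)
  refine ⟨Θ.restrOpen _ hs, c, ⟨h.restrOpen hs, ?_⟩, hx, hx, ?_⟩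
  · rintro y ⟨hy, -, hfy⟩ hy0
    obtain ⟨e', -, hspan⟩ := h.exists_complexFrame J hcomplex hH' hy hy0
    have hmem : ∀ i, ∃ r : Fin (2 * p) → ℝ, ∑ j, r j • complexFrame (jChart J (ι x) y) e' j =
        fderiv ℝ Θ.symm (Θ y) (flatFrame (2 * p) (G × R) i) := fun i => by
      refine Submodule.mem_span_range_iff_exists_fun ℝ |>.1 ((hspan _).1 ?_)
      have h5 := h.isC1.fderiv_fderiv_symm (Θ.map_source hy) (flatFrame (2 * p) (G × R) i)
      rw [Θ.left_inv hy] at h5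
      rw [h5]; rfl
    choose r hr using hmem
    refine ⟨e', Matrix.of r, ?_, fun i => (hr i).symm⟩
    have h6 := elementaryPositive_linearCombination
      (fun j => oneZeroForm (jChart J (ι x) y) (a j))
      (fun i => fderiv ℝ Θ.symm (Θ y) (flatFrame (2 * p) (G × R) i)) _ (Matrix.of r)
      fun i => (hr i).symm
    rw [elementaryPositive_complexFrame _ _ fun j w =>
      oneZeroForm_comp _ (jChart_sq J (h.source_subset hy)) _ _] at h6
    have h7 : 0 < (f y).re := hfy
    have h8 : f y = _ := h6
    rw [h8, ← Complex.ofReal_mul, Complex.ofReal_re] at h7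
    refine pos_of_mul_pos_left h7 ?_
    have := Complex.normSq_nonneg (Matrix.of fun i j =>
      oneZeroForm (jChart J (ι x) y) (a i) (e' j)).det
    positivity
  · change 0 < (f y₀).re
    have h3 : f y₀ = d := by
      rw [← had]
      change elementaryPositive _ _ = _
      congr 1
      exact funext hv₀
    rw [h3]; exact hd

end OrientedFlowBox

/-! ### Closed functionals and changes of coordinates of class `C^1` -/

section Transport

variable {E V : Type*} [NormedAddCommGroup E] [NormedSpace ℝ E] [FiniteDimensional ℝ E]
  [NormedAddCommGroup V] [NormedSpace ℝ V] [FiniteDimensional ℝ V]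

/-- A `C^1` function with compact support is approximated, together with its derivative, by its
convolutions with smooth functions. -/
lemma HasCompactSupport.exists_contDiff_dist_fderiv_le {g : E → V} (hg : ContDiff ℝ 1 g)
    (hgc : HasCompactSupport g) {ε : ℝ} (hε : 0 < ε) : ∃ h : E → V, ContDiff ℝ ∞ h ∧
      ∀ y, dist (h y) (g y) ≤ ε ∧ dist (fderiv ℝ h y) (fderiv ℝ g y) ≤ ε := by
  borelize E
  have hg' : Continuous (fderiv ℝ g) := hg.continuous_fderiv one_ne_zero
  obtain ⟨δ, hδ, h1⟩ := Metric.uniformContinuous_iff.1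
    (hgc.uniformContinuous_of_continuous hg.continuous) ε hε
  obtain ⟨δ', hδ', h2⟩ := Metric.uniformContinuous_iff.1
    ((hgc.fderiv ℝ).uniformContinuous_of_continuous hg') ε hε
  have hr : 0 < min δ δ' := lt_min hδ hδ'
  let φ : ContDiffBump (0 : E) := ⟨min δ δ' / 2, min δ δ', half_pos hr, half_lt_self hr⟩
  let μ : Measure E := .addHaar
  refine ⟨MeasureTheory.convolution (φ.normed μ) g (ContinuousLinearMap.lsmul ℝ ℝ) μ,
    φ.hasCompactSupport_normed.contDiff_convolution_left _ φ.contDiff_normed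
      hg.continuous.locallyIntegrable, fun y => ⟨?_, ?_⟩⟩
  · exact φ.dist_normed_convolution_le hg.continuous.aestronglyMeasurable fun x hx =>
      (h1 (lt_of_lt_of_le hx (min_le_left _ _))).le
  · have h3 := hgc.hasFDerivAt_convolution_right (ContinuousLinearMap.lsmul ℝ ℝ) (μ := μ)
      (f := φ.normed μ) (φ.contDiff_normed (n := 0)).continuous.locallyIntegrable hg y
    rw [h3.fderiv]
    exact φ.dist_normed_convolution_le hg'.aestronglyMeasurable fun x hx =>
      (h2 (lt_of_lt_of_le hx (min_le_right _ _))).le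

lemma extDeriv_complex_smul {m : ℕ} {F : E → ℂ} {ζ : E → E [⋀^Fin m]→L[ℝ] ℂ} {y : E}
    (hF : DifferentiableAt ℝ F y) (hζ : DifferentiableAt ℝ ζ y) (v : Fin (m + 1) → E) :
    extDeriv (fun y => F y • ζ y) y v = F y * extDeriv ζ y v +
      ∑ i : Fin (m + 1), (-1 : ℂ) ^ (i : ℕ) * (fderiv ℝ F y (v i) * ζ y (i.removeNth v)) := by
  have h1 := (hF.hasFDerivAt.fun_smul hζ.hasFDerivAt).fderiv
  rw [extDeriv, h1, ContinuousAlternatingMap.alternatizeUncurryFin_add,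
    ContinuousAlternatingMap.alternatizeUncurryFin_smul]
  change F y * extDeriv ζ y v + ContinuousAlternatingMap.alternatizeUncurryFin _ v = _
  congr 1
  rw [ContinuousAlternatingMap.alternatizeUncurryFin_apply]
  refine Finset.sum_congr rfl fun i _ => ?_
  rw [zsmul_eq_mul]
  push_cast
  rfl

/-- The pull-back of continuous forms on `X'` to continuous forms on `X`, by the map `θ : X → X'`
whose derivative is `D`. -/
def pullbackCLM {k : ℕ} {X X' : Type*} [TopologicalSpace X] [TopologicalSpace X']
    [LocallyCompactSpace X'] (θ : C(X, X')) (D : C(X, E →L[ℝ] V)) :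
    C(X', V [⋀^Fin k]→L[ℝ] ℂ) →L[ℂ] C(X, E [⋀^Fin k]→L[ℝ] ℂ) where
  toFun β := ⟨fun y => (β (θ y)).compContinuousLinearMap (D y),
    continuousOn_univ.1 ((β.continuous.comp θ.continuous).continuousOn.form_comp_clm
      D.continuous.continuousOn)⟩
  map_add' _ _ := rfl
  map_smul' _ _ := rfl
  cont := by
    refine ContinuousMap.continuous_of_continuous_uncurry _ ?_
    have h1 : Continuous fun q : C(X', V [⋀^Fin k]→L[ℝ] ℂ) × X => q.1 (θ q.2) := by fun_prop
    exact continuousOn_univ.1 (h1.continuousOn.form_comp_clm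
      (D.continuous.comp continuous_snd).continuousOn)

lemma pullbackCLM_apply {k : ℕ} {X X' : Type*} [TopologicalSpace X] [TopologicalSpace X']
    [LocallyCompactSpace X'] (θ : C(X, X')) (D : C(X, E →L[ℝ] V))
    (β : C(X', V [⋀^Fin k]→L[ℝ] ℂ)) (y : X) (v : Fin k → E) :
    pullbackCLM θ D β y v = β (θ y) fun i => D y (v i) := rfl

/-- The functional `S`, on the continuous forms on `X`, vanishes on the exterior derivatives of
the smooth forms with compact support in `U`. -/
def VanishesOnExact {k : ℕ} {X : Set E} [CompactSpace X] (U : Set E)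
    (S : C(X, E [⋀^Fin k]→L[ℝ] ℂ) →L[ℂ] ℂ) : Prop :=
  ∀ (m : ℕ) (h : m + 1 = k) (ζ : E → E [⋀^Fin m]→L[ℝ] ℂ), ContDiff ℝ ∞ ζ → HasCompactSupport ζ →
    tsupport ζ ⊆ U → ∀ β : C(X, E [⋀^Fin k]→L[ℝ] ℂ),
      (∀ y v, β y v = extDeriv ζ y (fun i => v (Fin.cast h i))) → S β = 0

lemma exists_contDiff_one_nhds {K U : Set E} (hK : IsCompact K) (hU : IsOpen U) (hKU : K ⊆ U) :
    ∃ χ : E → ℝ, ContDiff ℝ ∞ χ ∧ HasCompactSupport χ ∧ tsupport χ ⊆ U ∧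
      (∀ y ∈ K, χ =ᶠ[𝓝 y] fun _ => 1) ∧ ∀ y, χ y ∈ Icc 0 1 := by
  obtain ⟨L, hL, hKL, hLU⟩ := exists_compact_between hK hU hKU
  obtain ⟨χ, h1, h2, h3⟩ := exists_contMDiffMap_one_nhds_of_subset_interior (I := 𝓘(ℝ, E)) (n := ⊤)
    hK.isClosed hKL
  have hs : tsupport χ ⊆ L := closure_minimal (fun y hy => by_contra fun h => hy (h2 y h))
    hL.isClosed
  exact ⟨χ, χ.contMDiff.contDiff, hL.of_isClosed_subset (isClosed_tsupport _) hs, hs.trans hLU,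
    fun y hy => Filter.Eventually.filter_mono (nhds_le_nhdsSet hy) h1, h3⟩

variable {k : ℕ} {X : Set E} [CompactSpace X] {S : C(X, E [⋀^Fin k]→L[ℝ] ℂ) →L[ℂ] ℂ} {U : Set E}

/-- A functional that vanishes on the exterior derivatives of smooth forms is transported, by a
change of coordinates `Θ` that is only of class `C^1`, to a closed functional: smooth maps converge
to `Θ` together with their derivatives, and the pull-back by a smooth map commutes with the exterior
derivative. -/
lemma VanishesOnExact.isClosedFunctional (hS : VanishesOnExact U S) (hU : IsOpen U)
    {X' : Set V} [CompactSpace X'] {Θ : OpenPartialHomeomorph E V} (hΘ : Θ.IsC1)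
    (hX : X ⊆ Θ.source) {θ : C(X, X')} {D : C(X, E →L[ℝ] V)}
    (hθ : ∀ y, (θ y : V) = Θ y) (hD : ∀ y : X, D y = fderiv ℝ Θ y) :
    IsClosedFunctional (Θ.target ∩ Θ.symm ⁻¹' U) (S.comp (pullbackCLM θ D)) := by
  rintro m rfl f hf hfc hfO θ₀ β hβ
  have hfsymm : ContinuousOn Θ.symm (tsupport f) := Θ.continuousOn_symm.mono fun z hz => (hfO hz).1
  have hL : IsCompact (Θ.symm '' tsupport f) := hfc.image_of_continuousOn hfsymm
  obtain ⟨χ, hχ, hχc, hχU, hχ1, -⟩ := exists_contDiff_one_nhds hL hU (by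
    rintro _ ⟨z, hz, rfl⟩; exact (hfO hz).2)
  obtain ⟨χ₁, hχ₁, hχ₁c, hχ₁U, hχ₁1, -⟩ := exists_contDiff_one_nhds
    (isCompact_iff_compactSpace.2 ‹_› : IsCompact X) Θ.open_source hX
  -- smooth approximations of `Θ` on `X`
  let g : E → V := fun y => χ₁ y • Θ y
  have hg : ContDiff ℝ 1 g := contDiff_iff_contDiffAt.2 fun y => by
    by_cases hy : y ∈ Θ.source
    · exact (hχ₁.of_le (by simp)).contDiffAt.smul
        (hΘ.contDiffOn.contDiffAt (Θ.open_source.mem_nhds hy))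
    · have h1 : χ₁ =ᶠ[𝓝 y] fun _ => 0 := notMem_tsupport_iff_eventuallyEq.1 fun h => hy (hχ₁U h)
      refine contDiffAt_const (c := (0 : V)) |>.congr_of_eventuallyEq ?_
      filter_upwards [h1] with z hz
      simp only [g, hz, zero_smul]
  have hgc : HasCompactSupport g := hχ₁c.smul_right
  have hgX : ∀ y ∈ X, g =ᶠ[𝓝 y] Θ := fun y hy => by
    filter_upwards [hχ₁1 y hy] with z hz
    simp only [g, hz, one_smul]
  choose h hh hhg using fun n : ℕ =>
    hgc.exists_contDiff_dist_fderiv_le hg (ε := 1 / ((n : ℝ) + 1)) (by positivity)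
  have hh' : ∀ n, Continuous (fderiv ℝ (h n)) := fun n => (hh n).continuous_fderiv (by simp)
  let u : C(X, E × (V × (E →L[ℝ] V))) :=
    ⟨fun y => (y, g y, fderiv ℝ g y), by
      have := hg.continuous_fderiv one_ne_zero
      have := hg.continuous
      fun_prop⟩
  let w : ℕ → C(X, E × (V × (E →L[ℝ] V))) := fun n =>
    ⟨fun y => (y, h n y, fderiv ℝ (h n) y), by
      have := hh' n
      have := (hh n).continuous
      fun_prop⟩
  have hw : Filter.Tendsto w Filter.atTop (𝓝 u) := by
    refine squeeze_zero (f := fun n => dist (w n) u) (fun _ => dist_nonneg) (fun n => ?_)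
      (tendsto_one_div_add_atTop_nhds_zero_nat (𝕜 := ℝ)) |> tendsto_iff_dist_tendsto_zero.2
    refine (ContinuousMap.dist_le (by positivity)).2 fun y => ?_
    simp only [w, u, ContinuousMap.coe_mk, Prod.dist_eq, dist_self]
    exact max_le (by positivity) (max_le (hhg n y).1 (hhg n y).2)
  -- the exterior derivative of `χ Θ^* (f θ₀)` as a function of `Θ` and of its derivative
  let ℓ : E × (V × (E →L[ℝ] V)) → (E →L[ℝ] ℂ) := fun q =>
    f q.2.1 • (Complex.ofRealCLM.comp (fderiv ℝ χ q.1)) +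
      (χ q.1 : ℂ) • ((fderiv ℝ f q.2.1).comp q.2.2)
  have hΦ : ∀ q v, ContinuousAlternatingMap.alternatizeUncurryFin
      ((ℓ q).smulRight (θ₀.compContinuousLinearMap q.2.2)) v =
      ∑ i : Fin (m + 1), (-1 : ℂ) ^ (i : ℕ) *
      (ℓ q (v i) * θ₀ fun j => q.2.2 (i.removeNth v j)) := fun q v => by
    refine (ContinuousAlternatingMap.alternatizeUncurryFin_apply _ _).trans
      (Finset.sum_congr rfl fun i _ => ?_)
    rw [zsmul_eq_mul]
    push_cast
    rfl
  let Φ : C(E × (V × (E →L[ℝ] V)), E [⋀^Fin (m + 1)]→L[ℝ] ℂ) :=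
    ⟨fun q => ContinuousAlternatingMap.alternatizeUncurryFin
      ((ℓ q).smulRight (θ₀.compContinuousLinearMap q.2.2)), by
      refine continuousOn_univ.1 (continuousOn_form_iff.2 fun v => continuousOn_univ.2 ?_)
      simp only [hΦ]
      have h1 : ∀ v, Continuous fun q => ℓ q v := fun v => by
        have h2 : Continuous (fderiv ℝ χ) := hχ.continuous_fderiv (by simp)
        have h3 : Continuous (fderiv ℝ f) := hf.continuous_fderiv (by simp)
        have h4 := hf.continuous
        have h5 := hχ.continuous
        simp only [ℓ, add_apply, smul_apply, ContinuousLinearMap.comp_apply]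
        fun_prop
      have h6 : ∀ v : Fin m → E, Continuous fun q : E × (V × (E →L[ℝ] V)) =>
          θ₀ fun j => q.2.2 (v j) := fun v => by
        refine θ₀.cont.comp (continuous_pi fun j => ?_)
        fun_prop
      exact continuous_finsetSum _ fun i _ => continuous_const.mul ((h1 _).mul (h6 _))⟩
  -- pull-back along the smooth map `h n` commutes with the exterior derivative
  have h0 : ∀ n, S (Φ.comp (w n)) = 0 := fun n => by
    let F : E → ℂ := fun y => (χ y : ℂ) * f (h n y)
    let ζ : E → E [⋀^Fin m]→L[ℝ] ℂ := fun y => θ₀.compContinuousLinearMap (fderiv ℝ (h n) y)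
    have hF : ContDiff ℝ ∞ F :=
      (Complex.ofRealCLM.contDiff.comp hχ).mul (hf.comp (hh n))
    have hζ : ContDiff ℝ ∞ ζ := contDiffOn_univ.1 (contDiffOn_const.form_comp_clm
      ((hh n).fderiv_right (m := ∞) (by simp)).contDiffOn)
    have hs : tsupport (fun y => F y • ζ y) ⊆ tsupport χ := closure_mono fun y hy h0 => hy (by
      simp only [F, h0, Complex.ofReal_zero, zero_mul]
      exact zero_smul ℂ (ζ y))
    refine hS m rfl (fun y => F y • ζ y) (hF.smul hζ)
      (hχc.of_isClosed_subset (isClosed_tsupport _) hs) (hs.trans hχU) _ fun y v => ?_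
    refine Eq.trans ?_ (extDeriv_complex_smul (hF.differentiable (by simp) y)
      (hζ.differentiable (by simp) y) _).symm
    have h1 : extDeriv ζ y = 0 := by
      have h2 : extDeriv ζ y = (extDeriv (fun _ : V => θ₀) (h n y)).compContinuousLinearMap
          (fderiv ℝ (h n) y) :=
        extDeriv_pullback (f := h n) (r := ∞) (differentiableAt_const θ₀) (hh n).contDiffAt
          (by rw [minSmoothness_of_isRCLikeNormedField]; exact WithTop.coe_le_coe.2 le_top)
      refine h2.trans ?_
      have h3 : extDeriv (fun _ : V => θ₀) (h n y) = 0 := by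
        rw [extDeriv, fderiv_fun_const]
        exact (ContinuousAlternatingMap.alternatizeUncurryFinCLM ℝ V ℂ).map_zero
      rw [h3]; rfl
    rw [h1]
    refine (hΦ _ v).trans ?_
    have hz : ∀ v : Fin (m + 1) → E, (0 : E [⋀^Fin (m + 1)]→L[ℝ] ℂ) v = 0 := fun _ => rfl
    rw [hz, mul_zero, zero_add]
    refine Finset.sum_congr rfl fun i _ => ?_
    have h2 : HasFDerivAt F ((χ y : ℂ) • ((fderiv ℝ f (h n y)).comp (fderiv ℝ (h n) y)) +
        f (h n y) • (Complex.ofRealCLM.comp (fderiv ℝ χ y))) (y : E) := by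
      refine HasFDerivAt.fun_mul (c := fun y => (χ y : ℂ)) (d := fun y => f (h n y)) ?_ ?_
      · exact Complex.ofRealCLM.hasFDerivAt.comp (y : E)
          (hχ.differentiable (by simp) _).hasFDerivAt
      · exact (hf.differentiable (by simp) _).hasFDerivAt.comp (y : E)
          ((hh n).differentiable (by simp) _).hasFDerivAt
    rw [h2.fderiv]
    congr 2
    exact add_comm _ _
  -- the maps `h n` converge to the coordinate change in the `C^1` sense on `X`
  have h1 : S (Φ.comp u) = 0 := by
    have h2 : Filter.Tendsto (fun n => S (Φ.comp (w n))) Filter.atTop (𝓝 (S (Φ.comp u))) :=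
      (S.continuous.tendsto _).comp ((Φ.continuous_postcomp.tendsto u).comp hw)
    simp only [h0] at h2
    exact (tendsto_nhds_unique h2 tendsto_const_nhds)
  rw [ContinuousLinearMap.comp_apply, ← h1]
  congr 1
  ext y v
  have hy := hX y.2
  have hgy : g y = Θ y := (hgX y y.2).self_of_nhds
  have hgy' : fderiv ℝ g y = fderiv ℝ Θ y := (hgX y y.2).fderiv_eq
  rw [pullbackCLM_apply, hβ]
  refine Eq.trans ?_ (hΦ _ v).symm
  refine Finset.sum_congr rfl fun i _ => ?_
  simp only [u, ContinuousMap.coe_mk, hgy, hgy', hθ, hD, Fin.cast_eq_self]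
  congr 2
  change fderiv ℝ f (Θ y) (fderiv ℝ Θ y (v i)) = f (Θ y) * (fderiv ℝ χ y (v i) : ℂ) +
    (χ y : ℂ) * fderiv ℝ f (Θ y) (fderiv ℝ Θ y (v i))
  by_cases hs : Θ y ∈ tsupport f
  · have h3 := hχ1 y ⟨Θ y, hs, Θ.left_inv hy⟩
    rw [h3.self_of_nhds, h3.fderiv_eq]
    simp
  · have h3 : f =ᶠ[𝓝 (Θ y)] fun _ => 0 := notMem_tsupport_iff_eventuallyEq.1 hs
    rw [h3.self_of_nhds, h3.fderiv_eq]
    simp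

/-- If the functional `S` is invariant under a field `A` of endomorphisms acting on smooth forms, it
is so on continuous forms. -/
lemma apply_comp_eq_of_smooth {A : E → (E →L[ℝ] E)} (hU : IsOpen U) (hA : ContinuousOn A U)
    (hS : ∀ η : E → E [⋀^Fin k]→L[ℝ] ℂ, ContDiff ℝ ∞ η → HasCompactSupport η → tsupport η ⊆ U →
      ∀ ηX ηX' : C(X, E [⋀^Fin k]→L[ℝ] ℂ), (∀ y, ηX y = η y) →
        (∀ y v, ηX' y v = η y (fun i => A y (v i))) → S ηX' = S ηX)
    {η : E → E [⋀^Fin k]→L[ℝ] ℂ} (hη : Continuous η) (hηc : HasCompactSupport η)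
    (hηU : tsupport η ⊆ U) (ηX ηX' : C(X, E [⋀^Fin k]→L[ℝ] ℂ)) (h : ∀ y, ηX y = η y)
    (h' : ∀ y v, ηX' y v = η y (fun i => A y (v i))) : S ηX' = S ηX := by
  obtain ⟨χ, hχ, -, hχU, hχ1, -⟩ := exists_contDiff_one_nhds hηc hU hηU
  -- cutting off the field outside the support of the form makes it continuous
  let A' : C(X, E →L[ℝ] E) := ⟨fun y => χ y • A y, by
    refine Continuous.comp (g := fun y => χ y • A y) (continuous_iff_continuousAt.2 fun y => ?_)
      continuous_subtype_val
    by_cases hy : y ∈ U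
    · exact hχ.continuous.continuousAt.smul (hA.continuousAt (hU.mem_nhds hy))
    · have h1 : χ =ᶠ[𝓝 y] fun _ => 0 := notMem_tsupport_iff_eventuallyEq.1 fun h => hy (hχU h)
      refine (continuousAt_const (y := (0 : E →L[ℝ] E))).congr ?_
      filter_upwards [h1] with z hz
      rw [hz, zero_smul]⟩
  let Ψ := S.comp (pullbackCLM (ContinuousMap.id X) A') - S
  have hpull : ∀ ζ : E → E [⋀^Fin k]→L[ℝ] ℂ, Function.support ζ ⊆ Function.support η →
      ∀ ζX ζX' : C(X, E [⋀^Fin k]→L[ℝ] ℂ), (∀ y, ζX y = ζ y) →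
      (∀ y v, ζX' y v = ζ y (fun i => A y (v i))) →
      pullbackCLM (ContinuousMap.id X) A' ζX = ζX' := fun ζ hζ ζX ζX' h1 h2 => by
    ext y v
    rw [pullbackCLM_apply, h2, ContinuousMap.id_apply, h1]
    by_cases hy : ζ y = 0
    · rw [hy]; rfl
    · have h3 : χ y = 1 := (hχ1 y (subset_tsupport _ (hζ hy))).self_of_nhds
      simp [A', h3]
  choose ζ hζ hζη hζs using fun n : ℕ => hη.exists_contDiff_approx ⊤
    (ε := fun _ => 1 / ((n : ℝ) + 1)) continuous_const (fun _ => by positivity)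
  let ζX : ℕ → C(X, E [⋀^Fin k]→L[ℝ] ℂ) := fun n =>
    ⟨fun y => ζ n y, (hζ n).continuous.comp continuous_subtype_val⟩
  have hlim : Filter.Tendsto ζX Filter.atTop (𝓝 ηX) := by
    refine squeeze_zero (f := fun n => dist (ζX n) ηX) (fun _ => dist_nonneg) (fun n => ?_)
      (tendsto_one_div_add_atTop_nhds_zero_nat (𝕜 := ℝ)) |> tendsto_iff_dist_tendsto_zero.2
    refine (ContinuousMap.dist_le (by positivity)).2 fun y => ?_
    rw [h]
    exact (hζη n y).le
  have h0 : ∀ n, Ψ (ζX n) = 0 := fun n => by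
    have h1 := hS (ζ n) (hζ n) (hηc.mono (hζs n)) ((closure_mono (hζs n)).trans hηU) (ζX n)
      (pullbackCLM (ContinuousMap.id X) A' (ζX n)) (fun _ => rfl) fun y v => ?_
    · exact sub_eq_zero.2 h1
    · rw [pullbackCLM_apply, ContinuousMap.id_apply]
      change ζ n y _ = _
      by_cases hy : ζ n y = 0
      · rw [hy]; rfl
      · have h3 : χ y = 1 := (hχ1 y (subset_tsupport _ (hζs n hy))).self_of_nhds
        simp [A', h3]
  have h1 : Ψ ηX = 0 := by
    have h2 := (Ψ.continuous.tendsto ηX).comp hlim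
    have h3 : Ψ ∘ ζX = fun _ => 0 := funext h0
    rw [h3] at h2
    exact (tendsto_nhds_unique h2 tendsto_const_nhds)
  rw [← hpull η subset_rfl ηX ηX' h h']
  exact sub_eq_zero.1 h1

end Transport

/-! ### The local structure of closed currents on `ι(N)` -/

section ChartFunctional

/-- A linear form that is bounded by the uniform norm of `A w` factors through a continuous functional,
by the Hahn-Banach theorem. -/
lemma exists_clm_of_bound {W X L : Type*} [AddCommMonoid W] [Module ℂ W] [TopologicalSpace X]
    [CompactSpace X] [NormedAddCommGroup L] [NormedSpace ℂ L] (A : W →ₗ[ℂ] C(X, L))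
    (f : W →ₗ[ℂ] ℂ) {C : ℝ} (h' : ∀ w B, 0 ≤ B → (∀ y, ‖A w y‖ ≤ B) → ‖f w‖ ≤ C * B) :
    ∃ S : C(X, L) →L[ℂ] ℂ, ∀ w, S (A w) = f w := by
  let _ : AddCommGroup W := Module.addCommMonoidToAddCommGroup ℂ
  have h : ∀ w, ‖f w‖ ≤ C * ‖A w‖ := fun w => h' w _ (norm_nonneg _) (A w).norm_coe_le_norm
  have hker : LinearMap.ker A ≤ LinearMap.ker f := fun w hw => by
    have h1 : A w = 0 := hw
    have h2 := h w
    rw [h1, norm_zero, mul_zero] at h2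
    exact norm_le_zero_iff.1 h2
  let g : LinearMap.range A →ₗ[ℂ] ℂ :=
    ((LinearMap.ker A).liftQ f hker).comp A.quotKerEquivRange.symm.toLinearMap
  have hg : ∀ w, g ⟨A w, w, rfl⟩ = f w := fun w => by
    have h1 : A.quotKerEquivRange.symm ⟨A w, w, rfl⟩ = (LinearMap.ker A).mkQ w :=
      A.quotKerEquivRange_symm_apply_image w _
    simp only [g, LinearMap.comp_apply, LinearEquiv.coe_coe, h1]
    rfl
  obtain ⟨S, hS, -⟩ := exists_extension_norm_eq (LinearMap.range A) (g.mkContinuous C (by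
    rintro ⟨_, w, rfl⟩
    rw [hg]; exact h w))
  exact ⟨S, fun w => (hS ⟨A w, w, rfl⟩).trans (hg w)⟩

variable {E : Type*} [NormedAddCommGroup E] [NormedSpace ℝ E] [FiniteDimensional ℝ E]
  {M : Type*} [TopologicalSpace M] [T2Space M] [SecondCountableTopology M] [ChartedSpace E M]
  [IsManifold 𝓘(ℝ, E) ∞ M]

/-- The forms in the chart at `x₀` with support in `K`. -/
def chartFormsOn (x₀ : M) (k : ℕ) (K : Set E) : Submodule ℂ (E → E [⋀^Fin k]→L[ℝ] ℂ) where
  carrier := {η | η ∈ chartForms E x₀ k ∧ tsupport η ⊆ K}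
  zero_mem' := ⟨(chartForms E x₀ k).zero_mem, by simp [tsupport]⟩
  add_mem' := fun ha hb => ⟨(chartForms E x₀ k).add_mem ha.1 hb.1,
    (tsupport_add _ _).trans (union_subset ha.2 hb.2)⟩
  smul_mem' := fun c η h => by
    have h1 : tsupport (c • η) ⊆ tsupport η := closure_mono fun y hy h0 => hy (by
      change c • η y = 0
      rw [h0]
      exact smul_zero (A := E [⋀^Fin k]→L[ℝ] ℂ) c)
    exact ⟨(chartForms E x₀ k).smul_mem c h.1, h1.trans h.2⟩

/-- In a chart, a current of order `0` with support in the set `S` extends to a functional on the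
continuous forms on the compact sets `K ∩ S`. -/
lemma TestForm.IsOrderZero.exists_functional {k : ℕ} {T : TestForm E M k →ₗ[ℂ] ℂ}
    (hT : IsOrderZero T) {S : Set M} (hTS : currentSupport T ⊆ S) (x₀ : M)
    {K : Set E} (hK : IsCompact K) (hKt : K ⊆ (extChartAt 𝓘(ℝ, E) x₀).target) {X : Set E}
    [CompactSpace X] (hX : ∀ y ∈ K, (extChartAt 𝓘(ℝ, E) x₀).symm y ∈ S → y ∈ X) :
    ∃ Ŝ : C(X, E [⋀^Fin k]→L[ℝ] ℂ) →L[ℂ] ℂ, ∀ η : chartForms E x₀ k, tsupport η.1 ⊆ K →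
      ∀ ηX : C(X, E [⋀^Fin k]→L[ℝ] ℂ), (∀ y, ηX y = η.1 y) → Ŝ ηX = T (pushLinear x₀ k η) := by
  obtain ⟨C, hC, hb⟩ := hT.bound hTS x₀ hK hKt
  let ρ : chartFormsOn x₀ k K →ₗ[ℂ] chartForms E x₀ k := Submodule.inclusion fun η hη => hη.1
  let A : chartFormsOn x₀ k K →ₗ[ℂ] C(X, E [⋀^Fin k]→L[ℝ] ℂ) :=
    { toFun := fun η => ⟨fun y => η.1 y, η.2.1.1.continuous.comp continuous_subtype_val⟩
      map_add' := fun _ _ => rfl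
      map_smul' := fun _ _ => rfl }
  let f : chartFormsOn x₀ k K →ₗ[ℂ] ℂ := (T.comp (pushLinear x₀ k)).comp ρ
  have hf : ∀ η B, 0 ≤ B → (∀ y, ‖A η y‖ ≤ B) → ‖f η‖ ≤ C * B := fun η B hB hAB =>
    hb (ρ η) η.2.2 B hB fun y hy hyS => hAB ⟨y, hX y hy hyS⟩
  have hA : ∀ η, ∀ y, A η y = η.1 y := fun _ _ => rfl
  have hfe : ∀ η, f η = T (pushLinear x₀ k (ρ η)) := fun _ => rfl
  clear_value f A
  obtain ⟨Ŝ, hŜ⟩ := exists_clm_of_bound (W := chartFormsOn x₀ k K) (X := X)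
    (L := E [⋀^Fin k]→L[ℝ] ℂ) (A := A) (f := f) (C := C) hf
  refine ⟨Ŝ, fun η hη ηX hηX => ?_⟩
  have h1 : ηX = A ⟨η.1, η.2, hη⟩ := ContinuousMap.ext fun y => (hηX y).trans (hA ⟨η.1, η.2, hη⟩ y).symm
  rw [h1, hŜ, hfe]
  rfl

lemma TestForm.IsClosedCurrent.vanishesOnExact {k : ℕ} {T : TestForm E M k →ₗ[ℂ] ℂ}
    (hT : IsClosedCurrent T) {x₀ : M} {X U : Set E} [CompactSpace X]
    (hU : U ⊆ (extChartAt 𝓘(ℝ, E) x₀).target) {Ŝ : C(X, E [⋀^Fin k]→L[ℝ] ℂ) →L[ℂ] ℂ}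
    (hŜ : ∀ η : chartForms E x₀ k, tsupport η.1 ⊆ U → ∀ ηX : C(X, E [⋀^Fin k]→L[ℝ] ℂ),
      (∀ y, ηX y = η.1 y) → Ŝ ηX = T (pushLinear x₀ k η)) : VanishesOnExact U Ŝ := by
  rintro m rfl ζ hζ hζc hζU β hβ
  have hmem : ζ ∈ chartForms E x₀ m := ⟨hζ, hζc, hζU.trans hU⟩
  have hs : tsupport (_root_.extDeriv ζ) ⊆ tsupport ζ := by
    refine closure_minimal (fun y hy => ?_) (isClosed_tsupport _)
    by_contra h
    apply hy
    have h2 : ζ =ᶠ[𝓝 y] fun _ => 0 := notMem_tsupport_iff_eventuallyEq.1 h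
    rw [h2.extDeriv_eq, _root_.extDeriv, fderiv_fun_const]
    exact (ContinuousAlternatingMap.alternatizeUncurryFinCLM ℝ E ℂ).map_zero
  rw [hŜ ⟨_root_.extDeriv ζ, extDeriv_mem_chartForms ⟨ζ, hmem⟩⟩ (hs.trans hζU) β fun y =>
    ContinuousAlternatingMap.ext fun v => hβ y v]
  exact hT.apply_extDeriv ⟨ζ, hmem⟩

end ChartFunctional

section FlatForm

variable {E : Type*} [NormedAddCommGroup E] [NormedSpace ℝ E]
  {G : Type*} [NormedAddCommGroup G] [NormedSpace ℝ G]
  {R : Type*} [NormedAddCommGroup R] [NormedSpace ℝ R] {γ : Type*} [TopologicalSpace γ] {k : ℕ}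

open Classical in
/-- The expression of the form `η` in the coordinates `Θ`, extended by `0`. -/
def flatForm {V : Type*} [NormedAddCommGroup V] [NormedSpace ℝ V] (Θ : OpenPartialHomeomorph E V)
    (η : E → E [⋀^Fin k]→L[ℝ] ℂ) (z : V) : V [⋀^Fin k]→L[ℝ] ℂ :=
  if z ∈ Θ.target then (η (Θ.symm z)).compContinuousLinearMap (fderiv ℝ Θ.symm z) else 0

open Classical in
/-- The integral of the form `η` over the plaque of parameter `t`, that is over the part of the leaf
`L_t` that is contained in the flow box. -/
def plaqueIntegral (Θ : OpenPartialHomeomorph E (EuclideanSpace ℝ (Fin k) × (G × R)))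
    (c : OpenPartialHomeomorph γ G) (η : E → E [⋀^Fin k]→L[ℝ] ℂ) (t : γ) : ℂ :=
  if t ∈ c.source then ∫ s, flatForm Θ η (s, (c t, 0)) (flatFrame k (G × R)) else 0

section

variable {V : Type*} [NormedAddCommGroup V] [NormedSpace ℝ V] {Θ : OpenPartialHomeomorph E V}
  {η : E → E [⋀^Fin k]→L[ℝ] ℂ}

lemma flatForm_of_mem {z : V} (hz : z ∈ Θ.target) : flatForm Θ η z =
    (η (Θ.symm z)).compContinuousLinearMap (fderiv ℝ Θ.symm z) := if_pos hz

lemma tsupport_flatForm_subset (hη : HasCompactSupport η) (hs : tsupport η ⊆ Θ.source) :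
    tsupport (flatForm Θ η) ⊆ Θ '' tsupport η := by
  refine closure_minimal (fun z hz => ?_)
    (hη.image_of_continuousOn (Θ.continuousOn.mono hs)).isClosed
  by_cases hzt : z ∈ Θ.target
  · refine ⟨Θ.symm z, subset_tsupport _ fun h0 => hz ?_, Θ.right_inv hzt⟩
    rw [flatForm_of_mem hzt, h0]; rfl
  · exact absurd (if_neg hzt) hz

lemma hasCompactSupport_flatForm (hη : HasCompactSupport η) (hs : tsupport η ⊆ Θ.source) :
    HasCompactSupport (flatForm Θ η) :=
  (hη.image_of_continuousOn (Θ.continuousOn.mono hs)).of_isClosed_subset (isClosed_tsupport _)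
    (tsupport_flatForm_subset hη hs)

lemma continuous_flatForm [FiniteDimensional ℝ E] [FiniteDimensional ℝ V] (hΘ : Θ.IsC1)
    (hη : HasCompactSupport η) (hηc : Continuous η)
    (hs : tsupport η ⊆ Θ.source) : Continuous (flatForm Θ η) := by
  rw [continuous_iff_continuousAt]
  intro z
  by_cases hz : z ∈ Θ.target
  · have h1 : ContinuousOn (fun z => (η (Θ.symm z)).compContinuousLinearMap (fderiv ℝ Θ.symm z))
        Θ.target := (hηc.comp_continuousOn Θ.continuousOn_symm).form_comp_clm
      (hΘ.contDiffOn_symm.continuousOn_fderiv_of_isOpen Θ.open_target le_rfl)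
    refine (h1.continuousAt (Θ.open_target.mem_nhds hz)).congr ?_
    filter_upwards [Θ.open_target.mem_nhds hz] with w hw using (flatForm_of_mem hw).symm
  · have h2 : flatForm Θ η =ᶠ[𝓝 z] fun _ => 0 := notMem_tsupport_iff_eventuallyEq.1 fun h => by
      obtain ⟨y, hy, rfl⟩ := tsupport_flatForm_subset hη hs h
      exact hz (Θ.map_source (hs hy))
    exact (continuousAt_const (y := (0 : V [⋀^Fin k]→L[ℝ] ℂ))).congr h2.symm

end

end FlatForm

section LocalStructure

variable {E : Type*} [NormedAddCommGroup E] [NormedSpace ℝ E] [FiniteDimensional ℝ E]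
  {M : Type*} [TopologicalSpace M] [T2Space M] [SecondCountableTopology M] [ChartedSpace E M]
  [IsManifold 𝓘(ℝ, E) ∞ M]
  {E' : Type*} [NormedAddCommGroup E'] [NormedSpace ℝ E']
  {N : Type*} [TopologicalSpace N] [ChartedSpace E' N] [IsManifold 𝓘(ℝ, E') 1 N]
  {G : Type*} [NormedAddCommGroup G] [NormedSpace ℝ G] [FiniteDimensional ℝ G]
  {γ : Type*} [TopologicalSpace γ] [ChartedSpace G γ] [IsManifold 𝓘(ℝ, G) 1 γ]
  {R : Type*} [NormedAddCommGroup R] [NormedSpace ℝ R] [FiniteDimensional ℝ R]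
  (J : AlmostComplexStructure E M) {ι : N → M} {F : N → γ} {x₀ : M} {p : ℕ}
  {Θ : OpenPartialHomeomorph E (EuclideanSpace ℝ (Fin (2 * p)) × (G × R))}
  {c : OpenPartialHomeomorph γ G}

/-- Near a point of `ι(N)`, a closed current of order `0` and bidimension `(p,p)` with support in
`ι(N)` is an integral of plaques. -/
theorem IsFlowBox.exists_local_measure (h : IsFlowBox E' ι F x₀ Θ c)
    (hcomplex : ∀ x : N, ∀ v ∈ leafTangent E E' G ι F x,
      J.toFun (ι x) v ∈ leafTangent E E' G ι F x)
    (hCR : IsCRSubmanifold E' J ι p)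
    (hdim : ∀ x : N, finrank ℝ (leafTangent E E' G ι F x) = 2 * p)
    {T : TestForm E M (2 * p) →ₗ[ℂ] ℂ} (hT : TestForm.IsOrderZero T)
    (hTJ : ∀ φ, T (TestForm.compJ J φ) = T φ) (hTc : TestForm.IsClosedCurrent T)
    (hTs : TestForm.currentSupport T ⊆ range ι) {n : N}
    (hn : ι n ∈ (extChartAt 𝓘(ℝ, E) x₀).source)
    (hn' : extChartAt 𝓘(ℝ, E) x₀ (ι n) ∈ Θ.source) :
    ∃ W ⊆ Θ.source, IsOpen W ∧ extChartAt 𝓘(ℝ, E) x₀ (ι n) ∈ W ∧ ∃ ν : ComplexRadonMeasure γ,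
      ∀ η : chartForms E x₀ (2 * p), tsupport η.1 ⊆ W → ∀ f : C_c(γ, ℂ),
        (∀ t, f t = plaqueIntegral Θ c η.1 t) → T (pushLinear x₀ (2 * p) η) = ν.integral f := by
  set y₀ := extChartAt 𝓘(ℝ, E) x₀ (ι n) with hy₀
  obtain ⟨hFc, hΘy₀⟩ := h.map_eq n hn hn'
  have hz0 : (Θ y₀).2.2 = 0 := by rw [hΘy₀]
  -- the functional on a compact neighbourhood of the point
  obtain ⟨r, hr, hrs⟩ := Metric.nhds_basis_closedBall.mem_iff.1 (Θ.open_source.mem_nhds hn')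
  let K : Set E := Metric.closedBall y₀ r
  have hK : IsCompact K := isCompact_closedBall _ _
  let X : Set E := {y ∈ K | (Θ y).2.2 = 0}
  have hXK : X ⊆ K := fun y hy => hy.1
  have hXc : IsCompact X := by
    have h1 : ContinuousOn (fun y => (Θ y).2.2) K := (Θ.continuousOn.mono hrs).snd.snd
    exact hK.of_isClosed_subset
      (h1.preimage_isClosed_of_isClosed hK.isClosed (isClosed_singleton (x := (0 : R)))) hXK
  have : CompactSpace X := isCompact_iff_compactSpace.1 hXc
  have hKt : K ⊆ (extChartAt 𝓘(ℝ, E) x₀).target := hrs.trans h.source_subset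
  obtain ⟨S, hS⟩ := hT.exists_functional hTs x₀ hK hKt (X := X) (by
    rintro y hy ⟨m, hm⟩
    have hm1 : extChartAt 𝓘(ℝ, E) x₀ (ι m) = y := by
      rw [hm, (extChartAt 𝓘(ℝ, E) x₀).right_inv (hKt hy)]
    have h1 := (h.map_eq m (hm ▸ (extChartAt 𝓘(ℝ, E) x₀).map_target (hKt hy))
      (hm1 ▸ hrs hy)).2
    rw [hm1] at h1
    exact ⟨hy, by rw [h1]⟩)
  let U : Set E := Metric.ball y₀ r
  have hUK : U ⊆ K := Metric.ball_subset_closedBall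
  have hexact : VanishesOnExact U S := hTc.vanishesOnExact (hUK.trans hKt)
    fun η hη => hS η (hη.trans hUK)
  -- the functional in the coordinates `Θ`
  let X' : Set (EuclideanSpace ℝ (Fin (2 * p)) × (G × R)) := Θ '' X
  have : CompactSpace X' := isCompact_iff_compactSpace.1
    (hXc.image_of_continuousOn (Θ.continuousOn.mono (hXK.trans hrs)))
  let θ : C(X, X') := ⟨fun y => ⟨Θ y, y, y.2, rfl⟩, Continuous.subtype_mk
    (continuousOn_iff_continuous_domRestrict.1 (Θ.continuousOn.mono (hXK.trans hrs))) _⟩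
  let D : C(X, E →L[ℝ] EuclideanSpace ℝ (Fin (2 * p)) × (G × R)) := ⟨fun y => fderiv ℝ Θ y,
    continuousOn_iff_continuous_domRestrict.1
      ((h.isC1.contDiffOn.continuousOn_fderiv_of_isOpen Θ.open_source le_rfl).mono
        (hXK.trans hrs))⟩
  let O := Θ.target ∩ Θ.symm ⁻¹' U
  have hO : IsOpen O := Θ.isOpen_inter_preimage_symm Metric.isOpen_ball
  have hclosed : IsClosedFunctional O (S.comp (pullbackCLM θ D)) :=
    hexact.isClosedFunctional Metric.isOpen_ball h.isC1 (hXK.trans hrs)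
      (fun _ => rfl) (fun _ => rfl)
  -- the almost complex structure in the coordinates `Θ`
  let Ĵ : EuclideanSpace ℝ (Fin (2 * p)) × (G × R) →
      (EuclideanSpace ℝ (Fin (2 * p)) × (G × R) →L[ℝ] EuclideanSpace ℝ (Fin (2 * p)) × (G × R)) :=
    fun z => (fderiv ℝ Θ (Θ.symm z)).comp ((jChart J x₀ (Θ.symm z)).comp (fderiv ℝ Θ.symm z))
  have hOs : ∀ z ∈ O, Θ.symm z ∈ Θ.source := fun z hz => Θ.map_target hz.1
  have hJcont : ContinuousOn (jChart J x₀) (extChartAt 𝓘(ℝ, E) x₀).target :=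
    (contDiffOn_jChart J x₀).continuousOn
  have hsymmO : ContinuousOn Θ.symm O := Θ.continuousOn_symm.mono inter_subset_left
  have hĴ : ContinuousOn Ĵ O := by
    refine ContinuousOn.clm_comp ?_ (ContinuousOn.clm_comp ?_ ?_)
    · exact (h.isC1.contDiffOn.continuousOn_fderiv_of_isOpen Θ.open_source le_rfl).comp hsymmO hOs
    · exact hJcont.comp hsymmO fun z hz => h.source_subset (hOs z hz)
    · exact (h.isC1.contDiffOn_symm.continuousOn_fderiv_of_isOpen Θ.open_target le_rfl).mono
        inter_subset_left
  have hJH : ∀ z ∈ O, z.2.2 = 0 → ∀ v : EuclideanSpace ℝ (Fin (2 * p)), (Ĵ z (v, 0)).2 = 0 := by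
    intro z hz hz0 v
    refine h.fderiv_jChart_snd J hcomplex (hOs z hz) (by rwa [Θ.right_inv hz.1]) ?_
    exact congrArg Prod.snd (h.isC1.fderiv_fderiv_symm hz.1 (v, 0))
  have hJW : ∀ z ∈ O, z.2.2 = 0 → ∀ w : EuclideanSpace ℝ (Fin (2 * p)) × (G × R), w.2.2 = 0 →
      (Ĵ z w).2.2 = 0 → w.2 = 0 := by
    intro z hz hz0 w hw hw'
    have h1 := h.fderiv_snd_eq_zero J hcomplex hCR hdim (hOs z hz) (by rwa [Θ.right_inv hz.1])
      (v := fderiv ℝ Θ.symm z w) (by rwa [h.isC1.fderiv_fderiv_symm hz.1]) hw'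
    rwa [h.isC1.fderiv_fderiv_symm hz.1] at h1
  have hJS : ∀ β : EuclideanSpace ℝ (Fin (2 * p)) × (G × R) →
      (EuclideanSpace ℝ (Fin (2 * p)) × (G × R)) [⋀^Fin (2 * p)]→L[ℝ] ℂ, Continuous β →
      HasCompactSupport β → tsupport β ⊆ O →
      ∀ βX βX' : C(X', (EuclideanSpace ℝ (Fin (2 * p)) × (G × R)) [⋀^Fin (2 * p)]→L[ℝ] ℂ),
      (∀ z, βX z = β z) → (∀ z v, βX' z v = β z (fun i => Ĵ z (v i))) →
      (S.comp (pullbackCLM θ D)) βX' = (S.comp (pullbackCLM θ D)) βX := by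
    intro β hβ hβc hβO βX βX' hβX hβX'
    have hβs : tsupport β ⊆ Θ.symm.source := fun z hz => (hβO hz).1
    have hval : ∀ y : X, flatForm Θ.symm β y =
        (β (Θ y)).compContinuousLinearMap (fderiv ℝ Θ y) := fun y => by
      have := flatForm_of_mem (Θ := Θ.symm) (η := β) (z := (y : E)) (hrs (hXK y.2))
      simpa using this
    refine apply_comp_eq_of_smooth (A := jChart J x₀) Metric.isOpen_ball
      (hJcont.mono (hUK.trans hKt)) ?_ (continuous_flatForm h.isC1.symm hβc hβ hβs)
      (hasCompactSupport_flatForm hβc hβs) ((tsupport_flatForm_subset hβc hβs).trans ?_)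
      (pullbackCLM θ D βX) (pullbackCLM θ D βX') (fun y => ?_) fun y v => ?_
    · intro η hη hηc hηU ηX ηX' hηX hηX'
      have hmem : η ∈ chartForms E x₀ (2 * p) := ⟨hη, hηc, hηU.trans (hUK.trans hKt)⟩
      have hs : tsupport (fun y => (η y).compContinuousLinearMap (jChart J x₀ y)) ⊆ K :=
        (closure_mono (support_form_comp_subset η _)).trans (hηU.trans hUK)
      rw [hS ⟨η, hmem⟩ (hηU.trans hUK) ηX hηX,
        hS ⟨_, compJ_mem_chartForms J ⟨η, hmem⟩⟩ hs ηX' fun y =>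
          ContinuousAlternatingMap.ext fun v => hηX' y v,
        ← TestForm.compJ_pushLinear, hTJ]
    · rintro _ ⟨z, hz, rfl⟩
      exact (hβO hz).2
    · rw [hval]
      refine ContinuousAlternatingMap.ext fun v => ?_
      rw [pullbackCLM_apply, hβX]; rfl
    · rw [hval, pullbackCLM_apply, hβX']
      change β (Θ y) (fun i => Ĵ (Θ y) (fderiv ℝ Θ y (v i))) =
        β (Θ y) fun i => fderiv ℝ Θ y (jChart J x₀ y (v i))
      congr 1
      funext i
      simp only [Ĵ, ContinuousLinearMap.comp_apply, Θ.left_inv (hrs (hXK y.2)),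
        h.isC1.fderiv_symm_fderiv (hrs (hXK y.2))]
  obtain ⟨ε, hε, hεO, σ, hσ⟩ := hclosed.exists_transverse (X := X') (z₀ := Θ y₀)
    (by rintro _ ⟨y, hy, rfl⟩; exact hy.2) hO Ĵ hĴ hJS hJH hJW
    ⟨Θ.map_source hn', by
      change Θ.symm (Θ y₀) ∈ Metric.ball y₀ r
      rw [Θ.left_inv hn']; exact Metric.mem_ball_self hr⟩ hz0
  -- the transverse measure is transported to `γ` by the chart `c`
  have hτ : (Θ y₀).2.1 ∈ c.target := by rw [hΘy₀]; exact c.map_source hFc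
  obtain ⟨δ', hδ', hδs'⟩ := Metric.isOpen_iff.1 c.open_target _ hτ
  let δ := min ε δ'
  have hδ : 0 < δ := lt_min hε hδ'
  let B : Set (EuclideanSpace ℝ (Fin (2 * p)) × (G × R)) :=
    Metric.ball (Θ y₀).1 (δ / 2) ×ˢ Metric.ball (Θ y₀).2 (δ / 2)
  have hBε : B ⊆ Metric.ball (Θ y₀).1 ε ×ˢ Metric.ball (Θ y₀).2 ε := by
    have : δ / 2 ≤ ε := (half_le_self hδ.le).trans (min_le_left _ _)
    exact prod_mono (Metric.ball_subset_ball this) (Metric.ball_subset_ball this)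
  obtain ⟨χ, hχ, -, hχU, hχ1, hχI⟩ := exists_contDiff_one_nhds
    (isCompact_closedBall (Θ y₀).2.1 (δ / 2)) (Metric.isOpen_ball (x := (Θ y₀).2.1) (ε := δ))
    (Metric.closedBall_subset_ball (half_lt_self hδ))
  have hχc : tsupport χ ⊆ c.target :=
    hχU.trans ((Metric.ball_subset_ball (min_le_right _ _)).trans hδs')
  have hcont : ∀ f : C_c(γ, ℂ), Continuous fun τ : G => (χ τ : ℂ) * f (c.symm τ) := fun f => by
    rw [continuous_iff_continuousAt]
    intro τ
    by_cases hτ : τ ∈ c.target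
    · exact (Complex.continuous_ofReal.comp hχ.continuous).continuousAt.mul
        (f.continuous.continuousAt.comp (c.continuousAt_symm hτ))
    · have h1 : χ =ᶠ[𝓝 τ] fun _ => 0 := notMem_tsupport_iff_eventuallyEq.1 fun h => hτ (hχc h)
      refine (continuousAt_const (y := (0 : ℂ))).congr ?_
      filter_upwards [h1] with z hz
      rw [hz]; simp
  let Q : C_c(γ, ℂ) →ₗ[ℂ] C(X', ℂ) :=
    { toFun := fun f => ⟨fun z => (χ z.1.2.1 : ℂ) * f (c.symm z.1.2.1), (hcont f).comp
        (continuous_fst.comp (continuous_snd.comp continuous_subtype_val))⟩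
      map_add' := fun f g => by
        ext z
        exact mul_add _ _ _
      map_smul' := fun a f => by
        ext z
        exact mul_left_comm _ _ _ }
  let ν : ComplexRadonMeasure γ :=
    { integral := σ.toLinearMap.comp Q
      bounded := fun L _ => ⟨‖σ‖, fun f _ b hb hfb => by
        refine (σ.le_opNorm _).trans (mul_le_mul_of_nonneg_left ?_ (norm_nonneg _))
        refine (ContinuousMap.norm_le _ hb).2 fun z => ?_
        change ‖(χ z.1.2.1 : ℂ) * f (c.symm z.1.2.1)‖ ≤ b
        rw [norm_mul, Complex.norm_real, Real.norm_of_nonneg (hχI _).1]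
        exact (mul_le_of_le_one_left (norm_nonneg _) (hχI _).2).trans (hfb _)⟩ }
  refine ⟨Θ.source ∩ Θ ⁻¹' B, inter_subset_left, Θ.isOpen_inter_preimage
    (Metric.isOpen_ball.prod Metric.isOpen_ball), ⟨hn', Metric.mem_ball_self (half_pos hδ),
    Metric.mem_ball_self (half_pos hδ)⟩, ν, fun η hη f hf => ?_⟩
  have hηs : tsupport η.1 ⊆ Θ.source := hη.trans inter_subset_left
  let β := flatForm Θ η.1
  have hβB : tsupport β ⊆ B := (tsupport_flatForm_subset η.2.2.1 hηs).trans (by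
    rintro _ ⟨y, hy, rfl⟩; exact (hη hy).2)
  have hβc : Continuous β := continuous_flatForm h.isC1 η.2.2.1 η.2.1.continuous hηs
  have hβ0 : ∀ τ ∉ Metric.ball (Θ y₀).2.1 (δ / 2), ∀ s, β (s, (τ, 0)) = 0 := fun τ hτ s => by
    by_contra h0
    refine hτ ?_
    have h1 := (hβB (subset_tsupport _ h0)).2
    rw [Metric.mem_ball] at h1 ⊢
    exact lt_of_le_of_lt (le_max_left _ _) h1
  have hUO : tsupport η.1 ⊆ K := fun y hy => by
    have h1 : Θ y ∈ O := hεO (hBε (hη hy).2)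
    have h2 : Θ.symm (Θ y) ∈ U := h1.2
    rw [Θ.left_inv (hηs hy)] at h2
    exact hUK h2
  let βX : C(X', (EuclideanSpace ℝ (Fin (2 * p)) × (G × R)) [⋀^Fin (2 * p)]→L[ℝ] ℂ) :=
    ⟨fun z => β z, hβc.comp continuous_subtype_val⟩
  have h1 := hσ β hβc (hβB.trans hBε) βX (Q f) (fun _ => rfl) (by
    rintro ⟨_, y, hy, rfl⟩
    have hy0 : (Θ y).2 = ((Θ y).2.1, 0) := Prod.ext rfl hy.2
    change (χ (Θ y).2.1 : ℂ) * f (c.symm (Θ y).2.1) = ∫ s, β (s, (Θ y).2) (flatFrame (2 * p) (G × R))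
    rw [hy0]
    by_cases hτ : (Θ y).2.1 ∈ Metric.ball (Θ y₀).2.1 (δ / 2)
    · have h2 : χ (Θ y).2.1 = 1 := (hχ1 _ (Metric.ball_subset_closedBall hτ)).self_of_nhds
      have h3 : (Θ y).2.1 ∈ c.target := hχc (subset_tsupport _ (by
        rw [Function.mem_support, h2]; exact one_ne_zero))
      rw [h2, hf, plaqueIntegral, if_pos (c.map_target h3), c.right_inv h3]
      simp [β]
    · have h4 : ∫ s, β (s, ((Θ y).2.1, 0)) (flatFrame (2 * p) (G × R)) = 0 := by
        simp only [hβ0 _ hτ]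
        exact integral_zero _ _
      rw [h4]
      by_cases h3 : (Θ y).2.1 ∈ c.target
      · rw [hf, plaqueIntegral, if_pos (c.map_target h3), c.right_inv h3]
        exact mul_eq_zero_of_right _ h4
      · have h2 : χ (Θ y).2.1 = 0 := by
          by_contra h2
          exact h3 (hχc (subset_tsupport _ h2))
        rw [h2]; simp)
  refine Eq.trans ?_ h1
  refine (hS η hUO _ fun y => ContinuousAlternatingMap.ext fun v => ?_).symm
  have hys : (y : E) ∈ Θ.source := hrs (hXK y.2)
  change flatForm Θ η.1 (Θ y) (fun i => fderiv ℝ Θ y (v i)) = η.1 y v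
  rw [flatForm_of_mem (Θ.map_source hys), Θ.left_inv hys]
  change η.1 y (fun i => fderiv ℝ Θ.symm (Θ y) (fderiv ℝ Θ y (v i))) = _
  simp only [h.isC1.fderiv_symm_fderiv hys]

end LocalStructure

/-! ### Integration over a leaf in a flow box -/

section PlaqueIntegral

lemma ContinuousAlternatingMap.apply_linearCombination {V : Type*} [NormedAddCommGroup V]
    [NormedSpace ℝ V] {k : ℕ} (φ : V [⋀^Fin k]→L[ℝ] ℂ) (v w : Fin k → V)
    (A : Matrix (Fin k) (Fin k) ℝ) (h : ∀ i, v i = ∑ j, A i j • w j) : φ v = A.det • φ w := by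
  have h1 : φ.toAlternatingMap.compLinearMap (Fintype.linearCombination ℝ w) =
      ((LinearMap.toSpanSingleton ℝ ℂ (φ w)).compAlternatingMap Matrix.detRowAlternating) := by
    refine (Pi.basisFun ℝ (Fin k)).ext_alternating fun s hs => ?_
    obtain ⟨σ, rfl⟩ : ∃ σ : Equiv.Perm (Fin k), s = σ :=
      ⟨Equiv.ofBijective s (Finite.injective_iff_bijective.1 hs), rfl⟩
    have h2 := AlternatingMap.map_perm
      (φ.toAlternatingMap.compLinearMap (Fintype.linearCombination ℝ w)) (Pi.basisFun ℝ (Fin k)) σ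
    have h3 := AlternatingMap.map_perm ((LinearMap.toSpanSingleton ℝ ℂ (φ w)).compAlternatingMap
      Matrix.detRowAlternating) (Pi.basisFun ℝ (Fin k)) σ
    refine h2.trans (Eq.trans ?_ h3.symm)
    congr 1
    have h4 : Matrix.detRowAlternating (Pi.basisFun ℝ (Fin k)) = (1 : ℝ) := by
      rw [← Pi.basisFun_det]; exact Basis.det_self _
    rw [LinearMap.compAlternatingMap_apply, h4, LinearMap.toSpanSingleton_apply, one_smul]
    change φ (fun i => Fintype.linearCombination ℝ w (Pi.basisFun ℝ (Fin k) i)) = φ w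
    congr 1
    funext i
    simp [Fintype.linearCombination_apply, Pi.single_apply]
  have h2 := DFunLike.congr_fun h1 A
  have h3 : v = fun i => Fintype.linearCombination ℝ w (A i) := funext fun i => by
    rw [h, Fintype.linearCombination_apply]
  rw [h3]
  exact h2

variable {E : Type*} [NormedAddCommGroup E] [NormedSpace ℝ E] [FiniteDimensional ℝ E]
  {M : Type*} [TopologicalSpace M] [T2Space M] [ChartedSpace E M]
  [IsManifold 𝓘(ℝ, E) ∞ M]
  {E' : Type*} [NormedAddCommGroup E'] [NormedSpace ℝ E']
  {N : Type*} [TopologicalSpace N] [ChartedSpace E' N] [IsManifold 𝓘(ℝ, E') 1 N]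
  {G : Type*} [NormedAddCommGroup G] [NormedSpace ℝ G] [FiniteDimensional ℝ G]
  {γ : Type*} [TopologicalSpace γ] [ChartedSpace G γ] [IsManifold 𝓘(ℝ, G) 1 γ]
  {R : Type*} [NormedAddCommGroup R] [NormedSpace ℝ R] [FiniteDimensional ℝ R]
  (J : AlmostComplexStructure E M) {ι : N → M} {F : N → γ} {x₀ : M} {p : ℕ}
  {Θ : OpenPartialHomeomorph E (EuclideanSpace ℝ (Fin (2 * p)) × (G × R))}
  {c : OpenPartialHomeomorph γ G}

lemma integrable_flatForm_slice {k : ℕ}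
    {Θ : OpenPartialHomeomorph E (EuclideanSpace ℝ (Fin k) × (G × R))} (hΘ : Θ.IsC1)
    {η : E → E [⋀^Fin k]→L[ℝ] ℂ} (hη : HasCompactSupport η) (hηc : Continuous η)
    (hs : tsupport η ⊆ Θ.source) (a : G × R) :
    Integrable fun s => flatForm Θ η (s, a) (flatFrame k (G × R)) := by
  have h1 : Continuous fun s => flatForm Θ η (s, a) (flatFrame k (G × R)) :=
    (evalForm (flatFrame k (G × R))).continuous.comp
      ((continuous_flatForm hΘ hη hηc hs).comp (Continuous.prodMk_left a))
  refine h1.integrable_of_hasCompactSupport (HasCompactSupport.intro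
    ((hasCompactSupport_flatForm hη hs).isCompact.image continuous_fst) fun s hs' => ?_)
  have h2 : flatForm Θ η (s, a) = 0 := by
    by_contra h0
    exact hs' ⟨_, subset_tsupport _ h0, rfl⟩
  rw [h2]; rfl

/-- The derivative of a map into `M`, as a linear map into the model space `E`. -/
def dParam {D : Type*} [NormedAddCommGroup D] [NormedSpace ℝ D] (u : D → M) (y : D) : D →L[ℝ] E :=
  mfderiv 𝓘(ℝ, D) 𝓘(ℝ, E) u y

lemma hasFDerivAt_chart_comp {D : Type*} [NormedAddCommGroup D] [NormedSpace ℝ D] {u : D → M}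
    {y : D} (hu : MDifferentiableAt 𝓘(ℝ, D) 𝓘(ℝ, E) u y)
    (hy : u y ∈ (extChartAt 𝓘(ℝ, E) x₀).source) :
    HasFDerivAt (fun z => extChartAt 𝓘(ℝ, E) x₀ (u z))
      ((dChart (E := E) x₀ (u y)).comp (dParam (E := E) u y)) y := by
  have := isManifold_one_of_infty (E := E) (M := M)
  have h1 : MDifferentiableAt 𝓘(ℝ, E) 𝓘(ℝ, E) (extChartAt 𝓘(ℝ, E) x₀) (u y) :=
    mdifferentiableAt_extChartAt (by rwa [extChartAt_source] at hy)
  exact (HasMFDerivAt.comp (I' := 𝓘(ℝ, E)) y h1.hasMFDerivAt hu.hasMFDerivAt).hasFDerivAt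

lemma pushForm_dParam {k : ℕ} (η : E → E [⋀^Fin k]→L[ℝ] ℂ) {D : Type*} [NormedAddCommGroup D]
    [NormedSpace ℝ D] {u : D → M} {y : D} (hu : MDifferentiableAt 𝓘(ℝ, D) 𝓘(ℝ, E) u y)
    (hy : u y ∈ (extChartAt 𝓘(ℝ, E) x₀).source) (v : Fin k → D) :
    pushForm x₀ η (u y) (fun i => mfderiv 𝓘(ℝ, D) 𝓘(ℝ, E) u y (v i)) =
      η (extChartAt 𝓘(ℝ, E) x₀ (u y))
        fun i => fderiv ℝ (fun z => extChartAt 𝓘(ℝ, E) x₀ (u z)) y (v i) := by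
  rw [(hasFDerivAt_chart_comp hu hy).fderiv]
  exact DFunLike.congr_fun (pushForm_of_mem (η := η) hy) fun i => dParam (E := E) u y (v i)

/-- In a flow box, the integral of a form over a leaf can be computed with any oriented
parametrization of the leaf: the change of parameters `τ` has positive Jacobian determinant. -/
theorem IsOrientedFlowBox.plaqueIntegral_eq (h : IsOrientedFlowBox E' J p ι F x₀ Θ c) {t : γ}
    {V : Set (EuclideanSpace ℝ (Fin (2 * p)))} {u : EuclideanSpace ℝ (Fin (2 * p)) → M}
    (hu : IsOrientedParametrization J p (leaf ι F t) V u) (η : chartForms E x₀ (2 * p))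
    (hη : tsupport η.1 ⊆ Θ.source)
    (hs : formSupport (pushLinear x₀ (2 * p) η).1 ∩ leaf ι F t ⊆ u '' V) :
    IntegrableOn (fun y => (pushLinear x₀ (2 * p) η).1 (u y) (fun i =>
      mfderiv 𝓘(ℝ, EuclideanSpace ℝ (Fin (2 * p))) 𝓘(ℝ, E) u y
        (EuclideanSpace.single i (1 : ℝ)))) V ∧
    plaqueIntegral Θ c η.1 t = ∫ y in V, (pushLinear x₀ (2 * p) η).1 (u y) (fun i =>
      mfderiv 𝓘(ℝ, EuclideanSpace ℝ (Fin (2 * p))) 𝓘(ℝ, E) u y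
        (EuclideanSpace.single i (1 : ℝ))) := by
  set e := extChartAt 𝓘(ℝ, E) x₀ with he
  have huc : ContinuousOn u V := hu.contMDiffOn.continuousOn
  have hud : ∀ y ∈ V, MDifferentiableAt 𝓘(ℝ, EuclideanSpace ℝ (Fin (2 * p))) 𝓘(ℝ, E) u y :=
    fun y hy => (hu.contMDiffOn.contMDiffAt (hu.isOpen.mem_nhds hy)).mdifferentiableAt one_ne_zero
  let V' : Set (EuclideanSpace ℝ (Fin (2 * p))) := V ∩ u ⁻¹' (e.source ∩ e ⁻¹' Θ.source)
  have hbox : IsOpen (e.source ∩ e ⁻¹' Θ.source) :=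
    (continuousOn_extChartAt x₀).isOpen_inter_preimage (isOpen_extChartAt_source x₀) Θ.open_source
  have hV' : IsOpen V' := huc.isOpen_inter_preimage hu.isOpen hbox
  have hleaf : ∀ y ∈ V, u y ∈ leaf ι F t := fun y hy => by
    obtain ⟨W, -, hW⟩ := hu.image_open V subset_rfl hu.isOpen
    exact (hW.subset (mem_image_of_mem u hy)).1
  have hsnd : ∀ y ∈ V', t ∈ c.source ∧ (Θ (e (u y))).2 = (c t, 0) := by
    rintro y ⟨hy, hy1, hy2⟩
    obtain ⟨n, rfl, hn⟩ := hleaf y hy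
    have := h.map_eq n (by rw [hn]; exact hy1) (by rw [hn]; exact hy2)
    rwa [hn] at this
  let û : EuclideanSpace ℝ (Fin (2 * p)) → E := fun z => e (u z)
  have hû : ∀ y ∈ V', DifferentiableAt ℝ û y := fun y hy =>
    (hasFDerivAt_chart_comp (hud y hy.1) hy.2.1).differentiableAt
  -- `τ` is the change of parameters between `u` and the flow box
  let τ : EuclideanSpace ℝ (Fin (2 * p)) → EuclideanSpace ℝ (Fin (2 * p)) := fun y => (Θ (û y)).1
  let L : EuclideanSpace ℝ (Fin (2 * p)) →
      (EuclideanSpace ℝ (Fin (2 * p)) →L[ℝ] EuclideanSpace ℝ (Fin (2 * p)) × (G × R)) :=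
    fun y => (fderiv ℝ Θ (û y)).comp (fderiv ℝ û y)
  have hL : ∀ y ∈ V', HasFDerivAt (fun y => Θ (û y)) (L y) y := fun y hy =>
    (h.isC1.differentiableAt hy.2.2).hasFDerivAt.comp y (hû y hy).hasFDerivAt
  let τ' : EuclideanSpace ℝ (Fin (2 * p)) →
      (EuclideanSpace ℝ (Fin (2 * p)) →L[ℝ] EuclideanSpace ℝ (Fin (2 * p))) :=
    fun y => (ContinuousLinearMap.fst ℝ _ _).comp (L y)
  have hτ' : ∀ y ∈ V', HasFDerivAt τ (τ' y) y := fun y hy => (hL y hy).fst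
  have hL2 : ∀ y ∈ V', ∀ v, (L y v).2 = 0 := fun y hy v => by
    have h1 : HasFDerivAt (fun y => (Θ (û y)).2) ((ContinuousLinearMap.snd ℝ _ _).comp (L y)) y :=
      (hL y hy).snd
    have h2 : HasFDerivAt (fun y => (Θ (û y)).2) (0 : _ →L[ℝ] G × R) y := by
      refine (hasFDerivAt_const ((c t, 0) : G × R) y).congr_of_eventuallyEq ?_
      filter_upwards [hV'.mem_nhds hy] with z hz using (hsnd z hz).2
    exact DFunLike.congr_fun (h1.unique h2) v
  have hτinj : InjOn τ V' := fun y hy z hz hyz => by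
    have h1 : Θ (e (u y)) = Θ (e (u z)) :=
      Prod.ext hyz ((hsnd y hy).2.trans (hsnd z hz).2.symm)
    exact hu.injOn hy.1 hz.1 (e.injOn hy.2.1 hz.2.1 (Θ.injOn hy.2.2 hz.2.2 h1))
  -- the coefficients of the form in the two parametrizations
  have hcoef : ∀ y ∈ V', (pushLinear x₀ (2 * p) η).1 (u y) (fun i =>
      mfderiv 𝓘(ℝ, EuclideanSpace ℝ (Fin (2 * p))) 𝓘(ℝ, E) u y
        (EuclideanSpace.single i (1 : ℝ))) =
      |(τ' y).det| • flatForm Θ η.1 (τ y, (c t, 0)) (flatFrame (2 * p) (G × R)) := fun y hy => by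
    have hz : Θ (û y) = (τ y, (c t, 0)) := Prod.ext rfl (hsnd y hy).2
    have hz0 : (Θ (û y)).2.2 = 0 := by rw [hz]
    let A : Matrix (Fin (2 * p)) (Fin (2 * p)) ℝ :=
      Matrix.of fun i j => τ' y (EuclideanSpace.single i 1) j
    have hA : ∀ i, fderiv ℝ û y (EuclideanSpace.single i 1) =
        ∑ j, A i j • fderiv ℝ Θ.symm (Θ (û y)) (flatFrame (2 * p) (G × R) j) := fun i => by
      have h1 : L y (EuclideanSpace.single i 1) = ∑ j, A i j • flatFrame (2 * p) (G × R) j := by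
        refine Prod.ext ?_ ?_
        · rw [Prod.fst_sum]
          ext k
          simp [flatFrame, A, τ', WithLp.ofLp_sum, Finset.sum_apply, Pi.single_apply]
        · rw [Prod.snd_sum, hL2 y hy]
          simp [flatFrame]
      calc _ = fderiv ℝ Θ.symm (Θ (û y)) (L y (EuclideanSpace.single i 1)) :=
            (h.isC1.fderiv_symm_fderiv hy.2.2 _).symm
        _ = _ := by rw [h1, map_sum]; simp only [map_smul]
    have hAdet : A.det = (τ' y).det := by
      have h1 : A = (LinearMap.toMatrix (EuclideanSpace.basisFun (Fin (2 * p)) ℝ).toBasis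
          (EuclideanSpace.basisFun (Fin (2 * p)) ℝ).toBasis (τ' y).toLinearMap).transpose := by
        ext i j
        simp [LinearMap.toMatrix_apply, A]
      rw [h1, Matrix.det_transpose, LinearMap.det_toMatrix]
    have hû' : ∀ i, fderiv ℝ û y (EuclideanSpace.single i 1) = dChart (E := E) x₀ (u y)
        (dParam (E := E) u y (EuclideanSpace.single i 1)) := fun i => by
      rw [(hasFDerivAt_chart_comp (hud y hy.1) hy.2.1).fderiv]; rfl
    have hpos : IsPositivelyOriented (jChart J x₀ (û y))
        fun i => fderiv ℝ û y (EuclideanSpace.single i 1) := by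
      have h1 := hu.oriented y hy.1
      have h2 : IsPositivelyOriented (J.toEnd (u y))
        (fun i => dParam (E := E) u y (EuclideanSpace.single i 1)) := h1
      have h3 := h2.map (J' := jChart J x₀ (û y)) (dChart (E := E) x₀ (u y))
        fun v => dChart_toEnd J hy.2.1 v
      simpa only [hû'] using h3
    have hli : LinearIndependent ℝ fun i => fderiv ℝ û y (EuclideanSpace.single i 1) := by
      have h1 : LinearIndependent ℝ (fun i : Fin (2 * p) =>
          (EuclideanSpace.single i 1 : EuclideanSpace ℝ (Fin (2 * p)))) := by
        have h2 := (EuclideanSpace.basisFun (Fin (2 * p)) ℝ).toBasis.linearIndependent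
        have h3 : ⇑(EuclideanSpace.basisFun (Fin (2 * p)) ℝ).toBasis =
            fun i => EuclideanSpace.single i 1 := funext fun i => by simp
        rwa [h3] at h2
      refine h1.map' (fderiv ℝ û y).toLinearMap (LinearMap.ker_eq_bot.2 fun v w hvw => ?_)
      have h2 : fderiv ℝ û y = (dChart (E := E) x₀ (u y)).comp (dParam (E := E) u y) :=
        (hasFDerivAt_chart_comp (hud y hy.1) hy.2.1).fderiv
      have h3 : dChart (E := E) x₀ (u y) (dParam (E := E) u y v) =
          dChart (E := E) x₀ (u y) (dParam (E := E) u y w) := by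
        have h4 : fderiv ℝ û y v = fderiv ℝ û y w := hvw
        rw [h2] at h4
        exact h4
      have h4 := congrArg (dSymm (E := E) x₀ (e (u y))) h3
      rw [dSymm_dChart hy.2.1, dSymm_dChart hy.2.1] at h4
      exact hu.immersion y hy.1 h4
    -- both frames of the leaf are oriented by `J`
    have hdet : 0 < A.det := hpos.det_pos (jChart_sq J (e.map_source hy.2.1))
      (h.oriented _ hy.2.2 hz0) hli A hA
    rw [pushLinear_val, pushForm_dParam η.1 (hud y hy.1) hy.2.1,
      ContinuousAlternatingMap.apply_linearCombination _ _ _ A hA, ← hAdet, abs_of_pos hdet,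
      flatForm_of_mem (hz ▸ Θ.map_source hy.2.2), ← hz, Θ.left_inv hy.2.2]
    rfl
  have hzero : ∀ y ∈ V \ V', (pushLinear x₀ (2 * p) η).1 (u y) (fun i =>
      mfderiv 𝓘(ℝ, EuclideanSpace ℝ (Fin (2 * p))) 𝓘(ℝ, E) u y
        (EuclideanSpace.single i (1 : ℝ))) = 0 := fun y hy => by
    have h1 : (pushLinear x₀ (2 * p) η).1 (u y) = 0 := by
      by_contra h0
      obtain ⟨h2, h3⟩ := pushForm_ne_zero h0
      exact hy.2 ⟨hy.1, h2, hη (subset_tsupport _ h3)⟩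
    rw [h1]; rfl
  have hint : ∫ y in V', (pushLinear x₀ (2 * p) η).1 (u y) (fun i =>
      mfderiv 𝓘(ℝ, EuclideanSpace ℝ (Fin (2 * p))) 𝓘(ℝ, E) u y
        (EuclideanSpace.single i (1 : ℝ))) =
      ∫ s in τ '' V', flatForm Θ η.1 (s, (c t, 0)) (flatFrame (2 * p) (G × R)) := by
    rw [integral_image_eq_integral_abs_det_fderiv_smul volume hV'.measurableSet
      (fun y hy => (hτ' y hy).hasFDerivWithinAt) hτinj]
    exact setIntegral_congr_fun hV'.measurableSet hcoef
  constructor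
  · refine IntegrableOn.of_forall_sdiff_eq_zero ?_ hu.isOpen.measurableSet hzero
    refine ((integrableOn_image_iff_integrableOn_abs_det_fderiv_smul volume hV'.measurableSet
      (fun y hy => (hτ' y hy).hasFDerivWithinAt) hτinj
      fun s => flatForm Θ η.1 (s, (c t, 0)) (flatFrame (2 * p) (G × R))).1
      (integrable_flatForm_slice h.isC1 η.2.2.1 η.2.1.continuous hη _).integrableOn).congr_fun
      (fun y hy => (hcoef y hy).symm) hV'.measurableSet
  refine Eq.trans ?_ (hint.symm.trans (setIntegral_eq_of_subset_of_forall_sdiff_eq_zero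
    hu.isOpen.measurableSet inter_subset_left hzero).symm)
  rw [plaqueIntegral]
  split_ifs with ht
  -- the part of the plaque in the support of the form lies in the image of `u`
  · symm
    refine setIntegral_eq_integral_of_forall_compl_eq_zero fun s hs' => ?_
    by_contra h0
    apply hs'
    by_cases hst : ((s, (c t, 0)) : EuclideanSpace ℝ (Fin (2 * p)) × (G × R)) ∈ Θ.target
    swap
    · exact absurd (by rw [flatForm, if_neg hst]; rfl) h0
    have h1 : η.1 (Θ.symm (s, (c t, 0))) ≠ 0 := fun h1 => h0 (by
      rw [flatForm_of_mem hst, h1]; rfl)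
    have h2 := Θ.map_target hst
    have h3 := Θ.right_inv hst
    have h4 := h.source_subset h2
    obtain ⟨n, hn⟩ := h.exists_eq _ h2 (by rw [h3])
    have hes : e (ι n) = Θ.symm (s, (c t, 0)) := by rw [hn, e.right_inv h4]
    have hns : ι n ∈ e.source := by rw [hn]; exact e.map_target h4
    obtain ⟨h5, h6⟩ := h.map_eq n hns (by rw [← he, hes]; exact h2)
    rw [← he, hes, h3] at h6
    have h7 : F n = t := c.injOn h5 ht (congrArg Prod.fst h6).symm
    have h8 : ι n ∈ formSupport (pushLinear x₀ (2 * p) η).1 := subset_closure fun h9 => by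
      rw [pushLinear_val] at h9
      have h10 := formInChart_eq_zero_of (φ := pushForm x₀ η.1) (x₀ := x₀)
        (y := Θ.symm (s, (c t, 0))) (by rw [← he, ← hn]; exact h9)
      rw [formInChart_pushForm h4] at h10
      exact h1 h10
    obtain ⟨y, hy, hy'⟩ := hs ⟨h8, n, h7, rfl⟩
    refine ⟨y, ⟨hy, by rw [mem_preimage, hy']; exact ⟨hns, by rw [mem_preimage, hes]; exact h2⟩⟩, ?_⟩
    change (Θ (e (u y))).1 = s
    rw [hy', hes, h3]
  · have hV0 : V' = ∅ := eq_empty_of_forall_notMem fun y hy => ht (hsnd y hy).1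
    rw [hV0]; simp

/-- The coordinates of a flow box parametrize the plaques. -/
theorem IsOrientedFlowBox.isOrientedParametrization (h : IsOrientedFlowBox E' J p ι F x₀ Θ c)
    {t : γ} (ht : t ∈ c.source) :
    IsOrientedParametrization J p (leaf ι F t) {s | (s, (c t, 0)) ∈ Θ.target}
      (fun s => (extChartAt 𝓘(ℝ, E) x₀).symm (Θ.symm (s, (c t, 0)))) := by
  have := isManifold_one_of_infty (E := E) (M := M)
  set e := extChartAt 𝓘(ℝ, E) x₀ with he
  set V : Set (EuclideanSpace ℝ (Fin (2 * p))) := {s | (s, (c t, 0)) ∈ Θ.target} with hV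
  set u : EuclideanSpace ℝ (Fin (2 * p)) → M := fun s => e.symm (Θ.symm (s, (c t, 0))) with hu
  have hVo : IsOpen V := Θ.open_target.preimage (Continuous.prodMk_left _)
  have hsrc : ∀ s ∈ V, Θ.symm (s, (c t, 0)) ∈ Θ.source := fun s hs => Θ.map_target hs
  have htgt : ∀ s ∈ V, Θ.symm (s, (c t, 0)) ∈ e.target := fun s hs =>
    h.source_subset (hsrc s hs)
  have hder : ∀ s ∈ V, ∀ v, dParam (E := E) u s v =
      dSymm (E := E) x₀ (Θ.symm (s, (c t, 0))) (fderiv ℝ Θ.symm (s, (c t, 0)) (v, 0)) := by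
    intro s hs v
    have h1 : HasFDerivAt (fun s => Θ.symm (s, (c t, 0)))
        ((fderiv ℝ Θ.symm (s, (c t, 0))).comp (ContinuousLinearMap.inl ℝ _ (G × R))) s :=
      (h.isC1.symm.differentiableAt hs).hasFDerivAt.comp s (hasFDerivAt_prodMk_left s _)
    have h2 := HasMFDerivAt.comp (I' := 𝓘(ℝ, E)) s
      (mdifferentiableAt_extChartAt_symm' (htgt s hs)).hasMFDerivAt h1.hasMFDerivAt
    exact DFunLike.congr_fun h2.mfderiv v
  refine ⟨hVo, ?_, ?_, ?_, ?_, ?_⟩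
  · refine (contMDiffOn_extChartAt_symm x₀).comp (ContDiffOn.contMDiffOn ?_) htgt
    exact h.isC1.contDiffOn_symm.comp (contDiff_prodMk_left _).contDiffOn fun s hs => hs
  · intro s hs s' hs' hss'
    have h1 := Θ.symm.injOn hs hs' (e.symm.injOn (htgt s hs) (htgt s' hs') hss')
    exact congrArg Prod.fst h1
  · intro s hs v w hvw
    have h1 : dParam (E := E) u s v = dParam (E := E) u s w := hvw
    have h1 := (hder s hs v).symm.trans (h1.trans (hder s hs w))
    have h2 := congrArg (dChart (E := E) x₀ (e.symm (Θ.symm (s, (c t, 0))))) h1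
    rw [dChart_dSymm (htgt s hs), dChart_dSymm (htgt s hs)] at h2
    have h3 := congrArg (fderiv ℝ Θ (Θ.symm (s, (c t, 0)))) h2
    rw [h.isC1.fderiv_fderiv_symm hs, h.isC1.fderiv_fderiv_symm hs] at h3
    exact congrArg Prod.fst h3
  · intro V' hV' hV'o
    refine ⟨e.source ∩ e ⁻¹' (Θ.source ∩ Θ ⁻¹' (V' ×ˢ univ)),
      (continuousOn_extChartAt x₀).isOpen_inter_preimage (isOpen_extChartAt_source x₀)
        (Θ.isOpen_inter_preimage (hV'o.prod isOpen_univ)), ?_⟩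
    ext x
    constructor
    · rintro ⟨s, hs, rfl⟩
      have hs' := hV' hs
      have h3 := Θ.right_inv hs'
      obtain ⟨n, hn⟩ := h.exists_eq _ (hsrc s hs') (by rw [h3])
      have hen : e (ι n) = Θ.symm (s, (c t, 0)) := by rw [hn, e.right_inv (htgt s hs')]
      have hns : ι n ∈ e.source := by rw [hn]; exact e.map_target (htgt s hs')
      obtain ⟨h5, h6⟩ := h.map_eq n hns (by rw [← he, hen]; exact hsrc s hs')
      rw [← he, hen, h3] at h6
      refine ⟨⟨n, c.injOn h5 ht (congrArg Prod.fst h6).symm, hn⟩,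
        e.map_target (htgt s hs'), ?_, ?_, mem_univ _⟩
      · rw [e.right_inv (htgt s hs')]; exact hsrc s hs'
      · rw [e.right_inv (htgt s hs'), h3]; exact hs
    · rintro ⟨⟨n, hn, rfl⟩, hx1, hx2, hx3, -⟩
      have h6 := (h.map_eq n hx1 hx2).2
      have hn' : F n = t := hn
      rw [hn'] at h6
      have h7 : ((Θ (e (ι n))).1, (c t, (0 : R))) = Θ (e (ι n)) := Prod.ext rfl h6.symm
      refine ⟨(Θ (e (ι n))).1, hx3, ?_⟩
      change e.symm (Θ.symm ((Θ (e (ι n))).1, (c t, 0))) = ι n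
      rw [h7, Θ.left_inv hx2, e.left_inv hx1]
  · intro s hs
    have h3 := Θ.right_inv hs
    have h1 := h.oriented _ (hsrc s hs) (by rw [h3])
    rw [h3] at h1
    have h2 : IsPositivelyOriented (J.toEnd (u s)) _ :=
      h1.map (J' := J.toEnd (u s)) (dSymm (E := E) x₀ (Θ.symm (s, (c t, 0))))
        fun v => dSymm_jChart J (htgt s hs) v
    have h4 : (fun i => dSymm (E := E) x₀ (Θ.symm (s, (c t, 0)))
        (fderiv ℝ Θ.symm (s, (c t, 0)) (flatFrame (2 * p) (G × R) i))) =
        fun i => dParam (E := E) u s (EuclideanSpace.single i 1) :=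
      funext fun i => (hder s hs _).symm
    rw [h4] at h2
    exact h2

/-- The part of a leaf in a flow box is a plaque. -/
lemma IsFlowBox.mem_plaque (h : IsFlowBox E' ι F x₀ Θ c) {n : N}
    (hn : ι n ∈ (extChartAt 𝓘(ℝ, E) x₀).source)
    (hn' : extChartAt 𝓘(ℝ, E) x₀ (ι n) ∈ Θ.source) :
    ι n ∈ (fun s => (extChartAt 𝓘(ℝ, E) x₀).symm (Θ.symm (s, (c (F n), 0)))) ''
      {s | (s, (c (F n), 0)) ∈ Θ.target} := by
  have h7 : ((Θ (extChartAt 𝓘(ℝ, E) x₀ (ι n))).1, (c (F n), (0 : R))) =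
      Θ (extChartAt 𝓘(ℝ, E) x₀ (ι n)) := Prod.ext rfl (h.map_eq n hn hn').2.symm
  refine ⟨(Θ (extChartAt 𝓘(ℝ, E) x₀ (ι n))).1, ?_, ?_⟩
  · rw [mem_ofPred_eq, h7]; exact Θ.map_source hn'
  · change (extChartAt 𝓘(ℝ, E) x₀).symm (Θ.symm (_, (c (F n), 0))) = _
    rw [h7, Θ.left_inv hn', (extChartAt 𝓘(ℝ, E) x₀).left_inv hn]

lemma plaqueIntegral_add (hΘ : Θ.IsC1) {η η' : E → E [⋀^Fin (2 * p)]→L[ℝ] ℂ}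
    (hη : HasCompactSupport η) (hηc : Continuous η) (hs : tsupport η ⊆ Θ.source)
    (hη' : HasCompactSupport η') (hηc' : Continuous η') (hs' : tsupport η' ⊆ Θ.source) (t : γ) :
    plaqueIntegral Θ c (η + η') t = plaqueIntegral Θ c η t + plaqueIntegral Θ c η' t := by
  unfold plaqueIntegral
  split_ifs
  · rw [← integral_add (integrable_flatForm_slice hΘ hη hηc hs _)
      (integrable_flatForm_slice hΘ hη' hηc' hs' _)]
    refine integral_congr_ae (Filter.Eventually.of_forall fun s => ?_)
    change flatForm Θ (η + η') _ _ = flatForm Θ η _ _ + flatForm Θ η' _ _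
    unfold flatForm
    split_ifs
    · rfl
    · exact (add_zero (0 : ℂ)).symm
  · simp

lemma plaqueIntegral_smul (a : ℂ) (η : E → E [⋀^Fin (2 * p)]→L[ℝ] ℂ) (t : γ) :
    plaqueIntegral Θ c (a • η) t = a * plaqueIntegral Θ c η t := by
  unfold plaqueIntegral
  split_ifs
  · rw [← integral_const_mul]
    refine integral_congr_ae (Filter.Eventually.of_forall fun s => ?_)
    change flatForm Θ (a • η) _ _ = a * flatForm Θ η _ _
    unfold flatForm
    split_ifs
    · rfl
    · exact (mul_zero a).symm
  · simp

/-- The integral over the plaques is a continuous function of the plaque. -/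
lemma IsFlowBox.continuous_plaqueIntegral [T2Space γ] (h : IsFlowBox E' ι F x₀ Θ c)
    {η : E → E [⋀^Fin (2 * p)]→L[ℝ] ℂ} (hη : HasCompactSupport η) (hηc : Continuous η)
    (hs : tsupport η ⊆ Θ.source) :
    Continuous (plaqueIntegral Θ c η) ∧ HasCompactSupport (plaqueIntegral Θ c η) := by
  set β := flatForm Θ η with hβ
  have hβc : Continuous β := continuous_flatForm h.isC1 hη hηc hs
  have hβK : HasCompactSupport β := hasCompactSupport_flatForm hη hs
  let K₀ : Set (EuclideanSpace ℝ (Fin (2 * p)) × (G × R)) := tsupport β ∩ {z | z.2.2 = 0}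
  have hK₀ : IsCompact K₀ := hβK.isCompact.inter_right
    (isClosed_eq (continuous_snd.comp continuous_snd) continuous_const)
  have hc : (fun z : EuclideanSpace ℝ (Fin (2 * p)) × (G × R) => z.2.1) '' K₀ ⊆ c.target := by
    rintro _ ⟨z, ⟨hz, hz0⟩, rfl⟩
    obtain ⟨y, hy, rfl⟩ := tsupport_flatForm_subset hη hs hz
    have hys := hs hy
    obtain ⟨n, hn⟩ := h.exists_eq y hys hz0
    have hen : extChartAt 𝓘(ℝ, E) x₀ (ι n) = y := by
      rw [hn, (extChartAt 𝓘(ℝ, E) x₀).right_inv (h.source_subset hys)]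
    obtain ⟨h1, h2⟩ := h.map_eq n
      (by rw [hn]; exact (extChartAt 𝓘(ℝ, E) x₀).map_target (h.source_subset hys))
      (by rw [hen]; exact hys)
    rw [hen] at h2
    change (Θ y).2.1 ∈ c.target
    rw [h2]
    exact c.map_source h1
  let K : Set γ := c.symm '' ((fun z : EuclideanSpace ℝ (Fin (2 * p)) × (G × R) => z.2.1) '' K₀)
  have hK : IsCompact K := (hK₀.image (continuous_fst.comp continuous_snd)).image_of_continuousOn
    (c.continuousOn_symm.mono hc)
  have hzero : ∀ t ∉ K, plaqueIntegral Θ c η t = 0 := by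
    intro t ht
    unfold plaqueIntegral
    split_ifs with hts
    · refine integral_eq_zero_of_ae (Filter.Eventually.of_forall fun s => ?_)
      change β (s, (c t, 0)) _ = 0
      have h0 : β (s, (c t, 0)) = 0 := by
        by_contra h0
        exact ht ⟨c t, ⟨(s, (c t, 0)), ⟨subset_tsupport _ h0, rfl⟩, rfl⟩, c.left_inv hts⟩
      rw [h0]; rfl
    · rfl
  refine ⟨?_, HasCompactSupport.intro hK hzero⟩
  have hcont : Continuous fun a : G => ∫ s, β (s, (a, 0)) (flatFrame (2 * p) (G × R)) := by
    have h1 : Continuous (Function.uncurry fun (a : G) s =>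
        β (s, (a, 0)) (flatFrame (2 * p) (G × R))) :=
      (evalForm (flatFrame (2 * p) (G × R))).continuous.comp (hβc.comp
        (continuous_snd.prodMk (continuous_fst.prodMk continuous_const)))
    have h2 := continuous_parametric_integral_of_continuous (μ := volume) h1
      (hβK.isCompact.image continuous_fst)
    refine h2.congr fun a => ?_
    refine setIntegral_eq_integral_of_forall_compl_eq_zero fun s hs => ?_
    have h0 : β (s, (a, 0)) = 0 := by
      by_contra h0
      exact hs ⟨_, subset_tsupport _ h0, rfl⟩
    rw [h0]; rfl
  rw [continuous_iff_continuousAt]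
  intro t
  by_cases ht : t ∈ c.source
  · refine ((hcont.continuousAt).comp (c.continuousAt ht)).congr ?_
    filter_upwards [c.open_source.mem_nhds ht] with z hz
    exact (if_pos hz).symm
  · have htK : t ∉ K := by
      rintro ⟨a, ha, rfl⟩
      exact ht (c.map_target (hc ha))
    refine (continuousAt_const (y := (0 : ℂ))).congr ?_
    filter_upwards [hK.isClosed.isOpen_compl.mem_nhds htK] with z hz
    exact (hzero z hz).symm

end PlaqueIntegral

/-! ### The currents of integration over the leaves -/

section IntegrationCurrent

variable {E : Type*} [NormedAddCommGroup E] [NormedSpace ℝ E] [FiniteDimensional ℝ E]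
  {M : Type*} [TopologicalSpace M] [T2Space M] [SecondCountableTopology M] [ChartedSpace E M]
  [IsManifold 𝓘(ℝ, E) ∞ M]
  {E' : Type*} [NormedAddCommGroup E'] [NormedSpace ℝ E']
  {N : Type*} [TopologicalSpace N] [ChartedSpace E' N] [IsManifold 𝓘(ℝ, E') 1 N]
  {G : Type*} [NormedAddCommGroup G] [NormedSpace ℝ G] [FiniteDimensional ℝ G]
  {γ : Type*} [TopologicalSpace γ] [T2Space γ] [ChartedSpace G γ] [IsManifold 𝓘(ℝ, G) 1 γ]
  {R : Type*} [NormedAddCommGroup R] [NormedSpace ℝ R] [FiniteDimensional ℝ R]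
  (J : AlmostComplexStructure E M) {ι : N → M} {F : N → γ} {p : ℕ}

lemma isOrientedParametrization_empty (S : Set M) (u : EuclideanSpace ℝ (Fin (2 * p)) → M) :
    IsOrientedParametrization J p S ∅ u where
  isOpen := isOpen_empty
  contMDiffOn := fun y hy => absurd hy (notMem_empty y)
  injOn := injOn_empty u
  immersion := fun y hy => absurd hy (notMem_empty y)
  image_open := fun V' hV' _ => ⟨∅, isOpen_empty, by rw [subset_empty_iff.1 hV']; simp⟩
  oriented := fun y hy => absurd hy (notMem_empty y)

/-- A closed submanifold has only one current of integration. -/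
lemma IsIntegrationCurrent.unique {S : Set M} (hS : IsClosed S)
    (hpar : ∀ x ∈ S, ∃ V u, IsOrientedParametrization J p S V u ∧ ∃ U ∈ 𝓝 x, U ∩ S ⊆ u '' V)
    {I I' : TestForm E M (2 * p) →ₗ[ℂ] ℂ} (hI : IsIntegrationCurrent J p S I)
    (hI' : IsIntegrationCurrent J p S I') : I = I' := by
  refine LinearMap.ext fun φ => ?_
  refine LinearMap.mem_eqLocus.1 (TestForm.induction_local (LinearMap.eqLocus I I') (S := univ)
    (fun x _ => ?_) φ (subset_univ _))
  by_cases hx : x ∈ S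
  · obtain ⟨V, u, hu, U, hU, hUS⟩ := hpar x hx
    refine ⟨U, hU, fun ψ hψ => LinearMap.mem_eqLocus.2 ?_⟩
    have h := (inter_subset_inter_left S hψ).trans hUS
    rw [hI V u hu ψ h, hI' V u hu ψ h]
  · refine ⟨Sᶜ, hS.isOpen_compl.mem_nhds hx, fun ψ hψ => LinearMap.mem_eqLocus.2 ?_⟩
    have h : formSupport ψ.1 ∩ S ⊆ (fun _ : EuclideanSpace ℝ (Fin (2 * p)) => x) '' ∅ := fun z hz =>
      absurd hz.2 (hψ hz.1)
    rw [hI _ _ (isOrientedParametrization_empty J S _) ψ h,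
      hI' _ _ (isOrientedParametrization_empty J S _) ψ h]

variable (E' G R) in
/-- Every point of `ι(N)` has an oriented flow box, with transverse coordinates in `G × R`. -/
def HasOrientedFlowBoxes (p : ℕ) (ι : N → M) (F : N → γ) : Prop :=
  ∀ n : N, ∃ (Θ : OpenPartialHomeomorph E (EuclideanSpace ℝ (Fin (2 * p)) × (G × R)))
    (c : OpenPartialHomeomorph γ G), IsOrientedFlowBox E' J p ι F (ι n) Θ c ∧
      extChartAt 𝓘(ℝ, E) (ι n) (ι n) ∈ Θ.source

lemma eq_localForm {k : ℕ} {x₀ : M} {φ : TestForm E M k} {η : chartForms E x₀ k}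
    (h : ∀ y ∈ (extChartAt 𝓘(ℝ, E) x₀).target, η.1 y = formInChart φ.1 x₀ y) :
    η.1 = localForm φ.1 x₀ := by
  funext y
  by_cases hy : y ∈ (extChartAt 𝓘(ℝ, E) x₀).target
  · rw [h y hy, localForm, indicator_of_mem hy]
  · rw [localForm, indicator_of_notMem hy]
    by_contra h0
    exact hy (η.2.2.2 (subset_tsupport _ h0))

lemma localForm_add {k : ℕ} (φ ψ : TestForm E M k) (x₀ : M) :
    localForm (φ + ψ).1 x₀ = localForm φ.1 x₀ + localForm ψ.1 x₀ := by
  unfold localForm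
  rw [← indicator_add']
  rfl

lemma localForm_smul {k : ℕ} (a : ℂ) (φ : TestForm E M k) (x₀ : M) :
    localForm (a • φ).1 x₀ = a • localForm φ.1 x₀ := by
  unfold localForm
  exact indicator_const_smul (extChartAt 𝓘(ℝ, E) x₀).target a (formInChart φ.1 x₀)

namespace TestForm

lemma mulFun_add {k : ℕ} (f : M → ℝ) (hf : ContMDiff 𝓘(ℝ, E) 𝓘(ℝ) ∞ f) (φ ψ : TestForm E M k) :
    mulFun f hf (φ + ψ) = mulFun f hf φ + mulFun f hf ψ :=
  Subtype.ext (funext fun x => smul_add (A := E [⋀^Fin k]→L[ℝ] ℂ) (f x) (formAt φ.1 x) (formAt ψ.1 x))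

lemma mulFun_smul {k : ℕ} (f : M → ℝ) (hf : ContMDiff 𝓘(ℝ, E) 𝓘(ℝ) ∞ f) (a : ℂ)
    (φ : TestForm E M k) : mulFun f hf (a • φ) = a • mulFun f hf φ :=
  Subtype.ext (funext fun x => ContinuousAlternatingMap.ext fun v => by
    change f x • (a * formAt φ.1 x v) = a * (f x • formAt φ.1 x v)
    rw [mul_smul_comm])

end TestForm

/-- The currents of integration over the leaves exist, and depend continuously on the leaf: the
integrals over the plaques are added up with a partition of unity. -/
theorem exists_isIntegrationCurrent (hbox : HasOrientedFlowBoxes E' G R J p ι F)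
    (hclosed : IsClosed (range ι)) : ∃ I : γ → TestForm E M (2 * p) →ₗ[ℂ] ℂ,
      (∀ t, IsIntegrationCurrent J p (leaf ι F t) (I t)) ∧
      ∀ φ, Continuous (fun t => I t φ) ∧ HasCompactSupport (fun t => I t φ) := by
  choose Θ c h hx using hbox
  have : LocallyCompactSpace M := ChartedSpace.locallyCompactSpace E M
  let U : N → Set M := fun n => (extChartAt 𝓘(ℝ, E) (ι n)).source ∩
    extChartAt 𝓘(ℝ, E) (ι n) ⁻¹' (Θ n).source
  have hU : ∀ n, IsOpen (U n) := fun n => (continuousOn_extChartAt (ι n)).isOpen_inter_preimage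
    (isOpen_extChartAt_source (ι n)) (Θ n).open_source
  obtain ⟨ρ, hρ⟩ := SmoothPartitionOfUnity.exists_isSubordinate 𝓘(ℝ, E) hclosed U hU (by
    rintro _ ⟨n, rfl⟩
    exact mem_iUnion.2 ⟨n, mem_extChartAt_source _, hx n⟩)
  -- `D n φ` is the part of `φ` in the flow box of `n`, and `P n t φ` its integral over the plaque
  -- with parameter `t`; only finitely many of these are nonzero for a given `φ`
  let D : N → TestForm E M (2 * p) → TestForm E M (2 * p) := fun n φ =>
    TestForm.mulFun (ρ n) (ρ n).contMDiff φ
  have hη : ∀ n φ, ∃ η : chartForms E (ι n) (2 * p), pushLinear (ι n) (2 * p) η = D n φ ∧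
      tsupport η.1 ⊆ (Θ n).source ∧ η.1 = localForm (D n φ).1 (ι n) := fun n φ => by
    have h1 : formSupport (D n φ).1 ⊆ U n :=
      (TestForm.formSupport_mulFun _ _ φ).trans (inter_subset_left.trans (hρ n))
    obtain ⟨η, hη1, hη2, hη3⟩ := exists_pushLinear_eq (ι n) (D n φ) (h1.trans inter_subset_left)
    refine ⟨η, hη1, hη2.trans ?_, eq_localForm hη3⟩
    rintro _ ⟨x, hx, rfl⟩
    exact (h1 hx).2
  choose η hη1 hη2 hη3 using hη
  let P : N → γ → TestForm E M (2 * p) → ℂ := fun n t φ =>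
    plaqueIntegral (Θ n) (c n) (η n φ).1 t
  have hfin : ∀ φ : TestForm E M (2 * p), {n | (Function.support (ρ n) ∩
      formSupport φ.1).Nonempty}.Finite :=
    fun φ => ρ.locallyFinite.finite_nonempty_inter_compact φ.2.1
  have hP0 : ∀ φ n, n ∉ (hfin φ).toFinset → ∀ t, P n t φ = 0 := by
    intro φ n hn t
    have h0 : D n φ = 0 := by
      refine Subtype.ext (funext fun x => ?_)
      change ρ n x • formAt φ.1 x = 0
      by_cases hxφ : x ∈ formSupport φ.1
      · have h1 : ρ n x = 0 := by
          by_contra h1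
          exact hn ((hfin φ).mem_toFinset.2 ⟨x, h1, hxφ⟩)
        rw [h1]
        exact zero_smul ℝ (formAt φ.1 x)
      · have h1 : formAt φ.1 x = 0 := by
          by_contra h1
          exact hxφ (subset_closure h1)
        rw [h1]
        exact smul_zero (A := E [⋀^Fin (2 * p)]→L[ℝ] ℂ) (ρ n x)
    change plaqueIntegral (Θ n) (c n) (η n φ).1 t = 0
    rw [hη3, h0]
    have h2 := localForm_smul (0 : ℂ) (0 : TestForm E M (2 * p)) (ι n)
    rw [zero_smul ℂ (0 : TestForm E M (2 * p))] at h2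
    rw [h2, plaqueIntegral_smul, zero_mul]
  have hPsupp : ∀ t φ, (Function.support fun n => P n t φ) ⊆ (hfin φ).toFinset := fun t φ n hn => by
    by_contra h0
    exact hn (hP0 φ n h0 t)
  let I : γ → TestForm E M (2 * p) →ₗ[ℂ] ℂ := fun t =>
    { toFun := fun φ => ∑ᶠ n, P n t φ
      map_add' := fun φ ψ => by
        rw [← finsum_add_distrib ((hfin φ).toFinset.finite_toSet.subset (hPsupp t φ))
          ((hfin ψ).toFinset.finite_toSet.subset (hPsupp t ψ))]
        refine finsum_congr fun n => ?_
        change plaqueIntegral (Θ n) (c n) (η n (φ + ψ)).1 t =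
          plaqueIntegral (Θ n) (c n) (η n φ).1 t + plaqueIntegral (Θ n) (c n) (η n ψ).1 t
        rw [← plaqueIntegral_add (h n).isC1 (η n φ).2.2.1 (η n φ).2.1.continuous (hη2 n φ)
          (η n ψ).2.2.1 (η n ψ).2.1.continuous (hη2 n ψ), hη3, hη3, hη3, ← localForm_add]
        congr 2
        exact congrArg Subtype.val (TestForm.mulFun_add _ _ φ ψ)
      map_smul' := fun a φ => by
        rw [RingHom.id_apply, smul_eq_mul, mul_finsum]
        refine finsum_congr fun n => ?_
        change plaqueIntegral (Θ n) (c n) (η n (a • φ)).1 t =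
          a * plaqueIntegral (Θ n) (c n) (η n φ).1 t
        rw [← plaqueIntegral_smul, hη3, hη3, ← localForm_smul]
        congr 2
        exact congrArg Subtype.val (TestForm.mulFun_smul _ _ a φ) }
  have hI : ∀ t φ, I t φ = ∑ n ∈ (hfin φ).toFinset, P n t φ := fun t φ =>
    finsum_eq_sum_of_support_subset _ (hPsupp t φ)
  refine ⟨I, fun t V u hu φ hφ => ?_, fun φ => ?_⟩
  · have h1 : ∀ n, formSupport (pushLinear (ι n) (2 * p) (η n φ)).1 ∩ leaf ι F t ⊆ u '' V := by
      intro n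
      rw [hη1]
      exact (inter_subset_inter_left _
        ((TestForm.formSupport_mulFun _ _ φ).trans inter_subset_right)).trans hφ
    have h2 := fun n => (h n).plaqueIntegral_eq J hu (η n φ) (hη2 n φ) (h1 n)
    rw [hI]
    have h3 : ∀ n, P n t φ = _ := fun n => (h2 n).2
    rw [Finset.sum_congr rfl fun n _ => h3 n, ← integral_finsetSum _ fun n _ => (h2 n).1]
    refine setIntegral_congr_fun hu.isOpen.measurableSet fun y hy => ?_
    have huy : u y ∈ leaf ι F t := by
      obtain ⟨W, -, hW⟩ := hu.image_open V subset_rfl hu.isOpen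
      exact (hW.subset (mem_image_of_mem u hy)).1
    have huN : u y ∈ range ι := image_subset_range _ _ huy
    simp only [hη1]
    change ∑ n ∈ (hfin φ).toFinset, ρ n (u y) • formAt φ.1 (u y) _ = formAt φ.1 (u y) _
    rw [← Finset.sum_smul]
    by_cases hyφ : u y ∈ formSupport φ.1
    · have h4 : ∑ n ∈ (hfin φ).toFinset, ρ n (u y) = 1 := by
        rw [← ρ.sum_eq_one huN, finsum_eq_sum_of_support_subset]
        intro n hn
        rw [Finite.coe_toFinset]
        exact ⟨u y, hn, hyφ⟩
      rw [h4, one_smul]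
    · have h4 : formAt φ.1 (u y) = 0 := by
        by_contra h4
        exact hyφ (subset_closure h4)
      rw [h4]
      exact smul_zero _
  · have h1 := fun n => (h n).continuous_plaqueIntegral (η n φ).2.2.1 (η n φ).2.1.continuous
      (hη2 n φ)
    simp only [hI]
    refine ⟨continuous_finsetSum _ fun n _ => (h1 n).1, HasCompactSupport.intro
      ((hfin φ).toFinset.isCompact_biUnion fun n _ => (h1 n).2.isCompact) fun t ht => ?_⟩
    refine Finset.sum_eq_zero fun n hn => ?_
    by_contra h0
    exact ht (mem_biUnion hn (subset_tsupport _ h0))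

lemma isClosed_leaf (hι : IsEmbedding ι) (hclosed : IsClosed (range ι)) (hF : Continuous F)
    (t : γ) : IsClosed (leaf ι F t) :=
  (IsClosedEmbedding.mk hι hclosed).isClosedMap _ (isClosed_singleton.preimage hF)

/-- The current of integration over a leaf, in a flow box. -/
lemma IsIntegrationCurrent.apply_pushLinear {x₀ : M}
    {Θ : OpenPartialHomeomorph E (EuclideanSpace ℝ (Fin (2 * p)) × (G × R))}
    {c : OpenPartialHomeomorph γ G} (h : IsOrientedFlowBox E' J p ι F x₀ Θ c) {t : γ}
    {I : TestForm E M (2 * p) →ₗ[ℂ] ℂ} (hI : IsIntegrationCurrent J p (leaf ι F t) I)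
    (η : chartForms E x₀ (2 * p)) (hη : tsupport η.1 ⊆ Θ.source) :
    I (pushLinear x₀ (2 * p) η) = plaqueIntegral Θ c η.1 t := by
  have hmem : ∀ n, ι n ∈ formSupport (pushLinear x₀ (2 * p) η).1 →
      ι n ∈ (extChartAt 𝓘(ℝ, E) x₀).source ∧ extChartAt 𝓘(ℝ, E) x₀ (ι n) ∈ Θ.source := by
    intro n hn
    obtain ⟨y, hy, hyn⟩ := formSupport_pushLinear x₀ η hn
    have h1 := h.source_subset (hη hy)
    rw [← hyn, (extChartAt 𝓘(ℝ, E) x₀).right_inv h1]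
    exact ⟨(extChartAt 𝓘(ℝ, E) x₀).map_target h1, hη hy⟩
  by_cases ht : t ∈ c.source
  · have hu := h.isOrientedParametrization J ht
    have hs : formSupport (pushLinear x₀ (2 * p) η).1 ∩ leaf ι F t ⊆
        (fun s => (extChartAt 𝓘(ℝ, E) x₀).symm (Θ.symm (s, (c t, 0)))) ''
          {s | (s, (c t, 0)) ∈ Θ.target} := by
      rintro _ ⟨hx, n, hn, rfl⟩
      obtain ⟨h1, h2⟩ := hmem n hx
      have h3 := h.mem_plaque h1 h2
      have hn' : F n = t := hn
      rwa [hn'] at h3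
    rw [hI _ _ hu _ hs, (h.plaqueIntegral_eq J hu η hη hs).2]
  · have hs : formSupport (pushLinear x₀ (2 * p) η).1 ∩ leaf ι F t ⊆
        (fun _ : EuclideanSpace ℝ (Fin (2 * p)) => x₀) '' ∅ := by
      rintro _ ⟨hx, n, hn, rfl⟩
      obtain ⟨h1, h2⟩ := hmem n hx
      have hn' : F n = t := hn
      exact absurd (hn' ▸ (h.map_eq n h1 h2).1) ht
    rw [hI _ _ (isOrientedParametrization_empty J _ _) _ hs, plaqueIntegral, if_neg ht]
    simp

lemma isIntegrationCurrent_integrationCurrent (hbox : HasOrientedFlowBoxes E' G R J p ι F)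
    (hclosed : IsClosed (range ι)) (t : γ) :
    IsIntegrationCurrent J p (leaf ι F t) (integrationCurrent J p (leaf ι F t)) := by
  obtain ⟨I, hI, -⟩ := exists_isIntegrationCurrent J hbox hclosed
  have h : ∃ I, IsIntegrationCurrent J p (leaf ι F t) I := ⟨I t, hI t⟩
  rw [integrationCurrent, dif_pos h]
  exact h.choose_spec

lemma continuous_integrationCurrent (hbox : HasOrientedFlowBoxes E' G R J p ι F)
    (hι : IsEmbedding ι) (hclosed : IsClosed (range ι)) (hF : Continuous F)
    (φ : TestForm E M (2 * p)) :
    Continuous (fun t => integrationCurrent J p (leaf ι F t) φ) ∧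
      HasCompactSupport (fun t => integrationCurrent J p (leaf ι F t) φ) := by
  obtain ⟨I, hI, hIc⟩ := exists_isIntegrationCurrent J hbox hclosed
  have h : ∀ t, integrationCurrent J p (leaf ι F t) = I t := fun t => by
    refine IsIntegrationCurrent.unique J (isClosed_leaf hι hclosed hF t) ?_
      (isIntegrationCurrent_integrationCurrent J hbox hclosed t) (hI t)
    rintro _ ⟨n, hn, rfl⟩
    obtain ⟨Θ, c, h, hx⟩ := hbox n
    have hn' : F n = t := hn
    have hs := mem_extChartAt_source (I := 𝓘(ℝ, E)) (ι n)
    have ht : t ∈ c.source := hn' ▸ (h.map_eq n hs hx).1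
    refine ⟨_, _, h.isOrientedParametrization J ht, (extChartAt 𝓘(ℝ, E) (ι n)).source ∩
      extChartAt 𝓘(ℝ, E) (ι n) ⁻¹' Θ.source, ((continuousOn_extChartAt (ι n)).isOpen_inter_preimage
        (isOpen_extChartAt_source (ι n)) Θ.open_source).mem_nhds ⟨hs, hx⟩, ?_⟩
    rintro _ ⟨⟨h1, h2⟩, m, hm, rfl⟩
    have h3 := h.mem_plaque h1 h2
    have hm' : F m = t := hm
    rwa [hm'] at h3
  simp only [h]
  exact hIc φ

end IntegrationCurrent

/-! ### Gluing of complex measures -/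

section Measures

variable {X : Type*} [TopologicalSpace X]

@[ext] lemma ComplexRadonMeasure.ext {μ ν : ComplexRadonMeasure X}
    (h : ∀ f, μ.integral f = ν.integral f) : μ = ν := by
  obtain ⟨I, hI⟩ := μ
  obtain ⟨I', hI'⟩ := ν
  obtain rfl : I = I' := LinearMap.ext h
  rfl

/-- The measures `μ` and `ν` have the same germ at `x`. -/
def ComplexRadonMeasure.EqNear (μ ν : ComplexRadonMeasure X) (x : X) : Prop :=
  ∃ Q ∈ 𝓝 x, ∀ f : C_c(X, ℂ), tsupport f ⊆ Q → μ.integral f = ν.integral f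

namespace ComplexRadonMeasure.EqNear

lemma symm {μ ν : ComplexRadonMeasure X} {x : X} (h : EqNear μ ν x) : EqNear ν μ x :=
  let ⟨Q, hQ, h⟩ := h
  ⟨Q, hQ, fun f hf => (h f hf).symm⟩

lemma trans {μ ν ξ : ComplexRadonMeasure X} {x : X} (h : EqNear μ ν x) (h' : EqNear ν ξ x) :
    EqNear μ ξ x :=
  let ⟨Q, hQ, h⟩ := h
  let ⟨Q', hQ', h'⟩ := h'
  ⟨Q ∩ Q', Filter.inter_mem hQ hQ', fun f hf =>
    (h f (hf.trans inter_subset_left)).trans (h' f (hf.trans inter_subset_right))⟩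

end ComplexRadonMeasure.EqNear

/-- The multiplication by a continuous function, on the functions with compact support. -/
def mulCompactlySupported (χ : C(X, ℝ)) : C_c(X, ℂ) →ₗ[ℂ] C_c(X, ℂ) where
  toFun f := χ • f
  map_add' f g := by ext x; exact smul_add (χ x) (f x) (g x)
  map_smul' a f := by ext x; exact smul_comm (χ x) a (f x)

lemma mulCompactlySupported_apply (χ : C(X, ℝ)) (f : C_c(X, ℂ)) (x : X) :
    mulCompactlySupported χ f x = χ x • f x := rfl

lemma tsupport_mulCompactlySupported (χ : C(X, ℝ)) (f : C_c(X, ℂ)) :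
    tsupport (mulCompactlySupported χ f) ⊆ tsupport χ ∩ tsupport f := by
  refine subset_inter (closure_mono fun x hx h0 => hx ?_) (closure_mono fun x hx h0 => hx ?_)
  · rw [mulCompactlySupported_apply, h0, zero_smul]
  · rw [mulCompactlySupported_apply, h0, smul_zero]

variable {κ : Type*}

/-- Only finitely many functions of a partition of unity meet a given compact set. -/
lemma PartitionOfUnity.exists_sum_mulCompactlySupported (ρ : PartitionOfUnity κ X) {K : Set X}
    (hK : IsCompact K) : ∃ s : Finset κ, ∀ f : C_c(X, ℂ), tsupport f ⊆ K →
      f = ∑ i ∈ s, mulCompactlySupported (ρ i) f ∧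
        ∀ i ∉ s, mulCompactlySupported (ρ i) f = 0 := by
  have hfin := ρ.locallyFinite.finite_nonempty_inter_compact hK
  have h0 : ∀ f : C_c(X, ℂ), tsupport f ⊆ K → ∀ i ∉ hfin.toFinset, ∀ x, ρ i x • f x = 0 := by
    intro f hf i hi x
    by_cases hx : x ∈ K
    · have h1 : ρ i x = 0 := by
        by_contra h1
        exact hi (hfin.mem_toFinset.2 ⟨x, h1, hx⟩)
      rw [h1, zero_smul]
    · have h1 : f x = 0 := by
        by_contra h1
        exact hx (hf (subset_tsupport _ h1))
      rw [h1, smul_zero]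
  refine ⟨hfin.toFinset, fun f hf => ⟨?_, fun i hi => ?_⟩⟩
  · ext x
    rw [CompactlySupportedContinuousMap.sum_apply]
    simp only [mulCompactlySupported_apply]
    by_cases hx : x ∈ K
    · rw [← Finset.sum_smul]
      have h1 : ∑ i ∈ hfin.toFinset, ρ i x = 1 := by
        rw [← ρ.sum_eq_one (mem_univ x), finsum_eq_sum_of_support_subset]
        intro i hi
        rw [Finite.coe_toFinset]
        exact ⟨x, hi, hx⟩
      rw [h1, one_smul]
    · have h1 : f x = 0 := by
        by_contra h1
        exact hx (hf (subset_tsupport _ h1))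
      simp [h1]
  · ext x
    exact h0 f hf i hi x

variable [NormalSpace X] [ParacompactSpace X]

/-- A function with compact support is a finite sum of its products with nonnegative functions whose
supports are small. -/
lemma exists_sum_of_nhds [T2Space X] {Q : X → Set X} (hQ : ∀ x, Q x ∈ 𝓝 x) (f : C_c(X, ℂ)) :
    ∃ (s : Finset X) (χ : X → C(X, ℝ)), f = ∑ i ∈ s, mulCompactlySupported (χ i) f ∧
      ∀ i, tsupport (χ i) ⊆ Q i ∧ ∀ x, 0 ≤ χ i x := by
  obtain ⟨ρ, hρ⟩ := PartitionOfUnity.exists_isSubordinate (isClosed_univ (X := X))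
    (fun x => interior (Q x)) (fun x => isOpen_interior)
    (fun x _ => mem_iUnion.2 ⟨x, mem_interior_iff_mem_nhds.2 (hQ x)⟩)
  obtain ⟨s, hs⟩ := ρ.exists_sum_mulCompactlySupported f.2.isCompact
  exact ⟨s, ρ, (hs f subset_rfl).1, fun i => ⟨(hρ i).trans interior_subset, ρ.nonneg i⟩⟩

lemma ComplexRadonMeasure.eq_of_eqNear [T2Space X] {μ ν : ComplexRadonMeasure X}
    (h : ∀ x, EqNear μ ν x) : μ = ν := by
  choose Q hQ hμν using h
  ext f
  obtain ⟨s, χ, hf, hχ⟩ := exists_sum_of_nhds hQ f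
  rw [hf, map_sum, map_sum]
  exact Finset.sum_congr rfl fun i _ => hμν i _
    ((tsupport_mulCompactlySupported _ _).trans (inter_subset_left.trans (hχ i).1))

lemma ComplexRadonMeasure.isPositive_of_nhds [T2Space X] {ν : ComplexRadonMeasure X}
    (h : ∀ x, ∃ Q ∈ 𝓝 x, ∀ f : C_c(X, ℂ), tsupport f ⊆ Q → (∀ x, 0 ≤ (f x).re ∧ (f x).im = 0) →
      0 ≤ (ν.integral f).re ∧ (ν.integral f).im = 0) : ν.IsPositive := by
  choose Q hQ hν using h
  intro f hf0
  obtain ⟨s, χ, hf, hχ⟩ := exists_sum_of_nhds hQ f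
  have h1 : ∀ i, _ := fun i => hν i (mulCompactlySupported (χ i) f)
    ((tsupport_mulCompactlySupported _ _).trans (inter_subset_left.trans (hχ i).1)) fun x => by
      rw [mulCompactlySupported_apply, Complex.smul_re, Complex.smul_im, (hf0 x).2]
      exact ⟨mul_nonneg ((hχ i).2 x) (hf0 x).1, smul_zero _⟩
  rw [hf, map_sum, Complex.re_sum, Complex.im_sum]
  exact ⟨Finset.sum_nonneg fun i _ => (h1 i).1, Finset.sum_eq_zero fun i _ => (h1 i).2⟩

/-- A family of germs of complex measures, locally induced by measures, is the family of germs of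
a complex measure. -/
theorem exists_measure_eqNear [T2Space X] (μ : X → ComplexRadonMeasure X)
    (h : ∀ x, ∀ᶠ y in 𝓝 x, (μ x).EqNear (μ y) y) :
    ∃ ν : ComplexRadonMeasure X, ∀ x, ν.EqNear (μ x) x := by
  obtain ⟨ρ, hρ⟩ := PartitionOfUnity.exists_isSubordinate (isClosed_univ (X := X))
    (fun x => interior {y | (μ x).EqNear (μ y) y}) (fun x => isOpen_interior)
    (fun x _ => mem_iUnion.2 ⟨x, mem_interior_iff_mem_nhds.2 (h x)⟩)
  let A : X → C_c(X, ℂ) →ₗ[ℂ] ℂ := fun i => (μ i).integral.comp (mulCompactlySupported (ρ i))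
  have hsum : ∀ K, IsCompact K → ∃ s : Finset X, ∀ f : C_c(X, ℂ), tsupport f ⊆ K →
      f = ∑ i ∈ s, mulCompactlySupported (ρ i) f ∧
        (Function.support fun i => A i f) ⊆ s := fun K hK => by
    obtain ⟨s, hs⟩ := ρ.exists_sum_mulCompactlySupported hK
    refine ⟨s, fun f hf => ⟨(hs f hf).1, fun i hi => ?_⟩⟩
    by_contra h0
    apply hi
    change (μ i).integral (mulCompactlySupported (ρ i) f) = 0
    rw [(hs f hf).2 i h0, map_zero]
  have hfin : ∀ f, (Function.support fun i => A i f).Finite := fun f =>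
    let ⟨s, hs⟩ := hsum _ f.2.isCompact
    s.finite_toSet.subset (hs f subset_rfl).2
  -- `ν` is the locally finite sum of the measures `ρ i • μ i`
  let ν : ComplexRadonMeasure X :=
    { integral :=
        { toFun := fun f => ∑ᶠ i, A i f
          map_add' := fun f g => by
            rw [← finsum_add_distrib (hfin f) (hfin g)]
            exact finsum_congr fun i => map_add _ _ _
          map_smul' := fun a f => by
            rw [RingHom.id_apply, smul_eq_mul, mul_finsum]
            exact finsum_congr fun i => map_smul _ _ _ }
      bounded := fun K hK => by
        obtain ⟨s, hs⟩ := hsum K hK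
        choose C hC using fun i => (μ i).bounded K hK
        refine ⟨∑ i ∈ s, C i, fun f hf B hB hfB => ?_⟩
        change ‖∑ᶠ i, A i f‖ ≤ _
        rw [finsum_eq_sum_of_support_subset _ (hs f hf).2, Finset.sum_mul]
        refine (norm_sum_le _ _).trans (Finset.sum_le_sum fun i _ => hC i _
          ((tsupport_mulCompactlySupported _ _).trans (inter_subset_right.trans hf)) B hB
          fun x => ?_)
        rw [mulCompactlySupported_apply, norm_smul, Real.norm_of_nonneg (ρ.nonneg i x)]
        exact (mul_le_of_le_one_left (norm_nonneg _) (ρ.le_one i x)).trans (hfB x) }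
  refine ⟨ν, fun y => ?_⟩
  have hloc : ∀ i, ∃ W ∈ 𝓝 y, ∀ f : C_c(X, ℂ), tsupport f ⊆ W →
      A i f = (μ y).integral (mulCompactlySupported (ρ i) f) := by
    intro i
    by_cases hy : y ∈ tsupport (ρ i)
    · obtain ⟨W, hW, hμ⟩ := interior_subset (hρ i hy)
      exact ⟨W, hW, fun f hf => hμ _
        ((tsupport_mulCompactlySupported _ _).trans (inter_subset_right.trans hf))⟩
    · refine ⟨(tsupport (ρ i))ᶜ, (isClosed_tsupport _).isOpen_compl.mem_nhds hy, fun f hf => ?_⟩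
      have h0 : mulCompactlySupported (ρ i) f = 0 := by
        ext x
        rw [mulCompactlySupported_apply]
        by_cases hx : x ∈ tsupport f
        · rw [image_eq_zero_of_notMem_tsupport (hf hx), zero_smul]; rfl
        · rw [image_eq_zero_of_notMem_tsupport hx, smul_zero]; rfl
      change (μ i).integral (mulCompactlySupported (ρ i) f) = _
      rw [h0, map_zero, map_zero]
  choose W hW hWA using hloc
  obtain ⟨V, hV, hVfin⟩ := ρ.locallyFinite y
  refine ⟨V ∩ ⋂ i ∈ hVfin.toFinset, W i, Filter.inter_mem hV
    ((Filter.biInter_finset_mem _).2 fun i _ => hW i), fun f hf => ?_⟩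
  have h1 : ∀ i, A i f = (μ y).integral (mulCompactlySupported (ρ i) f) := fun i => by
    by_cases hi : i ∈ hVfin.toFinset
    · exact hWA i f fun x hx => mem_iInter₂.1 (hf hx).2 i hi
    · have h0 : mulCompactlySupported (ρ i) f = 0 := by
        ext x
        rw [mulCompactlySupported_apply]
        by_cases hx : x ∈ tsupport f
        · have h2 : ρ i x = 0 := by
            by_contra h2
            exact hi (hVfin.mem_toFinset.2 ⟨x, h2, (hf hx).1⟩)
          rw [h2, zero_smul]; rfl
        · rw [image_eq_zero_of_notMem_tsupport hx, smul_zero]; rfl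
      change (μ i).integral (mulCompactlySupported (ρ i) f) = _
      rw [h0, map_zero, map_zero]
  obtain ⟨s, hs⟩ := hsum _ f.2.isCompact
  change ∑ᶠ i, A i f = _
  rw [finsum_eq_sum_of_support_subset _ (hs f subset_rfl).2, Finset.sum_congr rfl fun i _ => h1 i,
    ← map_sum, ← (hs f subset_rfl).1]

end Measures

/-! ### Strongly positive test forms -/

section StronglyPositive

variable {V : Type*} [NormedAddCommGroup V] [NormedSpace ℝ V] {p : ℕ}

/-- The covectors `α₀, ᾱ₀, α₁, ᾱ₁, …`. -/
def conjPairCLM (α : Fin p → (V →L[ℝ] ℂ)) (i : Fin (2 * p)) : V →L[ℝ] ℂ :=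
  if i.1 % 2 = 0 then α ⟨i.1 / 2, by omega⟩
  else Complex.conjCLE.toContinuousLinearMap.comp (α ⟨i.1 / 2, by omega⟩)

lemma conjPairCLM_apply (α : Fin p → (V →L[ℝ] ℂ)) (i : Fin (2 * p)) (w : V) :
    conjPairCLM α i w = conjPair α i w := by
  unfold conjPairCLM conjPair
  split_ifs <;> rfl

/-- The determinant of the rows, as a continuous alternating map. -/
def detForm (k : ℕ) : (Fin k → ℂ) [⋀^Fin k]→L[ℂ] ℂ :=
  { Matrix.detRowAlternating with cont := Continuous.matrix_det continuous_id }

/-- The form `i α₀ ∧ ᾱ₀ ∧ … ∧ i α_{p-1} ∧ ᾱ_{p-1}`. -/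
def elementaryForm (α : Fin p → (V →L[ℝ] ℂ)) : V [⋀^Fin (2 * p)]→L[ℝ] ℂ :=
  Complex.I ^ p • ((detForm (2 * p)).restrictScalars ℝ).compContinuousLinearMap
    (ContinuousLinearMap.pi (conjPairCLM α))

lemma elementaryForm_apply (α : Fin p → (V →L[ℝ] ℂ)) (v : Fin (2 * p) → V) :
    elementaryForm α v = elementaryPositive α v := by
  unfold elementaryPositive
  rw [← Matrix.det_transpose]
  change Complex.I ^ p * Matrix.det (Matrix.of fun i j => conjPairCLM α j (v i)) = _
  congr 2
  ext i j
  exact conjPairCLM_apply α j (v i)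

lemma isStronglyPositive_smul_elementaryForm (J : V →L[ℝ] V) (α : Fin p → (V →L[ℝ] ℂ))
    (hα : ∀ j w, α j (J w) = Complex.I * α j w) {r : ℝ} (hr : 0 ≤ r) :
    IsStronglyPositive J (r • elementaryForm α) := by
  refine ⟨1, fun _ => r, fun _ => α, fun _ => hr, fun _ => hα, fun v => ?_⟩
  rw [Fin.sum_univ_one]
  exact (Complex.real_smul).trans (congrArg _ (elementaryForm_apply α v))

lemma isStronglyPositive_zero (J : V →L[ℝ] V) :
    IsStronglyPositive J (0 : V [⋀^Fin (2 * p)]→L[ℝ] ℂ) :=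
  ⟨0, Fin.elim0, Fin.elim0, fun a => a.elim0, fun a => a.elim0, fun _ => by simp⟩

lemma IsStronglyPositive.comp {W : Type*} [NormedAddCommGroup W] [NormedSpace ℝ W]
    {J : V →L[ℝ] V} {J' : W →L[ℝ] W} {φ : W [⋀^Fin (2 * p)]→L[ℝ] ℂ} (hφ : IsStronglyPositive J' φ)
    (L : V →L[ℝ] W) (hL : ∀ v, L (J v) = J' (L v)) :
    IsStronglyPositive J (φ.compContinuousLinearMap L) := by
  obtain ⟨m, c, α, hc, hα, h⟩ := hφ
  refine ⟨m, c, fun a j => (α a j).comp L, hc, fun a j w => ?_, fun v => (h _).trans ?_⟩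
  · change α a j (L (J w)) = _
    rw [hL, hα]; rfl
  · rfl

lemma ContDiffOn.elementaryForm {D : Type*} [NormedAddCommGroup D] [NormedSpace ℝ D]
    [FiniteDimensional ℝ V] {n : WithTop ℕ∞} {s : Set D} {A : D → (V →L[ℝ] V)}
    (hA : ContDiffOn ℝ n A s) (a : Fin p → (V →L[ℝ] ℝ)) :
    ContDiffOn ℝ n (fun y => _root_.elementaryForm fun j => oneZeroForm (A y) (a j)) s := by
  refine contDiffOn_form_iff.2 fun v => ?_
  have h1 : ∀ j w, ContDiffOn ℝ n (fun y => oneZeroForm (A y) (a j) w) s := fun j w => by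
    simp only [oneZeroForm_apply]
    exact contDiffOn_const.sub (contDiffOn_const.mul (Complex.ofRealCLM.contDiff.comp_contDiffOn
      ((a j).contDiff.comp_contDiffOn (hA.clm_apply contDiffOn_const))))
  have h2 : ∀ i w, ContDiffOn ℝ n
      (fun y => conjPair (fun j => oneZeroForm (A y) (a j)) i w) s := fun i w => by
    unfold conjPair
    split_ifs
    · exact h1 _ _
    · exact Complex.conjCLE.contDiff.comp_contDiffOn (h1 _ _)
  simp only [elementaryForm_apply, elementaryPositive, Matrix.det_apply]
  refine contDiffOn_const.mul (ContDiffOn.sum fun σ _ => ?_)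
  have h3 : ContDiffOn ℝ n (fun y => ∏ i, (Matrix.of fun i j =>
      conjPair (fun j => oneZeroForm (A y) (a j)) i (v j)) (σ i) i) s :=
    contDiffOn_prod fun i _ => h2 _ _
  exact h3.const_smul (Equiv.Perm.sign σ)

variable {E : Type*} [NormedAddCommGroup E] [NormedSpace ℝ E] [FiniteDimensional ℝ E]
  {M : Type*} [TopologicalSpace M] [T2Space M] [ChartedSpace E M] [IsManifold 𝓘(ℝ, E) ∞ M]
  {E' : Type*} [NormedAddCommGroup E'] [NormedSpace ℝ E']
  {N : Type*} [TopologicalSpace N] [ChartedSpace E' N] [IsManifold 𝓘(ℝ, E') 1 N]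
  {G : Type*} [NormedAddCommGroup G] [NormedSpace ℝ G] [FiniteDimensional ℝ G]
  {γ : Type*} [TopologicalSpace γ] [ChartedSpace G γ] [IsManifold 𝓘(ℝ, G) 1 γ]
  {R : Type*} [NormedAddCommGroup R] [NormedSpace ℝ R] [FiniteDimensional ℝ R]
  (J : AlmostComplexStructure E M) {ι : N → M} {F : N → γ} {x₀ : M}
  {Θ : OpenPartialHomeomorph E (EuclideanSpace ℝ (Fin (2 * p)) × (G × R))}
  {c : OpenPartialHomeomorph γ G}

lemma isStronglyPositive_pushLinear (η : chartForms E x₀ (2 * p))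
    (hη : ∀ y ∈ (extChartAt 𝓘(ℝ, E) x₀).target, IsStronglyPositive (jChart J x₀ y) (η.1 y))
    (x : M) : IsStronglyPositive (J.toFun x) ((pushLinear x₀ (2 * p) η).1 x) := by
  change IsStronglyPositive (J.toEnd x) (formAt (pushForm x₀ η.1) x)
  by_cases hx : x ∈ (extChartAt 𝓘(ℝ, E) x₀).source
  · rw [pushForm_of_mem hx]
    exact (hη _ ((extChartAt 𝓘(ℝ, E) x₀).map_source hx)).comp _ fun v => dChart_toEnd J hx v
  · have h : formAt (pushForm x₀ η.1) x = 0 := pushForm_of_notMem hx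
    rw [h]
    exact isStronglyPositive_zero _

lemma isStronglyPositive_formInChart {φ : TestForm E M (2 * p)}
    (hφ : ∀ x, IsStronglyPositive (J.toFun x) (φ.1 x)) {y : E}
    (hy : y ∈ (extChartAt 𝓘(ℝ, E) x₀).target) :
    IsStronglyPositive (jChart J x₀ y) (formInChart φ.1 x₀ y) := by
  rw [formInChart_eq]
  have h : IsStronglyPositive (J.toEnd ((extChartAt 𝓘(ℝ, E) x₀).symm y))
    (formAt φ.1 ((extChartAt 𝓘(ℝ, E) x₀).symm y)) := hφ _
  exact h.comp _ fun v => dSymm_jChart J hy v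

/-- A strongly positive form is nonnegative on the oriented frames of the plaques. -/
lemma IsOrientedFlowBox.flatForm_nonneg (h : IsOrientedFlowBox E' J p ι F x₀ Θ c)
    {η : E → E [⋀^Fin (2 * p)]→L[ℝ] ℂ} (hη : ∀ y ∈ (extChartAt 𝓘(ℝ, E) x₀).target,
      IsStronglyPositive (jChart J x₀ y) (η y)) (s : EuclideanSpace ℝ (Fin (2 * p))) (τ : G) :
    0 ≤ (flatForm Θ η (s, (τ, 0)) (flatFrame (2 * p) (G × R))).re ∧
      (flatForm Θ η (s, (τ, 0)) (flatFrame (2 * p) (G × R))).im = 0 := by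
  by_cases hz : (s, (τ, (0 : R))) ∈ Θ.target
  · rw [flatForm_of_mem hz]
    have h1 := h.oriented _ (Θ.map_target hz) (by rw [Θ.right_inv hz])
    rw [Θ.right_inv hz] at h1
    exact (hη _ (h.source_subset (Θ.map_target hz))).apply_nonneg h1
  · rw [flatForm, if_neg hz]
    exact ⟨le_refl (0 : ℝ), rfl⟩

lemma IsOrientedFlowBox.plaqueIntegral_nonneg (h : IsOrientedFlowBox E' J p ι F x₀ Θ c)
    {η : E → E [⋀^Fin (2 * p)]→L[ℝ] ℂ} (hη : ∀ y ∈ (extChartAt 𝓘(ℝ, E) x₀).target,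
      IsStronglyPositive (jChart J x₀ y) (η y)) (t : γ) :
    ∃ m : ℝ, plaqueIntegral Θ c η t = m ∧ 0 ≤ m ∧ (t ∈ c.source →
      m = ∫ s, (flatForm Θ η (s, (c t, 0)) (flatFrame (2 * p) (G × R))).re) := by
  unfold plaqueIntegral
  split_ifs with ht
  · refine ⟨_, ?_, integral_nonneg fun s => (h.flatForm_nonneg J hη s (c t)).1, fun _ => rfl⟩
    refine Eq.trans ?_ integral_complex_ofReal
    exact integral_congr_ae (Filter.Eventually.of_forall fun s =>
      Complex.ext rfl (h.flatForm_nonneg J hη s (c t)).2)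
  · exact ⟨0, by simp, le_rfl, fun h => absurd h ht⟩

end StronglyPositive

/-! ### Integrals of strongly positive forms over the plaques -/

section Density

variable {E : Type*} [NormedAddCommGroup E] [NormedSpace ℝ E] [FiniteDimensional ℝ E]
  {M : Type*} [TopologicalSpace M] [T2Space M] [ChartedSpace E M] [IsManifold 𝓘(ℝ, E) ∞ M]
  {E' : Type*} [NormedAddCommGroup E'] [NormedSpace ℝ E']
  {N : Type*} [TopologicalSpace N] [ChartedSpace E' N] [IsManifold 𝓘(ℝ, E') 1 N]
  {G : Type*} [NormedAddCommGroup G] [NormedSpace ℝ G] [FiniteDimensional ℝ G]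
  {γ : Type*} [TopologicalSpace γ] [T2Space γ] [ChartedSpace G γ] [IsManifold 𝓘(ℝ, G) 1 γ]
  {R : Type*} [NormedAddCommGroup R] [NormedSpace ℝ R] [FiniteDimensional ℝ R]
  (J : AlmostComplexStructure E M) {ι : N → M} {F : N → γ} {x₀ : M} {p : ℕ}
  {Θ : OpenPartialHomeomorph E (EuclideanSpace ℝ (Fin (2 * p)) × (G × R))}
  {c : OpenPartialHomeomorph γ G}

/-- If the integral of the form `η` over the plaque of parameter `t` is not zero, then the leaf
`L_t` meets the support of `η`. -/
lemma IsFlowBox.exists_mem_of_plaqueIntegral_ne_zero (h : IsFlowBox E' ι F x₀ Θ c)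
    {η : E → E [⋀^Fin (2 * p)]→L[ℝ] ℂ} {t : γ} (ht : plaqueIntegral Θ c η t ≠ 0) :
    t ∈ c.source ∧ ∃ n, F n = t ∧ ι n ∈ (extChartAt 𝓘(ℝ, E) x₀).source ∧
      η (extChartAt 𝓘(ℝ, E) x₀ (ι n)) ≠ 0 := by
  have hts : t ∈ c.source := by
    by_contra h0
    exact ht (if_neg h0)
  refine ⟨hts, ?_⟩
  obtain ⟨s, hs⟩ : ∃ s, flatForm Θ η (s, (c t, 0)) (flatFrame (2 * p) (G × R)) ≠ 0 := by
    by_contra! h0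
    rw [plaqueIntegral, if_pos hts] at ht
    exact ht (by simp only [h0]; exact integral_zero _ _)
  have hz : (s, (c t, (0 : R))) ∈ Θ.target := by
    by_contra h0
    rw [flatForm, if_neg h0] at hs
    exact hs rfl
  have h3 := Θ.right_inv hz
  have h2 := Θ.map_target hz
  have h4 := h.source_subset h2
  obtain ⟨n, hn⟩ := h.exists_eq _ h2 (by rw [h3])
  have hes : extChartAt 𝓘(ℝ, E) x₀ (ι n) = Θ.symm (s, (c t, 0)) := by
    rw [hn, (extChartAt 𝓘(ℝ, E) x₀).right_inv h4]
  have hns : ι n ∈ (extChartAt 𝓘(ℝ, E) x₀).source := by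
    rw [hn]; exact (extChartAt 𝓘(ℝ, E) x₀).map_target h4
  obtain ⟨h5, h6⟩ := h.map_eq n hns (by rw [hes]; exact h2)
  rw [hes, h3] at h6
  refine ⟨n, c.injOn h5 hts (congrArg Prod.fst h6).symm, hns, fun h0 => hs ?_⟩
  rw [flatForm_of_mem hz, ← hes, h0]; rfl

/-- Near a point of `ι(N)` there is a strongly positive test form whose integrals over the leaves
form a function `m` that is positive at the given leaf. Multiplying this test form by functions
that are almost constant along the leaves, one obtains test forms whose integrals over the leaves
are arbitrarily close to any nonnegative continuous multiple of `m`. -/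
theorem IsOrientedFlowBox.exists_approx (h : IsOrientedFlowBox E' J p ι F x₀ Θ c) {n : N}
    (hn : ι n ∈ (extChartAt 𝓘(ℝ, E) x₀).source)
    (hn' : extChartAt 𝓘(ℝ, E) x₀ (ι n) ∈ Θ.source) {W : Set E} (hW : IsOpen W)
    (hnW : extChartAt 𝓘(ℝ, E) x₀ (ι n) ∈ W) :
    ∃ m : γ → ℝ, Continuous m ∧ HasCompactSupport m ∧ 0 < m (F n) ∧ (∀ t, 0 ≤ m t) ∧
      (∀ t, m t ≠ 0 → ∃ n', F n' = t ∧ ι n' ∈ (extChartAt 𝓘(ℝ, E) x₀).source ∧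
        extChartAt 𝓘(ℝ, E) x₀ (ι n') ∈ W) ∧
      ∀ g : γ → ℝ, Continuous g → (∀ t, 0 ≤ g t) → ∀ ε > 0, ∃ η : chartForms E x₀ (2 * p),
        tsupport η.1 ⊆ W ∩ Θ.source ∧ (∀ y ∈ (extChartAt 𝓘(ℝ, E) x₀).target,
          IsStronglyPositive (jChart J x₀ y) (η.1 y)) ∧
        ∀ t, ‖plaqueIntegral Θ c η.1 t - (g t * m t : ℝ)‖ ≤ ε * m t := by
  set y₀ := extChartAt 𝓘(ℝ, E) x₀ (ι n) with hy₀
  obtain ⟨hFc, hΘy₀⟩ := h.map_eq n hn hn'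
  have hz0 : (Θ y₀).2.2 = 0 := by rw [hΘy₀]
  have hJ := fun y (hy : y ∈ (extChartAt 𝓘(ℝ, E) x₀).target) => jChart_sq J hy
  have hy₀t := h.source_subset hn'
  -- a positive form at the point
  have hli : LinearIndependent ℝ fun i => fderiv ℝ Θ.symm (Θ y₀) (flatFrame (2 * p) (G × R) i) := by
    have h1 : LinearIndependent ℝ (flatFrame (2 * p) (G × R)) := by
      have h2 := (EuclideanSpace.basisFun (Fin (2 * p)) ℝ).toBasis.linearIndependent.map'
        (LinearMap.inl ℝ _ (G × R)) (LinearMap.ker_eq_bot.2 LinearMap.inl_injective)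
      have h3 : (LinearMap.inl ℝ _ (G × R)) ∘ (EuclideanSpace.basisFun (Fin (2 * p)) ℝ).toBasis =
          flatFrame (2 * p) (G × R) := by
        funext i; simp [flatFrame]
      rwa [h3] at h2
    exact h1.map' (fderiv ℝ Θ.symm (Θ y₀)).toLinearMap
      (LinearMap.ker_eq_bot.2 (h.isC1.symm.fderiv_injective (Θ.map_source hn')))
  obtain ⟨a, d, hd, had⟩ := (h.oriented y₀ hn' hz0).exists_elementaryPositive_pos (hJ y₀ hy₀t) hli
  let ζ : E → E [⋀^Fin (2 * p)]→L[ℝ] ℂ := fun y =>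
    elementaryForm fun j => oneZeroForm (jChart J x₀ y) (a j)
  have hζ : ContDiffOn ℝ ∞ ζ (extChartAt 𝓘(ℝ, E) x₀).target :=
    (contDiffOn_jChart J x₀).elementaryForm a
  let W' : Set E := W ∩ (Θ.source ∩ Θ ⁻¹' {z | z.2.1 ∈ c.target})
  have hW' : IsOpen W' := hW.inter (Θ.isOpen_inter_preimage
    (c.open_target.preimage (continuous_fst.comp continuous_snd)))
  obtain ⟨ψ, hψ, hψc, hψW, hψ1, hψI⟩ := exists_contDiff_one_nhds (isCompact_singleton (x := y₀)) hW'
    (singleton_subset_iff.2 ⟨hnW, hn', by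
      change (Θ y₀).2.1 ∈ c.target
      rw [hΘy₀]; exact c.map_source hFc⟩)
  have hψy₀ : ψ y₀ = 1 := (hψ1 y₀ rfl).self_of_nhds
  have hψs : tsupport ψ ⊆ Θ.source := fun y hy => (hψW hy).2.1
  have hψt : tsupport ψ ⊆ (extChartAt 𝓘(ℝ, E) x₀).target := hψs.trans h.source_subset
  have hmem : ∀ q : E → ℝ, ContDiff ℝ ∞ q → (fun y => (ψ y * q y) • ζ y) ∈ chartForms E x₀ (2 * p) ∧
      tsupport (fun y => (ψ y * q y) • ζ y) ⊆ tsupport ψ := by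
    intro q hq
    have h0 : tsupport (fun y => (ψ y * q y) • ζ y) ⊆ tsupport ψ := closure_mono fun y hy h0 =>
      hy (by
        change (ψ y * q y) • ζ y = 0
        rw [h0, zero_mul]; exact zero_smul ℝ (ζ y))
    refine ⟨⟨contDiff_iff_contDiffAt.2 fun y => ?_,
      hψc.of_isClosed_subset (isClosed_tsupport _) h0, h0.trans hψt⟩, h0⟩
    by_cases hy : y ∈ (extChartAt 𝓘(ℝ, E) x₀).target
    · exact (hψ.mul hq).contDiffAt.smul
        (hζ.contDiffAt ((isOpen_extChartAt_target x₀).mem_nhds hy))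
    · have h1 := notMem_tsupport_iff_eventuallyEq.1 fun h2 => hy (hψt (h0 h2))
      exact contDiffAt_const.congr_of_eventuallyEq h1
  have hpos : ∀ q : E → ℝ, (∀ y ∈ tsupport ψ, 0 ≤ q y) → ∀ y ∈ (extChartAt 𝓘(ℝ, E) x₀).target,
      IsStronglyPositive (jChart J x₀ y) ((ψ y * q y) • ζ y) := fun q hq y hy => by
    refine isStronglyPositive_smul_elementaryForm _ _
      (fun j w => oneZeroForm_comp _ (hJ y hy) _ _) ?_
    by_cases hyψ : y ∈ tsupport ψ
    · exact mul_nonneg (hψI y).1 (hq y hyψ)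
    · rw [image_eq_zero_of_notMem_tsupport hyψ, zero_mul]
  -- the function `m`
  let η₀ : chartForms E x₀ (2 * p) := ⟨_, (hmem (fun _ => 1) contDiff_const).1⟩
  have hη₀s : tsupport η₀.1 ⊆ tsupport ψ := (hmem (fun _ => 1) contDiff_const).2
  have hη₀p := hpos (fun _ => 1) fun _ _ => zero_le_one
  have hnn := h.flatForm_nonneg J hη₀p
  choose m hm hm0 hmi using h.plaqueIntegral_nonneg J (η := η₀.1) hη₀p
  have hcts := h.continuous_plaqueIntegral η₀.2.2.1 η₀.2.1.continuous (hη₀s.trans hψs)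
  have hmre : m = fun t => (plaqueIntegral Θ c η₀.1 t).re := funext fun t => by rw [hm]; rfl
  have hβc : ∀ τ : G × R, Continuous fun s =>
      flatForm Θ η₀.1 (s, τ) (flatFrame (2 * p) (G × R)) := fun τ =>
    (evalForm (flatFrame (2 * p) (G × R))).continuous.comp ((continuous_flatForm h.isC1
      η₀.2.2.1 η₀.2.1.continuous (hη₀s.trans hψs)).comp (Continuous.prodMk_left τ))
  refine ⟨m, ?_, ?_, ?_, hm0, fun t ht => ?_, fun g hg hg0 ε hε => ?_⟩
  · rw [hmre]; exact Complex.continuous_re.comp hcts.1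
  · rw [hmre]; exact hcts.2.comp_left (g := Complex.re) Complex.zero_re
  · rw [hmi _ hFc]
    refine integral_pos_of_integrable_nonneg_nonzero (x := (Θ y₀).1)
      (Complex.continuous_re.comp (hβc _)) (integrable_flatForm_slice h.isC1 η₀.2.2.1
        η₀.2.1.continuous (hη₀s.trans hψs) _).re (fun s => (hnn s (c (F n))).1) ?_
    have h1 : ((Θ y₀).1, (c (F n), (0 : R))) = Θ y₀ := Prod.ext rfl hΘy₀.symm
    rw [h1, flatForm_of_mem (Θ.map_source hn'), Θ.left_inv hn']
    change ((ψ y₀ * 1) • elementaryForm _ fun i =>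
      fderiv ℝ Θ.symm (Θ y₀) (flatFrame (2 * p) (G × R) i)).re ≠ 0
    rw [elementaryForm_apply, had, hψy₀, mul_one, one_smul, Complex.ofReal_re]
    exact hd.ne'
  · obtain ⟨-, n', h1, h2, h3⟩ := h.exists_mem_of_plaqueIntegral_ne_zero (η := η₀.1) (t := t)
      (by rw [hm]; exact_mod_cast ht)
    exact ⟨n', h1, h2, (hψW (hη₀s (subset_tsupport _ h3))).1⟩
  · -- `g`, as a function on the support of the form, is extended and smoothed
    have hcl : ContinuousOn (fun y => g (c.symm (Θ y).2.1)) (tsupport ψ) := by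
      refine hg.comp_continuousOn (c.continuousOn_symm.comp
        ((Θ.continuousOn.mono hψs).snd.fst) fun y hy => (hψW hy).2.2)
    obtain ⟨k, -, hk⟩ := ContinuousMap.exists_restrict_eq_forall_mem_of_closed
      (⟨_, continuousOn_iff_continuous_domRestrict.1 hcl⟩ : C(tsupport ψ, ℝ)) (t := univ)
      (fun _ => mem_univ _) univ_nonempty (isClosed_tsupport ψ)
    have hk' : ∀ y ∈ tsupport ψ, k y = g (c.symm (Θ y).2.1) := fun y hy =>
      DFunLike.congr_fun hk ⟨y, hy⟩
    obtain ⟨q, hq, hqk, -⟩ := k.continuous.exists_contDiff_approx ⊤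
      (continuous_const (y := ε / 2)) fun _ => half_pos hε
    have hqk' : ∀ y ∈ tsupport ψ, 0 ≤ q y + ε / 2 ∧ |q y + ε / 2 - g (c.symm (Θ y).2.1)| ≤ ε := by
      intro y hy
      have h1 := abs_lt.1 (Real.dist_eq _ _ ▸ hqk y)
      rw [hk' y hy] at h1
      have h2 := hg0 (c.symm (Θ y).2.1)
      exact ⟨by linarith [h1.1], abs_le.2 ⟨by linarith [h1.1], by linarith [h1.2]⟩⟩
    have hη := hmem (fun y => q y + ε / 2) (hq.add contDiff_const)
    refine ⟨⟨_, hη.1⟩, hη.2.trans fun y hy => ⟨(hψW hy).1, hψs hy⟩,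
      hpos _ fun y hy => (hqk' y hy).1, fun t => ?_⟩
    by_cases ht : t ∈ c.source
    · have hi := integrable_flatForm_slice h.isC1 hη.1.2.1 hη.1.1.continuous (hη.2.trans hψs)
        (c t, (0 : R))
      have hi₀ := integrable_flatForm_slice h.isC1 η₀.2.2.1 η₀.2.1.continuous (hη₀s.trans hψs)
        (c t, (0 : R))
      have h1 : ((g t * m t : ℝ) : ℂ) = ∫ s, (g t : ℂ) *
          flatForm Θ η₀.1 (s, (c t, 0)) (flatFrame (2 * p) (G × R)) := by
        rw [integral_const_mul, Complex.ofReal_mul, ← hm, plaqueIntegral, if_pos ht]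
      rw [h1, plaqueIntegral, if_pos ht, ← integral_sub hi (hi₀.const_mul _), hmi t ht,
        ← integral_const_mul]
      refine norm_integral_le_of_norm_le (hi₀.re.const_mul ε)
        (Filter.Eventually.of_forall fun s => ?_)
      have hre : ‖flatForm Θ η₀.1 (s, (c t, 0)) (flatFrame (2 * p) (G × R))‖ =
          (flatForm Θ η₀.1 (s, (c t, 0)) (flatFrame (2 * p) (G × R))).re := by
        have h2 : flatForm Θ η₀.1 (s, (c t, 0)) (flatFrame (2 * p) (G × R)) =
            ((flatForm Θ η₀.1 (s, (c t, 0)) (flatFrame (2 * p) (G × R))).re : ℂ) :=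
          Complex.ext rfl (hnn s (c t)).2
        rw [h2, Complex.norm_real, Real.norm_of_nonneg (hnn s (c t)).1]; rfl
      change _ ≤ ε * (flatForm Θ η₀.1 (s, (c t, 0)) (flatFrame (2 * p) (G × R))).re
      rw [← hre]
      by_cases hz : (s, (c t, (0 : R))) ∈ Θ.target
      · rw [flatForm_of_mem hz, flatForm_of_mem hz]
        set y := Θ.symm (s, (c t, (0 : R))) with hy
        set B : ℂ := ζ y fun i => fderiv ℝ Θ.symm (s, (c t, 0)) (flatFrame (2 * p) (G × R) i) with hB
        change ‖(ψ y * (q y + ε / 2)) • B - (g t : ℂ) * ((ψ y * 1) • B)‖ ≤ ε * ‖(ψ y * 1) • B‖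
        by_cases hyψ : y ∈ tsupport ψ
        · have h2 := (hqk' y hyψ).2
          rw [hy, Θ.right_inv hz, ← hy, c.left_inv ht] at h2
          have h3 : (ψ y * (q y + ε / 2)) • B - (g t : ℂ) * ((ψ y * 1) • B) =
              (q y + ε / 2 - g t) • ((ψ y * 1) • B) := by
            simp only [Complex.real_smul]; push_cast; ring
          rw [h3, norm_smul, Real.norm_eq_abs]
          exact mul_le_mul_of_nonneg_right h2 (norm_nonneg _)
        · rw [image_eq_zero_of_notMem_tsupport hyψ]
          simp
      · rw [flatForm, flatForm, if_neg hz, if_neg hz]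
        change ‖(0 : ℂ) - (g t : ℂ) * 0‖ ≤ ε * ‖(0 : ℂ)‖
        simp
    · have h1 : m t = 0 := by
        have h2 := hm t
        rw [plaqueIntegral, if_neg ht] at h2
        exact_mod_cast h2.symm
      rw [h1, plaqueIntegral, if_neg ht]
      simp

end Density

/-! ### Measures on the space of leaves -/

section BoundAndParts

variable {X : Type*} [TopologicalSpace X]

lemma ComplexRadonMeasure.exists_norm_le (ν : ComplexRadonMeasure X) (m : C_c(X, ℂ)) :
    ∃ C : ℝ, 0 ≤ C ∧ ∀ f : C_c(X, ℂ), ∀ ε : ℝ, 0 ≤ ε → (∀ x, ‖f x‖ ≤ ε * ‖m x‖) →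
      ‖ν.integral f‖ ≤ C * ε := by
  obtain ⟨C, hC⟩ := ν.bounded _ m.2.isCompact
  obtain ⟨B, hB⟩ := m.2.exists_bound_of_continuous m.1.continuous
  have hB0 : ∀ x, ‖m x‖ ≤ |B| := fun x => (hB x).trans (le_abs_self B)
  refine ⟨|C| * |B|, by positivity, fun f ε hε hf => ?_⟩
  have h1 : tsupport f ⊆ tsupport m := closure_mono fun x hx h0 => hx (by
    have h2 := hf x
    rw [h0, norm_zero, mul_zero] at h2
    exact norm_le_zero_iff.1 h2)
  refine (hC f h1 (ε * |B|) (by positivity) fun x =>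
    (hf x).trans (mul_le_mul_of_nonneg_left (hB0 x) hε)).trans ?_
  have h2 : C * (ε * |B|) ≤ |C| * (ε * |B|) := mul_le_mul_of_nonneg_right (le_abs_self C)
    (by positivity)
  linarith

/-- A function with compact support is a combination of nonnegative ones. -/
lemma exists_nonneg_parts (f : C_c(X, ℂ)) : ∃ g : Fin 4 → C_c(X, ℂ),
    f = g 0 - g 1 + Complex.I • (g 2 - g 3) ∧
      ∀ i, tsupport (g i) ⊆ tsupport f ∧ ∀ x, 0 ≤ (g i x).re ∧ (g i x).im = 0 := by
  have key : ∀ q : ℂ → ℝ, Continuous q → q 0 = 0 → ∃ g : C_c(X, ℂ),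
      (∀ x, g x = ((max (q (f x)) 0 : ℝ) : ℂ)) ∧ tsupport g ⊆ tsupport f ∧
        ∀ x, 0 ≤ (g x).re ∧ (g x).im = 0 := by
    intro q hq hq0
    have hc : Continuous fun z => ((max (q z) 0 : ℝ) : ℂ) :=
      Complex.continuous_ofReal.comp (hq.max continuous_const)
    refine ⟨⟨⟨fun x => ((max (q (f x)) 0 : ℝ) : ℂ), hc.comp f.1.continuous⟩,
      f.2.comp_left (g := fun z => ((max (q z) 0 : ℝ) : ℂ)) (by simp [hq0])⟩, fun x => rfl,
      closure_mono fun x hx h0 => hx ?_, fun x => ⟨?_, Complex.ofReal_im _⟩⟩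
    · change ((max (q (f x)) 0 : ℝ) : ℂ) = 0
      rw [h0, hq0]; simp
    · exact (Complex.ofReal_re _).symm ▸ le_max_right _ _
  obtain ⟨g₀, h₀, h₀'⟩ := key Complex.re Complex.continuous_re rfl
  obtain ⟨g₁, h₁, h₁'⟩ := key (fun z => -z.re) Complex.continuous_re.neg (by simp)
  obtain ⟨g₂, h₂, h₂'⟩ := key Complex.im Complex.continuous_im rfl
  obtain ⟨g₃, h₃, h₃'⟩ := key (fun z => -z.im) Complex.continuous_im.neg (by simp)
  have hmax : ∀ r : ℝ, max r 0 - max (-r) 0 = r := fun r => by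
    rcases le_total 0 r with hr | hr
    · rw [max_eq_left hr, max_eq_right (by linarith), sub_zero]
    · rw [max_eq_right hr, max_eq_left (by linarith)]; ring
  refine ⟨![g₀, g₁, g₂, g₃], ?_, fun i => ?_⟩
  · ext x
    change f x = g₀ x - g₁ x + Complex.I * (g₂ x - g₃ x)
    rw [h₀, h₁, h₂, h₃, ← Complex.ofReal_sub, ← Complex.ofReal_sub, hmax, hmax, mul_comm,
      Complex.re_add_im]
  · fin_cases i
    exacts [h₀', h₁', h₂', h₃']

end BoundAndParts

section Leaves

variable {E : Type*} [NormedAddCommGroup E] [NormedSpace ℝ E] [FiniteDimensional ℝ E]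
  {M : Type*} [TopologicalSpace M] [T2Space M] [SecondCountableTopology M] [ChartedSpace E M]
  [IsManifold 𝓘(ℝ, E) ∞ M]
  {E' : Type*} [NormedAddCommGroup E'] [NormedSpace ℝ E']
  {N : Type*} [TopologicalSpace N] [ChartedSpace E' N] [IsManifold 𝓘(ℝ, E') 1 N]
  {G : Type*} [NormedAddCommGroup G] [NormedSpace ℝ G] [FiniteDimensional ℝ G]
  {γ : Type*} [TopologicalSpace γ] [T2Space γ] [ChartedSpace G γ] [IsManifold 𝓘(ℝ, G) 1 γ]
  {R : Type*} [NormedAddCommGroup R] [NormedSpace ℝ R] [FiniteDimensional ℝ R]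
  (J : AlmostComplexStructure E M) {ι : N → M} {F : N → γ} {p : ℕ}

/-- The function `t ↦ ⟨[L_t], φ⟩`. -/
def leafIntegrals (hbox : HasOrientedFlowBoxes E' G R J p ι F)
    (hι : IsEmbedding ι) (hclosed : IsClosed (range ι)) (hF : Continuous F) :
    TestForm E M (2 * p) →ₗ[ℂ] C_c(γ, ℂ) where
  toFun φ := ⟨⟨fun t => integrationCurrent J p (leaf ι F t) φ,
    (continuous_integrationCurrent J hbox hι hclosed hF φ).1⟩,
    (continuous_integrationCurrent J hbox hι hclosed hF φ).2⟩
  map_add' φ ψ := by ext t; exact map_add (integrationCurrent J p (leaf ι F t)) φ ψ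
  map_smul' a φ := by ext t; exact map_smul (integrationCurrent J p (leaf ι F t)) a φ

variable (hbox : HasOrientedFlowBoxes E' G R J p ι F)
    (hι : IsEmbedding ι) (hclosed : IsClosed (range ι)) (hF : Continuous F)

lemma leafIntegrals_pushLinear {x₀ : M}
    {Θ : OpenPartialHomeomorph E (EuclideanSpace ℝ (Fin (2 * p)) × (G × R))}
    {c : OpenPartialHomeomorph γ G} (h : IsOrientedFlowBox E' J p ι F x₀ Θ c)
    (η : chartForms E x₀ (2 * p)) (hη : tsupport η.1 ⊆ Θ.source) (t : γ) :
    leafIntegrals J hbox hι hclosed hF (pushLinear x₀ (2 * p) η) t = plaqueIntegral Θ c η.1 t :=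
  (isIntegrationCurrent_integrationCurrent J hbox hclosed t).apply_pushLinear J h η hη

lemma leafIntegrals_eq_zero {φ : TestForm E M (2 * p)} {t : γ}
    (h : Disjoint (formSupport φ.1) (leaf ι F t)) :
    leafIntegrals J hbox hι hclosed hF φ t = 0 := by
  rcases isEmpty_or_nonempty M with hM | ⟨⟨x₀⟩⟩
  · have h0 : φ = 0 := Subtype.ext (funext fun x => hM.elim x)
    rw [h0, map_zero]; rfl
  · have hs : formSupport φ.1 ∩ leaf ι F t ⊆
        (fun _ : EuclideanSpace ℝ (Fin (2 * p)) => x₀) '' ∅ := by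
      rw [h.inter_eq]; exact empty_subset _
    refine (isIntegrationCurrent_integrationCurrent J hbox hclosed t _ _
      (isOrientedParametrization_empty J _ _) φ hs).trans ?_
    simp

lemma tsupport_leafIntegrals (φ : TestForm E M (2 * p)) :
    tsupport (leafIntegrals J hbox hι hclosed hF φ) ⊆ F '' (ι ⁻¹' formSupport φ.1) := by
  refine closure_minimal (fun t ht => ?_)
    (((IsClosedEmbedding.mk hι hclosed).isCompact_preimage φ.2.1).image hF).isClosed
  by_contra h0
  refine ht (leafIntegrals_eq_zero J hbox hι hclosed hF (disjoint_left.2 ?_))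
  rintro _ hx ⟨n, hn, rfl⟩
  exact h0 ⟨n, hx, hn⟩

lemma isOpen_chart_preimage {x₀ : M} {W : Set E} (hW : IsOpen W) :
    IsOpen ((extChartAt 𝓘(ℝ, E) x₀).source ∩ extChartAt 𝓘(ℝ, E) x₀ ⁻¹' W) :=
  (continuousOn_extChartAt x₀).isOpen_inter_preimage (isOpen_extChartAt_source x₀) hW

/-- The test forms near a point, in a chart. -/
lemma exists_pushLinear_eq_of_subset {x₀ : M} {W : Set E} {k : ℕ} {φ : TestForm E M k}
    (h : formSupport φ.1 ⊆
      (extChartAt 𝓘(ℝ, E) x₀).source ∩ extChartAt 𝓘(ℝ, E) x₀ ⁻¹' W) :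
    ∃ η : chartForms E x₀ k, pushLinear x₀ k η = φ ∧ tsupport η.1 ⊆ W ∧
      ∀ y ∈ (extChartAt 𝓘(ℝ, E) x₀).target, η.1 y = formInChart φ.1 x₀ y := by
  obtain ⟨η, h1, h2, h3⟩ := exists_pushLinear_eq x₀ φ (h.trans inter_subset_left)
  refine ⟨η, h1, h2.trans ?_, h3⟩
  rintro _ ⟨x, hx, rfl⟩
  exact (h hx).2

/-- The integrals of a strongly positive form over the leaves are nonnegative. -/
lemma leafIntegrals_nonneg {φ : TestForm E M (2 * p)}
    (hφ : ∀ x, IsStronglyPositive (J.toFun x) (φ.1 x)) (t : γ) :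
    0 ≤ (leafIntegrals J hbox hι hclosed hF φ t).re ∧
      (leafIntegrals J hbox hι hclosed hF φ t).im = 0 := by
  let P : AddSubmonoid (TestForm E M (2 * p)) :=
    { carrier := {φ | 0 ≤ (leafIntegrals J hbox hι hclosed hF φ t).re ∧
        (leafIntegrals J hbox hι hclosed hF φ t).im = 0}
      zero_mem' := by
        change 0 ≤ (leafIntegrals J hbox hι hclosed hF 0 t).re ∧
          (leafIntegrals J hbox hι hclosed hF 0 t).im = 0
        rw [map_zero]
        exact ⟨le_rfl, rfl⟩
      add_mem' := by
        intro φ ψ h1 h2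
        change 0 ≤ (leafIntegrals J hbox hι hclosed hF (φ + ψ) t).re ∧
          (leafIntegrals J hbox hι hclosed hF (φ + ψ) t).im = 0
        rw [map_add]
        exact ⟨add_nonneg h1.1 h2.1, (congrArg₂ (· + ·) h1.2 h2.2).trans (add_zero _)⟩ }
  refine TestForm.induction_mulFun P φ fun x _ => ?_
  by_cases hx : x ∈ range ι
  · obtain ⟨n, rfl⟩ := hx
    obtain ⟨Θ, c, h, hn⟩ := hbox n
    refine ⟨_, (isOpen_chart_preimage (x₀ := ι n) Θ.open_source).mem_nhds
      ⟨mem_extChartAt_source _, hn⟩, fun f hf hf0 hs => ?_⟩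
    obtain ⟨η, h1, h2, h3⟩ := exists_pushLinear_eq_of_subset hs
    have h4 : ∀ x, IsStronglyPositive (J.toFun x) ((TestForm.mulFun f hf φ).1 x) := fun x => by
      obtain ⟨m, c, α, hc, hα, hv⟩ := hφ x
      refine ⟨m, fun a => f x * c a, α, fun a => mul_nonneg (hf0 x) (hc a), hα, fun v => ?_⟩
      have h5 : (TestForm.mulFun f hf φ).1 x v = f x • φ.1 x v := rfl
      rw [h5, hv, Finset.smul_sum]
      refine Finset.sum_congr rfl fun a _ => ?_
      rw [Complex.real_smul]; push_cast; ring
    obtain ⟨m, hm, hm0, -⟩ := h.plaqueIntegral_nonneg J (η := η.1) (fun y hy => by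
      rw [h3 y hy]; exact isStronglyPositive_formInChart J h4 hy) t
    have h5 := leafIntegrals_pushLinear J hbox hι hclosed hF h η h2 t
    rw [h1, hm] at h5
    change 0 ≤ (leafIntegrals J hbox hι hclosed hF (TestForm.mulFun f hf φ) t).re ∧
      (leafIntegrals J hbox hι hclosed hF (TestForm.mulFun f hf φ) t).im = 0
    rw [h5]
    exact ⟨hm0, Complex.ofReal_im _⟩
  · refine ⟨_, hclosed.isOpen_compl.mem_nhds hx, fun f hf _ hs => ?_⟩
    change 0 ≤ (leafIntegrals J hbox hι hclosed hF (TestForm.mulFun f hf φ) t).re ∧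
      (leafIntegrals J hbox hι hclosed hF (TestForm.mulFun f hf φ) t).im = 0
    rw [leafIntegrals_eq_zero J hbox hι hclosed hF
      (disjoint_left.2 fun x hx hxl => hs hx (image_subset_range _ _ hxl))]
    exact ⟨le_rfl, rfl⟩

/-- Near the leaf of a point `ι n` every nonnegative function on the space of leaves is approximated
by the functions `t ↦ ⟨[L_t], φ⟩`, with `φ` strongly positive and supported near `ι n`. -/
lemma exists_leafIntegrals_approx (n : N) {U : Set M} (hU : U ∈ 𝓝 (ι n)) :
    ∃ Q ∈ 𝓝 (F n), (∀ t ∈ Q, ∃ n', F n' = t ∧ ι n' ∈ U) ∧ ∃ m : C_c(γ, ℂ),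
      ∀ f : C_c(γ, ℂ), tsupport f ⊆ Q → (∀ t, 0 ≤ (f t).re ∧ (f t).im = 0) → ∀ ε > 0,
        ∃ φ : TestForm E M (2 * p), formSupport φ.1 ⊆ U ∧
          (∀ x, IsStronglyPositive (J.toFun x) (φ.1 x)) ∧
          ∀ t, ‖(leafIntegrals J hbox hι hclosed hF φ - f) t‖ ≤ ε * ‖m t‖ := by
  obtain ⟨Θ, c, h, hn⟩ := hbox n
  obtain ⟨U', hU'U, hU', hnU'⟩ := mem_nhds_iff.1 hU
  set e := extChartAt 𝓘(ℝ, E) (ι n) with he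
  let W : Set E := e.target ∩ e.symm ⁻¹' U'
  have hW : IsOpen W := (continuousOn_extChartAt_symm (ι n)).isOpen_inter_preimage
    (isOpen_extChartAt_target (ι n)) hU'
  obtain ⟨m, hm, hmc, hmn, hm0, hmW, hg⟩ := h.exists_approx J (mem_extChartAt_source _) hn hW
    ⟨mem_extChartAt_target _, by
      change e.symm (e (ι n)) ∈ U'
      rw [e.left_inv (mem_extChartAt_source _)]; exact hnU'⟩
  have hQ : IsOpen {t | m t ≠ 0} := hm.isOpen_preimage _ isOpen_compl_singleton
  refine ⟨{t | m t ≠ 0}, hQ.mem_nhds hmn.ne', fun t ht => ?_,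
    ⟨⟨fun t => (m t : ℂ), Complex.continuous_ofReal.comp hm⟩,
      hmc.comp_left (g := fun r : ℝ => (r : ℂ)) Complex.ofReal_zero⟩, fun f hf hf0 ε hε => ?_⟩
  · obtain ⟨n', h1, h2, h3⟩ := hmW t ht
    refine ⟨n', h1, hU'U ?_⟩
    have h4 : e.symm (e (ι n')) ∈ U' := h3.2
    rwa [e.left_inv h2] at h4
  · have hgc : Continuous fun t => (f t).re / m t := by
      rw [continuous_iff_continuousAt]
      intro t
      by_cases ht : m t = 0
      · have h1 : f =ᶠ[𝓝 t] fun _ => 0 :=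
          notMem_tsupport_iff_eventuallyEq.1 fun h2 => hf h2 ht
        refine (continuousAt_const (y := (0 : ℝ))).congr ?_
        filter_upwards [h1] with z hz
        rw [hz]; simp
      · exact (Complex.continuous_re.comp f.1.continuous).continuousAt.div hm.continuousAt ht
    obtain ⟨η, h1, h2, h3⟩ := hg _ hgc (fun t => div_nonneg (hf0 t).1 (hm0 t)) ε hε
    refine ⟨pushLinear (ι n) (2 * p) η, ?_, isStronglyPositive_pushLinear J η h2, fun t => ?_⟩
    · refine (formSupport_pushLinear _ η).trans ?_
      rintro _ ⟨y, hy, rfl⟩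
      exact hU'U (h1 hy).1.2
    · have h4 : f t = (((f t).re / m t * m t : ℝ) : ℂ) := by
        by_cases ht : m t = 0
        · rw [ht, mul_zero]
          by_contra h5
          exact hf (subset_tsupport _ h5) ht
        · rw [div_mul_cancel₀ _ ht]
          exact Complex.ext rfl (hf0 t).2
      have h5 : (leafIntegrals J hbox hι hclosed hF (pushLinear (ι n) (2 * p) η) - f) t =
          plaqueIntegral Θ c η.1 t - (((f t).re / m t * m t : ℝ) : ℂ) := by
        rw [← h4, ← leafIntegrals_pushLinear J hbox hι hclosed hF h η (h1.trans inter_subset_right)]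
        rfl
      rw [h5]
      refine (h3 t).trans_eq ?_
      change _ = ε * ‖(m t : ℂ)‖
      rw [Complex.norm_real, Real.norm_of_nonneg (hm0 t)]

/-- Measures that agree on the functions `t ↦ ⟨[L_t], φ⟩`, for `φ` supported near a point of a leaf,
agree near this leaf. -/
lemma eqNear_of_leafIntegrals {n : N} {U : Set M} (hU : U ∈ 𝓝 (ι n)) {μ ν : ComplexRadonMeasure γ}
    (h : ∀ φ : TestForm E M (2 * p), formSupport φ.1 ⊆ U →
      μ.integral (leafIntegrals J hbox hι hclosed hF φ) =
        ν.integral (leafIntegrals J hbox hι hclosed hF φ)) : μ.EqNear ν (F n) := by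
  obtain ⟨Q, hQ, -, m, hm⟩ := exists_leafIntegrals_approx J hbox hι hclosed hF n hU
  obtain ⟨C, hC0, hC⟩ := μ.exists_norm_le m
  obtain ⟨C', hC0', hC'⟩ := ν.exists_norm_le m
  have key : ∀ f : C_c(γ, ℂ), tsupport f ⊆ Q → (∀ t, 0 ≤ (f t).re ∧ (f t).im = 0) →
      μ.integral f = ν.integral f := by
    intro f hf hf0
    have h1 : ∀ ε > 0, ‖μ.integral f - ν.integral f‖ ≤ (C + C') * ε := fun ε hε => by
      obtain ⟨φ, h1, -, h2⟩ := hm f hf hf0 ε hε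
      have h3 := hC _ ε hε.le h2
      have h4 := hC' _ ε hε.le h2
      have h5 : μ.integral f - ν.integral f =
          ν.integral (leafIntegrals J hbox hι hclosed hF φ - f) -
            μ.integral (leafIntegrals J hbox hι hclosed hF φ - f) := by
        rw [map_sub, map_sub, h φ h1]; ring
      rw [h5]
      refine (norm_sub_le _ _).trans ?_
      linarith
    rw [← sub_eq_zero, ← norm_le_zero_iff]
    refine le_of_forall_pos_le_add fun δ hδ => ?_
    have h2 := h1 (δ / (C + C' + 1)) (by positivity)
    have h3 : (C + C') * (δ / (C + C' + 1)) ≤ δ := by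
      rw [mul_div_assoc', div_le_iff₀ (by positivity)]
      nlinarith
    linarith
  refine ⟨Q, hQ, fun f hf => ?_⟩
  obtain ⟨g, hfg, hg⟩ := exists_nonneg_parts f
  have h1 := fun i => key (g i) ((hg i).1.trans hf) (hg i).2
  rw [hfg, map_add, map_add, map_sub, map_sub, map_smul, map_smul, map_sub, map_sub, h1, h1, h1, h1]

/-- A measure that takes nonnegative values on the functions `t ↦ ⟨[L_t], φ⟩`, for `φ` strongly
positive, is positive near every leaf. -/
lemma nonneg_of_leafIntegrals_nonneg {ν : ComplexRadonMeasure γ}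
    (h : ∀ φ : TestForm E M (2 * p), (∀ x, IsStronglyPositive (J.toFun x) (φ.1 x)) →
      0 ≤ (ν.integral (leafIntegrals J hbox hι hclosed hF φ)).re ∧
        (ν.integral (leafIntegrals J hbox hι hclosed hF φ)).im = 0) (n : N) :
    ∃ Q ∈ 𝓝 (F n), ∀ f : C_c(γ, ℂ), tsupport f ⊆ Q → (∀ t, 0 ≤ (f t).re ∧ (f t).im = 0) →
      0 ≤ (ν.integral f).re ∧ (ν.integral f).im = 0 := by
  obtain ⟨Q, hQ, -, m, hm⟩ := exists_leafIntegrals_approx J hbox hι hclosed hF n Filter.univ_mem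
  obtain ⟨C, hC0, hC⟩ := ν.exists_norm_le m
  refine ⟨Q, hQ, fun f hf hf0 => ?_⟩
  have h1 : ∀ δ > 0, -δ ≤ (ν.integral f).re ∧ |(ν.integral f).im| ≤ δ := fun δ hδ => by
    obtain ⟨φ, -, hφ, h2⟩ := hm f hf hf0 (δ / (C + 1)) (by positivity)
    have h3 := hC _ _ (by positivity) h2
    have h4 : C * (δ / (C + 1)) ≤ δ := by
      rw [mul_div_assoc', div_le_iff₀ (by positivity)]
      nlinarith
    obtain ⟨h5, h6⟩ := h φ hφ
    rw [map_sub] at h3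
    have h7 := (Complex.abs_re_le_norm _).trans (h3.trans h4)
    have h8 := (Complex.abs_im_le_norm _).trans (h3.trans h4)
    rw [Complex.sub_re] at h7
    rw [Complex.sub_im, h6, zero_sub, abs_neg] at h8
    exact ⟨by linarith [(abs_le.1 h7).2], h8⟩
  constructor
  · exact le_of_forall_pos_le_add fun δ hδ => by linarith [(h1 δ hδ).1]
  · rw [← abs_nonpos_iff]
    exact le_of_forall_pos_le_add fun δ hδ => by linarith [(h1 δ hδ).2]

end Leaves

/-! ### The transverse measure of a closed current -/

section TransverseMeasure

variable {E : Type*} [NormedAddCommGroup E] [NormedSpace ℝ E] [FiniteDimensional ℝ E]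
  {M : Type*} [TopologicalSpace M] [T2Space M] [SecondCountableTopology M] [ChartedSpace E M]
  [IsManifold 𝓘(ℝ, E) ∞ M]
  {E' : Type*} [NormedAddCommGroup E'] [NormedSpace ℝ E']
  {N : Type*} [TopologicalSpace N] [ChartedSpace E' N] [IsManifold 𝓘(ℝ, E') 1 N]
  {G : Type*} [NormedAddCommGroup G] [NormedSpace ℝ G] [FiniteDimensional ℝ G]
  {γ : Type*} [TopologicalSpace γ] [T2Space γ] [ChartedSpace G γ] [IsManifold 𝓘(ℝ, G) 1 γ]
  {R : Type*} [NormedAddCommGroup R] [NormedSpace ℝ R] [FiniteDimensional ℝ R]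
  (J : AlmostComplexStructure E M) {ι : N → M} {F : N → γ} {p : ℕ}

/-- The space of leaves is `σ`-compact, as a continuous image of a closed subset of `M`. -/
lemma sigmaCompactSpace_leaves (E : Type*) [NormedAddCommGroup E] [NormedSpace ℝ E]
    [FiniteDimensional ℝ E] {M : Type*} [TopologicalSpace M] [SecondCountableTopology M]
    [ChartedSpace E M] {ι : N → M} {F : N → γ} (hι : IsClosedEmbedding ι) (hF : Continuous F)
    (hsurj : Function.Surjective F) : SigmaCompactSpace γ := by
  have := ChartedSpace.locallyCompactSpace E M
  have := hι.sigmaCompactSpace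
  rw [← isSigmaCompact_univ_iff, ← hsurj.range_eq]
  exact isSigmaCompact_range hF

variable (hbox : HasOrientedFlowBoxes E' G R J p ι F)
    (hι : IsEmbedding ι) (hclosed : IsClosed (range ι)) (hF : Continuous F)

/-- Near every point of `ι(N)` the current is given by a measure on the space of leaves. -/
lemma exists_local_leafMeasure (hcomplex : ∀ x : N, ∀ v ∈ leafTangent E E' G ι F x,
      J.toFun (ι x) v ∈ leafTangent E E' G ι F x)
    (hCR : IsCRSubmanifold E' J ι p)
    (hdim : ∀ x : N, finrank ℝ (leafTangent E E' G ι F x) = 2 * p)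
    {T : TestForm E M (2 * p) →ₗ[ℂ] ℂ} (hT : TestForm.IsOrderZero T)
    (hTJ : TestForm.IsBidimension J p T) (hTc : TestForm.IsClosedCurrent T)
    (hTs : TestForm.currentSupport T ⊆ range ι) (n : N) :
    ∃ U : Set M, IsOpen U ∧ ι n ∈ U ∧ ∃ ν : ComplexRadonMeasure γ,
      ∀ φ : TestForm E M (2 * p), formSupport φ.1 ⊆ U →
        T φ = ν.integral (leafIntegrals J hbox hι hclosed hF φ) := by
  obtain ⟨Θ, c, h, hn⟩ := hbox n
  obtain ⟨W, hWΘ, hW, hnW, ν, hν⟩ := h.toIsFlowBox.exists_local_measure J hcomplex hCR hdim hT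
    hTJ.apply_compJ hTc hTs (mem_extChartAt_source _) hn
  refine ⟨_, isOpen_chart_preimage (x₀ := ι n) hW, ⟨mem_extChartAt_source _, hnW⟩, ν,
    fun φ hφ => ?_⟩
  obtain ⟨η, rfl, hη, -⟩ := exists_pushLinear_eq_of_subset hφ
  exact hν η hη _ fun t => leafIntegrals_pushLinear J hbox hι hclosed hF h η (hη.trans hWΘ) t

/-- A current with support in `ι(N)` that is given, near every point of `ι(N)`, by a measure on the
space of leaves is given by one such measure. The measures at two points of the same
leaf have the same germ at the parameter of this leaf, because the leaf is connected. Hence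
there is a well defined germ at every point of the space of leaves, and these germs glue. -/
lemma exists_leafMeasure (hconn : ∀ t : γ, IsConnected (F ⁻¹' {t}))
    {T : TestForm E M (2 * p) →ₗ[ℂ] ℂ} (hTs : TestForm.currentSupport T ⊆ range ι)
    (hT : ∀ n : N, ∃ U : Set M, IsOpen U ∧ ι n ∈ U ∧ ∃ ν : ComplexRadonMeasure γ,
      ∀ φ : TestForm E M (2 * p), formSupport φ.1 ⊆ U →
        T φ = ν.integral (leafIntegrals J hbox hι hclosed hF φ)) :
    ∃ ν : ComplexRadonMeasure γ, ∀ φ : TestForm E M (2 * p),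
      T φ = ν.integral (leafIntegrals J hbox hι hclosed hF φ) := by
  have hsurj : Function.Surjective F := fun t => (hconn t).nonempty
  have := ChartedSpace.locallyCompactSpace G γ
  have := sigmaCompactSpace_leaves E ⟨hι, hclosed⟩ hF hsurj
  choose U hU hnU μ hμ using hT
  -- `exists_leafIntegrals_approx` shows that the measures `μ n` agree near every common leaf
  have hnear : ∀ n n', ι n' ∈ U n → (μ n).EqNear (μ n') (F n') := fun n n' h =>
    eqNear_of_leafIntegrals J hbox hι hclosed hF
      (((hU n).inter (hU n')).mem_nhds ⟨h, hnU n'⟩) fun φ hφ =>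
        (hμ n φ (hφ.trans inter_subset_left)).symm.trans (hμ n' φ (hφ.trans inter_subset_right))
  -- chain of such neighbourhoods along the connected leaf
  have hleaf : ∀ n n', F n = F n' → (μ n).EqNear (μ n') (F n') := by
    intro n n' h
    refine (hconn (F n')).isPreconnected.induction₂ (fun a b => (μ a).EqNear (μ b) (F n'))
      (fun a _ => ?_) (fun a b c _ _ _ h1 h2 => h1.trans h2) (fun a b _ _ h1 => h1.symm) h rfl
    filter_upwards [nhdsWithin_le_nhds (((hU a).preimage hι.continuous).mem_nhds (hnU a)),
      self_mem_nhdsWithin] with b hb hbt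
    have h1 := hnear a b hb
    rwa [show F b = F n' from hbt] at h1
  choose s hs using hsurj
  obtain ⟨ν, hν⟩ := exists_measure_eqNear (fun t => μ (s t)) fun t => by
    obtain ⟨Q, hQ, hQU, -⟩ := exists_leafIntegrals_approx J hbox hι hclosed hF (s t)
      ((hU (s t)).mem_nhds (hnU (s t)))
    rw [hs] at hQ
    filter_upwards [hQ] with t' ht'
    obtain ⟨n', rfl, hn'⟩ := hQU t' ht'
    exact (hnear _ _ hn').trans (hleaf _ n' (hs _)).symm
  refine ⟨ν, fun φ => ?_⟩
  refine TestForm.induction_local (S := univ) (LinearMap.eqLocus T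
    (ν.integral.comp (leafIntegrals J hbox hι hclosed hF))) (fun x _ => ?_) φ (subset_univ _)
  by_cases hx : x ∈ range ι
  · obtain ⟨n, rfl⟩ := hx
    obtain ⟨Q, hQ, hQν⟩ := (hν (F n)).trans (hleaf _ n (hs _))
    obtain ⟨V, hV, hVQ⟩ := (hι.isInducing.nhds_eq_comap n ▸ hF.continuousAt.preimage_mem_nhds hQ :
      F ⁻¹' Q ∈ Filter.comap ι (𝓝 (ι n)))
    refine ⟨U n ∩ V, Filter.inter_mem ((hU n).mem_nhds (hnU n)) hV, fun ψ hψ => ?_⟩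
    refine (hμ n ψ (hψ.trans inter_subset_left)).trans (hQν _ ?_).symm
    refine (tsupport_leafIntegrals J hbox hι hclosed hF ψ).trans ?_
    rintro _ ⟨n', hn', rfl⟩
    exact hVQ (hψ hn').2
  · refine ⟨_, hclosed.isOpen_compl.mem_nhds hx, fun ψ hψ => ?_⟩
    have h0 : leafIntegrals J hbox hι hclosed hF ψ = 0 := by
      ext t
      exact leafIntegrals_eq_zero J hbox hι hclosed hF
        (disjoint_left.2 fun x hx hxl => hψ hx (image_subset_range _ _ hxl))
    change T ψ = ν.integral (leafIntegrals J hbox hι hclosed hF ψ)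
    rw [h0, map_zero]
    exact TestForm.apply_eq_zero_of_disjoint T ψ
      (disjoint_left.2 fun x hx hxT => hψ hx (hTs hxT))

/-- The functionals `φ ↦ ∫ ⟨[L_t], φ⟩ dν(t)` determine `ν`. -/
lemma leafMeasure_unique (hsurj : Function.Surjective F) {μ ν : ComplexRadonMeasure γ}
    (h : ∀ φ : TestForm E M (2 * p), μ.integral (leafIntegrals J hbox hι hclosed hF φ) =
      ν.integral (leafIntegrals J hbox hι hclosed hF φ)) : μ = ν := by
  have := ChartedSpace.locallyCompactSpace G γ
  have := sigmaCompactSpace_leaves E ⟨hι, hclosed⟩ hF hsurj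
  refine ComplexRadonMeasure.eq_of_eqNear fun t => ?_
  obtain ⟨n, rfl⟩ := hsurj t
  exact eqNear_of_leafIntegrals J hbox hι hclosed hF Filter.univ_mem fun φ _ => h φ

/-- The current `∫ [L_t] dν(t)` is positive if and only if `ν` is. -/
lemma isPositiveCurrent_iff (hsurj : Function.Surjective F) {T : TestForm E M (2 * p) →ₗ[ℂ] ℂ}
    {ν : ComplexRadonMeasure γ}
    (h : ∀ φ, T φ = ν.integral (leafIntegrals J hbox hι hclosed hF φ)) :
    TestForm.IsPositiveCurrent J p T ↔ ν.IsPositive := by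
  have := ChartedSpace.locallyCompactSpace G γ
  have := sigmaCompactSpace_leaves E ⟨hι, hclosed⟩ hF hsurj
  refine ⟨fun hT => ComplexRadonMeasure.isPositive_of_nhds fun t => ?_, fun hν φ hφ => ?_⟩
  · obtain ⟨n, rfl⟩ := hsurj t
    exact nonneg_of_leafIntegrals_nonneg J hbox hι hclosed hF
      (fun φ hφ => by rw [← h]; exact hT φ hφ) n
  · rw [h]
    exact hν _ (leafIntegrals_nonneg J hbox hι hclosed hF hφ)

end TransverseMeasure

section Structure

variable {E : Type*} [NormedAddCommGroup E] [NormedSpace ℝ E] [FiniteDimensional ℝ E]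
  {M : Type*} [TopologicalSpace M] [T2Space M] [SecondCountableTopology M] [ChartedSpace E M]
  [IsManifold 𝓘(ℝ, E) ∞ M]
  {E' : Type*} [NormedAddCommGroup E'] [NormedSpace ℝ E'] [FiniteDimensional ℝ E']
  {N : Type*} [TopologicalSpace N] [ChartedSpace E' N] [IsManifold 𝓘(ℝ, E') 1 N]
  {G : Type*} [NormedAddCommGroup G] [NormedSpace ℝ G] [FiniteDimensional ℝ G]
  {γ : Type*} [TopologicalSpace γ] [T2Space γ] [ChartedSpace G γ] [IsManifold 𝓘(ℝ, G) 1 γ]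
  (J : AlmostComplexStructure E M) {ι : N → M} {F : N → γ} {p : ℕ}

/-- The structure of the closed currents on `ι(N)`, if `ι(N)` is covered by flow boxes. -/
lemma HasOrientedFlowBoxes.exists_isIntegralOfLeaves {R : Type*} [NormedAddCommGroup R]
    [NormedSpace ℝ R] [FiniteDimensional ℝ R] (hbox : HasOrientedFlowBoxes E' G R J p ι F)
    (hι : IsEmbedding ι) (hclosed : IsClosed (range ι)) (hF : Continuous F)
    (hconn : ∀ t : γ, IsConnected (F ⁻¹' {t}))
    (hcomplex : ∀ x : N, ∀ v ∈ leafTangent E E' G ι F x,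
      J.toFun (ι x) v ∈ leafTangent E E' G ι F x)
    (hCR : IsCRSubmanifold E' J ι p)
    (hdim : ∀ x : N, finrank ℝ (leafTangent E E' G ι F x) = 2 * p) :
    (∀ t : γ, IsIntegrationCurrent J p (leaf ι F t) (integrationCurrent J p (leaf ι F t))) ∧
      ∀ T : TestForm E M (2 * p) →ₗ[ℂ] ℂ, TestForm.IsOrderZero T → TestForm.IsBidimension J p T →
        TestForm.IsClosedCurrent T → TestForm.currentSupport T ⊆ range ι →
        ∃ ν : ComplexRadonMeasure γ, IsIntegralOfLeaves J p ι F T ν ∧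
          (∀ ν' : ComplexRadonMeasure γ, IsIntegralOfLeaves J p ι F T ν' → ν' = ν) ∧
          (TestForm.IsPositiveCurrent J p T ↔ ν.IsPositive) := by
  have hsurj : Function.Surjective F := fun t => (hconn t).nonempty
  refine ⟨fun t => isIntegrationCurrent_integrationCurrent J hbox hclosed t,
    fun T hT hTJ hTc hTs => ?_⟩
  obtain ⟨ν, hν⟩ := exists_leafMeasure J hbox hι hclosed hF hconn hTs
    (exists_local_leafMeasure J hbox hι hclosed hF hcomplex hCR hdim hT hTJ hTc hTs)
  refine ⟨ν, fun φ => ⟨_, fun t => rfl, hν φ⟩, fun ν' hν' => ?_,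
    isPositiveCurrent_iff J hbox hι hclosed hF hsurj hν⟩
  refine leafMeasure_unique J hbox hι hclosed hF hsurj fun φ => ?_
  obtain ⟨f, hf, hfT⟩ := hν' φ
  have h1 : f = leafIntegrals J hbox hι hclosed hF φ := by
    ext t; exact hf t
  rw [← hν, hfT, h1]

/-- The structure theorem for the closed currents of order `0` and bidimension `(p,p)` on a Levi-flat
CR submanifold of CR dimension `p`, foliated by complex submanifolds. -/
theorem exists_isIntegralOfLeaves
    (hι : Manifold.IsSmoothEmbedding 𝓘(ℝ, E') 𝓘(ℝ, E) 1 ι) (hclosed : IsClosed (range ι))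
    (hF : Manifold.IsSubmersion 𝓘(ℝ, E') 𝓘(ℝ, G) 1 F)
    (hconn : ∀ t : γ, IsConnected (F ⁻¹' {t}))
    (hcomplex : ∀ x : N, ∀ v ∈ leafTangent E E' G ι F x,
      J.toFun (ι x) v ∈ leafTangent E E' G ι F x)
    (hCR : IsCRSubmanifold E' J ι p)
    (hdim : ∀ x : N, finrank ℝ (leafTangent E E' G ι F x) = 2 * p) :
    (∀ t : γ, IsIntegrationCurrent J p (leaf ι F t) (integrationCurrent J p (leaf ι F t))) ∧
      ∀ T : TestForm E M (2 * p) →ₗ[ℂ] ℂ, TestForm.IsOrderZero T → TestForm.IsBidimension J p T →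
        TestForm.IsClosedCurrent T → TestForm.currentSupport T ⊆ range ι →
        ∃ ν : ComplexRadonMeasure γ, IsIntegralOfLeaves J p ι F T ν ∧
          (∀ ν' : ComplexRadonMeasure γ, IsIntegralOfLeaves J p ι F T ν' → ν' = ν) ∧
          (TestForm.IsPositiveCurrent J p T ↔ ν.IsPositive) := by
  have hFc : Continuous F := hF.contMDiff.continuous
  rcases isEmpty_or_nonempty N with hN | ⟨⟨n₀⟩⟩
  · have hbox : HasOrientedFlowBoxes E' G E J p ι F := fun n => hN.elim n
    exact hbox.exists_isIntegralOfLeaves J hι.isEmbedding hclosed hFc hconn hcomplex hCR hdim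
  · have h₁ := hι.isImmersion.isImmersionOfComplement_complement
    have : FiniteDimensional ℝ (E' × hι.isImmersion.complement) :=
      (h₁ n₀).equiv.symm.toLinearEquiv.finiteDimensional
    have : FiniteDimensional ℝ hι.isImmersion.complement := Module.Finite.of_surjective
      (LinearMap.snd ℝ E' hι.isImmersion.complement) LinearMap.snd_surjective
    have hbox : HasOrientedFlowBoxes E' G hι.isImmersion.complement J p ι F := fun n =>
      exists_isOrientedFlowBox J hι.isEmbedding (h₁ n)
        (hF.isSubmersionOfComplement_complement n) hcomplex hdim
    exact hbox.exists_isIntegralOfLeaves J hι.isEmbedding hclosed hFc hconn hcomplex hCR hdim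

/-- The maximal complex subspace of a real hyperplane `S` of a complex plane has real dimension `2`:
it is even, at most `3`, and at least `2` because `S` contains a complex line. -/
lemma finrank_inf_map_eq_two {V : Type*} [AddCommGroup V] [Module ℝ V] [FiniteDimensional ℝ V]
    {j : V →ₗ[ℝ] V} (hj : ∀ v, j (j v) = -v) {S L : Submodule ℝ V} (hLS : L ≤ S)
    (hL : ∀ v ∈ L, j v ∈ L) (hS : finrank ℝ S = 3) (hL2 : finrank ℝ L = 2) :
    finrank ℝ ↥(S ⊓ S.map j) = 2 := by
  have h1 : L ≤ S ⊓ S.map j := fun v hv =>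
    ⟨hLS hv, -j v, S.neg_mem (hLS (hL v hv)), by rw [map_neg, hj, neg_neg]⟩
  have h2 := Submodule.finrank_mono h1
  have h3 := Submodule.finrank_mono (inf_le_left : S ⊓ S.map j ≤ S)
  by_contra h4
  have h5 : S ⊓ S.map j = S := Submodule.eq_of_le_of_finrank_eq inf_le_left (by omega)
  have h6 : ∀ v ∈ S, j v ∈ S := fun v hv => by
    obtain ⟨-, w, hw, rfl⟩ := h5.symm ▸ hv
    rw [hj]
    exact S.neg_mem hw
  -- the square of the determinant of `j` on `S` would be `(-1)^3`
  have h7 : (j.restrict h6).comp (j.restrict h6) = (-1 : ℝ) • LinearMap.id :=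
    LinearMap.ext fun v => Subtype.ext (by simp [hj])
  have h8 := congrArg LinearMap.det h7
  rw [LinearMap.det_comp, LinearMap.det_smul, LinearMap.det_id, hS] at h8
  nlinarith [mul_self_nonneg (LinearMap.det (j.restrict h6))]

/-- In a flow box the tangent space of `ι(N)` is mapped onto `H × G × {0}`. -/
lemma IsFlowBox.finrank_tangentOf {H R : Type*} [NormedAddCommGroup H] [NormedSpace ℝ H]
    [NormedAddCommGroup R] [NormedSpace ℝ R] {x₀ : M} {c : OpenPartialHomeomorph γ G}
    {Θ : OpenPartialHomeomorph E (H × (G × R))} (h : IsFlowBox E' ι F x₀ Θ c) {n : N}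
    (hn : ι n ∈ (extChartAt 𝓘(ℝ, E) x₀).source)
    (hn' : extChartAt 𝓘(ℝ, E) x₀ (ι n) ∈ Θ.source) :
    finrank ℝ (tangentOf E E' ι n) = finrank ℝ (H × G) := by
  refine finrank_eq_of_forall_mem_iff (V := E)
    (L := (LinearEquiv.prodAssoc ℝ H G R).symm.toLinearMap.comp
      ((fderiv ℝ Θ (extChartAt 𝓘(ℝ, E) x₀ (ι n))).comp (dChart x₀ (ι n))).toLinearMap)
    ?_ (h.mem_tangentOf n hn hn')
  refine (LinearEquiv.prodAssoc ℝ H G R).symm.bijective.comp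
    ((h.isC1.fderiv_bijective hn').comp ⟨fun v w hvw => ?_, fun w => ?_⟩)
  · rw [← dSymm_dChart hn v, ← dSymm_dChart hn w]
    exact congrArg _ hvw
  · have h1 := dChart_dSymm ((extChartAt 𝓘(ℝ, E) x₀).map_source hn) w
    rw [(extChartAt 𝓘(ℝ, E) x₀).left_inv hn] at h1
    exact ⟨_, h1⟩

/-- A real hypersurface of an almost complex manifold of complex dimension `2` foliated by complex
curves is a CR submanifold of CR dimension `1`, and the leaves have real dimension `2`. -/
lemma isCRSubmanifold_of_hypersurface
    (hι : Manifold.IsSmoothEmbedding 𝓘(ℝ, E') 𝓘(ℝ, E) 1 ι)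
    (hF : Manifold.IsSubmersion 𝓘(ℝ, E') 𝓘(ℝ, G) 1 F)
    (hcomplex : ∀ x : N, ∀ v ∈ leafTangent E E' G ι F x,
      J.toFun (ι x) v ∈ leafTangent E E' G ι F x)
    (hE' : finrank ℝ E' = 3) (hG : finrank ℝ G = 1) :
    IsCRSubmanifold E' J ι 1 ∧ ∀ x : N, finrank ℝ (leafTangent E E' G ι F x) = 2 * 1 := by
  rw [IsCRSubmanifold, ← forall_and]
  intro n
  have h₁ := hι.isImmersion.isImmersionOfComplement_complement n
  have h₂ := hF.isSubmersionOfComplement_complement n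
  obtain ⟨Θ, c, h, -, hn'⟩ := exists_isFlowBox hι.isEmbedding h₁ h₂
  have hn : ι n ∈ (extChartAt 𝓘(ℝ, E) (ι n)).source := mem_extChartAt_source _
  have hfin : FiniteDimensional ℝ (G × hF.complement) :=
    h₂.equiv.toLinearEquiv.finiteDimensional
  have hfin' : FiniteDimensional ℝ hF.complement := Module.Finite.of_surjective
    (LinearMap.snd ℝ G hF.complement) LinearMap.snd_surjective
  have hH : finrank ℝ hF.complement = 2 := by
    have h3 := h₂.equiv.toLinearEquiv.finrank_eq
    rw [finrank_prod] at h3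
    omega
  have hL : finrank ℝ (leafTangent E E' G ι F n) = 2 := (h.finrank_leafTangent hn hn').trans hH
  have hS : finrank ℝ (tangentOf E E' ι n) = 3 := by
    rw [h.finrank_tangentOf hn hn', finrank_prod]
    omega
  have hfinE : FiniteDimensional ℝ (TangentSpace 𝓘(ℝ, E) (ι n)) :=
    inferInstanceAs (FiniteDimensional ℝ E)
  exact ⟨finrank_inf_map_eq_two (V := TangentSpace 𝓘(ℝ, E) (ι n)) (J.sq (ι n)) LinearMap.map_le_range (hcomplex n) hS hL, hL⟩

end Structure

end

theorem mainTheorem8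
    {E : Type*} [NormedAddCommGroup E] [NormedSpace ℝ E] [FiniteDimensional ℝ E]
    {M : Type*} [TopologicalSpace M] [T2Space M] [SecondCountableTopology M]
    [ChartedSpace E M] [IsManifold 𝓘(ℝ, E) ∞ M]
    {E' : Type*} [NormedAddCommGroup E'] [NormedSpace ℝ E'] [FiniteDimensional ℝ E']
    {N : Type*} [TopologicalSpace N] [ChartedSpace E' N] [IsManifold 𝓘(ℝ, E') 1 N]
    {G : Type*} [NormedAddCommGroup G] [NormedSpace ℝ G] [FiniteDimensional ℝ G]
    {γ : Type*} [TopologicalSpace γ] [T2Space γ] [ChartedSpace G γ] [IsManifold 𝓘(ℝ, G) 1 γ]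
    (J : AlmostComplexStructure E M) (ι : N → M) (F : N → γ)
    -- `ι(N)` is a closed `C^1` submanifold of `M`
    (hι : Manifold.IsSmoothEmbedding 𝓘(ℝ, E') 𝓘(ℝ, E) 1 ι) (hclosed : IsClosed (range ι))
    -- `F` is a `C^1` submersion whose fibres are connected and `J`-complex
    (hF : Manifold.IsSubmersion 𝓘(ℝ, E') 𝓘(ℝ, G) 1 F)
    (hconn : ∀ t : γ, IsConnected (F ⁻¹' {t}))
    (hcomplex : ∀ x : N, ∀ v ∈ leafTangent E E' G ι F x,
      J.toFun (ι x) v ∈ leafTangent E E' G ι F x) :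
    -- Levi-flat hypersurfaces in complex dimension `2`, foliated by complex curves
    (finrank ℝ E = 4 → finrank ℝ E' = 3 → finrank ℝ G = 1 →
      (∀ t : γ, IsIntegrationCurrent J 1 (leaf ι F t) (integrationCurrent J 1 (leaf ι F t))) ∧
      ∀ T : TestForm E M (2 * 1) →ₗ[ℂ] ℂ, TestForm.IsOrderZero T → TestForm.IsBidimension J 1 T →
        TestForm.IsClosedCurrent T → TestForm.currentSupport T ⊆ range ι →
        ∃ ν : ComplexRadonMeasure γ, IsIntegralOfLeaves J 1 ι F T ν ∧
          (∀ ν' : ComplexRadonMeasure γ, IsIntegralOfLeaves J 1 ι F T ν' → ν' = ν) ∧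
          (TestForm.IsPositiveCurrent J 1 T ↔ ν.IsPositive)) ∧
    -- Levi-flat CR submanifolds of CR dimension `p`, foliated by complex submanifolds
    (∀ p : ℕ, IsCRSubmanifold E' J ι p →
      (∀ x : N, finrank ℝ ↥(leafTangent E E' G ι F x) = 2 * p) →
      (∀ t : γ, IsIntegrationCurrent J p (leaf ι F t) (integrationCurrent J p (leaf ι F t))) ∧
      ∀ T : TestForm E M (2 * p) →ₗ[ℂ] ℂ, TestForm.IsOrderZero T → TestForm.IsBidimension J p T →
        TestForm.IsClosedCurrent T → TestForm.currentSupport T ⊆ range ι →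
        ∃ ν : ComplexRadonMeasure γ, IsIntegralOfLeaves J p ι F T ν ∧
          (∀ ν' : ComplexRadonMeasure γ, IsIntegralOfLeaves J p ι F T ν' → ν' = ν) ∧
          (TestForm.IsPositiveCurrent J p T ↔ ν.IsPositive)) := by
  refine ⟨fun _ hE' hG => ?_, fun p hCR hdim =>
    exists_isIntegralOfLeaves J hι hclosed hF hconn hcomplex hCR hdim⟩
  obtain ⟨hCR, hdim⟩ := isCRSubmanifold_of_hypersurface J hι hF hcomplex hE' hG
  exact exists_isIntegralOfLeaves J hι hclosed hF hconn hcomplex hCR hdim
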